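/- Let $N\ge 1$, $l\ge 0$ be integers, let $R$ be a commutative $\mathbb C$-algebra which is an integral domain, and let $q,\mathbf t,Z_1,\dots,Z_l\in R^\times$. (For numerical parameters take $R=\mathbb C$; for indeterminate parameters take $R=\mathbb C[q^{\pm1},\mathbf t^{\pm1},Z_1^{\pm1},\dots,Z_l^{\pm1}]$.) Let $HH_N$ be the double affine Hecke algebra, i.e. the $R$-algebra generated by $T_i$ ($1\le i\le N-1$) and invertible $X_i,Y_i$ ($1\le i\le N$) with relations - (R1) $(T_i-\mathbf t)(T_i+\mathbf t^{-1})=0$; (R2) $T_iT_{i+1}T_i=T_{i+1}T_iT_{i+1}$; (R3) $T_iT_j=T_jT_i$ for $|i-j|\ge2$; - (R4) $T_iX_iT_i=X_{i+1}$; (R5) $T_iX_j=X_jT_i$ for $j\ne i,i+1$; (R6) $T_iY_iT_i=Y_{i+1}$; (R7) $T_iY_j=Y_jT_i$ for $j\ne i,i+1$; - (R8) $X_1^{-1}Y_2^{-1}X_1Y_2=T_1^2$ (for $N\ge 2$); (R9) $Y_i\tilde X=q\tilde XY_i$; (R10) $X_i\tilde Y=q^{-1}\tilde YX_i$, where $\tilde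 X=\prod_iX_i$, $\tilde Y=\prod_iY_i$; - (R11) $[X_i,X_j]=0$; (R12) $[Y_i,Y_j]=0$. Put $f(u)=(u-Z_1)\cdots(u-Z_l)$, $D_1=X_1^{-1}f(Y_1)$, $D_i=T_{i-1}^{-1}\cdots T_1^{-1}D_1T_1^{-1}\cdots T_{i-1}^{-1}$, $\pi=X_1T_1\cdots T_{N-1}$, $\pi_-=\pi^{-1}f(Y_1)$. Let $HH_N^{l,+}\subset HH_N$ be the subalgebra generated by all $T_i,X_i,Y_i,D_i$, and let $HH_N^l\subset HH_N$ be the subalgebra generated by all $T_i,Y_i^{\pm1}$, $\pi$ and $\pi_-$. Write $$J_i=T_i\cdots T_{N-2}T_{N-1}^2T_{N-2}\cdots T_i,\qquad V_i=T_{i-1}^{-1}\cdots T_2^{-1}T_1^{-2}T_2^{-1}\cdots T_{i-1}^{-1}$$ (so $J_N=1$ and $V_1=1$). 1. *Presentation of $HH_N^{l,+}$.* The algebra $HH_N^{l,+}$ is generated by $T_i,X_i,Y_i,D_i$ with defining relations (R1)–(R7), (R11), (R12) and the following, where $T_i^{-1}=T_i-\mathbf t+\mathbf t^{-1}$: - (cd1)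 $X_iY_j=Y_jX_i\,T_{j-1}^{-1}\cdots T_{i+1}^{-1}T_i^{2}T_{i+1}\cdots T_{j-1}$, $i<j$; - (cd2) $Y_iX_j=T_{j-1}\cdots T_{i+1}T_i^{-2}T_{i+1}^{-1}\cdots T_{j-1}^{-1}\,X_jY_i$, $i<j$; - (cd3) $Y_iV_iX_i=q\,X_iJ_iY_i$; - (cd4) $[D_i,D_j]=0$; - (cd5) $T_i^{-1}D_iT_i^{-1}=D_{i+1}$, and $[T_j,D_i]=0$ for $|i-j|\ge2$; - (cd6) $D_iY_j=Y_j\,T_{j-1}^{-1}\cdots T_{i+1}^{-1}T_i^{-2}T_{i+1}\cdots T_{j-1}\,D_i$, $i<j$; - (cd7) $D_j\,T_{j-1}\cdots T_{i+1}T_i^{2}T_{i+1}^{-1}\cdots T_{j-1}^{-1}\,Y_i=Y_iD_j$, $i<j$; - (cd8) $D_iY_iV_i=q\,J_iY_iD_i$; - (cd9) $X_1D_1=f(Y_1)$ and $D_1X_1=f(qJ_1Y_1)$; - (cd10) (for $N\ge2$) $[D_1,X_2]=(\mathbf t^{-1}-\mathbf t)\sum_{r=1}^l\Big(\prod_{m<r}(qJ_1Y_1-Z_m)\Big)\,Y_2T_1^{-2}\,\Big(\prod_{m>r}(Y_2T_1^{-2}-Z_m)\Big)\,T_1$.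 That is, the algebra defined abstractly by these generators and relations maps isomorphically onto $HH_N^{l,+}$ by sending each generator to the element of the same name. 2. *Basis.* For $s\in S_N$ let $T_s$ be the product of the $T_i$ along a reduced expression of $s$ (the statement holds for every choice of reduced expressions). If $l\ge1$, the elements $$X_1^{a_1}\cdots X_N^{a_N}\;Y_1^{b_1}\cdots Y_N^{b_N}\;T_s\;D_1^{c_1}\cdots D_N^{c_N},\qquad a_i,c_i\ge0,\ 0\le b_i\le l-1,\ s\in S_N,$$ form a basis of $HH_N^{l,+}$ over $R$. 3. *Presentation of $HH_N^l$.* The algebra $HH_N^l$ is defined by the same generators and relations as in 1 with the additional condition that the $Y_i$ are invertible: the algebra with generators $T_i,X_i,Y_i,Y_i^{-1},D_i$ and the relations of 1 together with $Y_iY_i^{-1}=Y_i^{-1}Y_i=1$ maps isomorphically onto $HH_N^l$ by sending each generator to the element of the same name. -/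

import Mathlib

/-!
Conventions.  `n` is the rank minus one: the number of variables is `N = n + 1`.
All indices start at `0`: the generators are `X 0, …, X n`, `Y 0, …, Y n`, `D 0, …, D n` and
`T 0, …, T (n - 1)`, so that `T k` braids the variables `k.castSucc` and `k.succ`.
The parameters `q`, `t`, `Z m` are units of the commutative base ring `R`; `t` is the bold parameter
with Hecke relation `(T - t) (T + t⁻¹) = 0`.
-/

namespace CycDAHA

open Polynomial

section Words

variable {R : Type*} [CommRing R] {A : Type*} [Ring A] [Algebra R A] {n : ℕ}

/-- The family `T` extended by `1` outside its range. -/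
def ext (T : Fin n → A) (k : ℕ) : A := if h : k < n then T ⟨k, h⟩ else 1

/-- `asc T a b = T_a T_{a+1} ⋯ T_{b-1}` (equal to `1` if `b ≤ a`). -/
def asc (T : Fin n → A) (a b : ℕ) : A := ((List.Ico a b).map (ext T)).prod

/-- `desc T a b = T_{b-1} ⋯ T_{a+1} T_a` (equal to `1` if `b ≤ a`). -/
def desc (T : Fin n → A) (a b : ℕ) : A := ((List.Ico a b).reverse.map (ext T)).prod

/-- The inverse `T_k⁻¹ = T_k - t + t⁻¹`; it is the two-sided inverse of `T_k` whenever
`(T_k - t) (T_k + t⁻¹) = 0`. -/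
def tInv (t : Rˣ) (T : Fin n → A) (k : Fin n) : A :=
  T k - algebraMap R A ((t : R) - ((t⁻¹ : Rˣ) : R))

/-- `T_i ⋯ T_{N-1}² ⋯ T_i` (the last index being `n - 1` here); equal to `1` for `i = n`. -/
def jUp (T : Fin n → A) (i : ℕ) : A := asc T i n * desc T i n

/-- `T_{i-1}⁻¹ ⋯ T_0⁻² ⋯ T_{i-1}⁻¹`; equal to `1` for `i = 0`. -/
def jDown (t : Rˣ) (T : Fin n → A) (i : ℕ) : A := desc (tInv t T) 0 i * asc (tInv t T) 0 i

/-- The monomial `X_0^{a_0} ⋯ X_n^{a_n}`. -/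
def mono {m : ℕ} (X : Fin m → A) (a : Fin m → ℕ) : A := (List.ofFn fun i => X i ^ a i).prod

end Words

section Perms

variable {n : ℕ}

/-- The product in the symmetric group of a word in the simple transpositions. -/
def permWord (L : List (Fin n)) : Equiv.Perm (Fin (n + 1)) :=
  (L.map fun k => Equiv.swap k.castSucc k.succ).prod

/-- `L` is a reduced expression of the permutation `s`. -/
def IsReducedWord (L : List (Fin n)) (s : Equiv.Perm (Fin (n + 1))) : Prop :=
  permWord L = s ∧ ∀ L' : List (Fin n), permWord L' = s → L.length ≤ L'.length

end Perms

section Relations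

variable {R : Type*} [CommRing R] {n l : ℕ}

/-- `∏_{m ∈ S} (x - Z_m)`. -/
noncomputable def zPoly (Z : Fin l → Rˣ) (S : Finset (Fin l)) : R[X] := ∏ m ∈ S, (X - C (Z m : R))

/-- `(u - Z_1) ⋯ (u - Z_l)`, restricted to the factors with index in `S`. -/
noncomputable def zEval {A : Type*} [Ring A] [Algebra R A] (Z : Fin l → Rˣ) (S : Finset (Fin l))
    (u : A) : A := aeval u (zPoly Z S)

/-- The relations of the double affine Hecke algebra that do not involve both `X` and `Y`, imposed on
elements `T`, `X`, `Y` of an algebra `A`. -/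
inductive BaseRel {A : Type*} [Ring A] [Algebra R A] (t : Rˣ) (T : Fin n → A)
    (X Y : Fin (n + 1) → A) : A → A → Prop
  | R1 (i : Fin n) : BaseRel t T X Y
      ((T i - algebraMap R A (t : R)) * (T i + algebraMap R A ((t⁻¹ : Rˣ) : R))) 0
  | R2 (i j : Fin n) (h : (i : ℕ) + 1 = j) : BaseRel t T X Y (T i * T j * T i) (T j * T i * T j)
  | R3 (i j : Fin n) (h : (i : ℕ) + 2 ≤ j ∨ (j : ℕ) + 2 ≤ i) :
      BaseRel t T X Y (T i * T j) (T j * T i)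
  | R4 (i : Fin n) : BaseRel t T X Y (T i * X i.castSucc * T i) (X i.succ)
  | R5 (i : Fin n) (j : Fin (n + 1)) (h : j ≠ i.castSucc) (h' : j ≠ i.succ) :
      BaseRel t T X Y (T i * X j) (X j * T i)
  | R6 (i : Fin n) : BaseRel t T X Y (T i * Y i.castSucc * T i) (Y i.succ)
  | R7 (i : Fin n) (j : Fin (n + 1)) (h : j ≠ i.castSucc) (h' : j ≠ i.succ) :
      BaseRel t T X Y (T i * Y j) (Y j * T i)
  | R11 (i j : Fin (n + 1)) : BaseRel t T X Y (X i * X j) (X j * X i)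
  | R12 (i j : Fin (n + 1)) : BaseRel t T X Y (Y i * Y j) (Y j * Y i)

/-- All relations of the double affine Hecke algebra, including that `X i` and `Y i` are invertible
with inverses `X' i` and `Y' i`. -/
inductive DahaRel {A : Type*} [Ring A] [Algebra R A] (q t : Rˣ) (T : Fin n → A)
    (X X' Y Y' : Fin (n + 1) → A) : A → A → Prop
  | base {a b : A} (h : BaseRel t T X Y a b) : DahaRel q t T X X' Y Y' a b
  | X_mul_inv (i : Fin (n + 1)) : DahaRel q t T X X' Y Y' (X i * X' i) 1
  | inv_mul_X (i : Fin (n + 1)) : DahaRel q t T X X' Y Y' (X' i * X i) 1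
  | Y_mul_inv (i : Fin (n + 1)) : DahaRel q t T X X' Y Y' (Y i * Y' i) 1
  | inv_mul_Y (i : Fin (n + 1)) : DahaRel q t T X X' Y Y' (Y' i * Y i) 1
  | R8 (k : Fin n) (hk : (k : ℕ) = 0) : DahaRel q t T X X' Y Y'
      (X' k.castSucc * Y' k.succ * X k.castSucc * Y k.succ) (T k ^ 2)
  | R9 (i : Fin (n + 1)) : DahaRel q t T X X' Y Y'
      (Y i * (List.ofFn X).prod) ((q : R) • ((List.ofFn X).prod * Y i))
  | R10 (i : Fin (n + 1)) : DahaRel q t T X X' Y Y'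
      (X i * (List.ofFn Y).prod) (((q⁻¹ : Rˣ) : R) • ((List.ofFn Y).prod * X i))

/-- The defining relations of the unlocalized cyclotomic DAHA, imposed on elements `T`, `X`, `Y`, `D`
of an algebra `A`: the relations `BaseRel` and the mixed relations `cd1`, ..., `cd10`. -/
inductive CycRel {A : Type*} [Ring A] [Algebra R A] (q t : Rˣ) (Z : Fin l → Rˣ) (T : Fin n → A)
    (X Y D : Fin (n + 1) → A) : A → A → Prop
  | base {a b : A} (h : BaseRel t T X Y a b) : CycRel q t Z T X Y D a b
  | cd1 (i j : Fin (n + 1)) (h : i < j) : CycRel q t Z T X Y D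
      (X i * Y j)
      (Y j * X i * (desc (tInv t T) (i + 1) j * ext T i ^ 2 * asc T (i + 1) j))
  | cd2 (i j : Fin (n + 1)) (h : i < j) : CycRel q t Z T X Y D
      (Y i * X j)
      (desc T (i + 1) j * ext (tInv t T) i ^ 2 * asc (tInv t T) (i + 1) j * X j * Y i)
  | cd3 (i : Fin (n + 1)) : CycRel q t Z T X Y D
      (Y i * jDown t T i * X i) ((q : R) • (X i * jUp T i * Y i))
  | cd4 (i j : Fin (n + 1)) : CycRel q t Z T X Y D (D i * D j) (D j * D i)
  | cd5 (i : Fin n) : CycRel q t Z T X Y D (tInv t T i * D i.castSucc * tInv t T i) (D i.succ)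
  | cd5_comm (j : Fin n) (i : Fin (n + 1)) (h : (i : ℕ) + 2 ≤ j ∨ (j : ℕ) + 2 ≤ i) :
      CycRel q t Z T X Y D (T j * D i) (D i * T j)
  | cd6 (i j : Fin (n + 1)) (h : i < j) : CycRel q t Z T X Y D
      (D i * Y j)
      (Y j * (desc (tInv t T) (i + 1) j * ext (tInv t T) i ^ 2 * asc T (i + 1) j) * D i)
  | cd7 (i j : Fin (n + 1)) (h : i < j) : CycRel q t Z T X Y D
      (D j * (desc T (i + 1) j * ext T i ^ 2 * asc (tInv t T) (i + 1) j) * Y i)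
      (Y i * D j)
  | cd8 (i : Fin (n + 1)) : CycRel q t Z T X Y D
      (D i * Y i * jDown t T i) ((q : R) • (jUp T i * Y i * D i))
  | cd9_left : CycRel q t Z T X Y D (X 0 * D 0) (zEval Z Finset.univ (Y 0))
  | cd9_right : CycRel q t Z T X Y D
      (D 0 * X 0) (zEval Z Finset.univ ((q : R) • (jUp T 0 * Y 0)))
  | cd10 (k : Fin n) (hk : (k : ℕ) = 0) : CycRel q t Z T X Y D
      (D k.castSucc * X k.succ - X k.succ * D k.castSucc)
      ((((t⁻¹ : Rˣ) : R) - (t : R)) • ∑ r : Fin l,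
        zEval Z (Finset.Iio r) ((q : R) • (jUp T 0 * Y k.castSucc)) *
          (Y k.succ * tInv t T k ^ 2) *
          zEval Z (Finset.Ioi r) (Y k.succ * tInv t T k ^ 2) * T k)

end Relations

section Algebras

variable {R : Type*} [CommRing R] {l : ℕ}

/-- Generators of the double affine Hecke algebra. -/
inductive DahaGen (n : ℕ) : Type
  | T (i : Fin n)
  | X (i : Fin (n + 1))
  | Xinv (i : Fin (n + 1))
  | Y (i : Fin (n + 1))
  | Yinv (i : Fin (n + 1))

/-- Cherednik's double affine Hecke algebra of type `GL_{n+1}`. -/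
abbrev DAHA (n : ℕ) (q t : Rˣ) : Type _ :=
  RingQuot (DahaRel (R := R) (A := FreeAlgebra R (DahaGen n)) q t
    (fun i => FreeAlgebra.ι R (DahaGen.T i)) (fun i => FreeAlgebra.ι R (DahaGen.X i))
    (fun i => FreeAlgebra.ι R (DahaGen.Xinv i)) (fun i => FreeAlgebra.ι R (DahaGen.Y i))
    (fun i => FreeAlgebra.ι R (DahaGen.Yinv i)))

/-- The image of a generator in the double affine Hecke algebra. -/
noncomputable def DAHA.gen (n : ℕ) (q t : Rˣ) (g : DahaGen n) : DAHA n q t :=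
  RingQuot.mkAlgHom R _ (FreeAlgebra.ι R g)

/-- The element `T_i` of the double affine Hecke algebra. -/
noncomputable def DAHA.T {n : ℕ} (q t : Rˣ) (i : Fin n) : DAHA n q t := DAHA.gen n q t (.T i)

/-- The element `X_i` of the double affine Hecke algebra. -/
noncomputable def DAHA.X {n : ℕ} (q t : Rˣ) (i : Fin (n + 1)) : DAHA n q t := DAHA.gen n q t (.X i)

/-- The element `X_i⁻¹` of the double affine Hecke algebra. -/
noncomputable def DAHA.Xinv {n : ℕ} (q t : Rˣ) (i : Fin (n + 1)) : DAHA n q t :=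
  DAHA.gen n q t (.Xinv i)

/-- The element `Y_i` of the double affine Hecke algebra. -/
noncomputable def DAHA.Y {n : ℕ} (q t : Rˣ) (i : Fin (n + 1)) : DAHA n q t := DAHA.gen n q t (.Y i)

/-- The element `Y_i⁻¹` of the double affine Hecke algebra. -/
noncomputable def DAHA.Yinv {n : ℕ} (q t : Rˣ) (i : Fin (n + 1)) : DAHA n q t :=
  DAHA.gen n q t (.Yinv i)

/-- The `q`-Dunkl element `D_i = T_{i-1}⁻¹ ⋯ T_0⁻¹ D_0 T_0⁻¹ ⋯ T_{i-1}⁻¹`, where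
`D_0 = X_0⁻¹ (Y_0 - Z_1) ⋯ (Y_0 - Z_l)`. -/
noncomputable def DAHA.D {n : ℕ} (q t : Rˣ) (Z : Fin l → Rˣ) (i : Fin (n + 1)) : DAHA n q t :=
  desc (tInv t (DAHA.T q t)) 0 i *
    (DAHA.Xinv q t 0 * zEval Z Finset.univ (DAHA.Y q t 0)) * asc (tInv t (DAHA.T q t)) 0 i

/-- The element `π = X_0 T_0 ⋯ T_{n-1}`. -/
noncomputable def DAHA.pi (n : ℕ) (q t : Rˣ) : DAHA n q t :=
  DAHA.X q t 0 * asc (DAHA.T q t) 0 n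

/-- The element `π⁻¹ = T_{n-1}⁻¹ ⋯ T_0⁻¹ X_0⁻¹`. -/
noncomputable def DAHA.piInv (n : ℕ) (q t : Rˣ) : DAHA n q t :=
  desc (tInv t (DAHA.T q t)) 0 n * DAHA.Xinv q t 0

/-- The element `π₋ = π⁻¹ (Y_0 - Z_1) ⋯ (Y_0 - Z_l)`. -/
noncomputable def DAHA.piMinus (n : ℕ) (q t : Rˣ) (Z : Fin l → Rˣ) : DAHA n q t :=
  DAHA.piInv n q t * zEval Z Finset.univ (DAHA.Y q t 0)

/-- The cyclotomic DAHA: the subalgebra of the DAHA generated by `T_i`, `Y_i`, `Y_i⁻¹`, `π`, `π₋`. -/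
noncomputable def cyclotomic (n : ℕ) (q t : Rˣ) (Z : Fin l → Rˣ) : Subalgebra R (DAHA n q t) :=
  Algebra.adjoin R (Set.range (DAHA.T q t) ∪ Set.range (DAHA.Y q t) ∪ Set.range (DAHA.Yinv q t) ∪
    {DAHA.pi n q t, DAHA.piMinus n q t Z})

/-- The unlocalized cyclotomic DAHA: the subalgebra of the DAHA generated by `T_i`, `X_i`, `Y_i` and
the `q`-Dunkl elements `D_i`. -/
noncomputable def cyclotomicPlus (n : ℕ) (q t : Rˣ) (Z : Fin l → Rˣ) : Subalgebra R (DAHA n q t) :=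
  Algebra.adjoin R (Set.range (DAHA.T q t) ∪ Set.range (DAHA.X q t) ∪ Set.range (DAHA.Y q t) ∪
    Set.range (DAHA.D q t Z))

/-- The element `M_X M_Y T_s M_D` of the DAHA, where `T_s` is the product of the `T_i` along the word
`L` (to be used with a reduced expression `L` of `s`). -/
noncomputable def stdMonomial {n : ℕ} (q t : Rˣ) (Z : Fin l → Rˣ) (a b : Fin (n + 1) → ℕ)
    (L : List (Fin n)) (c : Fin (n + 1) → ℕ) : DAHA n q t :=
  mono (DAHA.X q t) a * mono (DAHA.Y q t) b * (L.map (DAHA.T q t)).prod * mono (DAHA.D q t Z) c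

/-- Generators of the presentation of the unlocalized cyclotomic DAHA. -/
inductive CycGen (n : ℕ) : Type
  | T (i : Fin n)
  | X (i : Fin (n + 1))
  | Y (i : Fin (n + 1))
  | D (i : Fin (n + 1))

/-- The abstract algebra with generators `T_i`, `X_i`, `Y_i`, `D_i` and the relations `CycRel`. -/
abbrev PresPlus (n : ℕ) (q t : Rˣ) (Z : Fin l → Rˣ) : Type _ :=
  RingQuot (CycRel (A := FreeAlgebra R (CycGen n)) q t Z
    (fun i => FreeAlgebra.ι R (CycGen.T i)) (fun i => FreeAlgebra.ι R (CycGen.X i))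
    (fun i => FreeAlgebra.ι R (CycGen.Y i)) (fun i => FreeAlgebra.ι R (CycGen.D i)))

/-- The image of a generator in `PresPlus`. -/
noncomputable def PresPlus.gen {n : ℕ} (q t : Rˣ) (Z : Fin l → Rˣ) (g : CycGen n) :
    PresPlus n q t Z :=
  RingQuot.mkAlgHom R _ (FreeAlgebra.ι R g)

/-- Generators of the presentation of the cyclotomic DAHA: those of `CycGen` and the `Y_i⁻¹`. -/
inductive CycLocGen (n : ℕ) : Type
  | T (i : Fin n)
  | X (i : Fin (n + 1))
  | Y (i : Fin (n + 1))
  | Yinv (i : Fin (n + 1))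
  | D (i : Fin (n + 1))

/-- The relations `CycRel` together with the relations saying that `Y i` is invertible with inverse
`Y' i`. -/
inductive CycLocRel {n : ℕ} {A : Type*} [Ring A] [Algebra R A] (q t : Rˣ) (Z : Fin l → Rˣ)
    (T : Fin n → A) (X Y Y' D : Fin (n + 1) → A) : A → A → Prop
  | cyc {a b : A} (h : CycRel q t Z T X Y D a b) : CycLocRel q t Z T X Y Y' D a b
  | Y_mul_inv (i : Fin (n + 1)) : CycLocRel q t Z T X Y Y' D (Y i * Y' i) 1
  | inv_mul_Y (i : Fin (n + 1)) : CycLocRel q t Z T X Y Y' D (Y' i * Y i) 1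

/-- The abstract algebra with generators `T_i`, `X_i`, `Y_i`, `Y_i⁻¹`, `D_i` and the relations
`CycLocRel`. -/
abbrev PresLoc (n : ℕ) (q t : Rˣ) (Z : Fin l → Rˣ) : Type _ :=
  RingQuot (CycLocRel (A := FreeAlgebra R (CycLocGen n)) q t Z
    (fun i => FreeAlgebra.ι R (CycLocGen.T i)) (fun i => FreeAlgebra.ι R (CycLocGen.X i))
    (fun i => FreeAlgebra.ι R (CycLocGen.Y i)) (fun i => FreeAlgebra.ι R (CycLocGen.Yinv i))
    (fun i => FreeAlgebra.ι R (CycLocGen.D i)))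

/-- The image of a generator in `PresLoc`. -/
noncomputable def PresLoc.gen {n : ℕ} (q t : Rˣ) (Z : Fin l → Rˣ) (g : CycLocGen n) :
    PresLoc n q t Z :=
  RingQuot.mkAlgHom R _ (FreeAlgebra.ι R g)

end Algebras

end CycDAHA

/-! Write `H` for the span of the Hecke algebra generated by the `T_k` and `f(u) = ∏ (u - Z_m)`. The
relations `CycRel` hold in the DAHA: conjugation by `X_0⁻¹` sends `Y_0` to `q J_0 Y_0`, from which
the relations for `D_0 = X_0⁻¹ f(Y_0)` follow, and conjugation by the `T_k` carries them to the
other `D_i` (`eq_of_cycRel_of_dahaRel`). So the presented algebra maps onto `HH^{l,+}`. For `l ≥ 1`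
everything else reduces to two facts: the standard monomials span every algebra generated by
elements satisfying `CycRel`, and they are linearly independent in the DAHA.

Spanning. Submodules of an algebra form an idempotent semiring, in which the relations become
inclusions such as `H X ≤ X H`, `Y X ≤ X Y H`, `D Y ≤ Y H D` and `D X ≤ X H D + Y^l H`, where in the
last one `X` and `Y` also contain `1`. They show that the pieces `X^p Y^r H D^k` with `p - k ≤ d`
and `r + l k ≤ e` form a filtration `filt` compatible with multiplication by generators
(`exists_mem_filt`). The relation `X_0 D_0 = f(Y_0)`, conjugated by the `T_k`, rewrites `Y_i^l`
through `X H D`, through monomials in `Y` of smaller weight and through lower degree (`pow_Y_mem`),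
so all exponents of the `Y_i` can be brought below `l` inside the same filtration step
(`filt_le_span`).

Independence. The standard monomials are not treated directly. The DAHA acts on a vector space whose
basis is the extended affine symmetric group, its elements being written as windows: `Y_j` is
diagonal with generic eigenvalues, `π` rotates windows, and `T_i` combines a window with its
reflection (`extAffine_rep`). Starting from the identity window, products of `T_i`, `π` and `π⁻¹
f(Y_0)` give, for every window `b`, an element `G_b` whose value is a nonzero multiple of `b` plus
shorter windows (`exists_triangular`). Hence the `Y^β G_b` are independent
(`linearIndependent_Y_mul`). The bijection `stdEquiv` matches the pairs `(b, β)` with the standard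
monomials and respects the filtration: `Y^β G_b` lies in every step whose bounds its standard
monomial satisfies. Each step is spanned by finitely many standard monomials and contains as many
independent elements. Over a domain this forces the spanning family to be independent
(`linearIndependent_of_filtered_span`).

For `l = 0` one has `D_i = X_i⁻¹`. Denominators are cleared by a power of `∏ X_i`, and independence
of the `X^a Y^b T_s` is obtained from the case of large `l` (`linearIndependent_pbwElem`). For the
algebra with invertible `Y_i`, the product `∏ Y_i` commutes with each generator up to a power of
`q`, so denominators can again be cleared and injectivity is inherited from the unlocalized algebra
(`injective_presLoc_hom`). -/

namespace CycDAHA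

/-! ### Linear independence by counting over a domain -/

section Counting

variable {R M : Type*} [CommRing R] [IsDomain R] [AddCommGroup M] [Module R M]

/-- Both families have the same finite index set, so a square matrix `W` expresses `v` through `u`.
Independence of `v` makes `det W` nonzero, and the adjugate then expresses `det W • u` through `v`,
which transfers a relation among the `u` to one among the `v`. No division is needed, only the
absence of zero divisors. -/
theorem linearIndependent_of_mem_span_range {ι : Type*} [Fintype ι] {u v : ι → M}
    (hv : LinearIndependent R v) (h : ∀ i, v i ∈ Submodule.span R (Set.range u)) :
    LinearIndependent R u := by
  classical
  rw [Fintype.linearIndependent_iff] at hv ⊢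
  have h' : ∀ i, ∃ w : ι → R, ∑ j, w j • u j = v i := fun i =>
    (Submodule.mem_span_range_iff_exists_fun R).1 (h i)
  choose W hW using h'
  have key : ∀ c : ι → R, ∑ i, c i • v i = ∑ j, (Matrix.vecMul c (Matrix.of W)) j • u j := by
    intro c
    simp_rw [← hW, Finset.smul_sum, Matrix.vecMul, dotProduct, Finset.sum_smul, mul_smul]
    rw [Finset.sum_comm]
    rfl
  -- A singular matrix over a domain has a nonzero left null vector, which would be a relation among
  -- the `v i`.
  have hdet : (Matrix.of W).det ≠ 0 := by
    intro h0
    obtain ⟨c, hc0, hc⟩ := Matrix.exists_vecMul_eq_zero_iff.2 h0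
    apply hc0
    funext i
    exact hv c (by rw [key, hc]; simp) i
  intro r hr i
  -- Applying `r * adj W` to `v = W u` gives `det W • ∑ r_j u_j = 0`.
  have h1 : ∑ i, (Matrix.vecMul r (Matrix.of W).adjugate) i • v i = 0 := by
    rw [key, Matrix.vecMul_vecMul, Matrix.adjugate_mul, Matrix.vecMul_smul, Matrix.vecMul_one]
    simp only [Pi.smul_apply, smul_assoc]
    rw [← Finset.smul_sum, hr, smul_zero]
  have h2 : Matrix.vecMul r (Matrix.of W).adjugate = 0 := funext fun i => hv _ h1 i
  have h3 : (Matrix.of W).det • r = 0 := by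
    have := congrArg (fun x => Matrix.vecMul x (Matrix.of W)) h2
    simpa [Matrix.vecMul_vecMul, Matrix.adjugate_mul, Matrix.vecMul_smul] using this
  have h4 := congrFun h3 i
  simp only [Pi.smul_apply, smul_eq_mul, Pi.zero_apply, mul_eq_zero] at h4
  exact h4.resolve_left hdet

/-- A family indexed compatibly with a linearly independent one that lies, level by level, in its span,
is linearly independent. -/
theorem linearIndependent_of_filtered_span {I J : Type*} {u : I → M} {v : J → M} (e : I ≃ J)
    (hv : LinearIndependent R v)
    (h : ∀ S : Finset I, ∃ S' : Finset I, S ⊆ S' ∧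
      ∀ i ∈ S', v (e i) ∈ Submodule.span R (u '' (S' : Set I))) :
    LinearIndependent R u := by
  rw [linearIndependent_iff_finset_linearIndependent]
  intro S
  obtain ⟨S', hS, hS'⟩ := h S
  have h1 : LinearIndependent R (fun i : S' => u i) := by
    refine linearIndependent_of_mem_span_range (v := fun i : S' => v (e i)) ?_ ?_
    · exact hv.comp (fun i : S' => e i) (e.injective.comp Subtype.val_injective)
    · intro i
      convert hS' i i.2 using 2
      ext x; simp
  exact h1.comp (fun i : S => (⟨i.1, hS i.2⟩ : S')) (fun a b hab => by
    apply Subtype.ext; simpa using hab)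

end Counting

/-! ### Windows of the extended affine symmetric group and their length -/

section Windows

variable {n : ℕ}

/-- The extended affine symmetric group, in window notation: a permutation together with a
translation part. -/
abbrev Window (n : ℕ) : Type := Equiv.Perm (Fin (n + 1)) × (Fin (n + 1) → ℤ)

namespace Window

/-- The `j`-th entry of a window. -/
def entry (b : Window n) (j : Fin (n + 1)) : Fin (n + 1) × ℤ := (b.1 j, b.2 j)

/-- The signed number of affine inversions between two entries. -/
def gap (c d : Fin (n + 1) × ℤ) : ℤ := c.2 - d.2 - if d.1 < c.1 then 1 else 0

/-- Shi's formula for the length of an affine permutation. -/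
def len (b : Window n) : ℕ := ∑ p, ∑ q, if p < q then (gap (b.entry p) (b.entry q)).natAbs else 0

/-- The simple reflection exchanging the entries `i` and `i + 1`. -/
def refl (i : Fin n) (b : Window n) : Window n :=
  (b.1 * Equiv.swap i.castSucc i.succ, b.2 ∘ Equiv.swap i.castSucc i.succ)

/-- The cyclic permutation `j ↦ j + 1`. -/
def cyc (n : ℕ) : Equiv.Perm (Fin (n + 1)) := finRotate (n + 1)

/-- The rotation of length zero. -/
def rot (b : Window n) : Window n :=
  (b.1 * (cyc n)⁻¹, fun j => b.2 ((cyc n).symm j) + if j = 0 then 1 else 0)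

/-- The inverse of `rot`. -/
def rotInv (b : Window n) : Window n :=
  (b.1 * cyc n, fun j => b.2 (cyc n j) - if j = Fin.last n then 1 else 0)

theorem cyc_last : cyc n (Fin.last n) = 0 := finRotate_last

theorem cyc_castSucc (j : Fin n) : cyc n j.castSucc = j.succ := by
  simp [cyc]

theorem cyc_symm_zero : (cyc n).symm 0 = Fin.last n := by
  rw [Equiv.symm_apply_eq, cyc_last]

theorem cyc_symm_succ (j : Fin n) : (cyc n).symm j.succ = j.castSucc := by
  rw [Equiv.symm_apply_eq, cyc_castSucc]

theorem rot_rotInv (b : Window n) : rot (rotInv b) = b := by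
  refine Prod.ext ?_ ?_
  · simp [rot, rotInv, mul_assoc]
  · funext j
    simp only [rot, rotInv, Equiv.apply_symm_apply]
    refine Fin.cases ?_ (fun j => ?_) j
    · simp [cyc_symm_zero]
    · simp [cyc_symm_succ, Fin.succ_ne_zero, (Fin.castSucc_lt_last j).ne]

theorem rotInv_rot (b : Window n) : rotInv (rot b) = b := by
  refine Prod.ext ?_ ?_
  · simp [rot, rotInv, mul_assoc]
  · funext j
    simp only [rot, rotInv, Equiv.symm_apply_apply]
    refine Fin.lastCases ?_ (fun j => ?_) j
    · simp [cyc_last]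
    · simp [cyc_castSucc, Fin.succ_ne_zero, (Fin.castSucc_lt_last j).ne]

theorem refl_refl (i : Fin n) (b : Window n) : refl i (refl i b) = b := by
  refine Prod.ext ?_ ?_
  · simp [refl, mul_assoc]
  · funext j; simp [refl]

theorem entry_refl (i : Fin n) (b : Window n) (j : Fin (n + 1)) :
    (refl i b).entry j = b.entry (Equiv.swap i.castSucc i.succ j) := rfl

theorem entry_rot_zero (b : Window n) :
    (rot b).entry 0 = ((b.entry (Fin.last n)).1, (b.entry (Fin.last n)).2 + 1) := by
  simp [rot, entry, cyc_symm_zero]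

theorem entry_rot_succ (b : Window n) (j : Fin n) : (rot b).entry j.succ = b.entry j.castSucc := by
  simp [rot, entry, cyc_symm_succ, Fin.succ_ne_zero]

theorem ext_entry {b c : Window n} (h : ∀ j, b.entry j = c.entry j) : b = c := by
  refine Prod.ext (Equiv.ext fun j => (congrArg Prod.fst (h j) : _)) (funext fun j => (congrArg Prod.snd (h j) : _))

theorem entry_fst_ne (b : Window n) {p q : Fin (n + 1)} (h : p ≠ q) :
    (b.entry p).1 ≠ (b.entry q).1 := fun h' => h (b.1.injective h')

/-- Exactly one of the two indicator terms is `1`, as the residues differ. Exchanging two entries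
thus replaces `|m|` by `|-m - 1|`, which is larger by one for `m ≥ 0` and smaller by one for `m <
0`. This is why a reflection always changes the length by exactly one. -/
theorem gap_comm {c d : Fin (n + 1) × ℤ} (h : c.1 ≠ d.1) : gap d c = - gap c d - 1 := by
  unfold gap
  rcases lt_or_gt_of_ne h with h | h
  · rw [if_pos h, if_neg h.not_gt]; ring
  · rw [if_neg h.not_gt, if_pos h]; ring

theorem swap_lt_swap (i : Fin n) {p q : Fin (n + 1)} (h : p < q)
    (h' : ¬(p = i.castSucc ∧ q = i.succ)) :
    Equiv.swap i.castSucc i.succ p < Equiv.swap i.castSucc i.succ q := by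
  have hi : (i.castSucc : Fin (n + 1)).val = i.val := rfl
  have hi' : (i.succ : Fin (n + 1)).val = i.val + 1 := rfl
  simp only [Equiv.swap_apply_def, Fin.ext_iff, Fin.lt_def] at *
  split_ifs <;> omega

/-- The transposition permutes all the pairs `p < q` other than `(i, i + 1)` among themselves, so
only the term of that pair changes. The identity is stated additively to avoid subtraction of
natural numbers. -/
theorem len_refl_add (i : Fin n) (b : Window n) :
    (refl i b).len + (gap (b.entry i.castSucc) (b.entry i.succ)).natAbs =
      b.len + (gap (b.entry i.succ) (b.entry i.castSucc)).natAbs := by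
  classical
  set s := Equiv.swap i.castSucc i.succ with hs
  set S : Finset (Fin (n + 1) × Fin (n + 1)) := Finset.univ.filter fun x => x.1 < x.2 with hS
  have hlen : ∀ c : Window n, c.len = ∑ x ∈ S, (gap (c.entry x.1) (c.entry x.2)).natAbs := by
    intro c
    rw [len, hS, Finset.sum_filter, Fintype.sum_prod_type]
  have hi : i.castSucc < i.succ := Fin.castSucc_lt_succ
  have hmem : (i.castSucc, i.succ) ∈ S := by simp [hS, hi]
  rw [hlen, hlen, ← Finset.add_sum_erase S _ hmem, ← Finset.add_sum_erase S _ hmem]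
  simp only [entry_refl, ← hs]
  have h1 : s i.castSucc = i.succ := by simp [hs]
  have h2 : s i.succ = i.castSucc := by simp [hs]
  have h3 : ∑ x ∈ S.erase (i.castSucc, i.succ), (gap (b.entry (s x.1)) (b.entry (s x.2))).natAbs =
      ∑ x ∈ S.erase (i.castSucc, i.succ), (gap (b.entry x.1) (b.entry x.2)).natAbs := by
    have hmap : ∀ x ∈ S.erase (i.castSucc, i.succ), (s x.1, s x.2) ∈ S.erase (i.castSucc, i.succ) := by
      rintro ⟨p, q⟩ hx
      simp only [hS, Finset.mem_erase, Finset.mem_filter, Finset.mem_univ, true_and, ne_eq,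
        Prod.mk.injEq] at hx ⊢
      refine ⟨?_, swap_lt_swap i hx.2 hx.1⟩
      rintro ⟨hp, hq⟩
      have hp' : p = i.succ := by rw [← h1, ← hp]; simp [hs]
      have hq' : q = i.castSucc := by rw [← h2, ← hq]; simp [hs]
      rw [hp', hq'] at hx
      exact absurd hx.2 hi.not_gt
    refine Finset.sum_nbij' (fun x => (s x.1, s x.2)) (fun x => (s x.1, s x.2)) hmap hmap ?_ ?_ ?_
    · intro x _; simp [hs]
    · intro x _; simp [hs]
    · intro x _; rfl
  rw [h3, h1, h2]
  ring

/-- The reflection `i` is an ascent of the window. -/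
def Ascent (i : Fin n) (b : Window n) : Prop := 0 ≤ gap (b.entry i.castSucc) (b.entry i.succ)

theorem gap_symm (i : Fin n) (b : Window n) : gap (b.entry i.succ) (b.entry i.castSucc) =
    - gap (b.entry i.castSucc) (b.entry i.succ) - 1 :=
  gap_comm (b.entry_fst_ne Fin.castSucc_lt_succ.ne)

theorem len_refl_of_ascent {i : Fin n} {b : Window n} (h : Ascent i b) :
    (refl i b).len = b.len + 1 := by
  have h1 := len_refl_add i b
  rw [gap_symm] at h1
  unfold Ascent at h
  omega

theorem len_refl_of_not_ascent {i : Fin n} {b : Window n} (h : ¬ Ascent i b) :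
    (refl i b).len + 1 = b.len := by
  have h1 := len_refl_add i b
  rw [gap_symm] at h1
  unfold Ascent at h
  omega

theorem len_refl_le (i : Fin n) (b : Window n) : (refl i b).len ≤ b.len + 1 := by
  by_cases h : Ascent i b
  · exact (len_refl_of_ascent h).le
  · have := len_refl_of_not_ascent h; omega

/-- The last entry moves to the front and its translation grows by one. Its gap with any other entry
`c` becomes `gap last c + 1 = -gap c last`, with the same absolute value; all the other gaps keep
their value and their order. -/
theorem len_rot (b : Window n) : (rot b).len = b.len := by
  unfold len
  rw [Fin.sum_univ_succ, Fin.sum_univ_castSucc (f := fun p => ∑ q, if p < q then _ else _)]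
  have e1 : ∀ i : Fin n, (∑ q, if i.succ < q then
      (gap ((rot b).entry i.succ) ((rot b).entry q)).natAbs else 0) =
      ∑ j : Fin n, if i < j then (gap (b.entry i.castSucc) (b.entry j.castSucc)).natAbs else 0 := by
    intro i
    rw [Fin.sum_univ_succ]
    simp [entry_rot_succ]
  have e2 : ∀ i : Fin n, (∑ q, if i.castSucc < q then
      (gap (b.entry i.castSucc) (b.entry q)).natAbs else 0) =
      (∑ j : Fin n, if i < j then (gap (b.entry i.castSucc) (b.entry j.castSucc)).natAbs else 0) +
        (gap (b.entry i.castSucc) (b.entry (Fin.last n))).natAbs := by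
    intro i
    rw [Fin.sum_univ_castSucc]
    simp [Fin.castSucc_lt_last]
  have e3 : (∑ q, if Fin.last n < q then
      (gap (b.entry (Fin.last n)) (b.entry q)).natAbs else 0) = 0 := by
    apply Finset.sum_eq_zero
    intro q _
    rw [if_neg (Fin.le_last q).not_gt]
  have e4 : (∑ q, if 0 < q then
      (gap ((rot b).entry 0) ((rot b).entry q)).natAbs else 0) =
      ∑ j : Fin n, (gap (b.entry j.castSucc) (b.entry (Fin.last n))).natAbs := by
    rw [Fin.sum_univ_succ]
    simp only [lt_self_iff_false, if_false, Fin.succ_pos, if_true, zero_add]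
    refine Finset.sum_congr rfl fun j _ => ?_
    rw [entry_rot_zero, entry_rot_succ]
    have h := b.entry_fst_ne (Fin.castSucc_lt_last j).ne
    have h2 := gap_comm h
    unfold gap at h2 ⊢
    simp only at h2 ⊢
    omega
  simp only [e1, e2, e3, e4, Finset.sum_add_distrib]
  ring

theorem len_rotInv (b : Window n) : (rotInv b).len = b.len := by
  conv_rhs => rw [← rot_rotInv b]
  rw [len_rot]

/-- The window of the inverse of a finite permutation. -/
def ofPerm (s : Equiv.Perm (Fin (n + 1))) : Window n := (s⁻¹, 0)

/-- The simple transposition exchanging `i` and `i + 1`. -/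
def simple (i : Fin n) : Equiv.Perm (Fin (n + 1)) := Equiv.swap i.castSucc i.succ

theorem simple_mul_simple (i : Fin n) : simple i * simple i = 1 := by simp [simple]

theorem refl_ofPerm (i : Fin n) (s : Equiv.Perm (Fin (n + 1))) :
    refl i (ofPerm s) = ofPerm (simple i * s) := by
  refine Prod.ext ?_ ?_
  · simp [refl, ofPerm, simple]
  · rfl

theorem ascent_ofPerm_iff {i : Fin n} {s : Equiv.Perm (Fin (n + 1))} :
    Ascent i (ofPerm s) ↔ s⁻¹ i.castSucc < s⁻¹ i.succ := by
  have h : s⁻¹ i.castSucc ≠ s⁻¹ i.succ := fun h => Fin.castSucc_lt_succ.ne (s⁻¹.injective h)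
  unfold Ascent gap entry ofPerm
  simp only [Pi.zero_apply, sub_self, zero_sub]
  split_ifs with h'
  · exact iff_of_false (by norm_num) h'.not_gt
  · exact iff_of_true (by norm_num) (lt_of_le_of_ne (not_lt.1 h') h)

theorem antitone_of_ascents {b : Window n} (h : ∀ i, Ascent i b) : Antitone b.2 := by
  rw [Fin.antitone_iff_succ_le]
  intro i
  have := h i
  unfold Ascent gap at this
  simp only [entry] at this
  split_ifs at this <;> omega

/-- When the translations vanish, an ascent says that the residues increase, so the permutation is
strictly monotone and must be the identity. This is the base case both for reduced words and for the
triangularity argument. -/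
theorem eq_one_of_ascents {b : Window n} (h : ∀ i, Ascent i b) (h0 : b.2 = 0) : b = (1, 0) := by
  refine Prod.ext ?_ h0
  have hmono : StrictMono b.1 := by
    rw [Fin.strictMono_iff_lt_succ]
    intro i
    have := h i
    unfold Ascent gap at this
    simp only [entry, h0] at this
    have hne : b.1 i.castSucc ≠ b.1 i.succ := b.entry_fst_ne Fin.castSucc_lt_succ.ne
    by_contra hc
    rw [if_pos (lt_of_le_of_ne (not_lt.1 hc) hne.symm)] at this
    simp at this
  have := Subsingleton.elim (hmono.orderIsoOfSurjective _ b.1.surjective) (OrderIso.refl _)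
  exact Equiv.ext fun j => DFunLike.congr_fun this j

theorem len_one : Window.len ((1, 0) : Window n) = 0 := by
  unfold len gap entry
  refine Finset.sum_eq_zero fun p _ => Finset.sum_eq_zero fun q _ => ?_
  split_ifs with h h' <;> simp_all
  exact absurd h' h.not_gt

end Window
end Windows

/-! ### Reduced words and Matsumoto's theorem -/

section Matsumoto

open Window

variable {n : ℕ}

/-- The number of inversions of a permutation. -/
def invLen (s : Equiv.Perm (Fin (n + 1))) : ℕ := (ofPerm s).len

theorem permWord_cons (i : Fin n) (L : List (Fin n)) :
    permWord (i :: L) = simple i * permWord L := by simp [permWord, simple]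

theorem permWord_nil : permWord ([] : List (Fin n)) = 1 := rfl

theorem invLen_one : invLen (1 : Equiv.Perm (Fin (n + 1))) = 0 := len_one

theorem simple_mul_cancel (i : Fin n) (s : Equiv.Perm (Fin (n + 1))) :
    simple i * (simple i * s) = s := by rw [← mul_assoc, simple_mul_simple, one_mul]

theorem invLen_simple_mul_le (i : Fin n) (s : Equiv.Perm (Fin (n + 1))) :
    invLen (simple i * s) ≤ invLen s + 1 := by
  unfold invLen; rw [← refl_ofPerm]; exact len_refl_le _ _

theorem invLen_simple_mul_of_lt {i : Fin n} {s : Equiv.Perm (Fin (n + 1))}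
    (h : s⁻¹ i.castSucc < s⁻¹ i.succ) : invLen (simple i * s) = invLen s + 1 := by
  unfold invLen; rw [← refl_ofPerm]; exact len_refl_of_ascent (ascent_ofPerm_iff.2 h)

theorem invLen_simple_mul_of_gt {i : Fin n} {s : Equiv.Perm (Fin (n + 1))}
    (h : s⁻¹ i.succ < s⁻¹ i.castSucc) : invLen (simple i * s) + 1 = invLen s := by
  unfold invLen; rw [← refl_ofPerm]
  exact len_refl_of_not_ascent (fun h' => absurd (ascent_ofPerm_iff.1 h') h.not_gt)

theorem lt_or_gt_inv (i : Fin n) (s : Equiv.Perm (Fin (n + 1))) :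
    s⁻¹ i.castSucc < s⁻¹ i.succ ∨ s⁻¹ i.succ < s⁻¹ i.castSucc :=
  lt_or_gt_of_ne fun h => Fin.castSucc_lt_succ.ne (s⁻¹.injective h)

theorem gt_of_invLen {i : Fin n} {s : Equiv.Perm (Fin (n + 1))}
    (h : invLen (simple i * s) < invLen s) : s⁻¹ i.succ < s⁻¹ i.castSucc := by
  refine (lt_or_gt_inv i s).resolve_left fun h' => ?_
  have := invLen_simple_mul_of_lt h'; omega

theorem invLen_permWord_le (L : List (Fin n)) : invLen (permWord L) ≤ L.length := by
  induction L with
  | nil => simp [permWord_nil, invLen_one]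
  | cons i L ih =>
    rw [permWord_cons]
    exact (invLen_simple_mul_le _ _).trans (by simpa using ih)

/-- Left multiplication at a descent lowers the number of inversions, and a permutation without
descents is the identity. Together with `invLen_permWord_le` this identifies the length of a reduced
word with the number of inversions. -/
theorem exists_word (s : Equiv.Perm (Fin (n + 1))) :
    ∃ L : List (Fin n), permWord L = s ∧ L.length = invLen s := by
  induction h : invLen s using Nat.strong_induction_on generalizing s with
  | _ k ih =>
    by_cases hs : ∀ i, Ascent i (ofPerm s)
    · have h1 := eq_one_of_ascents hs rfl
      have h2 : s = 1 := inv_eq_one.1 (congrArg Prod.fst h1)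
      refine ⟨[], ?_, ?_⟩
      · rw [h2, permWord_nil]
      · rw [← h, h2, invLen_one]; rfl
    · push Not at hs
      obtain ⟨i, hi⟩ := hs
      have hlt := (lt_or_gt_inv i s).resolve_left (fun h' => hi (ascent_ofPerm_iff.2 h'))
      have hl := invLen_simple_mul_of_gt hlt
      obtain ⟨L, hL, hL'⟩ := ih (invLen (simple i * s)) (by omega) _ rfl
      refine ⟨i :: L, ?_, ?_⟩
      · rw [permWord_cons, hL, simple_mul_cancel]
      · rw [List.length_cons, hL']; omega

theorem IsReducedWord.length_eq {L : List (Fin n)} {s : Equiv.Perm (Fin (n + 1))}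
    (h : IsReducedWord L s) : L.length = invLen s := by
  obtain ⟨M, hM, hM'⟩ := exists_word s
  refine le_antisymm ((h.2 M hM).trans hM'.le) ?_
  rw [← h.1]
  exact invLen_permWord_le L

variable {A : Type*} [Monoid A]

/-- The braid relations for a family indexed by `Fin n`. -/
structure BraidFamily (T : Fin n → A) : Prop where
  braid : ∀ i j : Fin n, (i : ℕ) + 1 = j → T i * T j * T i = T j * T i * T j
  comm : ∀ i j : Fin n, (i : ℕ) + 2 ≤ j → T i * T j = T j * T i

theorem simple_inv_apply (i : Fin n) (s : Equiv.Perm (Fin (n + 1))) (x : Fin (n + 1)) :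
    (simple i * s)⁻¹ x = s⁻¹ (simple i x) := by simp [simple]

/-- Matsumoto's theorem for the symmetric group. -/
theorem BraidFamily.prod_eq {T : Fin n → A} (hT : BraidFamily T) {L L' : List (Fin n)}
    (h : permWord L = permWord L') (hL : L.length = invLen (permWord L))
    (hL' : L'.length = invLen (permWord L')) : (L.map T).prod = (L'.map T).prod := by
  induction hk : L.length using Nat.strong_induction_on generalizing L L' with
  | _ k ih =>
  have hlen : L.length = L'.length := by rw [hL, hL', h]
  match L, L' with
  | [], [] => rfl
  | [], _ :: _ => simp at hlen
  | _ :: _, [] => simp at hlen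
  | i :: L, j :: L' =>
    set s := permWord (i :: L) with hs
    have hsi : permWord L = simple i * s := by rw [hs, permWord_cons, simple_mul_cancel]
    have hsj : permWord L' = simple j * s := by rw [h, permWord_cons, simple_mul_cancel]
    simp only [List.length_cons] at hL hL' hlen hk
    have hL1 : L.length = invLen (permWord L) := by
      have h1 := invLen_permWord_le L
      have h2 := invLen_simple_mul_le i (permWord L)
      rw [← permWord_cons, ← hs] at h2; omega
    have hL1' : L'.length = invLen (permWord L') := by
      have h1 := invLen_permWord_le L'
      have h2 := invLen_simple_mul_le j (permWord L')
      rw [← permWord_cons, ← h] at h2; omega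
    -- The first letters of two reduced words are both descents of `s`. The induction compares each
    -- word with a third one beginning with the other letter, built from the longest element of the
    -- rank-two subgroup of the two letters.
    have hdi : s⁻¹ i.succ < s⁻¹ i.castSucc := gt_of_invLen (by rw [← hsi]; omega)
    have hdj : s⁻¹ j.succ < s⁻¹ j.castSucc := gt_of_invLen (by rw [← hsj]; rw [h]; omega)
    have hsw : invLen s = k := by omega
    -- the two commuting or braiding cases, for an ordered pair of descents
    have key : ∀ (i j : Fin n) (L L' : List (Fin n)), permWord L = simple i * s →
        permWord L' = simple j * s → L.length = invLen (permWord L) →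
        L'.length = invLen (permWord L') → L.length < k → L'.length < k →
        s⁻¹ i.succ < s⁻¹ i.castSucc → s⁻¹ j.succ < s⁻¹ j.castSucc → (i : ℕ) < j →
        T i * (L.map T).prod = T j * (L'.map T).prod := by
      intro i j L L' hLi hLj hL hL' hk hk' hdi hdj hij
      by_cases hfar : (i : ℕ) + 2 ≤ j
      · have e1 : simple i j.succ = j.succ := by
          apply Equiv.swap_apply_of_ne_of_ne <;> simp [Fin.ext_iff] <;> omega
        have e2 : simple i j.castSucc = j.castSucc := by
          apply Equiv.swap_apply_of_ne_of_ne <;> simp [Fin.ext_iff] <;> omega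
        have hc : simple i * simple j = simple j * simple i := by
          apply Equiv.Perm.Disjoint.commute
          rw [Equiv.Perm.disjoint_iff_disjoint_support]
          unfold simple
          rw [Equiv.Perm.support_swap Fin.castSucc_lt_succ.ne,
            Equiv.Perm.support_swap Fin.castSucc_lt_succ.ne]
          simp [Fin.ext_iff]; omega
        have g1 : invLen (simple j * (simple i * s)) + 1 = invLen (simple i * s) := by
          apply invLen_simple_mul_of_gt
          rw [simple_inv_apply, simple_inv_apply, e1, e2]; exact hdj
        have g0 := invLen_simple_mul_of_gt hdi
        have g0' := invLen_simple_mul_of_gt hdj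
        -- With `M` reduced for `s_j s_i s`, the words `j :: M` and `i :: M` are reduced for `s_i s`
        -- and `s_j s`. The induction hypothesis applies to both, and `T_i T_j = T_j T_i` closes the
        -- square.
        obtain ⟨M, hM, hM'⟩ := exists_word (simple j * (simple i * s))
        have p1 : permWord (j :: M) = simple i * s := by rw [permWord_cons, hM, simple_mul_cancel]
        have p2 : permWord (i :: M) = simple j * s := by
          rw [permWord_cons, hM, ← mul_assoc, ← mul_assoc, hc, mul_assoc (simple j),
            simple_mul_simple, mul_one]
        have q1 := ih L.length hk (L := L) (L' := j :: M) (by rw [hLi, p1]) hL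
          (by rw [p1, List.length_cons]; omega) rfl
        have q2 := ih L'.length hk' (L := L') (L' := i :: M) (by rw [hLj, p2]) hL'
          (by rw [p2, List.length_cons]; omega) rfl
        rw [q1, q2, List.map_cons, List.map_cons, List.prod_cons, List.prod_cons, ← mul_assoc,
          ← mul_assoc, hT.comm i j hfar]
      · have hj : (i : ℕ) + 1 = j := by omega
        have hmid : i.succ = j.castSucc := by ext; simp [hj]
        have e1 : simple i j.succ = j.succ := by
          apply Equiv.swap_apply_of_ne_of_ne <;> simp [Fin.ext_iff] <;> omega
        have e2 : simple i j.castSucc = i.castSucc := by rw [← hmid]; simp [simple]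
        have e3 : simple i i.castSucc = j.castSucc := by rw [← hmid]; simp [simple]
        have e4 : simple j i.castSucc = i.castSucc := by
          apply Equiv.swap_apply_of_ne_of_ne <;> simp [Fin.ext_iff] <;> omega
        have e5 : simple j i.succ = j.succ := by rw [hmid]; simp [simple]
        have e6 : simple j j.succ = i.succ := by rw [hmid]; simp [simple]
        have hb : simple i * simple j * simple i = simple j * simple i * simple j := by
          have hn1 : i.castSucc ≠ j.castSucc := by rw [← hmid]; exact Fin.castSucc_lt_succ.ne
          have hn2 : i.castSucc ≠ j.succ := by simp [Fin.ext_iff]; omega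
          unfold simple
          have k1 := Equiv.swap_mul_swap_mul_swap hn1 hn2
          have k2 := Equiv.swap_mul_swap_mul_swap
            (Fin.castSucc_lt_succ.ne' : j.succ ≠ j.castSucc) hn2.symm
          rw [Equiv.swap_comm j.castSucc i.castSucc, Equiv.swap_comm j.succ j.castSucc,
            Equiv.swap_comm i.castSucc j.succ] at k2
          rw [hmid, k1, k2]
        have d1 : invLen (simple j * (simple i * s)) + 1 = invLen (simple i * s) := by
          apply invLen_simple_mul_of_gt
          rw [simple_inv_apply, simple_inv_apply, e1, e2]
          rw [hmid] at hdi; exact hdj.trans hdi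
        have d2 : invLen (simple i * (simple j * s)) + 1 = invLen (simple j * s) := by
          apply invLen_simple_mul_of_gt
          rw [simple_inv_apply, simple_inv_apply, e4, e5]
          rw [hmid] at hdi; exact hdj.trans hdi
        have d3 : invLen (simple i * (simple j * (simple i * s))) + 1 =
            invLen (simple j * (simple i * s)) := by
          apply invLen_simple_mul_of_gt
          rw [simple_inv_apply, simple_inv_apply, simple_inv_apply, simple_inv_apply, e4, e3, e5, e1]
          exact hdj
        have g0 := invLen_simple_mul_of_gt hdi
        have g0' := invLen_simple_mul_of_gt hdj
        -- The same with the braid relation: three successive descents leave `M`, and `j :: i :: M`,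
        -- `i :: j :: M` are reduced for the two shortened permutations.
        obtain ⟨M, hM, hM'⟩ := exists_word (simple i * (simple j * (simple i * s)))
        have hb' : simple i * (simple j * (simple i * s)) = simple j * (simple i * (simple j * s)) := by
          simpa only [mul_assoc] using congrArg (· * s) hb
        have p1 : permWord (j :: i :: M) = simple i * s := by
          rw [permWord_cons, permWord_cons, hM, simple_mul_cancel, simple_mul_cancel]
        have p2 : permWord (i :: j :: M) = simple j * s := by
          rw [permWord_cons, permWord_cons, hM, hb', simple_mul_cancel, simple_mul_cancel]
        have q1 := ih L.length hk (L := L) (L' := j :: i :: M) (by rw [hLi, p1]) hL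
          (by rw [p1, List.length_cons, List.length_cons]; omega) rfl
        have q2 := ih L'.length hk' (L := L') (L' := i :: j :: M) (by rw [hLj, p2]) hL'
          (by rw [p2, List.length_cons, List.length_cons]; omega) rfl
        rw [q1, q2]
        simp only [List.map_cons, List.prod_cons, ← mul_assoc]
        rw [hT.braid i j hj]
    rw [List.map_cons, List.map_cons, List.prod_cons, List.prod_cons]
    rcases lt_trichotomy (i : ℕ) j with hij | hij | hij
    · exact key i j L L' hsi hsj hL1 hL1' (by omega) (by omega) hdi hdj hij
    · have hij' : i = j := Fin.ext hij
      subst hij'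
      congr 1
      exact ih L.length (by omega) (by rw [hsi, hsj]) hL1 hL1' rfl
    · exact (key j i L' L hsj hsi hL1' hL1 (by omega) (by omega) hdj hdi hij).symm

end Matsumoto

end CycDAHA

namespace CycDAHA
open Polynomial

/-! ### Braid calculus for sequences of elements of a monoid -/

section Sequences

variable {A : Type*} [Monoid A]

/-- `f_a f_{a+1} ⋯ f_{b-1}`. -/
def up (f : ℕ → A) (a b : ℕ) : A := ((List.Ico a b).map f).prod

/-- `f_{b-1} ⋯ f_{a+1} f_a`. -/
def dn (f : ℕ → A) (a b : ℕ) : A := ((List.Ico a b).reverse.map f).prod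

variable {f g : ℕ → A} {a b : ℕ} {x : A}

theorem up_self : up f a a = 1 := by simp [up]

theorem dn_self : dn f a a = 1 := by simp [dn]

theorem up_of_le (h : b ≤ a) : up f a b = 1 := by simp [up, List.Ico.eq_nil_of_le h]

theorem dn_of_le (h : b ≤ a) : dn f a b = 1 := by simp [dn, List.Ico.eq_nil_of_le h]

theorem up_succ (h : a ≤ b) : up f a (b + 1) = up f a b * f b := by
  simp [up, List.Ico.succ_top h]

theorem dn_succ (h : a ≤ b) : dn f a (b + 1) = f b * dn f a b := by
  simp [dn, List.Ico.succ_top h]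

theorem up_cons (h : a < b) : up f a b = f a * up f (a + 1) b := by
  simp [up, List.Ico.eq_cons h]

theorem dn_cons (h : a < b) : dn f a b = dn f (a + 1) b * f a := by
  simp [dn, List.Ico.eq_cons h]

theorem commute_up (h : ∀ k, a ≤ k → k < b → Commute x (f k)) : Commute x (up f a b) := by
  apply Commute.list_prod_right
  intro y hy
  obtain ⟨k, hk, rfl⟩ := List.mem_map.1 hy
  rw [List.Ico.mem] at hk
  exact h k hk.1 hk.2

theorem commute_dn (h : ∀ k, a ≤ k → k < b → Commute x (f k)) : Commute x (dn f a b) := by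
  apply Commute.list_prod_right
  intro y hy
  obtain ⟨k, hk, rfl⟩ := List.mem_map.1 hy
  rw [List.mem_reverse, List.Ico.mem] at hk
  exact h k hk.1 hk.2

/-- A family of invertible elements satisfying the braid relations of type `A_n`. -/
structure BraidSeq (n : ℕ) (T Ti : ℕ → A) : Prop where
  mul_inv : ∀ k, T k * Ti k = 1
  inv_mul : ∀ k, Ti k * T k = 1
  braid : ∀ k, k + 1 < n → T k * T (k + 1) * T k = T (k + 1) * T k * T (k + 1)
  comm : ∀ j k, j + 2 ≤ k → Commute (T j) (T k)

/-- A sequence `E` with `E_{k+1} = g_k E_k g_k`, with `g_k` commuting with the other `E_j`. -/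
structure Twisted (n : ℕ) (g E : ℕ → A) : Prop where
  step : ∀ k, k < n → g k * E k * g k = E (k + 1)
  comm : ∀ k j, j ≠ k → j ≠ k + 1 → Commute (g k) (E j)

theorem commute_inv {u v v' : A} (h : Commute u v) (h1 : v * v' = 1) (h2 : v' * v = 1) :
    Commute u v' := by
  have : u * v' = v' * u := by
    calc u * v' = v' * v * u * v' := by rw [h2, one_mul]
      _ = v' * (v * u) * v' := by simp only [mul_assoc]
      _ = v' * u * (v * v') := by rw [← h.eq]; simp only [mul_assoc]
      _ = v' * u := by rw [h1, mul_one]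
  exact this

theorem braid_conj {a b a' b' : A} (ha : a' * a = 1) (hb : b * b' = 1) (h : a * b * a = b * a * b) :
    b * a * b' = a' * b * a :=
  calc b * a * b' = a' * a * (b * a * b') := by rw [ha, one_mul]
    _ = a' * (a * b * a) * b' := by simp only [mul_assoc]
    _ = a' * b * a * (b * b') := by rw [h]; simp only [mul_assoc]
    _ = a' * b * a := by rw [hb, mul_one]

/-- Conjugation turns powers into powers, so the case `m = 1`, which is the braid relation itself,
implies all the others. -/
theorem braid_conj_pow {a b a' b' : A} (ha : a' * a = 1) (ha' : a * a' = 1) (hb : b * b' = 1)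
    (hb' : b' * b = 1) (h : a * b * a = b * a * b) (m : ℕ) :
    b * a ^ m * b' = a' * b ^ m * a := by
  induction m with
  | zero => simp [ha, hb]
  | succ m ih =>
    calc b * a ^ (m + 1) * b' = b * a ^ m * (b' * b) * a * b' := by
          rw [hb', pow_succ]; simp only [mul_assoc, one_mul]
      _ = (b * a ^ m * b') * (b * a * b') := by simp only [mul_assoc]
      _ = a' * b ^ m * (a * a') * b * a := by
          rw [ih, braid_conj ha hb h]; simp only [mul_assoc]
      _ = a' * b ^ (m + 1) * a := by rw [ha', pow_succ]; simp only [mul_assoc, one_mul]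

namespace BraidSeq

variable {n : ℕ} {T Ti : ℕ → A}

theorem mul_inv_assoc (B : BraidSeq n T Ti) (k : ℕ) (x : A) : T k * (Ti k * x) = x := by
  rw [← mul_assoc, B.mul_inv, one_mul]

theorem inv_mul_assoc (B : BraidSeq n T Ti) (k : ℕ) (x : A) : Ti k * (T k * x) = x := by
  rw [← mul_assoc, B.inv_mul, one_mul]

theorem comm_inv (B : BraidSeq n T Ti) {j k : ℕ} (h : j + 2 ≤ k) : Commute (T j) (Ti k) :=
  commute_inv (B.comm j k h) (B.mul_inv k) (B.inv_mul k)

theorem inv_comm (B : BraidSeq n T Ti) {j k : ℕ} (h : j + 2 ≤ k) : Commute (Ti j) (T k) :=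
  (commute_inv (B.comm j k h).symm (B.mul_inv j) (B.inv_mul j)).symm

theorem symm (B : BraidSeq n T Ti) : BraidSeq n Ti T where
  mul_inv := B.inv_mul
  inv_mul := B.mul_inv
  braid k hk := by
    have e1 : (Ti k * Ti (k + 1) * Ti k) * (T k * T (k + 1) * T k) = 1 := by
      simp only [mul_assoc, B.inv_mul_assoc, B.inv_mul]
    have e2 : (T k * T (k + 1) * T k) * (Ti (k + 1) * Ti k * Ti (k + 1)) = 1 := by
      rw [B.braid k hk]
      simp only [mul_assoc, B.mul_inv_assoc, B.mul_inv]
    exact left_inv_eq_right_inv e1 e2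
  comm j k h := commute_inv (B.inv_comm h) (B.mul_inv k) (B.inv_mul k)

theorem up_mul_dn (B : BraidSeq n T Ti) (a b : ℕ) : up T a b * dn Ti a b = 1 := by
  induction b with
  | zero => simp [up_of_le, dn_of_le]
  | succ b ih =>
    rcases le_or_gt a b with h | h
    · rw [up_succ h, dn_succ h, mul_assoc, B.mul_inv_assoc, ih]
    · simp [up_of_le h, dn_of_le h]

theorem dn_mul_up (B : BraidSeq n T Ti) (a b : ℕ) : dn Ti a b * up T a b = 1 := by
  induction b with
  | zero => simp [up_of_le, dn_of_le]
  | succ b ih =>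
    rcases le_or_gt a b with h | h
    · rw [up_succ h, dn_succ h, mul_assoc, ← mul_assoc _ (up T a b), ih, one_mul, B.inv_mul]
    · simp [up_of_le h, dn_of_le h]

/-- `T_{k-1} ⋯ T_{i+1} T_i^m T_{i+1}⁻¹ ⋯ = T_i⁻¹ ⋯ T_{k-1}^m ⋯ T_i`, for an element `T_i^m`. -/
theorem dn_conj_up (B : BraidSeq n T Ti) (m i : ℕ) {k : ℕ} (hi : i ≤ k) (hk : k < n) :
    dn T (i + 1) (k + 1) * T i ^ m * up Ti (i + 1) (k + 1) = up Ti i k * T k ^ m * dn T i k := by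
  induction k, hi using Nat.le_induction with
  | base => simp [dn_self, up_self]
  | succ k hik ih =>
    have hc := braid_conj_pow (B.inv_mul k) (B.mul_inv k) (B.mul_inv (k + 1)) (B.inv_mul (k + 1))
      (B.braid k hk) m
    have h1 : Commute (T (k + 1)) (up Ti i k) :=
      commute_up fun j _ hj => (B.inv_comm (by omega)).symm
    have h2 : Commute (Ti (k + 1)) (dn T i k) :=
      commute_dn fun j _ hj => (B.comm_inv (by omega)).symm
    rw [dn_succ (by omega), up_succ (f := Ti) (by omega : i + 1 ≤ k + 1), up_succ hik, dn_succ hik]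
    calc T (k + 1) * dn T (i + 1) (k + 1) * T i ^ m * (up Ti (i + 1) (k + 1) * Ti (k + 1))
        = T (k + 1) * (dn T (i + 1) (k + 1) * T i ^ m * up Ti (i + 1) (k + 1)) * Ti (k + 1) := by
          simp only [mul_assoc]
      _ = (T (k + 1) * up Ti i k) * T k ^ m * (dn T i k * Ti (k + 1)) := by
          rw [ih (by omega)]; simp only [mul_assoc]
      _ = up Ti i k * (T (k + 1) * T k ^ m * Ti (k + 1)) * dn T i k := by
          rw [h1.eq, ← h2.eq]; simp only [mul_assoc]
      _ = _ := by rw [hc]; simp only [mul_assoc]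

/-- `T_k` passes through the word `T_{j-1} ⋯ T_0` as `T_{k+1}`. -/
theorem mul_dn (B : BraidSeq n T Ti) {k j : ℕ} (hkj : k + 2 ≤ j) (hj : j ≤ n) :
    T k * dn T 0 j = dn T 0 j * T (k + 1) := by
  induction j, hkj using Nat.le_induction with
  | base =>
    rw [dn_succ (by omega), dn_succ (by omega)]
    have c : Commute (T (k + 1)) (dn T 0 k) :=
      commute_dn fun i _ hi => (B.comm i (k + 1) (by omega)).symm
    calc T k * (T (k + 1) * (T k * dn T 0 k)) = (T k * T (k + 1) * T k) * dn T 0 k := by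
          simp only [mul_assoc]
      _ = T (k + 1) * T k * (T (k + 1) * dn T 0 k) := by
          rw [B.braid k (by omega)]; simp only [mul_assoc]
      _ = _ := by rw [c.eq]; simp only [mul_assoc]
  | succ j hkj ih =>
    rw [dn_succ (by omega), ← mul_assoc, (B.comm k j (by omega)).eq, mul_assoc,
      ih (by omega), mul_assoc]

theorem up_mul (B : BraidSeq n T Ti) {k j : ℕ} (hkj : k + 2 ≤ j) (hj : j ≤ n) :
    up T 0 j * T k = T (k + 1) * up T 0 j := by
  induction j, hkj using Nat.le_induction with
  | base =>
    rw [up_succ (by omega), up_succ (by omega)]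
    have c : Commute (T (k + 1)) (up T 0 k) :=
      commute_up fun i _ hi => (B.comm i (k + 1) (by omega)).symm
    calc up T 0 k * T k * T (k + 1) * T k = up T 0 k * (T k * T (k + 1) * T k) := by
          simp only [mul_assoc]
      _ = (up T 0 k * T (k + 1)) * T k * T (k + 1) := by
          rw [B.braid k (by omega)]; simp only [mul_assoc]
      _ = _ := by rw [← c.eq]; simp only [mul_assoc]
  | succ j hkj ih =>
    rw [up_succ (by omega), mul_assoc, ← (B.comm k j (by omega)).eq, ← mul_assoc,
      ih (by omega), mul_assoc]

end BraidSeq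

namespace Twisted

variable {n : ℕ} {T Ti E F : ℕ → A}

theorem commute_inv (B : BraidSeq n T Ti) (hE : Twisted n T E) {k j : ℕ} (h : j ≠ k)
    (h' : j ≠ k + 1) : Commute (Ti k) (E j) :=
  (CycDAHA.commute_inv (hE.comm k j h h').symm (B.mul_inv k) (B.inv_mul k)).symm

theorem inv_mul_succ (B : BraidSeq n T Ti) (hE : Twisted n T E) {k : ℕ} (h : k < n) :
    Ti k * E (k + 1) = E k * T k := by
  rw [← hE.step k h, mul_assoc, B.inv_mul_assoc]

theorem succ_mul_inv (B : BraidSeq n T Ti) (hE : Twisted n T E) {k : ℕ} (h : k < n) :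
    E (k + 1) * Ti k = T k * E k := by
  rw [← hE.step k h, mul_assoc, B.mul_inv, mul_one]

/-- Propagation of a commutation relation `E_i F_j = F_j E_i a` to `F_{j+1}`. -/
theorem mixed_step (B : BraidSeq n T Ti) (hE : Twisted n T E) (hF : Twisted n T F) {i j : ℕ}
    (hij : i < j) (hj : j < n) {a : A} (h : E i * F j = F j * E i * a) :
    E i * F (j + 1) = F (j + 1) * E i * (Ti j * a * T j) := by
  have c1 := hE.comm j i (by omega) (by omega)
  have c2 := hE.commute_inv B (k := j) (j := i) (by omega) (by omega)
  rw [← hF.step j hj]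
  calc E i * (T j * F j * T j) = (E i * T j) * F j * T j := by simp only [mul_assoc]
    _ = T j * (E i * F j) * T j := by rw [← c1.eq]; simp only [mul_assoc]
    _ = T j * F j * (T j * (Ti j * (E i * (a * T j)))) := by
      rw [h, B.mul_inv_assoc]; simp only [mul_assoc]
    _ = T j * F j * T j * ((Ti j * E i) * (a * T j)) := by simp only [mul_assoc]
    _ = T j * F j * T j * E i * (Ti j * a * T j) := by rw [c2.eq]; simp only [mul_assoc]

/-- Propagation of a commutation relation `F_i E_j = a E_j F_i` to `E_{j+1}`. -/
theorem mixed_step' (B : BraidSeq n T Ti) (hE : Twisted n T E) (hF : Twisted n T F) {i j : ℕ}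
    (hij : i < j) (hj : j < n) {a : A} (h : F i * E j = a * E j * F i) :
    F i * E (j + 1) = (T j * a * Ti j) * E (j + 1) * F i := by
  have c1 := hF.comm j i (by omega) (by omega)
  rw [← hE.step j hj]
  calc F i * (T j * E j * T j) = (F i * T j) * E j * T j := by simp only [mul_assoc]
    _ = T j * (F i * E j) * T j := by rw [← c1.eq]; simp only [mul_assoc]
    _ = T j * a * E j * (F i * T j) := by rw [h]; simp only [mul_assoc]
    _ = T j * a * (Ti j * (T j * (E j * (T j * F i)))) := by
      rw [← c1.eq, B.inv_mul_assoc]; simp only [mul_assoc]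
    _ = _ := by simp only [mul_assoc]

/-- A twisted sequence generated by `E_0`, where `E_0` commutes with `T_k` for `k ≥ 1`. -/
theorem of_zero (B : BraidSeq n T Ti) (hT : ∀ k, n ≤ k → T k = 1) (hE : ∀ k, n < k → E k = 1)
    (h : ∀ k, k ≤ n → E k = dn T 0 k * E 0 * up T 0 k) (h0 : ∀ k, 0 < k → Commute (T k) (E 0)) :
    Twisted n T E where
  step k hk := by
    rw [h k hk.le, h (k + 1) hk, dn_succ (Nat.zero_le _), up_succ (Nat.zero_le _)]
    simp only [mul_assoc]
  comm k j h1 h2 := by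
    rcases le_or_gt n k with hk | hk
    · rw [hT k hk]; exact Commute.one_left _
    rcases lt_or_ge n j with hj | hj
    · rw [hE j hj]; exact Commute.one_right _
    rw [h j hj]
    rcases lt_or_ge j k with hjk | hjk
    · refine Commute.mul_right (Commute.mul_right ?_ (h0 k (by omega))) ?_
      · exact commute_dn fun i _ hi => (B.comm i k (by omega)).symm
      · exact commute_up fun i _ hi => (B.comm i k (by omega)).symm
    -- Here `T_k` enters the left word and comes out as `T_{k+1}`, passes `E_0` since its index is
    -- positive, and returns to `T_k` through the right word.
    · have hkj : k + 2 ≤ j := by omega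
      have c := h0 (k + 1) (by omega)
      show T k * (dn T 0 j * E 0 * up T 0 j) = dn T 0 j * E 0 * up T 0 j * T k
      calc T k * (dn T 0 j * E 0 * up T 0 j) = (T k * dn T 0 j) * E 0 * up T 0 j := by
            simp only [mul_assoc]
        _ = dn T 0 j * (T (k + 1) * E 0) * up T 0 j := by
            rw [B.mul_dn hkj hj]; simp only [mul_assoc]
        _ = dn T 0 j * E 0 * (up T 0 j * T k) := by
            rw [c.eq, B.up_mul hkj hj]; simp only [mul_assoc]
        _ = _ := by simp only [mul_assoc]

/-- A twisted sequence is commutative if `E_0` and `E_1` commute. -/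
theorem commute_of_zero (hE : Twisted n T E) (h : 0 < n → Commute (E 0) (E 1)) {i j : ℕ}
    (hi : i ≤ n) (hj : j ≤ n) : Commute (E i) (E j) := by
  have key : ∀ i j, i < j → j ≤ n → Commute (E i) (E j) := by
    intro i
    induction i with
    | zero =>
      intro j hj
      induction j, hj using Nat.le_induction with
      | base => exact h
      | succ j hj ih =>
        intro h
        rw [← hE.step j h]
        have c := (hE.comm j 0 (by omega) (by omega)).symm
        exact (c.mul_right (ih (by omega))).mul_right c
    | succ i ih =>
      intro j hij hj
      rw [← hE.step i (by omega)]
      have c := hE.comm i j (by omega) (by omega)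
      exact (c.mul_left (ih j (by omega) hj)).mul_left c
  rcases lt_trichotomy i j with h | h | h
  · exact key i j h hj
  · rw [h]
  · exact (key j i h hi).symm

/-- The product of a commutative twisted sequence commutes with the `T_k`. -/
theorem commute_prod (hE : Twisted n T E) (hc : ∀ i j, Commute (E i) (E j)) {k : ℕ} (hk : k < n) :
    Commute (T k) (up E 0 (n + 1)) := by
  have h2 : Commute (T k) (E k * E (k + 1)) := by
    have e := (hc k (k + 1)).eq
    have s := hE.step k hk
    have : T k * (E k * E (k + 1)) = E k * E (k + 1) * T k := by
      calc T k * (E k * E (k + 1)) = (T k * E k * T k) * E k * T k := by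
            rw [← s]; simp only [mul_assoc]
        _ = E k * E (k + 1) * T k := by rw [s, e]
    exact this
  have key : ∀ m, k + 2 ≤ m → Commute (T k) (up E 0 m) := by
    intro m hm
    induction m, hm using Nat.le_induction with
    | base =>
      rw [up_succ (by omega), up_succ (by omega), mul_assoc]
      exact (commute_up fun j _ hj => hE.comm k j (by omega) (by omega)).mul_right h2
    | succ m hm ih =>
      rw [up_succ (by omega)]
      exact ih.mul_right (hE.comm k m (by omega) (by omega))
  exact key _ (by omega)

end Twisted

/-- The relations of the double affine Hecke algebra that do not involve `q`. -/
structure MixedSeq (n : ℕ) (T Ti X Y : ℕ → A) : Prop where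
  braid : BraidSeq n T Ti
  tX : Twisted n T X
  tY : Twisted n T Y
  commX : ∀ i j, Commute (X i) (X j)
  commY : ∀ i j, Commute (Y i) (Y j)
  mixed : 0 < n → X 0 * Y 1 = Y 1 * X 0 * T 0 ^ 2

namespace MixedSeq

variable {n : ℕ} {T Ti X Y : ℕ → A}

/-- Only the pair `(0, 1)` is given. The relation for `(k, k+1)` is first propagated to `(k, k+2)`,
where the correction factor is a conjugate of `T_k ^ 2`; the braid relation makes it a conjugate of
`T_{k+1} ^ 2` by `T_k`, and conjugation by `T_k` then turns `X_k` into `X_{k+1}` without disturbing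
`Y_{k+2}`. -/
theorem mul_succ (S : MixedSeq n T Ti X Y) (k : ℕ) (hk : k < n) :
    X k * Y (k + 1) = Y (k + 1) * X k * T k ^ 2 := by
  induction k with
  | zero => exact S.mixed hk
  | succ k ih =>
    have B := S.braid
    have h1 := S.tX.mixed_step B S.tY (Nat.lt_succ_self k) hk (ih (by omega))
    have c := S.tY.comm k (k + 2) (by omega) (by omega)
    have hb : Ti (k + 1) * T k ^ 2 * T (k + 1) = T k * T (k + 1) ^ 2 * Ti k := by
      have := braid_conj_pow (a := T (k + 1)) (b := T k) (a' := Ti (k + 1)) (b' := Ti k)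
        (B.inv_mul _) (B.mul_inv _) (B.mul_inv _) (B.inv_mul _) (B.braid k hk).symm 2
      exact this.symm
    rw [hb] at h1
    calc X (k + 1) * Y (k + 2) = T k * X k * (T k * Y (k + 2)) := by
          rw [← S.tX.step k (by omega)]; simp only [mul_assoc]
      _ = T k * (X k * Y (k + 2)) * T k := by rw [c.eq]; simp only [mul_assoc]
      _ = (T k * Y (k + 2)) * X k * T k * T (k + 1) ^ 2 * (Ti k * T k) := by
          rw [h1]; simp only [mul_assoc]
      _ = Y (k + 2) * (T k * X k * T k) * T (k + 1) ^ 2 := by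
          rw [c.eq, B.inv_mul, mul_one]; simp only [mul_assoc]
      _ = _ := by rw [S.tX.step k (by omega)]

theorem mul_of_lt (S : MixedSeq n T Ti X Y) {i j : ℕ} (h : i < j) (hj : j ≤ n) :
    X i * Y j = Y j * X i * (dn Ti (i + 1) j * T i ^ 2 * up T (i + 1) j) := by
  induction j, h using Nat.le_induction with
  | base => simpa [dn_self, up_self] using S.mul_succ i hj
  | succ j hij ih =>
    rw [S.tX.mixed_step S.braid S.tY hij hj (ih (by omega)), dn_succ hij, up_succ hij]
    simp only [mul_assoc]

/-- This is `mul_succ` rewritten: `Y_{k+1} = T_k Y_k T_k` is substituted on both sides, and `X_k` is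
expressed through `X_{k+1}`. -/
theorem mul_succ' (S : MixedSeq n T Ti X Y) (k : ℕ) (hk : k < n) :
    Y k * X (k + 1) = Ti k ^ 2 * X (k + 1) * Y k := by
  have B := S.braid
  have h := S.mul_succ k hk
  rw [← S.tY.step k hk] at h
  have e : X k = Ti k * X (k + 1) * Ti k := by
    rw [S.tX.inv_mul_succ B hk, mul_assoc, B.mul_inv, mul_one]
  calc Y k * X (k + 1) = Ti k * ((T k * Y k * T k) * X k * T k ^ 2) * Ti k := by
        rw [← S.tX.step k hk, pow_two]
        simp only [mul_assoc, B.inv_mul_assoc, B.mul_inv, mul_one]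
    _ = Ti k * (X k * (T k * Y k * T k)) * Ti k := by rw [← h]
    _ = Ti k * (X k * T k) * Y k := by
        simp only [mul_assoc, B.mul_inv, mul_one]
    _ = _ := by
        rw [← S.tX.inv_mul_succ B hk, pow_two]; simp only [mul_assoc]

theorem mul_of_lt' (S : MixedSeq n T Ti X Y) {i j : ℕ} (h : i < j) (hj : j ≤ n) :
    Y i * X j = dn T (i + 1) j * Ti i ^ 2 * up Ti (i + 1) j * X j * Y i := by
  induction j, h using Nat.le_induction with
  | base => simpa [dn_self, up_self] using S.mul_succ' i hj
  | succ j hij ih =>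
    rw [Twisted.mixed_step' S.braid S.tX S.tY hij hj (ih (by omega)), dn_succ hij, up_succ hij]
    simp only [mul_assoc]

/-- `Y_0` commutes with `X_1 ⋯ X_k` up to a product of `T`s. -/
theorem Y_zero_mul_up (S : MixedSeq n T Ti X Y) {k : ℕ} (hk : k ≤ n) :
    Y 0 * up X 1 (k + 1) = up Ti 0 k * dn Ti 0 k * up X 1 (k + 1) * Y 0 := by
  have B := S.braid
  induction k with
  | zero => simp [up_of_le, dn_of_le]
  | succ k ih =>
    have c1 : Commute (X (k + 1)) (up X 1 (k + 1)) := commute_up fun j _ _ => S.commX _ _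
    have c2 : Commute (X (k + 1)) (up Ti 0 k * dn Ti 0 k) := by
      refine Commute.mul_right (commute_up fun j _ hj => ?_) (commute_dn fun j _ hj => ?_) <;>
      exact (S.tX.commute_inv B (by omega) (by omega)).symm
    -- The conjugation identity `dn_conj_up` treats nonnegative powers of `T_0` only; the version
    -- for `T_0⁻²` follows by taking inverses of both sides for the exponent `2`.
    have e1 : dn T 1 (k + 1) * Ti 0 ^ 2 * up Ti 1 (k + 1) = up Ti 0 k * Ti k ^ 2 * dn T 0 k := by
      have h := B.dn_conj_up 2 0 (Nat.zero_le k) (by omega)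
      have c : ∀ m : ℕ, Ti m ^ 2 * T m ^ 2 = 1 := fun m => by
        rw [pow_two, pow_two]; simp only [mul_assoc, B.inv_mul_assoc, B.inv_mul]
      have c' : ∀ m : ℕ, T m ^ 2 * Ti m ^ 2 = 1 := fun m => by
        rw [pow_two, pow_two]; simp only [mul_assoc, B.mul_inv_assoc, B.mul_inv]
      rw [zero_add] at h
      refine left_inv_eq_right_inv (a := dn T 1 (k + 1) * T 0 ^ 2 * up Ti 1 (k + 1)) ?_ ?_
      · calc dn T 1 (k + 1) * Ti 0 ^ 2 * up Ti 1 (k + 1) *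
            (dn T 1 (k + 1) * T 0 ^ 2 * up Ti 1 (k + 1))
            = dn T 1 (k + 1) * Ti 0 ^ 2 * (up Ti 1 (k + 1) *
            dn T 1 (k + 1)) * T 0 ^ 2 * up Ti 1 (k + 1) := by simp only [mul_assoc]
          _ = dn T 1 (k + 1) * (Ti 0 ^ 2 * T 0 ^ 2) * up Ti 1 (k + 1) := by
            rw [B.symm.up_mul_dn, mul_one]; simp only [mul_assoc]
          _ = 1 := by rw [c, mul_one, B.symm.dn_mul_up]
      · rw [h]
        calc up Ti 0 k * T k ^ 2 * dn T 0 k * (up Ti 0 k * Ti k ^ 2 * dn T 0 k)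
            = up Ti 0 k * T k ^ 2 * (dn T 0 k * up Ti 0 k) * Ti k ^ 2 * dn T 0 k := by
              simp only [mul_assoc]
          _ = up Ti 0 k * (T k ^ 2 * Ti k ^ 2) * dn T 0 k := by
              rw [B.symm.dn_mul_up, mul_one]; simp only [mul_assoc]
          _ = 1 := by rw [c', mul_one, B.symm.up_mul_dn]
    have e2 := S.mul_of_lt' (i := 0) (j := k + 1) (by omega) hk
    rw [zero_add, e1] at e2
    rw [up_succ (by omega : 1 ≤ k + 1), ← c1.eq]
    calc Y 0 * (X (k + 1) * up X 1 (k + 1)) = (Y 0 * X (k + 1)) * up X 1 (k + 1) := by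
          simp only [mul_assoc]
      _ = up Ti 0 k * Ti k ^ 2 * dn T 0 k * X (k + 1) * (Y 0 * up X 1 (k + 1)) := by
          rw [e2]; simp only [mul_assoc]
      _ = up Ti 0 k * Ti k ^ 2 * dn T 0 k * (X (k + 1) * (up Ti 0 k * dn Ti 0 k)) *
            up X 1 (k + 1) * Y 0 := by rw [ih (by omega)]; simp only [mul_assoc]
      _ = up Ti 0 k * Ti k ^ 2 * (dn T 0 k * up Ti 0 k) * dn Ti 0 k * (X (k + 1) *
            up X 1 (k + 1)) * Y 0 := by rw [c2.eq]; simp only [mul_assoc]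
      _ = _ := by
          rw [B.symm.dn_mul_up, mul_one, up_succ (Nat.zero_le _), dn_succ (Nat.zero_le _), pow_two]
          simp only [mul_assoc]

end MixedSeq
end Sequences
end CycDAHA

namespace CycDAHA
open Polynomial

/-! ### Families indexed by `Fin` as sequences extended by `1` -/

section Ext

variable {R A : Type*} [CommRing R] [Ring A] [Algebra R A] {n : ℕ}

theorem ext_of_lt {T : Fin n → A} {k : ℕ} (h : k < n) : ext T k = T ⟨k, h⟩ := dif_pos h

theorem ext_of_le {T : Fin n → A} {k : ℕ} (h : n ≤ k) : ext T k = 1 := dif_neg h.not_gt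

theorem ext_val (T : Fin n → A) (i : Fin n) : ext T (i : ℕ) = T i := by simp [ext]

theorem ext_cases {P : A → Prop} {T : Fin n → A} (h1 : P 1) (h : ∀ i, P (T i)) (k : ℕ) :
    P (ext T k) := by
  unfold ext; split_ifs
  · exact h _
  · exact h1

theorem twisted_ext {T : Fin n → A} {X : Fin (n + 1) → A}
    (h4 : ∀ i : Fin n, T i * X i.castSucc * T i = X i.succ)
    (h5 : ∀ (i : Fin n) (j : Fin (n + 1)), j ≠ i.castSucc → j ≠ i.succ → T i * X j = X j * T i) :
    Twisted n (ext T) (ext X) where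
  step k hk := by
    rw [ext_of_lt hk, ext_of_lt (by omega : k < n + 1), ext_of_lt (by omega : k + 1 < n + 1)]
    exact h4 ⟨k, hk⟩
  comm k j h1 h2 := by
    rcases lt_or_ge k n with hk | hk
    · rcases lt_or_ge j (n + 1) with hj | hj
      · rw [ext_of_lt hk, ext_of_lt hj]
        refine h5 _ _ ?_ ?_
        · simpa [Fin.ext_iff] using h1
        · simpa [Fin.ext_iff] using h2
      · rw [ext_of_le hj]; exact Commute.one_right _
    · rw [ext_of_le hk]; exact Commute.one_left _

theorem braidSeq_ext {T T' : Fin n → A} (h1 : ∀ i, T i * T' i = 1) (h1' : ∀ i, T' i * T i = 1)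
    (h2 : ∀ i j : Fin n, (i : ℕ) + 1 = j → T i * T j * T i = T j * T i * T j)
    (h3 : ∀ i j : Fin n, (i : ℕ) + 2 ≤ j → T i * T j = T j * T i) :
    BraidSeq n (ext T) (ext T') where
  mul_inv k := by
    rcases lt_or_ge k n with hk | hk
    · rw [ext_of_lt hk, ext_of_lt hk, h1]
    · rw [ext_of_le hk, ext_of_le hk, one_mul]
  inv_mul k := by
    rcases lt_or_ge k n with hk | hk
    · rw [ext_of_lt hk, ext_of_lt hk, h1']
    · rw [ext_of_le hk, ext_of_le hk, one_mul]
  braid k hk := by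
    rw [ext_of_lt hk, ext_of_lt (by omega : k < n)]
    exact h2 _ _ rfl
  comm j k h := by
    rcases lt_or_ge k n with hk | hk
    · rw [ext_of_lt hk, ext_of_lt (by omega : j < n)]; exact h3 _ _ h
    · rw [ext_of_le hk]; exact Commute.one_right _

/-- Expanding the Hecke relation, with `t * t⁻¹ = 1`, gives `T² - (t - t⁻¹) T = 1`, which factors as
`T (T - t + t⁻¹)` in either order since scalars are central. -/
theorem mul_tInv_of_quadratic {t : Rˣ} {T : Fin n → A} {i : Fin n}
    (h : (T i - algebraMap R A (t : R)) * (T i + algebraMap R A ((t⁻¹ : Rˣ) : R)) = 0) :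
    T i * tInv t T i = 1 ∧ tInv t T i * T i = 1 := by
  have e : algebraMap R A (t : R) * algebraMap R A ((t⁻¹ : Rˣ) : R) = 1 := by
    rw [← map_mul, Units.mul_inv, map_one]
  have c1 := Algebra.commutes (t : R) (T i)
  have c2 := Algebra.commutes ((t⁻¹ : Rˣ) : R) (T i)
  have key : T i * T i - T i * algebraMap R A (t : R) + T i * algebraMap R A ((t⁻¹ : Rˣ) : R) = 1 := by
    have h' : T i * T i + T i * algebraMap R A ((t⁻¹ : Rˣ) : R) - algebraMap R A (t : R) * T i - 1 = 0 := by
      rw [← h, ← e]; noncomm_ring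
    rw [c1] at h'
    rw [← sub_eq_zero, ← h']; abel
  constructor
  · rw [← key, tInv, map_sub]; noncomm_ring
  · rw [← key, tInv, map_sub, sub_mul, sub_mul, c1, c2]; noncomm_ring

theorem ext_sub_tInv {t : Rˣ} {T : Fin n → A} {k : ℕ} (hk : k < n) :
    ext T k = ext (tInv t T) k + algebraMap R A ((t : R) - ((t⁻¹ : Rˣ) : R)) := by
  rw [ext_of_lt hk, ext_of_lt hk, tInv, sub_add_cancel]

end Ext

/-! ### Values of the polynomial `f` and its partial products -/

section Evaluation

variable {R A : Type*} [CommRing R] [Ring A] [Algebra R A] {l : ℕ}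

theorem mul_aeval_of_semiconj {v u u' : A} (h : v * u = u' * v) (p : R[X]) :
    v * aeval u p = aeval u' p * v := by
  induction p using Polynomial.induction_on' with
  | add p q hp hq => simp only [map_add, mul_add, add_mul, hp, hq]
  | monomial k a =>
    have hk : v * u ^ k = u' ^ k * v := by
      induction k with
      | zero => simp
      | succ k ih => rw [pow_succ, ← mul_assoc, ih, mul_assoc, h, pow_succ, mul_assoc]
    rw [aeval_monomial, aeval_monomial, mul_assoc, ← hk, ← mul_assoc, ← mul_assoc,
      Algebra.commutes]

theorem mul_zEval_of_semiconj (Z : Fin l → Rˣ) (S : Finset (Fin l)) {v u u' : A}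
    (h : v * u = u' * v) : v * zEval Z S u = zEval Z S u' * v := mul_aeval_of_semiconj h _

theorem commute_zEval (Z : Fin l → Rˣ) (S : Finset (Fin l)) {v u : A} (h : Commute v u) :
    Commute v (zEval Z S u) := mul_zEval_of_semiconj Z S h.eq

theorem zEval_insert (Z : Fin l → Rˣ) {S : Finset (Fin l)} {r : Fin l} (h : r ∉ S) (u : A) :
    zEval Z (insert r S) u = (u - algebraMap R A (Z r)) * zEval Z S u := by
  simp [zEval, zPoly, Finset.prod_insert h]

theorem zEval_insert' (Z : Fin l → Rˣ) {S : Finset (Fin l)} {r : Fin l} (h : r ∉ S) (u : A) :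
    zEval Z (insert r S) u = zEval Z S u * (u - algebraMap R A (Z r)) := by
  rw [zEval, zPoly, Finset.prod_insert h, mul_comm]
  simp [zEval, zPoly]

theorem zEval_empty (Z : Fin l → Rˣ) (u : A) : zEval Z ∅ u = 1 := by simp [zEval, zPoly]

/-- The noncommutative Leibniz rule for a product of linear factors. -/
theorem zEval_mul_sub (Z : Fin l → Rˣ) (u x : A) :
    zEval Z Finset.univ u * x - x * zEval Z Finset.univ u =
      ∑ r : Fin l, zEval Z (Finset.Iio r) u * (u * x - x * u) * zEval Z (Finset.Ioi r) u := by
  classical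
  -- The element `x` is placed after the first `k` linear factors. The sum telescopes, each
  -- difference replacing `[u - Z_r, x]` by `[u, x]` because the scalar is central.
  set lo : ℕ → Finset (Fin l) := fun k => Finset.univ.filter fun m : Fin l => (m : ℕ) < k
  set hi : ℕ → Finset (Fin l) := fun k => Finset.univ.filter fun m : Fin l => k ≤ (m : ℕ)
  set g : ℕ → A := fun k => zEval Z (lo k) u * x * zEval Z (hi k) u with hg
  have e0 : g 0 = x * zEval Z Finset.univ u := by
    have h1 : lo 0 = ∅ := by simp [lo]
    have h2 : hi 0 = Finset.univ := by simp [hi]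
    rw [hg]; simp only [h1, h2, zEval_empty, one_mul]
  have el : g l = zEval Z Finset.univ u * x := by
    have h1 : lo l = Finset.univ := by simp [lo]
    have h2 : hi l = ∅ := by
      simp only [hi, Finset.filter_eq_empty_iff]; intro m _; have := m.2; omega
    rw [hg]; simp only [h1, h2, zEval_empty, mul_one]
  rw [← e0, ← el, ← Finset.sum_range_sub, Finset.sum_range]
  refine Finset.sum_congr rfl fun r _ => ?_
  have hl : lo (r + 1) = insert r (Finset.Iio r) := by
    ext m; simp only [lo, Finset.mem_filter, Finset.mem_univ, true_and, Finset.mem_insert,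
      Finset.mem_Iio, Fin.ext_iff, Fin.lt_def]; omega
  have hl' : lo r = Finset.Iio r := by
    ext m; simp [lo]
  have hh : hi r = insert r (Finset.Ioi r) := by
    ext m; simp only [hi, Finset.mem_filter, Finset.mem_univ, true_and, Finset.mem_insert,
      Finset.mem_Ioi, Fin.ext_iff, Fin.lt_def]; omega
  have hh' : hi (r + 1) = Finset.Ioi r := by
    ext m; simp only [hi, Finset.mem_filter, Finset.mem_univ, true_and,
      Finset.mem_Ioi, Fin.lt_def]; omega
  simp only [hg, hl, hl', hh, hh']
  rw [zEval_insert' Z (by simp), zEval_insert Z (by simp)]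
  have hc := Algebra.commutes (Z r : R) x
  rw [show ∀ a b : A, a * (u - algebraMap R A (Z r)) * x * b -
    a * x * ((u - algebraMap R A (Z r)) * b) =
    a * (u * x - x * u) * b - a * (algebraMap R A (Z r) * x - x * algebraMap R A (Z r)) * b
    from fun a b => by noncomm_ring, hc, sub_self, mul_zero, zero_mul, sub_zero]

end Evaluation

/-! ### The relations satisfied by the `q`-Dunkl elements -/

section Relations

variable {R A : Type*} [CommRing R] [Ring A] [Algebra R A] {n l : ℕ}

/-- Sequences satisfying the relations of the double affine Hecke algebra, with `X_0` invertible. -/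
structure DahaSeq (n : ℕ) (q : Rˣ) (c : R) (T Ti X Y : ℕ → A) (x : A) : Prop
    extends MixedSeq n T Ti X Y where
  quad : ∀ k, k < n → T k = Ti k + algebraMap R A c
  X_mul_inv : X 0 * x = 1
  inv_mul_X : x * X 0 = 1
  q_zero : Y 0 * X 0 = (q : R) • (X 0 * (up T 0 n * dn T 0 n) * Y 0)

namespace DahaSeq

variable {q : Rˣ} {c : R} {T Ti X Y D : ℕ → A} {x : A}

theorem jUp_succ {i : ℕ} (hi : i < n) :
    up T i n * dn T i n = T i * (up T (i + 1) n * dn T (i + 1) n) * T i := by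
  rw [up_cons hi, dn_cons hi]; simp only [mul_assoc]

theorem jDown_succ (i : ℕ) :
    dn T 0 (i + 1) * up T 0 (i + 1) = T i * (dn T 0 i * up T 0 i) * T i := by
  rw [up_succ (Nat.zero_le _), dn_succ (Nat.zero_le _)]; simp only [mul_assoc]

/-- For index `0` this is the hypothesis `q_zero`. In the step, one factor `T_i⁻¹` is split off each
side of `V_{i+1}` and one `T_i` off each side of `J_i`; they are absorbed using `Y_{i+1} T_i⁻¹ = T_i
Y_i` and `T_i⁻¹ X_{i+1} = X_i T_i`. -/
theorem Y_mul_X (S : DahaSeq n q c T Ti X Y x) {i : ℕ} (hi : i ≤ n) :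
    Y i * (dn Ti 0 i * up Ti 0 i) * X i = (q : R) • (X i * (up T i n * dn T i n) * Y i) := by
  have B := S.braid
  induction i with
  | zero => simpa [dn_self, up_self] using S.q_zero
  | succ i ih =>
    have hi' : i < n := hi
    calc Y (i + 1) * (dn Ti 0 (i + 1) * up Ti 0 (i + 1)) * X (i + 1)
        = (Y (i + 1) * Ti i) * (dn Ti 0 i * up Ti 0 i) * (Ti i * X (i + 1)) := by
          rw [jDown_succ]; simp only [mul_assoc]
      _ = T i * (Y i * (dn Ti 0 i * up Ti 0 i) * X i) * T i := by
          rw [S.tY.succ_mul_inv B hi', S.tX.inv_mul_succ B hi']; simp only [mul_assoc]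
      _ = (q : R) • (T i * X i * T i * (up T (i + 1) n * dn T (i + 1) n) * (T i * Y i * T i)) := by
          rw [ih hi'.le, jUp_succ hi', mul_smul_comm, smul_mul_assoc]; simp only [mul_assoc]
      _ = _ := by rw [S.tX.step i hi', S.tY.step i hi']

/-- Conjugation by `X_0⁻¹` takes `Y_0` to `q J_0 Y_0`. It therefore takes any polynomial in `Y_0` to
the same polynomial in `q J_0 Y_0`, which is the origin of the arguments in `cd9` and `cd10`. -/
theorem inv_mul_Y (S : DahaSeq n q c T Ti X Y x) :
    x * Y 0 = ((q : R) • (up T 0 n * dn T 0 n * Y 0)) * x := by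
  calc x * Y 0 = x * (Y 0 * X 0) * x := by
        rw [mul_assoc, mul_assoc, S.X_mul_inv, mul_one]
    _ = (q : R) • ((x * X 0) * (up T 0 n * dn T 0 n) * Y 0 * x) := by
        rw [S.q_zero, mul_smul_comm, smul_mul_assoc]; simp only [mul_assoc]
    _ = _ := by rw [S.inv_mul_X, one_mul, smul_mul_assoc]

theorem inv_mul_Y_one (S : DahaSeq n q c T Ti X Y x) (hn : 0 < n) :
    x * Y 1 = Y 1 * Ti 0 ^ 2 * x := by
  have B := S.braid
  have h := S.mixed hn
  have e : Y 1 * X 0 = X 0 * Y 1 * Ti 0 ^ 2 := by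
    rw [h, pow_two, pow_two]; simp only [mul_assoc, B.mul_inv_assoc, B.mul_inv, mul_one]
  calc x * Y 1 = x * (Y 1 * X 0) * x := by rw [mul_assoc, mul_assoc, S.X_mul_inv, mul_one]
    _ = (x * X 0) * Y 1 * Ti 0 ^ 2 * x := by rw [e]; simp only [mul_assoc]
    _ = _ := by rw [S.inv_mul_X, one_mul]

theorem inv_comm_T (S : DahaSeq n q c T Ti X Y x) {k : ℕ} (hk : 0 < k) : Commute (T k) x :=
  commute_inv (S.tX.comm k 0 (by omega) (by omega)) S.X_mul_inv S.inv_mul_X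

end DahaSeq

/-- Sequences as in `DahaSeq` together with the `q`-Dunkl elements. -/
structure DunklSeq (n : ℕ) (q : Rˣ) (c : R) (Z : Fin l → Rˣ)
    (T Ti X Y D : ℕ → A) (x : A) : Prop extends DahaSeq n q c T Ti X Y x where
  D_zero : D 0 = x * zEval Z Finset.univ (Y 0)
  tD : Twisted n Ti D

namespace DunklSeq

variable {q : Rˣ} {c : R} {Z : Fin l → Rˣ} {T Ti X Y D : ℕ → A} {x : A}

/-- The factor `f(Y_0)` of `D_0` commutes with `Y_1`, so the base case only concerns `X_0⁻¹`. The
induction follows `MixedSeq.mul_succ`, with `D` twisted by the `T_k⁻¹` instead of the `T_k`. -/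
theorem D_mul_succ (S : DunklSeq n q c Z T Ti X Y D x) (k : ℕ) (hk : k < n) :
    D k * Y (k + 1) = Y (k + 1) * Ti k ^ 2 * D k := by
  have B := S.braid
  induction k with
  | zero =>
    have hc : Commute (zEval Z Finset.univ (Y 0)) (Y 1) :=
      (commute_zEval Z _ (S.commY 1 0)).symm
    rw [S.D_zero, mul_assoc, hc.eq, ← mul_assoc, S.inv_mul_Y_one hk, mul_assoc]
  | succ k ih =>
    have hk' : k < n := by omega
    have c1 := S.tY.comm k (k + 2) (by omega) (by omega)
    have c1' := S.tY.commute_inv B (k := k) (j := k + 2) (by omega) (by omega)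
    have c2 := S.tD.comm (k + 1) k (by omega) (by omega)
    have c2' := S.tD.commute_inv B.symm (k := k + 1) (j := k) (by omega) (by omega)
    have e1 : D k * Y (k + 2) = Y (k + 2) * (Ti (k + 1) * Ti k ^ 2 * T (k + 1)) * D k := by
      rw [← S.tY.step (k + 1) hk]
      calc D k * (T (k + 1) * Y (k + 1) * T (k + 1))
          = (D k * T (k + 1)) * Y (k + 1) * T (k + 1) := by simp only [mul_assoc]
        _ = T (k + 1) * (D k * Y (k + 1)) * T (k + 1) := by rw [← c2'.eq]; simp only [mul_assoc]
        _ = T (k + 1) * Y (k + 1) * Ti k ^ 2 * (D k * T (k + 1)) := by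
          rw [ih hk']; simp only [mul_assoc]
        _ = _ := by rw [← c2'.eq]; simp only [mul_assoc, B.mul_inv_assoc]
    have hb : Ti (k + 1) * Ti k ^ 2 * T (k + 1) = T k * Ti (k + 1) ^ 2 * Ti k := by
      exact braid_conj_pow (a := Ti k) (b := Ti (k + 1)) (a' := T k) (b' := T (k + 1))
        (B.mul_inv _) (B.inv_mul _) (B.inv_mul _) (B.mul_inv _) (B.symm.braid k hk) 2
    calc D (k + 1) * Y (k + 2) = Ti k * D k * (Ti k * Y (k + 2)) := by
          rw [← S.tD.step k hk']; simp only [mul_assoc]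
      _ = Ti k * (D k * Y (k + 2)) * Ti k := by rw [c1'.eq]; simp only [mul_assoc]
      _ = (Ti k * Y (k + 2)) * (T k * (Ti (k + 1) ^ 2 * (Ti k * (D k * Ti k)))) := by
          rw [e1, hb]; simp only [mul_assoc]
      _ = Y (k + 2) * Ti (k + 1) ^ 2 * (Ti k * D k * Ti k) := by
          rw [c1'.eq, mul_assoc, B.inv_mul_assoc]; simp only [mul_assoc]
      _ = _ := by rw [S.tD.step k hk']

theorem D_mul_Y_of_lt (S : DunklSeq n q c Z T Ti X Y D x) {i j : ℕ} (h : i < j) (hj : j ≤ n) :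
    D i * Y j = Y j * (dn Ti (i + 1) j * Ti i ^ 2 * up T (i + 1) j) * D i := by
  have B := S.braid
  induction j, h using Nat.le_induction with
  | base => simpa [dn_self, up_self] using S.D_mul_succ i hj
  | succ j hij ih =>
    have c := S.tD.commute_inv B.symm (k := j) (j := i) (by omega) (by omega)
    rw [← S.tY.step j hj, dn_succ hij, up_succ hij]
    calc D i * (T j * Y j * T j) = (D i * T j) * Y j * T j := by simp only [mul_assoc]
      _ = T j * (D i * Y j) * T j := by rw [← c.eq]; simp only [mul_assoc]
      _ = T j * Y j * (dn Ti (i + 1) j * Ti i ^ 2 * up T (i + 1) j) * (D i * T j) := by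
        rw [ih (by omega)]; simp only [mul_assoc]
      _ = _ := by rw [← c.eq]; simp only [mul_assoc, B.mul_inv_assoc]

theorem D_succ_mul_Y (S : DunklSeq n q c Z T Ti X Y D x) (k : ℕ) (hk : k < n) :
    D (k + 1) * T k ^ 2 * Y k = Y k * D (k + 1) := by
  have B := S.braid
  calc D (k + 1) * T k ^ 2 * Y k = (D (k + 1) * T k) * (T k * Y k) := by
        rw [pow_two]; simp only [mul_assoc]
    _ = Ti k * (D k * Y (k + 1)) * Ti k := by
        rw [S.tD.succ_mul_inv B.symm hk, ← S.tY.succ_mul_inv B hk]; simp only [mul_assoc]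
    _ = (Ti k * Y (k + 1)) * Ti k * (Ti k * D k * Ti k) := by
        rw [S.D_mul_succ k hk, pow_two]; simp only [mul_assoc]
    _ = _ := by
        rw [S.tY.inv_mul_succ B hk, S.tD.step k hk]; simp only [mul_assoc, B.mul_inv_assoc]

theorem D_mul_Y_of_gt (S : DunklSeq n q c Z T Ti X Y D x) {i j : ℕ} (h : i < j) (hj : j ≤ n) :
    D j * (dn T (i + 1) j * T i ^ 2 * up Ti (i + 1) j) * Y i = Y i * D j := by
  have B := S.braid
  induction j, h using Nat.le_induction with
  | base => simpa [dn_self, up_self] using S.D_succ_mul_Y i hj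
  | succ j hij ih =>
    have cY := S.tY.commute_inv B (k := j) (j := i) (by omega) (by omega)
    rw [dn_succ hij, up_succ hij, ← S.tD.step j hj]
    calc Ti j * D j * Ti j * (T j * dn T (i + 1) j * T i ^ 2 * (up Ti (i + 1) j * Ti j)) * Y i
        = Ti j * D j * (dn T (i + 1) j * T i ^ 2 * up Ti (i + 1) j) * (Ti j * Y i) := by
          simp only [mul_assoc, B.inv_mul_assoc]
      _ = Ti j * (D j * (dn T (i + 1) j * T i ^ 2 * up Ti (i + 1) j) * Y i) * Ti j := by
          rw [cY.eq]; simp only [mul_assoc]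
      _ = (Ti j * Y i) * D j * Ti j := by rw [ih (by omega)]; simp only [mul_assoc]
      _ = _ := by rw [cY.eq]; simp only [mul_assoc]

theorem D_zero_mul_Y (S : DunklSeq n q c Z T Ti X Y D x) :
    D 0 * Y 0 = (q : R) • (up T 0 n * dn T 0 n * Y 0 * D 0) := by
  have hc : Commute (zEval Z Finset.univ (Y 0)) (Y 0) :=
    (commute_zEval Z _ (Commute.refl _)).symm
  rw [S.D_zero, mul_assoc, hc.eq, ← mul_assoc, S.inv_mul_Y, smul_mul_assoc, smul_mul_assoc,
    mul_assoc _ x]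

theorem D_mul_Y (S : DunklSeq n q c Z T Ti X Y D x) {i : ℕ} (hi : i ≤ n) :
    D i * Y i * (dn Ti 0 i * up Ti 0 i) = (q : R) • (up T i n * dn T i n * Y i * D i) := by
  have B := S.braid
  induction i with
  | zero => simpa [dn_self, up_self] using S.D_zero_mul_Y
  | succ i ih =>
    have hi' : i < n := hi
    calc D (i + 1) * Y (i + 1) * (dn Ti 0 (i + 1) * up Ti 0 (i + 1))
        = D (i + 1) * (Y (i + 1) * Ti i) * (dn Ti 0 i * up Ti 0 i) * Ti i := by
          rw [DahaSeq.jDown_succ]; simp only [mul_assoc]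
      _ = Ti i * (D i * Y i * (dn Ti 0 i * up Ti 0 i)) * Ti i := by
          rw [S.tY.succ_mul_inv B hi', ← mul_assoc (D (i + 1)), S.tD.succ_mul_inv B.symm hi']
          simp only [mul_assoc]
      _ = (q : R) • ((Ti i * T i) * (up T (i + 1) n * dn T (i + 1) n) * (T i * Y i) *
            (D i * Ti i)) := by
          rw [ih hi'.le, DahaSeq.jUp_succ hi', mul_smul_comm, smul_mul_assoc]
          simp only [mul_assoc]
      _ = _ := by
          rw [B.inv_mul, one_mul, ← S.tY.succ_mul_inv B hi', ← S.tD.step i hi']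
          simp only [mul_assoc]

theorem X_mul_D (S : DunklSeq n q c Z T Ti X Y D x) : X 0 * D 0 = zEval Z Finset.univ (Y 0) := by
  rw [S.D_zero, ← mul_assoc, S.X_mul_inv, one_mul]

theorem D_mul_X (S : DunklSeq n q c Z T Ti X Y D x) :
    D 0 * X 0 = zEval Z Finset.univ ((q : R) • (up T 0 n * dn T 0 n * Y 0)) := by
  rw [S.D_zero, mul_zEval_of_semiconj Z _ S.inv_mul_Y, mul_assoc, S.inv_mul_X, mul_one]

/-- As `X_0⁻¹` commutes with `X_1`, the commutator is `X_0⁻¹ [f(Y_0), X_1]`. The Leibniz rule and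
`[Y_0, X_1] = -c Y_1 X_0 T_0` give a sum over the linear factors. In each term `X_0⁻¹` moves right,
turning `Y_0` into `q J_0 Y_0`, and `T_0` moves right, turning `Y_0` into `Y_1 T_0⁻²`. -/
theorem D_commutator_X (S : DunklSeq n q c Z T Ti X Y D x) (hn : 0 < n) :
    D 0 * X 1 - X 1 * D 0 = (-c) • ∑ r : Fin l,
      zEval Z (Finset.Iio r) ((q : R) • (up T 0 n * dn T 0 n * Y 0)) * (Y 1 * Ti 0 ^ 2) *
        zEval Z (Finset.Ioi r) (Y 1 * Ti 0 ^ 2) * T 0 := by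
  have B := S.braid
  have cx : Commute x (X 1) := (commute_inv (S.commX 1 0) S.X_mul_inv S.inv_mul_X).symm
  have e : Y 0 * X 1 - X 1 * Y 0 = (-c) • (Y 1 * X 0 * T 0) := by
    have h1 : X 1 * Y 0 = T 0 ^ 2 * (Y 0 * X 1) := by
      rw [S.mul_succ' 0 hn, pow_two, pow_two]
      simp only [mul_assoc, B.mul_inv_assoc]
    have h2 : T 0 ^ 2 = 1 + c • T 0 := by
      rw [pow_two]
      nth_rewrite 1 [S.quad 0 hn]
      rw [add_mul, B.inv_mul, Algebra.smul_def]
    have h3 : T 0 * (Y 0 * X 1) = Y 1 * X 0 * T 0 := by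
      rw [← S.tX.step 0 hn, ← S.tY.step 0 hn]; simp only [mul_assoc]
    rw [h1, h2, add_mul, one_mul, smul_mul_assoc, h3, neg_smul]
    abel
  have e2 : T 0 * Y 0 = (Y 1 * Ti 0 ^ 2) * T 0 := by
    rw [← S.tY.succ_mul_inv B hn, pow_two]; simp only [mul_assoc, B.inv_mul, mul_one]
  have e3 : x * Y 1 * X 0 = Y 1 * Ti 0 ^ 2 := by
    rw [S.inv_mul_Y_one hn, mul_assoc, S.inv_mul_X, mul_one]
  calc D 0 * X 1 - X 1 * D 0
      = x * (zEval Z Finset.univ (Y 0) * X 1 - X 1 * zEval Z Finset.univ (Y 0)) := by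
        rw [S.D_zero, mul_sub, ← mul_assoc (X 1), ← cx.eq]; simp only [mul_assoc]
    _ = _ := by
        rw [zEval_mul_sub, e, Finset.mul_sum, Finset.smul_sum]
        refine Finset.sum_congr rfl fun r _ => ?_
        calc x * (zEval Z (Finset.Iio r) (Y 0) * (-c) • (Y 1 * X 0 * T 0) *
              zEval Z (Finset.Ioi r) (Y 0))
            = (-c) • ((x * zEval Z (Finset.Iio r) (Y 0)) * (Y 1 * X 0) * (T 0 *
              zEval Z (Finset.Ioi r) (Y 0))) := by
              rw [mul_smul_comm, smul_mul_assoc, mul_smul_comm]; simp only [mul_assoc]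
          _ = (-c) • (zEval Z (Finset.Iio r) ((q : R) • (up T 0 n * dn T 0 n * Y 0)) *
              (x * Y 1 * X 0) * zEval Z (Finset.Ioi r) (Y 1 * Ti 0 ^ 2) * T 0) := by
              rw [mul_zEval_of_semiconj Z _ S.inv_mul_Y, mul_zEval_of_semiconj Z _ e2]
              simp only [mul_assoc]
          _ = _ := by rw [e3]

/-- An element symmetric in `Y_0, Y_1` commutes with `T_0`. It is enough to treat one factor `(Y_0 -
Z)(Y_1 - Z)`, which is a combination of `Y_0 Y_1`, `Y_0 + Y_1` and scalars. -/
theorem commute_T_zEval_mul (S : DunklSeq n q c Z T Ti X Y D x) (hn : 0 < n) :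
    Commute (T 0) (zEval Z Finset.univ (Y 0) * zEval Z Finset.univ (Y 1)) := by
  have B := S.braid
  have p : Commute (T 0) (Y 0 * Y 1) := by
    show T 0 * (Y 0 * Y 1) = Y 0 * Y 1 * T 0
    calc T 0 * (Y 0 * Y 1) = (T 0 * Y 0 * T 0) * Y 0 * T 0 := by
          rw [← S.tY.step 0 hn]; simp only [mul_assoc]
      _ = _ := by rw [S.tY.step 0 hn, (S.commY 0 1).eq]
  have s : Commute (T 0) (Y 0 + Y 1) := by
    show T 0 * (Y 0 + Y 1) = (Y 0 + Y 1) * T 0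
    have h1 : T 0 * Y 0 = Y 1 * T 0 - c • Y 1 := by
      rw [← S.tY.succ_mul_inv B hn]
      rw [S.quad 0 hn, mul_add, Algebra.smul_def, ← Algebra.commutes]; abel
    have h2 : T 0 * Y 1 = c • Y 1 + Y 0 * T 0 := by
      nth_rewrite 1 [S.quad 0 hn]
      rw [add_mul, S.tY.inv_mul_succ B hn, Algebra.smul_def]; abel
    rw [mul_add, h1, h2, add_mul]; abel
  have key : ∀ I : Finset (Fin l), Commute (T 0) (zEval Z I (Y 0) * zEval Z I (Y 1)) := by
    classical
    intro I
    induction I using Finset.induction_on with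
    | empty => simp [zEval_empty]
    | insert r I hr ih =>
      rw [zEval_insert' Z hr, zEval_insert Z hr]
      have c1 : Commute (zEval Z I (Y 0)) (Y 0 - algebraMap R A (Z r)) :=
        (commute_zEval Z I ((Commute.refl (Y 0)).sub_left (Algebra.commutes _ _))).symm
      have c2 : Commute (zEval Z I (Y 0)) (Y 1 - algebraMap R A (Z r)) :=
        (commute_zEval Z I ((S.commY 1 0).sub_left (Algebra.commutes _ _))).symm
      have e : zEval Z I (Y 0) * (Y 0 - algebraMap R A (Z r)) *
          ((Y 1 - algebraMap R A (Z r)) * zEval Z I (Y 1)) =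
          ((Y 0 - algebraMap R A (Z r)) * (Y 1 - algebraMap R A (Z r))) *
            (zEval Z I (Y 0) * zEval Z I (Y 1)) := by
        rw [c1.eq]
        calc _ = (Y 0 - algebraMap R A (Z r)) * (zEval Z I (Y 0) * (Y 1 - algebraMap R A (Z r))) *
              zEval Z I (Y 1) := by simp only [mul_assoc]
          _ = _ := by rw [c2.eq]; simp only [mul_assoc]
      rw [e]
      refine Commute.mul_right ?_ ih
      have e2 : (Y 0 - algebraMap R A (Z r)) * (Y 1 - algebraMap R A (Z r)) =
          Y 0 * Y 1 - algebraMap R A (Z r) * (Y 0 + Y 1) +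
            algebraMap R A (Z r) * algebraMap R A (Z r) := by
        have := Algebra.commutes (Z r : R) (Y 0)
        rw [sub_mul, mul_sub, mul_sub, ← this]; noncomm_ring
      rw [e2]
      have cz : Commute (T 0) (algebraMap R A (Z r)) := (Algebra.commutes _ _).symm
      exact (p.sub_right (cz.mul_right s)).add_right (cz.mul_right cz)
  exact key _

/-- Moving `f(Y_0)` past `X_1⁻¹` yields `D_0 D_1 = X_0⁻¹ X_1⁻¹ f(Y_0) f(Y_1)`. Both halves of this
product commute with `T_0`. Since `D_1 = T_0⁻¹ D_0 T_0⁻¹`, commutation of `D_0 D_1` with `T_0` is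
equivalent to commutation of `D_0` with `D_1`. -/
theorem commute_D_zero_one (S : DunklSeq n q c Z T Ti X Y D x) (hn : 0 < n) :
    Commute (D 0) (D 1) := by
  have B := S.braid
  set F := zEval Z Finset.univ (Y 0) with hF
  set G := zEval Z Finset.univ (Y 1) with hG
  -- an inverse of `X_1`
  set y := Ti 0 * x * Ti 0 with hy
  have y1 : X 1 * y = 1 := by
    rw [hy, ← S.tX.step 0 hn]
    simp only [mul_assoc, B.mul_inv_assoc]
    rw [← mul_assoc (X 0), S.X_mul_inv, one_mul, B.mul_inv]
  have y2 : y * X 1 = 1 := by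
    rw [hy, ← S.tX.step 0 hn]
    simp only [mul_assoc, B.inv_mul_assoc]
    rw [← mul_assoc x, S.inv_mul_X, one_mul, B.inv_mul]
  have hYy : Y 0 * y = y * (T 0 ^ 2 * Y 0) := by
    have h1 : X 1 * Y 0 = T 0 ^ 2 * (Y 0 * X 1) := by
      rw [S.mul_succ' 0 hn, pow_two, pow_two]
      simp only [mul_assoc, B.mul_inv_assoc]
    calc Y 0 * y = (y * X 1) * Y 0 * y := by rw [y2, one_mul]
      _ = y * (X 1 * Y 0) * y := by simp only [mul_assoc]
      _ = y * T 0 ^ 2 * Y 0 * (X 1 * y) := by rw [h1]; simp only [mul_assoc]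
      _ = _ := by rw [y1, mul_one, mul_assoc]
  have hFy : F * y = y * zEval Z Finset.univ (T 0 ^ 2 * Y 0) :=
    (mul_zEval_of_semiconj Z _ hYy.symm).symm
  have hT : zEval Z Finset.univ (T 0 ^ 2 * Y 0) * T 0 = T 0 * G := by
    refine (mul_zEval_of_semiconj Z _ ?_).symm
    rw [← S.tY.step 0 hn, pow_two]; simp only [mul_assoc]
  have hFG : Commute F G := commute_zEval Z _ (commute_zEval Z _ (S.commY 1 0)).symm
  have hTF := S.commute_T_zEval_mul hn
  rw [← hF, ← hG] at hTF
  have cxy : Commute x y := (commute_inv (commute_inv (S.commX 0 1) y1 y2).symm S.X_mul_inv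
    S.inv_mul_X).symm
  have hxT : Commute (T 0) (x * y) := by
    show T 0 * (x * y) = x * y * T 0
    have e1 : T 0 * y = x * Ti 0 := by rw [hy]; simp only [mul_assoc, B.mul_inv_assoc]
    have e2 : y * T 0 = Ti 0 * x := by rw [hy]; simp only [mul_assoc, B.inv_mul, mul_one]
    rw [cxy.eq, ← mul_assoc, e1, mul_assoc, ← e2, ← mul_assoc, cxy.eq]
  have hD1 : D 1 = Ti 0 * D 0 * Ti 0 := (S.tD.step 0 hn).symm
  have hxy : Ti 0 * x = y * T 0 := by rw [hy]; simp only [mul_assoc, B.inv_mul, mul_one]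
  have hprod : D 0 * D 1 = x * y * (F * G) := by
    calc D 0 * D 1 = x * F * (Ti 0 * x) * F * Ti 0 := by
          rw [hD1, S.D_zero, ← hF]; simp only [mul_assoc]
      _ = x * (F * y) * T 0 * F * Ti 0 := by rw [hxy]; simp only [mul_assoc]
      _ = x * y * (zEval Z Finset.univ (T 0 ^ 2 * Y 0) * T 0) * F * Ti 0 := by
          rw [hFy]; simp only [mul_assoc]
      _ = x * y * (T 0 * (F * G)) * Ti 0 := by rw [hT, hFG.eq]; simp only [mul_assoc]
      _ = _ := by rw [hTF.eq]; simp only [mul_assoc, B.mul_inv, mul_one]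
  have hcomm : Commute (T 0) (D 0 * D 1) := by rw [hprod]; exact hxT.mul_right hTF
  have e : T 0 * (D 1 * D 0) = T 0 * (D 0 * D 1) := by
    rw [hcomm.eq, hD1]; simp only [mul_assoc, B.mul_inv_assoc, B.inv_mul, mul_one]
  have := congrArg (Ti 0 * ·) e
  simp only [B.inv_mul_assoc] at this
  exact this.symm

theorem commute_D (S : DunklSeq n q c Z T Ti X Y D x) {i j : ℕ} (hi : i ≤ n) (hj : j ≤ n) :
    Commute (D i) (D j) :=
  S.tD.commute_of_zero S.commute_D_zero_one hi hj

end DunklSeq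

end Relations
end CycDAHA

namespace CycDAHA
open Polynomial

/-! ### Validity of the cyclotomic relations in the DAHA -/

section FinToNat

variable {R A : Type*} [CommRing R] [Ring A] [Algebra R A] {n l : ℕ} {q t : Rˣ}
  {T : Fin n → A} {X Y : Fin (n + 1) → A}

theorem braidSeq_of_baseRel (H : ∀ a b, BaseRel t T X Y a b → a = b) :
    BraidSeq n (ext T) (ext (tInv t T)) :=
  braidSeq_ext (fun i => (mul_tInv_of_quadratic (H _ _ (.R1 i))).1)
    (fun i => (mul_tInv_of_quadratic (H _ _ (.R1 i))).2) (fun i j h => H _ _ (.R2 i j h))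
    (fun i j h => H _ _ (.R3 i j (Or.inl h)))

theorem twistedX_of_baseRel (H : ∀ a b, BaseRel t T X Y a b → a = b) :
    Twisted n (ext T) (ext X) :=
  twisted_ext (fun i => H _ _ (.R4 i)) (fun i j h h' => H _ _ (.R5 i j h h'))

theorem twistedY_of_baseRel (H : ∀ a b, BaseRel t T X Y a b → a = b) :
    Twisted n (ext T) (ext Y) :=
  twisted_ext (fun i => H _ _ (.R6 i)) (fun i j h h' => H _ _ (.R7 i j h h'))

theorem commute_ext {m : ℕ} {X : Fin m → A} (h : ∀ i j, X i * X j = X j * X i) (i j : ℕ) :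
    Commute (ext X i) (ext X j) := by
  refine ext_cases (P := fun u => Commute u (ext X j)) (Commute.one_left _) (fun i => ?_) i
  exact ext_cases (P := fun u => Commute (X i) u) (Commute.one_right _) (fun j => h i j) j

theorem up_eq_asc (T : Fin n → A) (a b : ℕ) : up (ext T) a b = asc T a b := rfl

theorem dn_eq_desc (T : Fin n → A) (a b : ℕ) : dn (ext T) a b = desc T a b := rfl

theorem ofFn_prod_eq_up {m : ℕ} (X : Fin m → A) : (List.ofFn X).prod = up (ext X) 0 m := by
  rw [up, List.Ico.zero_bot, ← List.map_coe_finRange_eq_range, List.map_map, List.ofFn_eq_map]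
  congr 2
  funext i
  simp [ext]

theorem ext_castSucc_zero {k : Fin n} (hk : (k : ℕ) = 0) (X : Fin (n + 1) → A) :
    X k.castSucc = ext X 0 := by
  rw [← ext_val X]; simp [hk]

theorem ext_succ_zero {k : Fin n} (hk : (k : ℕ) = 0) (X : Fin (n + 1) → A) :
    X k.succ = ext X 1 := by
  rw [← ext_val X]; simp [hk]

theorem ext_zero_of {k : Fin n} (hk : (k : ℕ) = 0) (T : Fin n → A) : T k = ext T 0 := by
  rw [← ext_val T, hk]

variable {X' Y' : Fin (n + 1) → A}

/-- R8, solved for `X_0 Y_1`, is the mixed relation. R9 says that `Y_0` commutes up to `q` with `∏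
X_i`; moving `Y_0` through `X_1 ⋯ X_n` produces only Hecke factors, and cancelling this invertible
product leaves the commutation of `Y_0` with `X_0`. -/
theorem dahaSeq_of_dahaRel (H : ∀ a b, DahaRel q t T X X' Y Y' a b → a = b) :
    DahaSeq n q ((t : R) - ((t⁻¹ : Rˣ) : R)) (ext T) (ext (tInv t T)) (ext X) (ext Y) (X' 0) := by
  have Hb : ∀ a b, BaseRel t T X Y a b → a = b := fun a b h => H a b (.base h)
  have B := braidSeq_of_baseRel Hb
  have x0 : ext X 0 = X 0 := ext_val X 0
  have y0 : ext Y 0 = Y 0 := ext_val Y 0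
  have hX1 : X 0 * X' 0 = 1 := H _ _ (.X_mul_inv 0)
  have hX2 : X' 0 * X 0 = 1 := H _ _ (.inv_mul_X 0)
  have S : MixedSeq n (ext T) (ext (tInv t T)) (ext X) (ext Y) :=
    { braid := B
      tX := twistedX_of_baseRel Hb
      tY := twistedY_of_baseRel Hb
      commX := commute_ext fun i j => Hb _ _ (.R11 i j)
      commY := commute_ext fun i j => Hb _ _ (.R12 i j)
      mixed := fun hn => by
        have h := H _ _ (.R8 ⟨0, hn⟩ rfl)
        have hy := H _ _ (.Y_mul_inv (Fin.succ ⟨0, hn⟩))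
        rw [show (Fin.castSucc (⟨0, hn⟩ : Fin n)) = 0 from rfl] at h
        have e1 : ext Y 1 = Y (Fin.succ ⟨0, hn⟩) := (ext_succ_zero rfl Y).symm
        have e2 : ext T 0 = T ⟨0, hn⟩ := ext_of_lt hn
        rw [x0, e1, e2, ← h]
        calc X 0 * Y _ = Y _ * Y' _ * X 0 * Y _ := by rw [hy, one_mul]
          _ = Y _ * (X 0 * X' 0) * Y' _ * X 0 * Y _ := by rw [hX1, mul_one]
          _ = _ := by simp only [mul_assoc] }
  refine { S with
    quad := fun k hk => ext_sub_tInv hk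
    X_mul_inv := by rw [x0]; exact hX1
    inv_mul_X := by rw [x0]; exact hX2
    q_zero := ?_ }
  have h9 := H _ _ (.R9 0)
  rw [ofFn_prod_eq_up, up_cons (Nat.succ_pos n), zero_add, ← y0] at h9
  have hk := S.Y_zero_mul_up (le_refl n)
  -- cancel the invertible factor `X_1 ⋯ X_n` on the right
  have hinv : ∀ k, k ≤ n → ∃ z, up (ext X) 1 (k + 1) * z = 1 := by
    intro k
    induction k with
    | zero => intro _; exact ⟨1, by simp [up_of_le]⟩
    | succ k ih =>
      intro hk
      obtain ⟨z, hz⟩ := ih (by omega)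
      refine ⟨X' ⟨k + 1, by omega⟩ * z, ?_⟩
      rw [up_succ (by omega), ext_of_lt (by omega : k + 1 < n + 1), mul_assoc,
        ← mul_assoc (X _), H _ _ (.X_mul_inv _), one_mul, hz]
  obtain ⟨z, hz⟩ := hinv n le_rfl
  have e : ext Y 0 * ext X 0 * up (ext X) 1 (n + 1) =
      ((q : R) • (ext X 0 * (up (ext T) 0 n * dn (ext T) 0 n) * ext Y 0)) * up (ext X) 1 (n + 1) := by
    rw [mul_assoc, h9, smul_mul_assoc, mul_assoc _ (ext Y 0), hk]
    congr 1
    calc ext X 0 * up (ext X) 1 (n + 1) * ext Y 0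
        = ext X 0 * (up (ext T) 0 n * (dn (ext T) 0 n * up (ext (tInv t T)) 0 n) *
            dn (ext (tInv t T)) 0 n) * up (ext X) 1 (n + 1) * ext Y 0 := by
          rw [B.symm.dn_mul_up, mul_one, B.up_mul_dn, mul_one]
      _ = _ := by simp only [mul_assoc]
  have := congrArg (· * z) e
  simpa only [mul_assoc, hz, mul_one] using this

variable {D : Fin (n + 1) → A} {Z : Fin l → Rˣ}

theorem dunklSeq_of_dahaRel (H : ∀ a b, DahaRel q t T X X' Y Y' a b → a = b)
    (hD : ∀ i : Fin (n + 1), D i = desc (tInv t T) 0 i * (X' 0 * zEval Z Finset.univ (Y 0)) *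
      asc (tInv t T) 0 i) :
    DunklSeq n q ((t : R) - ((t⁻¹ : Rˣ) : R)) Z (ext T) (ext (tInv t T)) (ext X) (ext Y) (ext D)
      (X' 0) := by
  have S := dahaSeq_of_dahaRel H
  have B := S.braid
  have y0 : ext Y 0 = Y 0 := ext_val Y 0
  have d0 : ext D 0 = X' 0 * zEval Z Finset.univ (ext Y 0) := by
    have h1 : ext D 0 = D 0 := ext_val D 0
    have h2 := hD 0
    rw [h1, h2, y0]
    simp [← up_eq_asc, ← dn_eq_desc, up_of_le, dn_of_le]
  refine { S with D_zero := d0, tD := ?_ }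
  refine Twisted.of_zero B.symm (fun k hk => ext_of_le hk) (fun k hk => ext_of_le hk) ?_ ?_
  · intro k hk
    rw [ext_of_lt (by omega : k < n + 1), hD, d0, y0]
    rfl
  · intro k hk
    rw [d0]
    have c1 : Commute (ext (tInv t T) k) (X' 0) :=
      (commute_inv (S.inv_comm_T hk).symm (B.mul_inv k) (B.inv_mul k)).symm
    exact c1.mul_right (commute_zEval Z _ (S.tY.commute_inv B (by omega) (by omega)))

/-- The relations of the cyclotomic presentation hold in the double affine Hecke algebra. -/
theorem eq_of_cycRel_of_dahaRel (H : ∀ a b, DahaRel q t T X X' Y Y' a b → a = b)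
    (hD : ∀ i : Fin (n + 1), D i = desc (tInv t T) 0 i * (X' 0 * zEval Z Finset.univ (Y 0)) *
      asc (tInv t T) 0 i) {a b : A} (h : CycRel q t Z T X Y D a b) : a = b := by
  have S := dunklSeq_of_dahaRel (Z := Z) H hD
  have e0 : ∀ E : Fin (n + 1) → A, E 0 = ext E 0 := fun E => (ext_val E 0).symm
  cases h with
  | base h => exact H _ _ (.base h)
  | cd1 i j h =>
    simpa only [ext_val, up_eq_asc, dn_eq_desc, jUp, jDown] using S.mul_of_lt h (Nat.lt_succ_iff.1 j.2)
  | cd2 i j h =>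
    simpa only [ext_val, up_eq_asc, dn_eq_desc, jUp, jDown] using S.mul_of_lt' h (Nat.lt_succ_iff.1 j.2)
  | cd3 i =>
    simpa only [ext_val, up_eq_asc, dn_eq_desc, jUp, jDown] using S.Y_mul_X (Nat.lt_succ_iff.1 i.2)
  | cd4 i j =>
    simpa only [ext_val] using (S.commute_D (Nat.lt_succ_iff.1 i.2) (Nat.lt_succ_iff.1 j.2)).eq
  | cd5 i =>
    have h1 := S.tD.step i i.2
    rw [← ext_val D, ← ext_val D, ← ext_val (tInv t T)]
    exact h1
  | cd5_comm j i h =>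
    have h1 := (S.tD.commute_inv S.braid.symm (k := j) (j := i) (by omega) (by omega)).eq
    simpa only [ext_val] using h1
  | cd6 i j h =>
    simpa only [ext_val, up_eq_asc, dn_eq_desc, jUp, jDown] using S.D_mul_Y_of_lt h (Nat.lt_succ_iff.1 j.2)
  | cd7 i j h =>
    simpa only [ext_val, up_eq_asc, dn_eq_desc, jUp, jDown] using S.D_mul_Y_of_gt h (Nat.lt_succ_iff.1 j.2)
  | cd8 i =>
    simpa only [ext_val, up_eq_asc, dn_eq_desc, jUp, jDown] using S.D_mul_Y (Nat.lt_succ_iff.1 i.2)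
  | cd9_left => rw [e0 X, e0 D, e0 Y]; exact S.X_mul_D
  | cd9_right => rw [e0 X, e0 D, e0 Y]; exact S.D_mul_X
  | cd10 k hk =>
    have h1 := S.D_commutator_X (by have := k.2; omega)
    rw [ext_castSucc_zero hk D, ext_castSucc_zero hk Y, ext_succ_zero hk X, ext_succ_zero hk Y,
      ext_zero_of hk T, ext_zero_of hk (tInv t T), h1, neg_sub]
    rfl

end FinToNat
end CycDAHA

namespace CycDAHA
open Polynomial

/-! ### Commutation inclusions in the semiring of submodules -/

section SubmoduleSemiring

variable {R A : Type*} [CommRing R] [Ring A] [Algebra R A]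

theorem mul_pow_le {U V : Submodule R A} (h : U * V ≤ V * U) (p : ℕ) : U * V ^ p ≤ V ^ p * U := by
  induction p with
  | zero => simp
  | succ p ih =>
    calc U * V ^ (p + 1) = U * V ^ p * V := by rw [pow_succ, mul_assoc]
      _ ≤ V ^ p * U * V := by gcongr
      _ = V ^ p * (U * V) := by rw [mul_assoc]
      _ ≤ V ^ p * (V * U) := by gcongr
      _ = _ := by rw [pow_succ, mul_assoc]

/-- If `U V ≤ V U W` and `W V ≤ V W`, then `U V^p ≤ V^p U W`. -/
theorem mul_pow_le_mul {U V W : Submodule R A} (hW : W * W ≤ W) (h1 : 1 ≤ W)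
    (h : U * V ≤ V * U * W) (hWV : W * V ≤ V * W) (p : ℕ) : U * V ^ p ≤ V ^ p * U * W := by
  induction p with
  | zero => simpa using le_mul_of_one_le_right' h1
  | succ p ih =>
    calc U * V ^ (p + 1) = U * V ^ p * V := by rw [pow_succ, mul_assoc]
      _ ≤ V ^ p * U * W * V := by gcongr
      _ = V ^ p * U * (W * V) := by rw [mul_assoc]
      _ ≤ V ^ p * U * (V * W) := by gcongr
      _ = V ^ p * (U * V) * W := by simp only [mul_assoc]
      _ ≤ V ^ p * (V * U * W) * W := by gcongr
      _ = V ^ (p + 1) * U * (W * W) := by rw [pow_succ]; simp only [mul_assoc]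
      _ ≤ _ := by gcongr

theorem mul_mem_of_forall {ι : Type*} {E : ι → A} {U : Submodule R A} {a v : A}
    (h : ∀ j, a * E j ∈ U) (hv : v ∈ Submodule.span R (Set.range E)) : a * v ∈ U := by
  have : Submodule.span R (Set.range E) ≤ U.comap (LinearMap.mulLeft R a) := by
    rw [Submodule.span_le]; rintro _ ⟨j, rfl⟩; exact h j
  exact this hv

theorem mul_mem_of_forall' {ι : Type*} {E : ι → A} {U : Submodule R A} {a v : A}
    (h : ∀ j, E j * a ∈ U) (hv : v ∈ Submodule.span R (Set.range E)) : v * a ∈ U := by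
  have : Submodule.span R (Set.range E) ≤ U.comap (LinearMap.mulRight R a) := by
    rw [Submodule.span_le]; rintro _ ⟨j, rfl⟩; exact h j
  exact this hv

end SubmoduleSemiring

/-! ### The Hecke algebra as a submodule -/

section Hecke

variable {R A : Type*} [CommRing R] [Ring A] [Algebra R A] {n : ℕ}

/-- The subalgebra generated by the `T_k`, as a submodule. -/
def heckeSpan (R : Type*) {A : Type*} [CommRing R] [Ring A] [Algebra R A] {n : ℕ}
    (T : Fin n → A) : Submodule R A :=
  Subalgebra.toSubmodule (Algebra.adjoin R (Set.range T))

/-- The span of the members of a family. -/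
def genSpan (R : Type*) {A ι : Type*} [CommRing R] [Ring A] [Algebra R A] (E : ι → A) :
    Submodule R A := Submodule.span R (Set.range E)

theorem mem_genSpan {ι : Type*} (E : ι → A) (i : ι) : E i ∈ genSpan R E :=
  Submodule.subset_span ⟨i, rfl⟩

variable {T : Fin n → A}

theorem mem_heckeSpan (k : Fin n) : T k ∈ heckeSpan R T := Algebra.subset_adjoin ⟨k, rfl⟩

theorem one_mem_heckeSpan : (1 : A) ∈ heckeSpan R T := one_mem (Algebra.adjoin R _)

theorem one_le_heckeSpan : 1 ≤ heckeSpan R T := Submodule.one_le.2 one_mem_heckeSpan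

theorem mul_mem_heckeSpan {a b : A} (ha : a ∈ heckeSpan R T) (hb : b ∈ heckeSpan R T) :
    a * b ∈ heckeSpan R T := mul_mem (S := Subalgebra R A) ha hb

theorem heckeSpan_mul_self_le : heckeSpan R T * heckeSpan R T ≤ heckeSpan R T :=
  Submodule.mul_le.2 fun _ ha _ hb => mul_mem_heckeSpan ha hb

theorem heckeSpan_mul_self : heckeSpan R T * heckeSpan R T = heckeSpan R T :=
  le_antisymm heckeSpan_mul_self_le (le_mul_of_one_le_left' one_le_heckeSpan)

theorem ext_mem_heckeSpan (k : ℕ) : ext T k ∈ heckeSpan R T :=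
  ext_cases one_mem_heckeSpan mem_heckeSpan k

theorem tInv_mem_heckeSpan {t : Rˣ} (k : Fin n) : tInv t T k ∈ heckeSpan R T :=
  Submodule.sub_mem _ (mem_heckeSpan k) ((Algebra.adjoin R (Set.range T)).algebraMap_mem _)

theorem ext_tInv_mem_heckeSpan {t : Rˣ} (k : ℕ) : ext (tInv t T) k ∈ heckeSpan R T :=
  ext_cases one_mem_heckeSpan tInv_mem_heckeSpan k

theorem up_mem_heckeSpan {f : ℕ → A} (h : ∀ k, f k ∈ heckeSpan R T) (a b : ℕ) :
    up f a b ∈ heckeSpan R T := by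
  refine Subalgebra.list_prod_mem (Algebra.adjoin R (Set.range T)) ?_
  intro x hx
  obtain ⟨k, _, rfl⟩ := List.mem_map.1 hx
  exact h k

theorem dn_mem_heckeSpan {f : ℕ → A} (h : ∀ k, f k ∈ heckeSpan R T) (a b : ℕ) :
    dn f a b ∈ heckeSpan R T := by
  refine Subalgebra.list_prod_mem (Algebra.adjoin R (Set.range T)) ?_
  intro x hx
  obtain ⟨k, _, rfl⟩ := List.mem_map.1 hx
  exact h k

/-- Since `H H = H`, the elements of the Hecke algebra that can be moved through `V` from left to
right are closed under products, so it suffices to test the generators. -/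
theorem heckeSpan_mul_le {V : Submodule R A}
    (h : ∀ k, ∀ v ∈ V, T k * v ∈ V * heckeSpan R T) : heckeSpan R T * V ≤ V * heckeSpan R T := by
  refine Submodule.mul_le.2 fun a ha => ?_
  refine Algebra.adjoin_induction (p := fun a _ => ∀ v ∈ V, a * v ∈ V * heckeSpan R T)
    ?_ ?_ ?_ ?_ ha
  · rintro _ ⟨k, rfl⟩; exact h k
  · intro r v hv
    rw [← Algebra.smul_def]
    simpa using Submodule.mul_mem_mul (V.smul_mem r hv) (one_mem_heckeSpan (T := T))
  · intro a b _ _ ha hb v hv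
    rw [add_mul]; exact add_mem (ha v hv) (hb v hv)
  · intro a b _ _ ha hb v hv
    rw [mul_assoc]
    refine Submodule.mul_induction_on (hb v hv) ?_ ?_
    · intro u hu c hc
      rw [← mul_assoc]
      have := Submodule.mul_mem_mul (ha u hu) hc
      rwa [mul_assoc V, heckeSpan_mul_self] at this
    · intro u u' hu hu'; rw [mul_add]; exact add_mem hu hu'

theorem mul_heckeSpan_le {V : Submodule R A}
    (h : ∀ k, ∀ v ∈ V, v * T k ∈ heckeSpan R T * V) : V * heckeSpan R T ≤ heckeSpan R T * V := by
  refine Submodule.mul_le.2 fun v hv a ha => ?_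
  refine Algebra.adjoin_induction (p := fun a _ => ∀ v ∈ V, v * a ∈ heckeSpan R T * V)
    ?_ ?_ ?_ ?_ ha v hv
  · rintro _ ⟨k, rfl⟩; exact h k
  · intro r v hv
    rw [← Algebra.commutes, ← Algebra.smul_def]
    simpa using Submodule.mul_mem_mul (one_mem_heckeSpan (T := T)) (V.smul_mem r hv)
  · intro a b _ _ ha hb v hv
    rw [mul_add]; exact add_mem (ha v hv) (hb v hv)
  · intro a b _ _ ha hb v hv
    rw [← mul_assoc]
    refine Submodule.mul_induction_on (ha v hv) ?_ ?_
    · intro c hc u hu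
      rw [mul_assoc]
      have := Submodule.mul_mem_mul hc (hb u hu)
      rwa [← mul_assoc, heckeSpan_mul_self] at this
    · intro u u' hu hu'; rw [add_mul]; exact add_mem hu hu'

/-- For a twisted family, the Hecke algebra can be moved to the other side. -/
theorem twisted_mem {g gi : ℕ → A} {E : Fin (n + 1) → A} {c : R} (B : BraidSeq n g gi)
    (hE : Twisted n g (ext E)) (hq : ∀ k, k < n → g k = gi k + algebraMap R A c)
    (hg : ∀ k, g k ∈ heckeSpan R T) (hgi : ∀ k, gi k ∈ heckeSpan R T) (k : Fin n)
    (j : Fin (n + 1)) :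
    g k * E j ∈ genSpan R E * heckeSpan R T ∧ gi k * E j ∈ genSpan R E * heckeSpan R T ∧
    E j * g k ∈ heckeSpan R T * genSpan R E ∧ E j * gi k ∈ heckeSpan R T * genSpan R E := by
  have hk := k.2
  have m := fun (i : Fin (n + 1)) {b : A} (hb : b ∈ heckeSpan R T) =>
    Submodule.mul_mem_mul (mem_genSpan (R := R) E i) hb
  have m' := fun (i : Fin (n + 1)) {b : A} (hb : b ∈ heckeSpan R T) =>
    Submodule.mul_mem_mul hb (mem_genSpan (R := R) E i)
  have s : ∀ (i : Fin (n + 1)) (d : R), d • E i ∈ genSpan R E * heckeSpan R T := fun i d =>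
    Submodule.smul_mem _ _ (by simpa using m i one_mem_heckeSpan)
  have s' : ∀ (i : Fin (n + 1)) (d : R), d • E i ∈ heckeSpan R T * genSpan R E := fun i d =>
    Submodule.smul_mem _ _ (by simpa using m' i one_mem_heckeSpan)
  have hgi' : gi k = g k - algebraMap R A c := by rw [hq k hk, add_sub_cancel_right]
  have e1 : algebraMap R A c * E j = c • E j := (Algebra.smul_def _ _).symm
  have e2 : E j * algebraMap R A c = c • E j := by rw [← Algebra.commutes, e1]
  -- it suffices to treat one of the two elements, on each side
  suffices h : (g k * E j ∈ genSpan R E * heckeSpan R T ∨ gi k * E j ∈ genSpan R E * heckeSpan R T) ∧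
      (E j * g k ∈ heckeSpan R T * genSpan R E ∨ E j * gi k ∈ heckeSpan R T * genSpan R E) by
    obtain ⟨h1, h2⟩ := h
    have a1 : g k * E j = gi k * E j + c • E j := by rw [hq k hk, add_mul, e1]
    have a2 : gi k * E j = g k * E j - c • E j := by rw [hgi', sub_mul, e1]
    have a3 : E j * g k = E j * gi k + c • E j := by rw [hq k hk, mul_add, e2]
    have a4 : E j * gi k = E j * g k - c • E j := by rw [hgi', mul_sub, e2]
    refine ⟨?_, ?_, ?_, ?_⟩
    · rcases h1 with h | h
      · exact h
      · rw [a1]; exact add_mem h (s j c)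
    · rcases h1 with h | h
      · rw [a2]; exact sub_mem h (s j c)
      · exact h
    · rcases h2 with h | h
      · exact h
      · rw [a3]; exact add_mem h (s' j c)
    · rcases h2 with h | h
      · rw [a4]; exact sub_mem h (s' j c)
      · exact h
  rw [← ext_val E j]
  rcases eq_or_ne (j : ℕ) k with hjk | hjk
  · refine ⟨Or.inl ?_, Or.inl ?_⟩
    · rw [hjk, ← hE.succ_mul_inv B hk, ext_of_lt (by omega : (k : ℕ) + 1 < n + 1)]
      exact m _ (hgi k)
    · rw [hjk, ← hE.inv_mul_succ B hk, ext_of_lt (by omega : (k : ℕ) + 1 < n + 1)]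
      exact m' _ (hgi k)
  rcases eq_or_ne (j : ℕ) (k + 1) with hjk' | hjk'
  · refine ⟨Or.inr ?_, Or.inr ?_⟩
    · rw [hjk', hE.inv_mul_succ B hk, ext_of_lt (by omega : (k : ℕ) < n + 1)]
      exact m _ (hg k)
    · rw [hjk', hE.succ_mul_inv B hk, ext_of_lt (by omega : (k : ℕ) < n + 1)]
      exact m' _ (hg k)
  · have c := hE.comm k j hjk hjk'
    refine ⟨Or.inl ?_, Or.inl ?_⟩
    · rw [c.eq, ext_val]; exact m j (hg k)
    · rw [← c.eq, ext_val]; exact m' j (hg k)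

end Hecke

/-! ### Moving Hecke elements through `X`, `Y` and `D` -/

section CycSeq

variable {R A : Type*} [CommRing R] [Ring A] [Algebra R A] {n l : ℕ} {q t : Rˣ} {Z : Fin l → Rˣ}
  {T : Fin n → A} {X Y D : Fin (n + 1) → A}

/-- The relation `cd5` only asks `T_k` to commute with `D_j` at distance at least two, while a
twisted sequence also needs the pair `T_{j+1}`, `D_j`. That pair is obtained from `[T_j, D_{j+2}] =
0` by writing `D_j` through `D_{j+2}` and using the braid relation. -/
theorem twistedD_of_cycRel (H : ∀ a b, CycRel q t Z T X Y D a b → a = b) :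
    Twisted n (ext (tInv t T)) (ext D) := by
  have B := braidSeq_of_baseRel fun a b h => H a b (.base h)
  have h5 : ∀ i : Fin n, tInv t T i * D i.castSucc * tInv t T i = D i.succ :=
    fun i => H _ _ (.cd5 i)
  have hstep : ∀ k, k < n → ext D k = ext T k * ext D (k + 1) * ext T k := by
    intro k hk
    have h := h5 ⟨k, hk⟩
    have e : ext D (k + 1) = ext (tInv t T) k * ext D k * ext (tInv t T) k := by
      rw [ext_of_lt hk, ext_of_lt (by omega : k < n + 1), ext_of_lt (by omega : k + 1 < n + 1)]
      exact h.symm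
    rw [e]; simp only [mul_assoc, B.mul_inv_assoc, B.inv_mul, mul_one]
  have far : ∀ k j : ℕ, (j + 2 ≤ k ∨ k + 2 ≤ j) → k < n → j < n + 1 →
      Commute (ext T k) (ext D j) := by
    intro k j h hk hj
    rw [ext_of_lt hk, ext_of_lt hj]
    exact H _ _ (.cd5_comm ⟨k, hk⟩ ⟨j, hj⟩ h)
  have key : ∀ (k : Fin n) (j : Fin (n + 1)), j ≠ k.castSucc → j ≠ k.succ → Commute (T k) (D j) := by
    intro k j h1 h2
    have hk := k.2
    have hj := j.2
    simp only [ne_eq, Fin.ext_iff, Fin.val_castSucc, Fin.val_succ] at h1 h2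
    rw [← ext_val T, ← ext_val D]
    by_cases h : (j : ℕ) + 2 ≤ k ∨ (k : ℕ) + 2 ≤ j
    · exact far k j h hk hj
    · -- the case `k = j + 1`, by conjugating the relation `[T_j, D_{j+2}] = 0`
      have hkj : (k : ℕ) = j + 1 := by omega
      have f := far j (j + 2) (Or.inr le_rfl) (by omega) (by omega)
      have hb := B.braid j (by omega)
      have e : ext D j = ext T j * (ext T (j + 1) * ext D (j + 2) * ext T (j + 1)) * ext T j := by
        rw [hstep j (by omega), hstep (j + 1) (by omega)]
      rw [hkj]
      show ext T (j + 1) * ext D j = ext D j * ext T (j + 1)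
      generalize ext D ((j : ℕ) + 2) = E at f e
      generalize ext T ((j : ℕ) + 1) = b at *
      generalize ext T (j : ℕ) = a at *
      rw [e]
      calc b * (a * (b * E * b) * a) = (b * a * b) * E * b * a := by simp only [mul_assoc]
        _ = a * b * (a * E) * b * a := by rw [← hb]; simp only [mul_assoc]
        _ = a * b * E * (a * b * a) := by rw [f.eq]; simp only [mul_assoc]
        _ = _ := by rw [hb]; simp only [mul_assoc]
  refine twisted_ext h5 fun k j h1 h2 => ?_
  have c := key k j h1 h2
  have := commute_inv c.symm (v' := tInv t T k)
    (mul_tInv_of_quadratic (H _ _ (.base (.R1 k)))).1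
    (mul_tInv_of_quadratic (H _ _ (.base (.R1 k)))).2
  exact this.symm.eq

/-- The span of `1` and the members of a family. -/
def oneSpan (R : Type*) {A ι : Type*} [CommRing R] [Ring A] [Algebra R A] (E : ι → A) :
    Submodule R A := 1 ⊔ genSpan R E

theorem one_le_oneSpan {ι : Type*} (E : ι → A) : 1 ≤ oneSpan R E := le_sup_left

theorem mem_oneSpan {ι : Type*} (E : ι → A) (i : ι) : E i ∈ oneSpan R E :=
  (le_sup_right : genSpan R E ≤ oneSpan R E) (mem_genSpan E i)

theorem one_mem_oneSpan {ι : Type*} (E : ι → A) : (1 : A) ∈ oneSpan R E :=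
  Submodule.one_le.1 (one_le_oneSpan E)

theorem oneSpan_le {ι : Type*} {E : ι → A} {U : Submodule R A} (h1 : (1 : A) ∈ U)
    (h : ∀ i, E i ∈ U) : oneSpan R E ≤ U :=
  sup_le (Submodule.one_le.2 h1) (Submodule.span_le.2 (by rintro _ ⟨i, rfl⟩; exact h i))

theorem genSpan_le {ι : Type*} {E : ι → A} {U : Submodule R A}
    (h : ∀ i, E i ∈ U) : genSpan R E ≤ U :=
  Submodule.span_le.2 (by rintro _ ⟨i, rfl⟩; exact h i)

theorem hecke_mul_X (H : ∀ a b, CycRel q t Z T X Y D a b → a = b) :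
    heckeSpan R T * genSpan R X ≤ genSpan R X * heckeSpan R T := by
  have Hb : ∀ a b, BaseRel t T X Y a b → a = b := fun a b h => H a b (.base h)
  refine heckeSpan_mul_le fun k v hv => mul_mem_of_forall (fun j => ?_) hv
  rw [← ext_val T]
  exact (twisted_mem (braidSeq_of_baseRel Hb) (twistedX_of_baseRel Hb) (fun k hk => ext_sub_tInv hk)
    ext_mem_heckeSpan ext_tInv_mem_heckeSpan k j).1

theorem hecke_mul_Y (H : ∀ a b, CycRel q t Z T X Y D a b → a = b) :
    heckeSpan R T * genSpan R Y ≤ genSpan R Y * heckeSpan R T := by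
  have Hb : ∀ a b, BaseRel t T X Y a b → a = b := fun a b h => H a b (.base h)
  refine heckeSpan_mul_le fun k v hv => mul_mem_of_forall (fun j => ?_) hv
  rw [← ext_val T]
  exact (twisted_mem (braidSeq_of_baseRel Hb) (twistedY_of_baseRel Hb) (fun k hk => ext_sub_tInv hk)
    ext_mem_heckeSpan ext_tInv_mem_heckeSpan k j).1

theorem twistedD_mem (H : ∀ a b, CycRel q t Z T X Y D a b → a = b) (k : Fin n) (j : Fin (n + 1)) :
    T k * D j ∈ genSpan R D * heckeSpan R T ∧ D j * T k ∈ heckeSpan R T * genSpan R D := by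
  have Hb : ∀ a b, BaseRel t T X Y a b → a = b := fun a b h => H a b (.base h)
  have h := twisted_mem (T := T) (braidSeq_of_baseRel Hb).symm (twistedD_of_cycRel H)
    (c := -((t : R) - ((t⁻¹ : Rˣ) : R)))
    (fun k hk => by rw [ext_sub_tInv (t := t) (T := T) hk, map_neg]; abel)
    ext_tInv_mem_heckeSpan ext_mem_heckeSpan k j
  rw [ext_val T] at h
  exact ⟨h.2.1, h.2.2.2⟩

theorem hecke_mul_D (H : ∀ a b, CycRel q t Z T X Y D a b → a = b) :
    heckeSpan R T * genSpan R D ≤ genSpan R D * heckeSpan R T :=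
  heckeSpan_mul_le fun k _ hv => mul_mem_of_forall (fun j => (twistedD_mem H k j).1) hv

theorem D_mul_hecke (H : ∀ a b, CycRel q t Z T X Y D a b → a = b) :
    genSpan R D * heckeSpan R T ≤ heckeSpan R T * genSpan R D :=
  mul_heckeSpan_le fun k _ hv => mul_mem_of_forall' (fun j => (twistedD_mem H k j).2) hv

theorem hecke_mul_one_X (H : ∀ a b, CycRel q t Z T X Y D a b → a = b) :
    heckeSpan R T * oneSpan R X ≤ oneSpan R X * heckeSpan R T := by
  rw [oneSpan, Submodule.mul_sup, Submodule.sup_mul, mul_one, one_mul]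
  exact sup_le_sup_left (hecke_mul_X H) _

theorem hecke_mul_one_Y (H : ∀ a b, CycRel q t Z T X Y D a b → a = b) :
    heckeSpan R T * oneSpan R Y ≤ oneSpan R Y * heckeSpan R T := by
  rw [oneSpan, Submodule.mul_sup, Submodule.sup_mul, mul_one, one_mul]
  exact sup_le_sup_left (hecke_mul_Y H) _

end CycSeq
end CycDAHA

namespace CycDAHA
open Polynomial

/-! ### Straightening inclusions and the filtration -/

section Filtration

variable {R A : Type*} [CommRing R] [Ring A] [Algebra R A] {n l : ℕ} {q t : Rˣ} {Z : Fin l → Rˣ}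
  {T : Fin n → A} {X Y D : Fin (n + 1) → A}

theorem singleton_le_hecke {a : A} (h : a ∈ heckeSpan R T) : (R ∙ a) ≤ heckeSpan R T :=
  (Submodule.span_singleton_le_iff_mem _ _).2 h

theorem span_singleton_mul (a b : A) : (R ∙ (a * b)) = (R ∙ a) * (R ∙ b) := by
  rw [Submodule.span_mul_span, Set.singleton_mul_singleton]

/-- Induction along a twisted family for inclusions `E_i V ≤ U`. -/
theorem twisted_mul_le {g : ℕ → A} {E : Fin (n + 1) → A} (hE : Twisted n g (ext E))
    (hg : ∀ k, g k ∈ heckeSpan R T) {V U : Submodule R A}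
    (hV : heckeSpan R T * V ≤ V * heckeSpan R T)
    (hU : heckeSpan R T * U * heckeSpan R T ≤ U) (h0 : (R ∙ E 0) * V ≤ U) :
    genSpan R E * V ≤ U := by
  have key : ∀ i : Fin (n + 1), (R ∙ E i) * V ≤ U := by
    intro i
    induction i using Fin.induction with
    | zero => exact h0
    | succ i ih =>
      have e : E i.succ = g i * E i.castSucc * g i := by
        have := hE.step i i.2
        rw [ext_of_lt (by omega : (i : ℕ) < n + 1), ext_of_lt (by omega : (i : ℕ) + 1 < n + 1)] at this
        exact this.symm
      have hh := singleton_le_hecke (hg i)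
      calc (R ∙ E i.succ) * V = (R ∙ g i) * (R ∙ E i.castSucc) * (R ∙ g i) * V := by
            rw [e, span_singleton_mul, span_singleton_mul]
        _ ≤ heckeSpan R T * (R ∙ E i.castSucc) * heckeSpan R T * V := by gcongr
        _ = heckeSpan R T * (R ∙ E i.castSucc) * (heckeSpan R T * V) := by simp only [mul_assoc]
        _ ≤ heckeSpan R T * (R ∙ E i.castSucc) * (V * heckeSpan R T) := by gcongr
        _ = heckeSpan R T * ((R ∙ E i.castSucc) * V) * heckeSpan R T := by simp only [mul_assoc]
        _ ≤ heckeSpan R T * U * heckeSpan R T := by gcongr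
        _ ≤ U := hU
  refine Submodule.mul_le.2 fun a ha v hv => ?_
  exact mul_mem_of_forall' (fun j => key j (Submodule.mul_mem_mul (Submodule.mem_span_singleton_self _) hv)) ha

theorem mul_mem_three {U V W : Submodule R A} {a b c : A} (ha : a ∈ U) (hb : b ∈ V) (hc : c ∈ W) :
    a * b * c ∈ U * V * W := Submodule.mul_mem_mul (Submodule.mul_mem_mul ha hb) hc

theorem singleton_mul_le {ι : Type*} {a : A} {E : ι → A} {U : Submodule R A}
    (h : ∀ j, a * E j ∈ U) : (R ∙ a) * genSpan R E ≤ U := by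
  rw [genSpan, Submodule.span_mul_span, Submodule.span_le]
  rintro _ ⟨x, hx, _, ⟨j, rfl⟩, rfl⟩
  rw [Set.mem_singleton_iff] at hx
  subst hx
  exact h j

theorem jUp_mem (k : ℕ) : jUp T k ∈ heckeSpan R T :=
  mul_mem_heckeSpan (up_mem_heckeSpan ext_mem_heckeSpan _ _) (dn_mem_heckeSpan ext_mem_heckeSpan _ _)

/-- The right-hand side is stable under `H` on both sides, so by `twisted_mul_le` only products
starting with `Y_0` need to be examined: `cd3` treats `X_0`, and `cd2` the other `X_j`. -/
theorem Y_mul_X_le (H : ∀ a b, CycRel q t Z T X Y D a b → a = b) :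
    genSpan R Y * genSpan R X ≤ genSpan R X * genSpan R Y * heckeSpan R T := by
  have Hb : ∀ a b, BaseRel t T X Y a b → a = b := fun a b h => H a b (.base h)
  have hX := hecke_mul_X H
  have hY := hecke_mul_Y H
  refine twisted_mul_le (twistedY_of_baseRel Hb) ext_mem_heckeSpan hX ?_ ?_
  · calc heckeSpan R T * (genSpan R X * genSpan R Y * heckeSpan R T) * heckeSpan R T
        = (heckeSpan R T * genSpan R X) * genSpan R Y * (heckeSpan R T * heckeSpan R T) := by
          simp only [mul_assoc]
      _ ≤ (genSpan R X * heckeSpan R T) * genSpan R Y * heckeSpan R T := by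
          rw [heckeSpan_mul_self]; gcongr
      _ = genSpan R X * (heckeSpan R T * genSpan R Y) * heckeSpan R T := by
          simp only [mul_assoc]
      _ ≤ genSpan R X * (genSpan R Y * heckeSpan R T) * heckeSpan R T := by gcongr
      _ = _ := by simp only [mul_assoc, heckeSpan_mul_self]
  · refine singleton_mul_le fun j => ?_
    have hX' : heckeSpan R T * genSpan R X * genSpan R Y ≤
        genSpan R X * genSpan R Y * heckeSpan R T :=
      calc heckeSpan R T * genSpan R X * genSpan R Y ≤ genSpan R X * heckeSpan R T * genSpan R Y := by
            gcongr
        _ = genSpan R X * (heckeSpan R T * genSpan R Y) := by rw [mul_assoc]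
        _ ≤ genSpan R X * (genSpan R Y * heckeSpan R T) := by gcongr
        _ = _ := by rw [mul_assoc]
    rcases Fin.eq_zero_or_eq_succ j with rfl | ⟨j, rfl⟩
    · have h := H _ _ (.cd3 0)
      have e : jDown t T ((0 : Fin (n + 1)) : ℕ) = 1 := by
        simp [jDown, ← up_eq_asc, ← dn_eq_desc, up_of_le, dn_of_le]
      rw [e, mul_one] at h
      rw [h]
      refine Submodule.smul_mem _ _ ?_
      have h1 : X 0 * jUp T ((0 : Fin (n + 1)) : ℕ) * Y 0 ∈
          genSpan R X * (heckeSpan R T * genSpan R Y) := by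
        rw [mul_assoc]
        exact Submodule.mul_mem_mul (mem_genSpan _ _)
          (Submodule.mul_mem_mul (jUp_mem _) (mem_genSpan _ _))
      have h2 : genSpan R X * (heckeSpan R T * genSpan R Y) ≤
          genSpan R X * (genSpan R Y * heckeSpan R T) := by gcongr
      rw [mul_assoc]
      exact h2 h1
    · have h := H _ _ (.cd2 0 j.succ (Fin.succ_pos j))
      rw [h]
      refine hX' (mul_mem_three ?_ (mem_genSpan _ _) (mem_genSpan _ _))
      refine mul_mem_heckeSpan (mul_mem_heckeSpan ?_ ?_) ?_
      · exact dn_mem_heckeSpan ext_mem_heckeSpan _ _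
      · rw [pow_two]; exact mul_mem_heckeSpan (ext_tInv_mem_heckeSpan _) (ext_tInv_mem_heckeSpan _)
      · exact up_mem_heckeSpan ext_tInv_mem_heckeSpan _ _

theorem one_Y_mul_one_X_le (H : ∀ a b, CycRel q t Z T X Y D a b → a = b) :
    oneSpan R Y * oneSpan R X ≤ oneSpan R X * oneSpan R Y * heckeSpan R T := by
  have h := Y_mul_X_le H
  have hH : 1 ≤ heckeSpan R T := one_le_heckeSpan
  have h1X := one_le_oneSpan (R := R) X
  have h1Y := one_le_oneSpan (R := R) Y
  have hX : genSpan R X ≤ oneSpan R X := le_sup_right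
  have hY : genSpan R Y ≤ oneSpan R Y := le_sup_right
  have e1 : oneSpan R X * oneSpan R Y ≤ oneSpan R X * oneSpan R Y * heckeSpan R T :=
    le_mul_of_one_le_right' hH
  nth_rewrite 1 [oneSpan, oneSpan]
  rw [Submodule.sup_mul, Submodule.mul_sup, Submodule.mul_sup, one_mul, one_mul, mul_one]
  refine sup_le (sup_le ?_ ?_) (sup_le ?_ ?_)
  · exact (h1X.trans (le_mul_of_one_le_right' h1Y)).trans e1
  · exact (hX.trans (le_mul_of_one_le_right' h1Y)).trans e1
  · exact (hY.trans (le_mul_of_one_le_left' h1X)).trans e1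
  · exact h.trans (by gcongr)

theorem hecke_mul_pow_X (H : ∀ a b, CycRel q t Z T X Y D a b → a = b) (p : ℕ) :
    heckeSpan R T * oneSpan R X ^ p ≤ oneSpan R X ^ p * heckeSpan R T :=
  mul_pow_le (hecke_mul_one_X H) p

theorem hecke_mul_pow_Y (H : ∀ a b, CycRel q t Z T X Y D a b → a = b) (p : ℕ) :
    heckeSpan R T * oneSpan R Y ^ p ≤ oneSpan R Y ^ p * heckeSpan R T :=
  mul_pow_le (hecke_mul_one_Y H) p

theorem one_Y_mul_pow_X (H : ∀ a b, CycRel q t Z T X Y D a b → a = b) (p : ℕ) :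
    oneSpan R Y * oneSpan R X ^ p ≤ oneSpan R X ^ p * oneSpan R Y * heckeSpan R T :=
  mul_pow_le_mul heckeSpan_mul_self_le one_le_heckeSpan (one_Y_mul_one_X_le H) (hecke_mul_one_X H) p

theorem pow_Y_mul_X (H : ∀ a b, CycRel q t Z T X Y D a b → a = b) (p : ℕ) :
    oneSpan R Y ^ p * oneSpan R X ≤ oneSpan R X * oneSpan R Y ^ p * heckeSpan R T := by
  have h := one_Y_mul_one_X_le H
  have hY := hecke_mul_pow_Y H
  induction p with
  | zero => simpa using le_mul_of_one_le_right' one_le_heckeSpan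
  | succ p ih =>
    calc oneSpan R Y ^ (p + 1) * oneSpan R X = oneSpan R Y * (oneSpan R Y ^ p * oneSpan R X) := by
          rw [pow_succ', mul_assoc]
      _ ≤ oneSpan R Y * (oneSpan R X * oneSpan R Y ^ p * heckeSpan R T) := by gcongr
      _ = (oneSpan R Y * oneSpan R X) * oneSpan R Y ^ p * heckeSpan R T := by simp only [mul_assoc]
      _ ≤ (oneSpan R X * oneSpan R Y * heckeSpan R T) * oneSpan R Y ^ p * heckeSpan R T := by gcongr
      _ = oneSpan R X * oneSpan R Y * (heckeSpan R T * oneSpan R Y ^ p) * heckeSpan R T := by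
          simp only [mul_assoc]
      _ ≤ oneSpan R X * oneSpan R Y * (oneSpan R Y ^ p * heckeSpan R T) * heckeSpan R T := by
          have := hY p
          gcongr
      _ = _ := by rw [pow_succ']; simp only [mul_assoc, heckeSpan_mul_self]

/-- Again it suffices to start with `D_0`, where `cd8` and `cd6` apply. Unlike for `Y X`, no lower
term appears. -/
theorem D_mul_Y_le (H : ∀ a b, CycRel q t Z T X Y D a b → a = b) :
    genSpan R D * genSpan R Y ≤ genSpan R Y * heckeSpan R T * genSpan R D := by
  have hY := hecke_mul_Y H
  have hD := hecke_mul_D H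
  have hD' := D_mul_hecke H
  refine twisted_mul_le (twistedD_of_cycRel H) ext_tInv_mem_heckeSpan hY ?_ ?_
  · calc heckeSpan R T * (genSpan R Y * heckeSpan R T * genSpan R D) * heckeSpan R T
        = (heckeSpan R T * genSpan R Y) * heckeSpan R T * (genSpan R D * heckeSpan R T) := by
          simp only [mul_assoc]
      _ ≤ (genSpan R Y * heckeSpan R T) * heckeSpan R T * (heckeSpan R T * genSpan R D) := by gcongr
      _ = genSpan R Y * (heckeSpan R T * heckeSpan R T * heckeSpan R T) * genSpan R D := by
          simp only [mul_assoc]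
      _ = _ := by rw [heckeSpan_mul_self, heckeSpan_mul_self]
  · refine singleton_mul_le fun j => ?_
    rcases Fin.eq_zero_or_eq_succ j with rfl | ⟨j, rfl⟩
    · have h := H _ _ (.cd8 0)
      have e : jDown t T ((0 : Fin (n + 1)) : ℕ) = 1 := by
        simp [jDown, ← up_eq_asc, ← dn_eq_desc, up_of_le, dn_of_le]
      rw [e, mul_one] at h
      rw [h]
      refine Submodule.smul_mem _ _ ?_
      have h2 : heckeSpan R T * genSpan R Y * genSpan R D ≤
          genSpan R Y * heckeSpan R T * genSpan R D := by gcongr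
      exact h2 (mul_mem_three (jUp_mem _) (mem_genSpan _ _) (mem_genSpan _ _))
    · rw [H _ _ (.cd6 0 j.succ (Fin.succ_pos j))]
      refine mul_mem_three (mem_genSpan _ _) ?_ (mem_genSpan _ _)
      refine mul_mem_heckeSpan (mul_mem_heckeSpan ?_ ?_) ?_
      · exact dn_mem_heckeSpan ext_tInv_mem_heckeSpan _ _
      · rw [pow_two]; exact mul_mem_heckeSpan (ext_tInv_mem_heckeSpan _) (ext_tInv_mem_heckeSpan _)
      · exact up_mem_heckeSpan ext_mem_heckeSpan _ _

theorem D_mul_pow_Y (H : ∀ a b, CycRel q t Z T X Y D a b → a = b) (p : ℕ) :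
    genSpan R D * oneSpan R Y ^ p ≤ oneSpan R Y ^ p * heckeSpan R T * genSpan R D := by
  have h1 : genSpan R D * oneSpan R Y ≤ oneSpan R Y * heckeSpan R T * genSpan R D := by
    rw [oneSpan, Submodule.mul_sup, Submodule.sup_mul, Submodule.sup_mul, mul_one, one_mul]
    exact sup_le_sup (le_mul_of_one_le_left' one_le_heckeSpan) (D_mul_Y_le H)
  have hY := hecke_mul_one_Y H
  induction p with
  | zero => simpa using le_mul_of_one_le_left' one_le_heckeSpan
  | succ p ih =>
    calc genSpan R D * oneSpan R Y ^ (p + 1) = genSpan R D * oneSpan R Y ^ p * oneSpan R Y := by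
          rw [pow_succ, mul_assoc]
      _ ≤ oneSpan R Y ^ p * heckeSpan R T * genSpan R D * oneSpan R Y := by gcongr
      _ = oneSpan R Y ^ p * heckeSpan R T * (genSpan R D * oneSpan R Y) := by simp only [mul_assoc]
      _ ≤ oneSpan R Y ^ p * heckeSpan R T * (oneSpan R Y * heckeSpan R T * genSpan R D) := by gcongr
      _ = oneSpan R Y ^ p * (heckeSpan R T * oneSpan R Y) * heckeSpan R T * genSpan R D := by
          simp only [mul_assoc]
      _ ≤ oneSpan R Y ^ p * (oneSpan R Y * heckeSpan R T) * heckeSpan R T * genSpan R D := by gcongr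
      _ = oneSpan R Y ^ p * oneSpan R Y * (heckeSpan R T * heckeSpan R T) * genSpan R D := by
          simp only [mul_assoc]
      _ = _ := by rw [pow_succ, heckeSpan_mul_self]

theorem zEval_mem_pow {V : Submodule R A} (h1 : 1 ≤ V) {u : A} (hu : u ∈ V) (S : Finset (Fin l)) :
    zEval Z S u ∈ V ^ S.card := by
  classical
  induction S using Finset.induction_on with
  | empty => simp [zEval_empty, Submodule.one_le.1 le_rfl]
  | insert r S hr ih =>
    rw [zEval_insert Z hr, Finset.card_insert_of_notMem hr, pow_succ']
    refine Submodule.mul_mem_mul (sub_mem hu (h1 ?_)) ih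
    exact Submodule.algebraMap_mem _

theorem pow_Y_hecke (H : ∀ a b, CycRel q t Z T X Y D a b → a = b) (p : ℕ) :
    (oneSpan R Y * heckeSpan R T) ^ p ≤ oneSpan R Y ^ p * heckeSpan R T := by
  induction p with
  | zero => simpa using one_le_heckeSpan
  | succ p ih =>
    have h := hecke_mul_one_Y H
    calc (oneSpan R Y * heckeSpan R T) ^ (p + 1)
        = (oneSpan R Y * heckeSpan R T) ^ p * (oneSpan R Y * heckeSpan R T) := pow_succ _ _
      _ ≤ (oneSpan R Y ^ p * heckeSpan R T) * (oneSpan R Y * heckeSpan R T) := by gcongr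
      _ = oneSpan R Y ^ p * (heckeSpan R T * oneSpan R Y) * heckeSpan R T := by simp only [mul_assoc]
      _ ≤ oneSpan R Y ^ p * (oneSpan R Y * heckeSpan R T) * heckeSpan R T := by gcongr
      _ = oneSpan R Y ^ p * oneSpan R Y * (heckeSpan R T * heckeSpan R T) := by simp only [mul_assoc]
      _ = _ := by rw [pow_succ, heckeSpan_mul_self]

theorem hecke_mul_XD (H : ∀ a b, CycRel q t Z T X Y D a b → a = b) :
    heckeSpan R T * (oneSpan R X * heckeSpan R T * genSpan R D) * heckeSpan R T ≤
      oneSpan R X * heckeSpan R T * genSpan R D := by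
  have hX := hecke_mul_one_X H
  have hD' := D_mul_hecke H
  calc heckeSpan R T * (oneSpan R X * heckeSpan R T * genSpan R D) * heckeSpan R T
      = (heckeSpan R T * oneSpan R X) * heckeSpan R T * (genSpan R D * heckeSpan R T) := by
        simp only [mul_assoc]
    _ ≤ (oneSpan R X * heckeSpan R T) * heckeSpan R T * (heckeSpan R T * genSpan R D) := by
        gcongr
    _ = oneSpan R X * (heckeSpan R T * heckeSpan R T * heckeSpan R T) * genSpan R D := by
        simp only [mul_assoc]
    _ = _ := by rw [heckeSpan_mul_self, heckeSpan_mul_self]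

theorem hecke_mul_Y_hecke (H : ∀ a b, CycRel q t Z T X Y D a b → a = b) (r : ℕ) :
    heckeSpan R T * (oneSpan R Y ^ r * heckeSpan R T) * heckeSpan R T ≤
      oneSpan R Y ^ r * heckeSpan R T := by
  have hY := hecke_mul_pow_Y H r
  calc heckeSpan R T * (oneSpan R Y ^ r * heckeSpan R T) * heckeSpan R T
      = (heckeSpan R T * oneSpan R Y ^ r) * (heckeSpan R T * heckeSpan R T) := by
        simp only [mul_assoc]
    _ ≤ (oneSpan R Y ^ r * heckeSpan R T) * (heckeSpan R T * heckeSpan R T) := by gcongr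
    _ = _ := by rw [heckeSpan_mul_self, mul_assoc, heckeSpan_mul_self]

theorem hecke_mul_straightened (H : ∀ a b, CycRel q t Z T X Y D a b → a = b) :
    heckeSpan R T * (oneSpan R X * heckeSpan R T * genSpan R D ⊔ oneSpan R Y ^ l * heckeSpan R T) *
      heckeSpan R T ≤
      oneSpan R X * heckeSpan R T * genSpan R D ⊔ oneSpan R Y ^ l * heckeSpan R T := by
  rw [Submodule.mul_sup, Submodule.sup_mul]
  exact sup_le_sup (hecke_mul_XD H) (hecke_mul_Y_hecke H l)

/-- The relations give only the first two cases: `cd9` for `X_0` and `cd10` for `X_1`. The rest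
follow by induction from `X_{k+1} = T_k X_k T_k`, since `T_k` commutes with `D_0` for `k ≥ 1`. -/
theorem D_zero_mul_X_mem (H : ∀ a b, CycRel q t Z T X Y D a b → a = b) (j : Fin (n + 1)) :
    D 0 * X j ∈ oneSpan R X * heckeSpan R T * genSpan R D ⊔ oneSpan R Y ^ l * heckeSpan R T := by
  have Hb : ∀ a b, BaseRel t T X Y a b → a = b := fun a b h => H a b (.base h)
  have B := braidSeq_of_baseRel Hb
  have hX := hecke_mul_one_X H
  have hD := hecke_mul_D H
  have hD' := D_mul_hecke H
  have hY := hecke_mul_pow_Y H l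
  have h1 : 1 ≤ oneSpan R Y * heckeSpan R T :=
    (one_le_oneSpan Y).trans (le_mul_of_one_le_right' one_le_heckeSpan)
  have hJ : (q : R) • (jUp T 0 * Y 0) ∈ oneSpan R Y * heckeSpan R T := by
    refine Submodule.smul_mem _ _ ?_
    exact hecke_mul_one_Y H (Submodule.mul_mem_mul (jUp_mem _) (mem_oneSpan _ _))
  have hXHD : ∀ i, X i * D 0 ∈ oneSpan R X * heckeSpan R T * genSpan R D := fun i => by
    rw [show X i * D 0 = X i * 1 * D 0 by rw [mul_one]]
    exact mul_mem_three (mem_oneSpan _ _) one_mem_heckeSpan (mem_genSpan _ _)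
  have key : ∀ k (hk : k < n + 1), D 0 * X ⟨k, hk⟩ ∈
      oneSpan R X * heckeSpan R T * genSpan R D ⊔ oneSpan R Y ^ l * heckeSpan R T := by
    intro k
    induction k with
    | zero =>
      intro hk
      have h := H _ _ .cd9_right
      rw [show (⟨0, hk⟩ : Fin (n + 1)) = 0 from rfl, h]
      refine Submodule.mem_sup_right (pow_Y_hecke H l ?_)
      have := zEval_mem_pow (Z := Z) h1 hJ Finset.univ
      rwa [Finset.card_univ, Fintype.card_fin] at this
    | succ k ih =>
      intro hk
      rcases Nat.eq_zero_or_pos k with rfl | hk0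
      · have h := H _ _ (.cd10 ⟨0, by omega⟩ rfl)
        rw [sub_eq_iff_eq_add] at h
        have e : D 0 * X ⟨0 + 1, hk⟩ = _ := h
        rw [e]
        refine add_mem (Submodule.smul_mem _ _ (Submodule.sum_mem _ fun r _ => ?_))
          (Submodule.mem_sup_left (hXHD _))
        refine Submodule.mem_sup_right ?_
        have hYT : Y (Fin.succ ⟨0, by omega⟩) * tInv t T ⟨0, by omega⟩ ^ 2 ∈
            oneSpan R Y * heckeSpan R T := by
          refine Submodule.mul_mem_mul (mem_oneSpan _ _) ?_
          rw [pow_two]; exact mul_mem_heckeSpan (tInv_mem_heckeSpan _) (tInv_mem_heckeSpan _)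
        have m1 := zEval_mem_pow (Z := Z) h1 hJ (Finset.Iio r)
        have m2 := zEval_mem_pow (Z := Z) h1 hYT (Finset.Ioi r)
        have m3 := Submodule.mul_mem_mul (Submodule.mul_mem_mul (Submodule.mul_mem_mul m1 hYT) m2)
          (mem_heckeSpan (R := R) (T := T) ⟨0, by omega⟩)
        -- In each summand of `cd10` one linear factor of `f` is replaced by `Y_1 T_0⁻²`, so the
        -- total `Y`-degree stays at most `l`.
        have ec : (Finset.Iio r).card + 1 + (Finset.Ioi r).card = l := by
          rw [Fin.card_Iio, Fin.card_Ioi]; have := r.2; omega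
        rw [← pow_succ, ← pow_add, ec] at m3
        have le : (oneSpan R Y * heckeSpan R T) ^ l * heckeSpan R T ≤ oneSpan R Y ^ l * heckeSpan R T := by
          calc _ ≤ oneSpan R Y ^ l * heckeSpan R T * heckeSpan R T := by
                have := pow_Y_hecke H l
                gcongr
            _ = _ := by rw [mul_assoc, heckeSpan_mul_self]
        exact le m3
      · have hk' : k < n := by omega
        have e : X ⟨k + 1, hk⟩ = T ⟨k, hk'⟩ * X ⟨k, by omega⟩ * T ⟨k, hk'⟩ :=
          (Hb _ _ (.R4 ⟨k, hk'⟩)).symm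
        have c : D 0 * T ⟨k, hk'⟩ = T ⟨k, hk'⟩ * D 0 := by
          have := (twistedD_of_cycRel H).commute_inv B.symm (k := k) (j := 0) (by omega) (by omega)
          rw [ext_of_lt hk', ext_of_lt (Nat.succ_pos n)] at this
          exact this.eq.symm
        have e2 : D 0 * X ⟨k + 1, hk⟩ = T ⟨k, hk'⟩ * (D 0 * X ⟨k, by omega⟩) * T ⟨k, hk'⟩ := by
          rw [e, ← mul_assoc, ← mul_assoc, c]; simp only [mul_assoc]
        rw [e2]
        have m := mul_mem_three (mem_heckeSpan (R := R) (T := T) ⟨k, hk'⟩) (ih (by omega))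
          (mem_heckeSpan (R := R) (T := T) ⟨k, hk'⟩)
        exact hecke_mul_straightened H m
  exact key j j.2

theorem D_mul_X_le (H : ∀ a b, CycRel q t Z T X Y D a b → a = b) :
    genSpan R D * oneSpan R X ≤
      oneSpan R X * heckeSpan R T * genSpan R D ⊔ oneSpan R Y ^ l * heckeSpan R T := by
  have hX := hecke_mul_one_X H
  have hD' := D_mul_hecke H
  have hY := hecke_mul_pow_Y H l
  refine twisted_mul_le (twistedD_of_cycRel H) ext_tInv_mem_heckeSpan hX ?_ ?_
  · exact hecke_mul_straightened H
  · nth_rewrite 1 [oneSpan]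
    rw [Submodule.mul_sup, mul_one]
    refine sup_le ?_ (singleton_mul_le (D_zero_mul_X_mem H))
    rw [Submodule.span_singleton_le_iff_mem]
    refine Submodule.mem_sup_left ?_
    rw [show D 0 = 1 * 1 * D 0 by rw [mul_one, one_mul]]
    exact mul_mem_three (one_mem_oneSpan _) one_mem_heckeSpan (mem_genSpan _ _)

/-- Passing one further `X` creates another correction `X^{p+1} Y^l H`, and the previous correction
is brought to the same form by moving `X` through `Y^l`. In the semiring of submodules the two
coincide, so the error term does not accumulate. -/
theorem D_mul_pow_X (H : ∀ a b, CycRel q t Z T X Y D a b → a = b) (p : ℕ) :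
    genSpan R D * oneSpan R X ^ (p + 1) ≤ oneSpan R X ^ (p + 1) * heckeSpan R T * genSpan R D ⊔
      oneSpan R X ^ p * oneSpan R Y ^ l * heckeSpan R T := by
  have h := D_mul_X_le H
  have hX := hecke_mul_one_X H
  have hY := hecke_mul_pow_Y H l
  have hYX := pow_Y_mul_X H l
  induction p with
  | zero => simpa using h
  | succ p ih =>
    calc genSpan R D * oneSpan R X ^ (p + 1 + 1)
        = genSpan R D * oneSpan R X ^ (p + 1) * oneSpan R X := by rw [pow_succ, mul_assoc]
      _ ≤ (oneSpan R X ^ (p + 1) * heckeSpan R T * genSpan R D ⊔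
            oneSpan R X ^ p * oneSpan R Y ^ l * heckeSpan R T) * oneSpan R X := by gcongr
      _ = oneSpan R X ^ (p + 1) * heckeSpan R T * (genSpan R D * oneSpan R X) ⊔
            oneSpan R X ^ p * oneSpan R Y ^ l * (heckeSpan R T * oneSpan R X) := by
          rw [Submodule.sup_mul]; simp only [mul_assoc]
      _ ≤ oneSpan R X ^ (p + 1) * heckeSpan R T * (oneSpan R X * heckeSpan R T * genSpan R D ⊔
            oneSpan R Y ^ l * heckeSpan R T) ⊔
            oneSpan R X ^ p * oneSpan R Y ^ l * (oneSpan R X * heckeSpan R T) := by gcongr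
      _ = (oneSpan R X ^ (p + 1) * (heckeSpan R T * oneSpan R X) * heckeSpan R T * genSpan R D ⊔
            oneSpan R X ^ (p + 1) * (heckeSpan R T * oneSpan R Y ^ l) * heckeSpan R T) ⊔
            oneSpan R X ^ p * (oneSpan R Y ^ l * oneSpan R X) * heckeSpan R T := by
          rw [Submodule.mul_sup]; simp only [mul_assoc]
      _ ≤ (oneSpan R X ^ (p + 1) * (oneSpan R X * heckeSpan R T) * heckeSpan R T * genSpan R D ⊔
            oneSpan R X ^ (p + 1) * (oneSpan R Y ^ l * heckeSpan R T) * heckeSpan R T) ⊔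
            oneSpan R X ^ p * (oneSpan R X * oneSpan R Y ^ l * heckeSpan R T) * heckeSpan R T := by
          gcongr
      _ = (oneSpan R X ^ (p + 1) * oneSpan R X * (heckeSpan R T * heckeSpan R T) * genSpan R D ⊔
            oneSpan R X ^ (p + 1) * oneSpan R Y ^ l * (heckeSpan R T * heckeSpan R T)) ⊔
            (oneSpan R X ^ p * oneSpan R X) * oneSpan R Y ^ l * (heckeSpan R T * heckeSpan R T) := by
          simp only [mul_assoc]
      _ = _ := by
          rw [heckeSpan_mul_self, ← pow_succ, ← pow_succ, sup_assoc, sup_idem]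

/-- The filtration: `X`-degree at most `d` plus the `D`-degree, weighted `Y`-degree at most `e`. -/
def filt (R : Type*) {A : Type*} [CommRing R] [Ring A] [Algebra R A] {n : ℕ} (l : ℕ) (T : Fin n → A)
    (X Y D : Fin (n + 1) → A) (d : ℤ) (e : ℕ) : Submodule R A :=
  ⨆ (x : ℕ × ℕ × ℕ) (_ : (x.1 : ℤ) ≤ d + x.2.2 ∧ x.2.1 + l * x.2.2 ≤ e),
    oneSpan R X ^ x.1 * oneSpan R Y ^ x.2.1 * heckeSpan R T * genSpan R D ^ x.2.2

theorem le_filt {d : ℤ} {e p r k : ℕ} (h1 : (p : ℤ) ≤ d + k) (h2 : r + l * k ≤ e) :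
    oneSpan R X ^ p * oneSpan R Y ^ r * heckeSpan R T * genSpan R D ^ k ≤ filt R l T X Y D d e :=
  le_iSup₂_of_le (f := fun (x : ℕ × ℕ × ℕ) (_ : (x.1 : ℤ) ≤ d + x.2.2 ∧ x.2.1 + l * x.2.2 ≤ e) =>
    oneSpan R X ^ x.1 * oneSpan R Y ^ x.2.1 * heckeSpan R T * genSpan R D ^ x.2.2)
    (p, r, k) ⟨h1, h2⟩ le_rfl

theorem mul_filt_le {V U : Submodule R A} {d : ℤ} {e : ℕ}
    (h : ∀ p r k : ℕ, (p : ℤ) ≤ d + k → r + l * k ≤ e →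
      V * (oneSpan R X ^ p * oneSpan R Y ^ r * heckeSpan R T * genSpan R D ^ k) ≤ U) :
    V * filt R l T X Y D d e ≤ U := by
  unfold filt
  simp only [Submodule.mul_iSup]
  exact iSup₂_le fun x hx => h _ _ _ hx.1 hx.2

theorem hecke_mul_filt (H : ∀ a b, CycRel q t Z T X Y D a b → a = b) (d : ℤ) (e : ℕ) :
    heckeSpan R T * filt R l T X Y D d e ≤ filt R l T X Y D d e := by
  refine mul_filt_le fun p r k h1 h2 => ?_
  have hX := hecke_mul_pow_X H p
  have hY := hecke_mul_pow_Y H r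
  calc heckeSpan R T * (oneSpan R X ^ p * oneSpan R Y ^ r * heckeSpan R T * genSpan R D ^ k)
      = (heckeSpan R T * oneSpan R X ^ p) * oneSpan R Y ^ r * heckeSpan R T * genSpan R D ^ k := by
        simp only [mul_assoc]
    _ ≤ (oneSpan R X ^ p * heckeSpan R T) * oneSpan R Y ^ r * heckeSpan R T * genSpan R D ^ k := by
        gcongr
    _ = oneSpan R X ^ p * (heckeSpan R T * oneSpan R Y ^ r) * heckeSpan R T * genSpan R D ^ k := by
        simp only [mul_assoc]
    _ ≤ oneSpan R X ^ p * (oneSpan R Y ^ r * heckeSpan R T) * heckeSpan R T * genSpan R D ^ k := by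
        gcongr
    _ = oneSpan R X ^ p * oneSpan R Y ^ r * (heckeSpan R T * heckeSpan R T) * genSpan R D ^ k := by
        simp only [mul_assoc]
    _ ≤ _ := by rw [heckeSpan_mul_self]; exact le_filt h1 h2

theorem X_mul_filt (d : ℤ) (e : ℕ) :
    oneSpan R X * filt R l T X Y D d e ≤ filt R l T X Y D (d + 1) e := by
  refine mul_filt_le fun p r k h1 h2 => ?_
  calc _ = oneSpan R X ^ (p + 1) * oneSpan R Y ^ r * heckeSpan R T * genSpan R D ^ k := by
        rw [pow_succ']; simp only [mul_assoc]
    _ ≤ _ := le_filt (by push_cast; omega) h2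

theorem Y_mul_filt (H : ∀ a b, CycRel q t Z T X Y D a b → a = b) (d : ℤ) (e : ℕ) :
    oneSpan R Y * filt R l T X Y D d e ≤ filt R l T X Y D d (e + 1) := by
  refine mul_filt_le fun p r k h1 h2 => ?_
  have hX := one_Y_mul_pow_X H p
  have hY := hecke_mul_pow_Y H r
  calc oneSpan R Y * (oneSpan R X ^ p * oneSpan R Y ^ r * heckeSpan R T * genSpan R D ^ k)
      = (oneSpan R Y * oneSpan R X ^ p) * oneSpan R Y ^ r * heckeSpan R T * genSpan R D ^ k := by
        simp only [mul_assoc]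
    _ ≤ (oneSpan R X ^ p * oneSpan R Y * heckeSpan R T) * oneSpan R Y ^ r * heckeSpan R T *
          genSpan R D ^ k := by gcongr
    _ = oneSpan R X ^ p * oneSpan R Y * (heckeSpan R T * oneSpan R Y ^ r) * heckeSpan R T *
          genSpan R D ^ k := by simp only [mul_assoc]
    _ ≤ oneSpan R X ^ p * oneSpan R Y * (oneSpan R Y ^ r * heckeSpan R T) * heckeSpan R T *
          genSpan R D ^ k := by gcongr
    _ = oneSpan R X ^ p * oneSpan R Y ^ (r + 1) * (heckeSpan R T * heckeSpan R T) *
          genSpan R D ^ k := by rw [pow_succ']; simp only [mul_assoc]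
    _ ≤ _ := by rw [heckeSpan_mul_self]; exact le_filt h1 (by omega)

/-- The main term gains a `D`; the correction loses an `X` and gains `Y^l`. Both lower the
difference of `X`- and `D`-degrees by one and raise the weighted `Y`-degree by `l`, which is what
weighting each `D` by `l` is designed for. The exponent `0` of `X` is separate because there is then
no correction. -/
theorem D_mul_filt (H : ∀ a b, CycRel q t Z T X Y D a b → a = b) (d : ℤ) (e : ℕ) :
    genSpan R D * filt R l T X Y D d e ≤ filt R l T X Y D (d - 1) (e + l) := by
  refine mul_filt_le fun p r k h1 h2 => ?_
  have hDY := D_mul_pow_Y H r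
  have hY := hecke_mul_pow_Y H r
  have hD' := D_mul_hecke H
  -- moving `D` through the `Y` and `T` part
  have step : heckeSpan R T * genSpan R D * (oneSpan R Y ^ r * heckeSpan R T * genSpan R D ^ k) ≤
      oneSpan R Y ^ r * heckeSpan R T * genSpan R D ^ (k + 1) := by
    calc heckeSpan R T * genSpan R D * (oneSpan R Y ^ r * heckeSpan R T * genSpan R D ^ k)
        = heckeSpan R T * (genSpan R D * oneSpan R Y ^ r) * heckeSpan R T * genSpan R D ^ k := by
          simp only [mul_assoc]
      _ ≤ heckeSpan R T * (oneSpan R Y ^ r * heckeSpan R T * genSpan R D) * heckeSpan R T *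
            genSpan R D ^ k := by gcongr
      _ = (heckeSpan R T * oneSpan R Y ^ r) * heckeSpan R T * (genSpan R D * heckeSpan R T) *
            genSpan R D ^ k := by simp only [mul_assoc]
      _ ≤ (oneSpan R Y ^ r * heckeSpan R T) * heckeSpan R T * (heckeSpan R T * genSpan R D) *
            genSpan R D ^ k := by gcongr
      _ = oneSpan R Y ^ r * (heckeSpan R T * heckeSpan R T * heckeSpan R T) * (genSpan R D *
            genSpan R D ^ k) := by simp only [mul_assoc]
      _ = _ := by rw [heckeSpan_mul_self, heckeSpan_mul_self, pow_succ']
  have h1H : 1 ≤ heckeSpan R T := one_le_heckeSpan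
  cases p with
  | zero =>
    calc genSpan R D * (oneSpan R X ^ 0 * oneSpan R Y ^ r * heckeSpan R T * genSpan R D ^ k)
        = 1 * genSpan R D * (oneSpan R Y ^ r * heckeSpan R T * genSpan R D ^ k) := by
          rw [pow_zero, one_mul, one_mul]
      _ ≤ heckeSpan R T * genSpan R D * (oneSpan R Y ^ r * heckeSpan R T * genSpan R D ^ k) := by
          gcongr
      _ ≤ _ := step
      _ = oneSpan R X ^ 0 * oneSpan R Y ^ r * heckeSpan R T * genSpan R D ^ (k + 1) := by
          rw [pow_zero, one_mul]
      _ ≤ _ := le_filt (by push_cast at h1 ⊢; omega) (by rw [mul_add]; omega)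
  | succ p =>
    have hDX := D_mul_pow_X H p
    calc genSpan R D * (oneSpan R X ^ (p + 1) * oneSpan R Y ^ r * heckeSpan R T * genSpan R D ^ k)
        = (genSpan R D * oneSpan R X ^ (p + 1)) * oneSpan R Y ^ r * heckeSpan R T *
            genSpan R D ^ k := by simp only [mul_assoc]
      _ ≤ (oneSpan R X ^ (p + 1) * heckeSpan R T * genSpan R D ⊔
            oneSpan R X ^ p * oneSpan R Y ^ l * heckeSpan R T) * oneSpan R Y ^ r * heckeSpan R T *
            genSpan R D ^ k := by gcongr
      _ = oneSpan R X ^ (p + 1) * (heckeSpan R T * genSpan R D * (oneSpan R Y ^ r * heckeSpan R T *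
            genSpan R D ^ k)) ⊔ oneSpan R X ^ p * oneSpan R Y ^ l * (heckeSpan R T *
            oneSpan R Y ^ r) * heckeSpan R T * genSpan R D ^ k := by
          simp only [Submodule.sup_mul]; simp only [mul_assoc]
      _ ≤ oneSpan R X ^ (p + 1) * (oneSpan R Y ^ r * heckeSpan R T * genSpan R D ^ (k + 1)) ⊔
            oneSpan R X ^ p * oneSpan R Y ^ l * (oneSpan R Y ^ r * heckeSpan R T) *
            heckeSpan R T * genSpan R D ^ k := by gcongr
      _ = oneSpan R X ^ (p + 1) * oneSpan R Y ^ r * heckeSpan R T * genSpan R D ^ (k + 1) ⊔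
            oneSpan R X ^ p * oneSpan R Y ^ (l + r) * (heckeSpan R T * heckeSpan R T) *
            genSpan R D ^ k := by rw [pow_add (oneSpan R Y) l r]; simp only [mul_assoc]
      _ ≤ _ := by
          rw [heckeSpan_mul_self]
          refine sup_le (le_filt ?_ ?_) (le_filt ?_ ?_)
          · push_cast at h1 ⊢; omega
          · rw [mul_add]; omega
          · push_cast at h1 ⊢; omega
          · omega

theorem filt_mono {d d' : ℤ} {e e' : ℕ} (hd : d ≤ d') (he : e ≤ e') :
    filt R l T X Y D d e ≤ filt R l T X Y D d' e' :=
  iSup₂_le fun _ hx => le_filt (by omega) (by omega)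

/-- Everything generated by the `T`, `X`, `Y`, `D` lies in some step of the filtration. -/
theorem exists_mem_filt (H : ∀ a b, CycRel q t Z T X Y D a b → a = b) {a : A}
    (ha : a ∈ Algebra.adjoin R (Set.range T ∪ Set.range X ∪ Set.range Y ∪ Set.range D)) :
    ∃ (d : ℤ) (e : ℕ), a ∈ filt R l T X Y D d e := by
  have h1 : ∀ (d : ℤ) (e : ℕ), 0 ≤ d → (1 : A) ∈ filt R l T X Y D d e := by
    intro d e hd
    have := le_filt (R := R) (l := l) (T := T) (X := X) (Y := Y) (D := D) (d := d) (e := e)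
      (p := 0) (r := 0) (k := 0) (by simpa using hd) (by omega)
    refine this ?_
    simpa using one_mem_heckeSpan
  have key : ∀ b ∈ Algebra.adjoin R (Set.range T ∪ Set.range X ∪ Set.range Y ∪ Set.range D),
      ∀ c : A, (∃ (d : ℤ) (e : ℕ), c ∈ filt R l T X Y D d e) →
        ∃ (d : ℤ) (e : ℕ), b * c ∈ filt R l T X Y D d e := by
    intro b hb
    induction hb using Algebra.adjoin_induction with
    | mem b hb =>
      rintro c ⟨d, e, hc⟩
      rcases hb with ((⟨k, rfl⟩ | ⟨i, rfl⟩) | ⟨i, rfl⟩) | ⟨i, rfl⟩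
      · exact ⟨d, e, hecke_mul_filt H d e (Submodule.mul_mem_mul (mem_heckeSpan k) hc)⟩
      · exact ⟨d + 1, e, X_mul_filt d e (Submodule.mul_mem_mul (mem_oneSpan _ i) hc)⟩
      · exact ⟨d, e + 1, Y_mul_filt H d e (Submodule.mul_mem_mul (mem_oneSpan _ i) hc)⟩
      · exact ⟨d - 1, e + l, D_mul_filt H d e (Submodule.mul_mem_mul (mem_genSpan _ i) hc)⟩
    | algebraMap r =>
      rintro c ⟨d, e, hc⟩
      exact ⟨d, e, by rw [← Algebra.smul_def]; exact Submodule.smul_mem _ _ hc⟩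
    | add a b _ _ iha ihb =>
      intro c hc
      obtain ⟨d, e, h⟩ := iha c hc
      obtain ⟨d', e', h'⟩ := ihb c hc
      refine ⟨max d d', max e e', ?_⟩
      rw [add_mul]
      exact add_mem (filt_mono (le_max_left _ _) (le_max_left _ _) h)
        (filt_mono (le_max_right _ _) (le_max_right _ _) h')
    | mul a b _ _ iha ihb =>
      intro c hc
      rw [mul_assoc]
      exact iha _ (ihb _ hc)
  simpa using key a ha 1 ⟨0, 0, h1 0 0 le_rfl⟩

end Filtration
end CycDAHA

namespace CycDAHA
open Polynomial

/-! ### Ordered monomials in commuting families -/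

section Monomials

variable {R A : Type*} [CommRing R] [Ring A] [Algebra R A]

theorem mono_succ {m : ℕ} (X : Fin (m + 1) → A) (a : Fin (m + 1) → ℕ) :
    mono X a = X 0 ^ a 0 * mono (fun i => X i.succ) (fun i => a i.succ) := by
  simp [mono, List.ofFn_succ]

theorem mono_zero {m : ℕ} (X : Fin m → A) : mono X 0 = 1 := by
  induction m with
  | zero => simp [mono]
  | succ m ih =>
    rw [mono_succ, Pi.zero_apply, pow_zero, one_mul]
    exact ih _

theorem commute_mono {m : ℕ} {X : Fin m → A} {x : A} (h : ∀ i, Commute x (X i)) (a : Fin m → ℕ) :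
    Commute x (mono X a) := by
  apply Commute.list_prod_right
  intro y hy
  obtain ⟨i, rfl⟩ := List.mem_ofFn.1 hy
  exact (h i).pow_right _

theorem mono_add {m : ℕ} {X : Fin m → A} (hX : ∀ i j, X i * X j = X j * X i) (a b : Fin m → ℕ) :
    mono X (a + b) = mono X a * mono X b := by
  induction m with
  | zero => simp [mono]
  | succ m ih =>
    have c : Commute (X 0 ^ b 0) (mono (fun i => X i.succ) fun i => a i.succ) :=
      commute_mono (fun i => Commute.pow_left (hX 0 i.succ) _) _
    have e := ih (X := fun i => X i.succ) (fun i j => hX _ _) (fun i => a i.succ) (fun i => b i.succ)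
    rw [mono_succ, mono_succ X a, mono_succ X b, Pi.add_apply, pow_add]
    rw [show (fun i : Fin m => (a + b) i.succ) = (fun i => a i.succ) + fun i => b i.succ from rfl, e]
    calc _ = X 0 ^ a 0 * (X 0 ^ b 0 * (mono (fun i => X i.succ) fun i => a i.succ)) *
          (mono (fun i => X i.succ) fun i => b i.succ) := by simp only [mul_assoc]
      _ = _ := by rw [c.eq]; simp only [mul_assoc]

theorem mono_single {m : ℕ} (X : Fin m → A) (i : Fin m) (k : ℕ) :
    mono X (Pi.single i k) = X i ^ k := by
  induction m with
  | zero => exact i.elim0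
  | succ m ih =>
    rw [mono_succ]
    refine Fin.cases ?_ (fun i => ?_) i
    · have : (fun j : Fin m => (Pi.single 0 k : Fin (m + 1) → ℕ) j.succ) = 0 := by
        funext j; simp [Fin.succ_ne_zero]
      rw [this, mono_zero]; simp
    · have : (fun j : Fin m => (Pi.single i.succ k : Fin (m + 1) → ℕ) j.succ) = Pi.single i k := by
        funext j
        by_cases h : j = i
        · subst h; simp
        · simp [h]
      rw [this, ih]
      simp [(Fin.succ_ne_zero i).symm]

theorem mono_mem_pow {m : ℕ} {X : Fin m → A} {V : Submodule R A} (h : ∀ i, X i ∈ V)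
    (a : Fin m → ℕ) : mono X a ∈ V ^ (∑ i, a i) := by
  induction m with
  | zero => simpa [mono] using Submodule.one_le.1 (le_refl (1 : Submodule R A))
  | succ m ih =>
    rw [mono_succ, Fin.sum_univ_succ, pow_add]
    exact Submodule.mul_mem_mul (Submodule.pow_mem_pow V (h 0) _) (ih (fun i => h i.succ) _)

/-- The span of the monomials whose exponent satisfies `P`. -/
def monoSpan (R : Type*) {A : Type*} [CommRing R] [Ring A] [Algebra R A] {m : ℕ} (X : Fin m → A)
    (P : (Fin m → ℕ) → Prop) : Submodule R A := Submodule.span R (mono X '' {a | P a})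

theorem mono_mem_monoSpan {m : ℕ} {X : Fin m → A} {P : (Fin m → ℕ) → Prop} {a : Fin m → ℕ}
    (h : P a) : mono X a ∈ monoSpan R X P := Submodule.subset_span ⟨a, h, rfl⟩

theorem monoSpan_mul_le {m : ℕ} {X : Fin m → A} (hX : ∀ i j, X i * X j = X j * X i)
    {P Q S : (Fin m → ℕ) → Prop} (h : ∀ a b, P a → Q b → S (a + b)) :
    monoSpan R X P * monoSpan R X Q ≤ monoSpan R X S := by
  rw [monoSpan, monoSpan, Submodule.span_mul_span, Submodule.span_le]
  rintro _ ⟨_, ⟨a, ha, rfl⟩, _, ⟨b, hb, rfl⟩, rfl⟩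
  show mono X a * mono X b ∈ _
  rw [← mono_add hX]
  exact mono_mem_monoSpan (h a b ha hb)

theorem sum_single {m : ℕ} (i : Fin m) (k : ℕ) : ∑ j, (Pi.single i k : Fin m → ℕ) j = k := by
  simp

theorem mem_monoSpan_single {m : ℕ} {X : Fin m → A} {P : (Fin m → ℕ) → Prop} (i : Fin m)
    (h : P (Pi.single i 1)) : X i ∈ monoSpan R X P := by
  have := mono_mem_monoSpan (R := R) (X := X) h
  rwa [mono_single, pow_one] at this

theorem one_mem_monoSpan {m : ℕ} {X : Fin m → A} {P : (Fin m → ℕ) → Prop} (h : P 0) :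
    (1 : A) ∈ monoSpan R X P := by
  have := mono_mem_monoSpan (R := R) (X := X) h
  rwa [mono_zero] at this

theorem pow_le_monoSpan {m : ℕ} {X : Fin m → A} (hX : ∀ i j, X i * X j = X j * X i)
    {V : Submodule R A} {P : ℕ → (Fin m → ℕ) → Prop} (h0 : P 0 0) (hV : V ≤ monoSpan R X (P 1))
    (h : ∀ k a b, P k a → P 1 b → P (k + 1) (a + b)) (k : ℕ) : V ^ k ≤ monoSpan R X (P k) := by
  induction k with
  | zero => rw [pow_zero]; exact Submodule.one_le.2 (one_mem_monoSpan h0)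
  | succ k ih =>
    rw [pow_succ]
    exact (mul_le_mul' ih hV).trans (monoSpan_mul_le hX (h k))

theorem oneSpan_pow_le {m : ℕ} {X : Fin m → A} (hX : ∀ i j, X i * X j = X j * X i) (p : ℕ) :
    oneSpan R X ^ p ≤ monoSpan R X fun a => ∑ i, a i ≤ p := by
  refine pow_le_monoSpan hX (P := fun p a => ∑ i, a i ≤ p) (by simp) ?_ ?_ p
  · exact oneSpan_le (one_mem_monoSpan (by simp)) fun i => mem_monoSpan_single i (by simp)
  · intro k a b ha hb
    simp only [Pi.add_apply, Finset.sum_add_distrib]; omega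

theorem genSpan_pow_le {m : ℕ} {X : Fin m → A} (hX : ∀ i j, X i * X j = X j * X i) (p : ℕ) :
    genSpan R X ^ p ≤ monoSpan R X fun a => ∑ i, a i = p := by
  refine pow_le_monoSpan hX (P := fun p a => ∑ i, a i = p) (by simp) ?_ ?_ p
  · exact genSpan_le fun i => mem_monoSpan_single i (by simp)
  · intro k a b ha hb
    simp only [Pi.add_apply, Finset.sum_add_distrib]; omega

end Monomials

/-! ### Spanning of the Hecke algebra by reduced products -/

section HeckeSpanning

variable {R A : Type*} [CommRing R] [Ring A] [Algebra R A] {n : ℕ} {t : Rˣ} {T : Fin n → A}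

/-- The products of the `T_k` along reduced words span the Hecke algebra. -/
theorem heckeSpan_le_span (B : BraidFamily T) {c : R}
    (hq : ∀ k, T k * T k = 1 + c • T k) {w : Equiv.Perm (Fin (n + 1)) → List (Fin n)}
    (hw : ∀ s, IsReducedWord (w s) s) :
    heckeSpan R T ≤ Submodule.span R (Set.range fun s => ((w s).map T).prod) := by
  set V := Submodule.span R (Set.range fun s => ((w s).map T).prod) with hV
  have hmem : ∀ s, ((w s).map T).prod ∈ V := fun s => Submodule.subset_span ⟨s, rfl⟩
  have hlen : ∀ s, (w s).length = invLen s := fun s => (hw s).length_eq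
  have hword : ∀ s, permWord (w s) = s := fun s => (hw s).1
  have h1 : (1 : A) ∈ V := by
    have : w 1 = [] := List.length_eq_zero_iff.1 ((hlen 1).trans invLen_one)
    have h := hmem 1
    rwa [this, List.map_nil, List.prod_nil] at h
  -- When the length increases, `k :: w s` is reduced, and Matsumoto's theorem identifies its
  -- product with that of the prescribed word. A length decrease is reduced to this case by the
  -- quadratic relation.
  have up : ∀ k s, invLen (Window.simple k * s) = invLen s + 1 →
      T k * ((w s).map T).prod = ((w (Window.simple k * s)).map T).prod := by
    intro k s h
    have := B.prod_eq (L := k :: w s) (L' := w (Window.simple k * s))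
      (by rw [permWord_cons, hword, hword])
      (by rw [permWord_cons, hword, List.length_cons, hlen, h])
      (by rw [hword, hlen])
    rw [← this, List.map_cons, List.prod_cons]
  have hT : ∀ k s, T k * ((w s).map T).prod ∈ V := by
    intro k s
    rcases lt_or_gt_inv k s with h | h
    · rw [up k s (invLen_simple_mul_of_lt h)]
      exact hmem _
    · have e := up k (Window.simple k * s)
        (by rw [simple_mul_cancel]; exact (invLen_simple_mul_of_gt h).symm)
      rw [simple_mul_cancel] at e
      have e2 : T k * ((w s).map T).prod =
          ((w (Window.simple k * s)).map T).prod + c • ((w s).map T).prod := by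
        rw [← e, ← mul_assoc, hq, add_mul, one_mul, smul_mul_assoc]
      rw [e2]
      exact add_mem (hmem _) (Submodule.smul_mem _ _ (hmem _))
  have key : ∀ a ∈ Algebra.adjoin R (Set.range T), ∀ v ∈ V, a * v ∈ V := by
    intro a ha
    induction ha using Algebra.adjoin_induction with
    | mem a ha => obtain ⟨k, rfl⟩ := ha; exact fun v hv => mul_mem_of_forall (hT k) hv
    | algebraMap r =>
      intro v hv; rw [← Algebra.smul_def]; exact Submodule.smul_mem _ _ hv
    | add a b _ _ iha ihb =>
      intro v hv; rw [add_mul]; exact add_mem (iha v hv) (ihb v hv)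
    | mul a b _ _ iha ihb =>
      intro v hv; rw [mul_assoc]; exact iha _ (ihb v hv)
  intro a ha
  simpa using key a ha 1 h1

end HeckeSpanning

/-! ### Residuals of products of submodules -/

section Residual

variable {R A : Type*} [CommRing R] [Ring A] [Algebra R A]

/-- The largest submodule `V` with `P V Q ≤ S`. -/
def resid (P Q S : Submodule R A) : Submodule R A := ⨆ V : {V : Submodule R A // P * V * Q ≤ S}, V.1

theorem le_resid {P Q S V : Submodule R A} (h : P * V * Q ≤ S) : V ≤ resid P Q S :=
  le_iSup (fun V : {V : Submodule R A // P * V * Q ≤ S} => V.1) ⟨V, h⟩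

theorem mul_resid_mul_le (P Q S : Submodule R A) : P * resid P Q S * Q ≤ S := by
  unfold resid
  rw [Submodule.mul_iSup, Submodule.iSup_mul]
  exact iSup_le fun V => V.2

end Residual

/-! ### Reduction of the exponents of `Y_i` below `l` -/

section Reduction

variable {R A : Type*} [CommRing R] [Ring A] [Algebra R A] {n l : ℕ} {q t : Rˣ} {Z : Fin l → Rˣ}
  {T : Fin n → A} {X Y D : Fin (n + 1) → A}

/-- `T_k` moved through a power of `Y_k`. -/
theorem T_mul_pow {T Ti y : ℕ → A} {c : R} (B : BraidSeq n T Ti) (hY : Twisted n T y)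
    (hq : ∀ k, k < n → T k = Ti k + algebraMap R A c) {i : ℕ}
    (hi : i < n) (k : ℕ) :
    T i * y i ^ (k + 1) = y (i + 1) ^ (k + 1) * Ti i -
      c • ∑ b ∈ Finset.range k, y (i + 1) ^ (b + 1) * y i ^ (k - b) := by
  induction k with
  | zero => simp [hY.succ_mul_inv B hi]
  | succ k ih =>
    have e : Ti i * y i = y (i + 1) * Ti i - c • y i := by
      rw [hY.succ_mul_inv B hi, hq i hi, add_mul, Algebra.smul_def, add_sub_cancel_right]
    rw [pow_succ, ← mul_assoc, ih, sub_mul, mul_assoc, e, mul_sub, ← mul_assoc, ← pow_succ,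
      smul_mul_assoc, Finset.sum_mul, Finset.sum_range_succ, smul_add, mul_smul_comm,
      Nat.add_sub_cancel_left, pow_one, sub_sub, add_comm (c • _)]
    congr 3
    refine Finset.sum_congr rfl fun b hb => ?_
    rw [mul_assoc, ← pow_succ]
    congr 2
    have := Finset.mem_range.1 hb; omega

/-- The span of the `Y_j` with `j < i`. -/
def lowSpan (R : Type*) {A : Type*} [CommRing R] [Ring A] [Algebra R A] (y : ℕ → A) (i : ℕ) :
    Submodule R A := genSpan R fun j : Fin i => y j

/-- The Hecke translates of the monomials of degree `l` in `Y_0, …, Y_i` other than `Y_i^l`. -/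
def lowerPart (R : Type*) {A : Type*} [CommRing R] [Ring A] [Algebra R A] {n : ℕ} (l : ℕ)
    (T : Fin n → A) (y : ℕ → A) (i : ℕ) : Submodule R A :=
  ⨆ (k : ℕ) (_ : k < l), (R ∙ (y i ^ k)) * lowSpan R y i ^ (l - k) * heckeSpan R T

theorem le_lowerPart {y : ℕ → A} {i k : ℕ} (hk : k < l) :
    (R ∙ (y i ^ k)) * lowSpan R y i ^ (l - k) * heckeSpan R T ≤ lowerPart R l T y i :=
  le_iSup₂_of_le (f := fun (k : ℕ) (_ : k < l) =>
    (R ∙ (y i ^ k)) * lowSpan R y i ^ (l - k) * heckeSpan R T) k hk le_rfl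

theorem lowSpan_mono {y : ℕ → A} (i : ℕ) : lowSpan R y i ≤ lowSpan R y (i + 1) :=
  genSpan_le fun j => mem_genSpan (fun j : Fin (i + 1) => y j) ⟨j, by omega⟩

theorem mem_lowSpan {y : ℕ → A} {i j : ℕ} (h : j < i) : y j ∈ lowSpan R y i :=
  mem_genSpan (fun j : Fin i => y j) ⟨j, h⟩

theorem hecke_mul_lowSpan {y g : ℕ → A} {i : ℕ} (h : ∀ j, j < i → Commute (g i) (y j)) (m : ℕ) :
    (R ∙ g i) * lowSpan R y i ^ m ≤ lowSpan R y i ^ m * (R ∙ g i) := by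
  refine mul_pow_le (singleton_mul_le fun j => ?_) m
  rw [(h j j.2).eq]
  exact Submodule.mul_mem_mul (mem_genSpan _ _) (Submodule.mem_span_singleton_self _)

/-- The factor `T_i` commutes with the `Y_j` for `j < i`, and `T_mul_pow` moves it through `Y_i^k`.
The result contains powers of `Y_{i+1}` no larger than `k < l`, and the `Y_i` left over now count
among the lower variables. -/
theorem mul_lowerPart_le {Tn Ti y : ℕ → A} {c : R} (B : BraidSeq n Tn Ti) (hY : Twisted n Tn y)
    (hq : ∀ k, k < n → Tn k = Ti k + algebraMap R A c)
    (hg : ∀ k, Tn k ∈ heckeSpan R T) (hgi : ∀ k, Ti k ∈ heckeSpan R T) {i : ℕ} (hi : i < n) :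
    (R ∙ Tn i) * lowerPart R l T y i * heckeSpan R T ≤ lowerPart R l T y (i + 1) := by
  have cT := fun m => hecke_mul_lowSpan (R := R) (y := y) (g := Tn) (i := i)
    (fun j hj => hY.comm i j (by omega) (by omega)) m
  have cTi := fun m => hecke_mul_lowSpan (R := R) (y := y) (g := Ti) (i := i)
    (fun j hj => hY.commute_inv B (by omega) (by omega)) m
  have lm := lowSpan_mono (R := R) (y := y) i
  have hT := singleton_le_hecke (hg i)
  have hTi := singleton_le_hecke (hgi i)
  unfold lowerPart
  simp only [Submodule.mul_iSup, Submodule.iSup_mul]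
  refine iSup₂_le fun k hk => ?_
  rcases Nat.eq_zero_or_pos k with rfl | hk0
  · have := cT (l - 0)
    calc (R ∙ Tn i) * ((R ∙ (y i ^ 0)) * lowSpan R y i ^ (l - 0) * heckeSpan R T) * heckeSpan R T
        = ((R ∙ Tn i) * lowSpan R y i ^ (l - 0)) * (heckeSpan R T * heckeSpan R T) := by
          rw [pow_zero, ← Submodule.one_eq_span, one_mul]; simp only [mul_assoc]
      _ ≤ (lowSpan R y i ^ (l - 0) * (R ∙ Tn i)) * (heckeSpan R T * heckeSpan R T) := by gcongr
      _ ≤ (lowSpan R y (i + 1) ^ (l - 0) * heckeSpan R T) * (heckeSpan R T * heckeSpan R T) := by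
          gcongr
      _ = (R ∙ (y (i + 1) ^ 0)) * lowSpan R y (i + 1) ^ (l - 0) * heckeSpan R T := by
          rw [pow_zero, ← Submodule.one_eq_span, one_mul, heckeSpan_mul_self, mul_assoc,
            heckeSpan_mul_self]
      _ ≤ _ := le_lowerPart hk
  · obtain ⟨k, rfl⟩ : ∃ k', k = k' + 1 := ⟨k - 1, by omega⟩
    have hmem : (R ∙ (Tn i * y i ^ (k + 1))) ≤ (R ∙ (y (i + 1) ^ (k + 1))) * (R ∙ Ti i) ⊔
        ⨆ (b : ℕ) (_ : b < k), (R ∙ (y (i + 1) ^ (b + 1))) * lowSpan R y (i + 1) ^ (k - b) := by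
      rw [Submodule.span_singleton_le_iff_mem, T_mul_pow B hY hq hi]
      refine sub_mem (Submodule.mem_sup_left (Submodule.mul_mem_mul
        (Submodule.mem_span_singleton_self _) (Submodule.mem_span_singleton_self _)))
        (Submodule.smul_mem _ _ (Submodule.sum_mem _ fun b hb => Submodule.mem_sup_right ?_))
      refine le_iSup₂ (f := fun (b : ℕ) (_ : b < k) =>
        (R ∙ (y (i + 1) ^ (b + 1))) * lowSpan R y (i + 1) ^ (k - b)) b (Finset.mem_range.1 hb) ?_
      exact Submodule.mul_mem_mul (Submodule.mem_span_singleton_self _)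
        (Submodule.pow_mem_pow _ (mem_lowSpan (Nat.lt_succ_self i)) _)
    calc (R ∙ Tn i) * ((R ∙ (y i ^ (k + 1))) * lowSpan R y i ^ (l - (k + 1)) * heckeSpan R T) *
          heckeSpan R T
        = (R ∙ (Tn i * y i ^ (k + 1))) * lowSpan R y i ^ (l - (k + 1)) *
            (heckeSpan R T * heckeSpan R T) := by
          rw [span_singleton_mul]; simp only [mul_assoc]
      _ ≤ ((R ∙ (y (i + 1) ^ (k + 1))) * (R ∙ Ti i) ⊔ ⨆ (b : ℕ) (_ : b < k),
            (R ∙ (y (i + 1) ^ (b + 1))) * lowSpan R y (i + 1) ^ (k - b)) *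
            lowSpan R y i ^ (l - (k + 1)) * (heckeSpan R T * heckeSpan R T) := by gcongr
      _ ≤ _ := by
          rw [heckeSpan_mul_self, Submodule.sup_mul, Submodule.sup_mul]
          refine sup_le ?_ ?_
          · have := cTi (l - (k + 1))
            calc (R ∙ (y (i + 1) ^ (k + 1))) * (R ∙ Ti i) * lowSpan R y i ^ (l - (k + 1)) *
                  heckeSpan R T
                = (R ∙ (y (i + 1) ^ (k + 1))) * ((R ∙ Ti i) * lowSpan R y i ^ (l - (k + 1))) *
                  heckeSpan R T := by simp only [mul_assoc]
              _ ≤ (R ∙ (y (i + 1) ^ (k + 1))) * (lowSpan R y i ^ (l - (k + 1)) * (R ∙ Ti i)) *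
                  heckeSpan R T := by gcongr
              _ ≤ (R ∙ (y (i + 1) ^ (k + 1))) * (lowSpan R y (i + 1) ^ (l - (k + 1)) *
                  heckeSpan R T) * heckeSpan R T := by gcongr
              _ = (R ∙ (y (i + 1) ^ (k + 1))) * lowSpan R y (i + 1) ^ (l - (k + 1)) *
                  (heckeSpan R T * heckeSpan R T) := by simp only [mul_assoc]
              _ ≤ _ := by rw [heckeSpan_mul_self]; exact le_lowerPart hk
          · simp only [Submodule.iSup_mul]
            refine iSup₂_le fun b hb => ?_
            calc (R ∙ (y (i + 1) ^ (b + 1))) * lowSpan R y (i + 1) ^ (k - b) *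
                  lowSpan R y i ^ (l - (k + 1)) * heckeSpan R T
                ≤ (R ∙ (y (i + 1) ^ (b + 1))) * lowSpan R y (i + 1) ^ (k - b) *
                  lowSpan R y (i + 1) ^ (l - (k + 1)) * heckeSpan R T := by gcongr
              _ = (R ∙ (y (i + 1) ^ (b + 1))) * lowSpan R y (i + 1) ^ (l - (b + 1)) *
                  heckeSpan R T := by
                  rw [mul_assoc _ (_ ^ (k - b)), ← pow_add]
                  congr 3; omega
              _ ≤ _ := le_lowerPart (by omega)

/-- The polynomial `f` is monic, so `u^l - f(u)` has degree below `l`; the induction removes one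
linear factor at a time. For the empty set the truncated exponent `0 - 1` is harmless because the
difference is zero. -/
theorem pow_sub_zEval_mem {V : Submodule R A} (h1 : 1 ≤ V) {u : A} (hu : u ∈ V)
    (S : Finset (Fin l)) : u ^ S.card - zEval Z S u ∈ V ^ (S.card - 1) := by
  classical
  induction S using Finset.induction_on with
  | empty => simp [zEval_empty]
  | insert r S hr ih =>
    rw [zEval_insert Z hr, Finset.card_insert_of_notMem hr, pow_succ', Nat.add_sub_cancel]
    have e : u * u ^ S.card - (u - algebraMap R A (Z r)) * zEval Z S u =
        u * (u ^ S.card - zEval Z S u) + algebraMap R A (Z r) * zEval Z S u := by noncomm_ring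
    rw [e, ← Algebra.smul_def]
    refine add_mem ?_ (Submodule.smul_mem _ _ (zEval_mem_pow h1 hu S))
    rcases Nat.eq_zero_or_pos S.card with h | h
    · rw [Finset.card_eq_zero] at h
      subst h; simp [zEval_empty]
    · have := Submodule.mul_mem_mul hu ih
      rwa [← pow_succ', Nat.sub_add_cancel h] at this

/-- The `l`-th power of `Y_i` is a combination of lower terms and of elements of `X H D`. -/
theorem pow_Y_mem (H : ∀ a b, CycRel q t Z T X Y D a b → a = b) (hl : 1 ≤ l) {i : ℕ} (hi : i ≤ n) :
    ext Y i ^ l ∈ oneSpan R X * heckeSpan R T * genSpan R D ⊔ lowerPart R l T (ext Y) i ⊔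
      oneSpan R Y ^ (l - 1) * heckeSpan R T := by
  have Hb : ∀ a b, BaseRel t T X Y a b → a = b := fun a b h => H a b (.base h)
  have B := braidSeq_of_baseRel Hb
  have hY := twistedY_of_baseRel Hb
  have hq : ∀ k, k < n → ext T k = ext (tInv t T) k + algebraMap R A _ :=
    fun k hk => ext_sub_tInv hk
  induction i with
  | zero =>
    have y0 : ext Y 0 = Y 0 := ext_val Y 0
    rw [y0]
    have h := pow_sub_zEval_mem (Z := Z) (one_le_oneSpan (R := R) Y) (mem_oneSpan Y 0) Finset.univ
    rw [Finset.card_univ, Fintype.card_fin] at h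
    -- The base case is `Y_0^l = f(Y_0) + lower degree` with `f(Y_0) = X_0 D_0`.
    rw [← sub_add_cancel (Y 0 ^ l) (zEval Z Finset.univ (Y 0)), ← H _ _ .cd9_left]
    refine add_mem (Submodule.mem_sup_right ?_) (Submodule.mem_sup_left (Submodule.mem_sup_left ?_))
    · rw [H _ _ .cd9_left]
      exact (le_mul_of_one_le_right' one_le_heckeSpan :
        oneSpan R Y ^ (l - 1) ≤ oneSpan R Y ^ (l - 1) * heckeSpan R T) h
    · rw [show X 0 * D 0 = X 0 * 1 * D 0 by rw [mul_one]]
      exact mul_mem_three (mem_oneSpan _ _) one_mem_heckeSpan (mem_genSpan _ _)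
  | succ i ih =>
    have hi' : i < n := hi
    obtain ⟨k, rfl⟩ : ∃ k, l = k + 1 := ⟨l - 1, by omega⟩
    have e := T_mul_pow B hY hq hi' k
    set c : R := (t : R) - ((t⁻¹ : Rˣ) : R)
    -- Solving `T_mul_pow` for the power of `Y_{i+1}`: up to mixed monomials with a smaller power of
    -- `Y_{i+1}`, it is the conjugate `T_i Y_i^l T_i`, to which the induction hypothesis applies.
    have e2 : ext Y (i + 1) ^ (k + 1) = ext T i * ext Y i ^ (k + 1) * ext T i +
        c • ∑ b ∈ Finset.range k, ext Y (i + 1) ^ (b + 1) * ext Y i ^ (k - b) * ext T i := by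
      rw [e, sub_mul, mul_assoc, B.inv_mul, mul_one, smul_mul_assoc, Finset.sum_mul, sub_add_cancel]
    rw [e2]
    refine add_mem ?_ (Submodule.smul_mem _ _ (Submodule.sum_mem _ fun b hb => ?_))
    · have hT := singleton_le_hecke (ext_mem_heckeSpan (R := R) (T := T) i)
      have m := mul_mem_three (Submodule.mem_span_singleton_self (R := R) (ext T i)) (ih hi'.le)
        (ext_mem_heckeSpan (R := R) (T := T) i)
      simp only [Submodule.mul_sup, Submodule.sup_mul] at m
      have hT' : ∀ V : Submodule R A, (R ∙ ext T i) * V * heckeSpan R T ≤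
          heckeSpan R T * V * heckeSpan R T := fun V => by gcongr
      have hle := sup_le_sup (sup_le_sup ((hT' _).trans (hecke_mul_XD H))
        (mul_lowerPart_le (l := k + 1) B hY hq ext_mem_heckeSpan ext_tInv_mem_heckeSpan hi'))
        ((hT' _).trans (hecke_mul_Y_hecke H (k + 1 - 1)))
      exact hle m
    · have hb' := Finset.mem_range.1 hb
      refine Submodule.mem_sup_left (Submodule.mem_sup_right ?_)
      refine le_lowerPart (k := b + 1) (by omega) ?_
      refine mul_mem_three (Submodule.mem_span_singleton_self _) ?_ (ext_mem_heckeSpan _)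
      rw [Nat.add_sub_add_right]
      exact Submodule.pow_mem_pow _ (mem_lowSpan (Nat.lt_succ_self i)) _

/-- The weight of an exponent. -/
def wt {m : ℕ} (b : Fin m → ℕ) : ℕ := ∑ i : Fin m, (i : ℕ) * b i

theorem wt_add {m : ℕ} (a b : Fin m → ℕ) : wt (a + b) = wt a + wt b := by
  simp [wt, mul_add, Finset.sum_add_distrib]

theorem wt_single {m : ℕ} (i : Fin m) (k : ℕ) : wt (Pi.single i k) = i * k := by
  rw [wt, Finset.sum_eq_single i]
  · simp
  · intro j _ hj; simp [hj]
  · simp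

/-- Variables of index below `i` contribute weight at most `i - 1` each. The bound `wt ≤ m (i - 1)`
is written additively to avoid truncated subtraction at `i = 0`. -/
theorem lowSpan_pow_le (hc : ∀ i j, Y i * Y j = Y j * Y i) {i : ℕ} (hi : i ≤ n) (m : ℕ) :
    lowSpan R (ext Y) i ^ m ≤ monoSpan R Y fun b => ∑ j, b j = m ∧ wt b + m ≤ m * i := by
  refine pow_le_monoSpan hc (P := fun m b => ∑ j, b j = m ∧ wt b + m ≤ m * i) (by simp [wt]) ?_ ?_ m
  · refine genSpan_le fun j => ?_
    rw [ext_of_lt (by omega : (j : ℕ) < n + 1)]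
    refine mem_monoSpan_single _ ⟨by simp, ?_⟩
    rw [wt_single]
    have := j.2
    dsimp only
    omega
  · rintro k a b ⟨h1, h2⟩ ⟨h3, h4⟩
    refine ⟨?_, ?_⟩
    · simp only [Pi.add_apply, Finset.sum_add_distrib]; omega
    · rw [wt_add, add_mul]; omega

/-- Reduction of the exponents of the `Y_i` below `l`. -/
theorem mono_Y_mem (H : ∀ a b, CycRel q t Z T X Y D a b → a = b) (hl : 1 ≤ l)
    {U : Submodule R A} {r : ℕ}
    (h1 : ∀ b : Fin (n + 1) → ℕ, (∀ i, b i < l) → ∑ i, b i = r → mono Y b ∈ U)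
    (hU : U * heckeSpan R T ≤ U)
    (h2 : 1 ≤ r → oneSpan R Y ^ (r - 1) * heckeSpan R T ≤ U)
    (h3 : l ≤ r → oneSpan R Y ^ (r - l) * (oneSpan R X * heckeSpan R T * genSpan R D) ≤ U)
    (b : Fin (n + 1) → ℕ) (hb : ∑ i, b i = r) : mono Y b ∈ U := by
  have Hb : ∀ a b, BaseRel t T X Y a b → a = b := fun a b h => H a b (.base h)
  have hc : ∀ i j, Y i * Y j = Y j * Y i := fun i j => Hb _ _ (.R12 i j)
  induction hw : wt b using Nat.strong_induction_on generalizing b with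
  | _ w ih =>
  by_cases hlt : ∀ i, b i < l
  · exact h1 b hlt hb
  push Not at hlt
  obtain ⟨i, hi⟩ := hlt
  -- An exponent at least `l` supplies a factor `Y_i^l` to rewrite by `pow_Y_mem`. Its three kinds
  -- of terms are covered by `h3`, by the induction on the weight, and by `h2`.
  obtain ⟨b', rfl⟩ : ∃ b' : Fin (n + 1) → ℕ, b = b' + Pi.single i l := by
    refine ⟨b - Pi.single i l, ?_⟩
    rw [tsub_add_cancel_of_le]
    intro j
    by_cases h : j = i
    · subst h; simpa using hi
    · simp [h]
  have hb' : ∑ j, b' j + l = r := by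
    rw [← hb]; simp [Finset.sum_add_distrib]
  have hr : l ≤ r := by omega
  have hrl : ∑ j, b' j = r - l := by omega
  rw [wt_add, wt_single] at hw
  have hmem := pow_Y_mem H hl (Nat.lt_succ_iff.1 i.2)
  have hb'Y : mono Y b' ∈ oneSpan R Y ^ (r - l) := by
    rw [← hrl]; exact mono_mem_pow (mem_oneSpan Y) b'
  rw [mono_add hc, mono_single, ← ext_val Y]
  have hm := Submodule.mul_mem_mul (Submodule.mem_span_singleton_self (R := R) (mono Y b')) hmem
  have hs : (R ∙ mono Y b') ≤ oneSpan R Y ^ (r - l) :=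
    (Submodule.span_singleton_le_iff_mem _ _).2 hb'Y
  refine (?_ : (R ∙ mono Y b') * _ ≤ U) hm
  rw [Submodule.mul_sup, Submodule.mul_sup]
  refine sup_le (sup_le ?_ ?_) ?_
  · exact le_trans (by gcongr) (h3 hr)
  · unfold lowerPart
    simp only [Submodule.mul_iSup]
    refine iSup₂_le fun k hk => ?_
    have p1 : (R ∙ mono Y b') ≤ monoSpan R Y fun a => a = b' :=
      (Submodule.span_singleton_le_iff_mem _ _).2 (mono_mem_monoSpan (P := fun a => a = b') rfl)
    have p2 : (R ∙ ext Y (i : ℕ) ^ k) ≤ monoSpan R Y fun a => a = Pi.single i k := by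
      rw [Submodule.span_singleton_le_iff_mem, ext_val Y, ← mono_single]
      exact mono_mem_monoSpan (P := fun a => a = Pi.single i k) rfl
    have p3 := lowSpan_pow_le (R := R) hc (Nat.lt_succ_iff.1 i.2) (l - k)
    have p4 : monoSpan R Y (fun a => ∑ j, a j = r ∧ wt a < w) ≤ U := by
      refine Submodule.span_le.2 ?_
      rintro _ ⟨a, ⟨ha, ha'⟩, rfl⟩
      exact ih _ ha' a ha rfl
    calc (R ∙ mono Y b') * ((R ∙ ext Y (i : ℕ) ^ k) * lowSpan R (ext Y) i ^ (l - k) * heckeSpan R T)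
        = ((R ∙ mono Y b') * (R ∙ ext Y (i : ℕ) ^ k)) * lowSpan R (ext Y) i ^ (l - k) *
            heckeSpan R T := by simp only [mul_assoc]
      _ ≤ ((monoSpan R Y fun a => a = b') * (monoSpan R Y fun a => a = Pi.single i k)) *
            (monoSpan R Y fun b => ∑ j, b j = l - k ∧ wt b + (l - k) ≤ (l - k) * i) *
            heckeSpan R T := by gcongr
      _ ≤ (monoSpan R Y fun a => a = b' + Pi.single i k) *
            (monoSpan R Y fun b => ∑ j, b j = l - k ∧ wt b + (l - k) ≤ (l - k) * i) *
            heckeSpan R T := by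
          gcongr
          exact monoSpan_mul_le hc (by rintro _ _ rfl rfl; rfl)
      _ ≤ (monoSpan R Y fun a => ∑ j, a j = r ∧ wt a < w) * heckeSpan R T := by
          gcongr
          refine monoSpan_mul_le hc ?_
          rintro _ a rfl ⟨ha, ha'⟩
          refine ⟨?_, ?_⟩
          · simp only [Pi.add_apply, Finset.sum_add_distrib, sum_single]; omega
          · rw [wt_add, wt_add, wt_single, ← hw]
            -- Replacing `Y_i^l` by `Y_i^k` times `l - k` earlier variables lowers the weight by at
            -- least `l - k`, which is positive.
            have e : (i : ℕ) * l = i * k + (l - k) * i := by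
              rw [mul_comm (l - k), ← mul_add]; congr 1; omega
            omega
      _ ≤ U * heckeSpan R T := by gcongr
      _ ≤ U := hU
  · refine le_trans ?_ (h2 (by omega))
    calc (R ∙ mono Y b') * (oneSpan R Y ^ (l - 1) * heckeSpan R T)
        ≤ oneSpan R Y ^ (r - l) * (oneSpan R Y ^ (l - 1) * heckeSpan R T) := by gcongr
      _ = _ := by
          rw [← mul_assoc, ← pow_add]; congr 2; omega

/-- The index set of the standard monomials. -/
abbrev StdIndex (n l : ℕ) : Type :=
  (Fin (n + 1) → ℕ) × (Fin (n + 1) → Fin l) × Equiv.Perm (Fin (n + 1)) × (Fin (n + 1) → ℕ)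

/-- The standard monomials in an algebra. -/
def stdElem (T : Fin n → A) (X Y D : Fin (n + 1) → A) (w : Equiv.Perm (Fin (n + 1)) → List (Fin n))
    (x : StdIndex n l) : A :=
  mono X x.1 * mono Y (fun i => (x.2.1 i : ℕ)) * ((w x.2.2.1).map T).prod * mono D x.2.2.2

/-- The standard monomials in the filtration step `(d, e)`. -/
def stdSet (n l : ℕ) (d : ℤ) (e : ℕ) : Set (StdIndex n l) :=
  {x | ((∑ i, x.1 i : ℕ) : ℤ) ≤ d + (∑ i, x.2.2.2 i : ℕ) ∧
    ∑ i, (x.2.1 i : ℕ) + l * ∑ i, x.2.2.2 i ≤ e}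

theorem braidFamily_of_baseRel (H : ∀ a b, BaseRel t T X Y a b → a = b) : BraidFamily T where
  braid i j h := H _ _ (.R2 i j h)
  comm i j h := H _ _ (.R3 i j (Or.inl h))

theorem quadratic_of_baseRel (H : ∀ a b, BaseRel t T X Y a b → a = b) (k : Fin n) :
    T k * T k = 1 + ((t : R) - ((t⁻¹ : Rˣ) : R)) • T k := by
  have h := (mul_tInv_of_quadratic (H _ _ (.R1 k))).2
  rw [tInv, sub_mul, sub_eq_iff_eq_add] at h
  rw [h, Algebra.smul_def]

/-- Strong induction on the `Y`-degree. Rewriting an excessive power of `Y_i` either lowers the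
weight at the same degree, or lowers the degree, or trades `Y^l` for one `X` and one `D`. The last
exchange preserves both `p - k` and `r + l k`, hence never leaves the filtration step. -/
theorem filt_le_span (H : ∀ a b, CycRel q t Z T X Y D a b → a = b) (hl : 1 ≤ l)
    {w : Equiv.Perm (Fin (n + 1)) → List (Fin n)} (hw : ∀ s, IsReducedWord (w s) s)
    (d : ℤ) (e : ℕ) :
    filt R l T X Y D d e ≤ Submodule.span R (stdElem T X Y D w '' stdSet n l d e) := by
  have Hb : ∀ a b, BaseRel t T X Y a b → a = b := fun a b h => H a b (.base h)
  have hX : ∀ i j, X i * X j = X j * X i := fun i j => Hb _ _ (.R11 i j)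
  have hY : ∀ i j, Y i * Y j = Y j * Y i := fun i j => Hb _ _ (.R12 i j)
  have hD : ∀ i j, D i * D j = D j * D i := fun i j => H _ _ (.cd4 i j)
  set S := Submodule.span R (stdElem T X Y D w '' stdSet n l d e) with hS
  have hH := heckeSpan_le_span (braidFamily_of_baseRel Hb) (quadratic_of_baseRel Hb) hw
  have base : ∀ p r k : ℕ, (p : ℤ) ≤ d + k → r + l * k ≤ e → ∀ b : Fin (n + 1) → ℕ,
      (∀ i, b i < l) → ∑ i, b i = r →
      oneSpan R X ^ p * (R ∙ mono Y b) * (heckeSpan R T * genSpan R D ^ k) ≤ S := by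
    intro p r k h1 h2 b hb hbr
    have a1 := oneSpan_pow_le (R := R) hX p
    have a2 := genSpan_pow_le (R := R) hD k
    calc oneSpan R X ^ p * (R ∙ mono Y b) * (heckeSpan R T * genSpan R D ^ k)
        ≤ (monoSpan R X fun a => ∑ i, a i ≤ p) * (R ∙ mono Y b) *
          (Submodule.span R (Set.range fun s => ((w s).map T).prod) *
            (monoSpan R D fun c => ∑ i, c i = k)) := by gcongr
      _ ≤ S := by
        rw [monoSpan, monoSpan, Submodule.span_mul_span, Submodule.span_mul_span,
          Submodule.span_mul_span, Submodule.span_le]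
        rintro _ ⟨_, ⟨_, ⟨a, ha, rfl⟩, _, rfl, rfl⟩, _, ⟨_, ⟨s, rfl⟩, _, ⟨c, hc, rfl⟩, rfl⟩, rfl⟩
        refine Submodule.subset_span ⟨(a, (fun i => ⟨b i, hb i⟩), s, c), ⟨?_, ?_⟩, ?_⟩
        · simp only [Set.mem_ofPred_eq] at ha hc ⊢
          rw [hc]; omega
        · simp only [Set.mem_ofPred_eq] at ha hc ⊢
          rw [hc, hbr]; exact h2
        · simp only [stdElem, mul_assoc]
  have main : ∀ r p k : ℕ, (p : ℤ) ≤ d + k → r + l * k ≤ e →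
      oneSpan R X ^ p * oneSpan R Y ^ r * (heckeSpan R T * genSpan R D ^ k) ≤ S := by
    intro r
    induction r using Nat.strong_induction_on with
    | _ r ih =>
    intro p k h1 h2
    -- The residual consists of what may stand between `X^p` and `H D^k` and still land in `S`. It
    -- lets `mono_Y_mem` work with the `Y`-part alone.
    have red : ∀ b : Fin (n + 1) → ℕ, ∑ i, b i = r →
        mono Y b ∈ resid (oneSpan R X ^ p) (heckeSpan R T * genSpan R D ^ k) S := by
      refine mono_Y_mem H hl ?_ ?_ ?_ ?_
      · intro b hb hbr
        exact le_resid (base p r k h1 h2 b hb hbr) (Submodule.mem_span_singleton_self _)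
      · refine le_resid ?_
        calc _ = oneSpan R X ^ p * resid (oneSpan R X ^ p) (heckeSpan R T * genSpan R D ^ k) S *
              ((heckeSpan R T * heckeSpan R T) * genSpan R D ^ k) := by simp only [mul_assoc]
          _ ≤ S := by rw [heckeSpan_mul_self]; exact mul_resid_mul_le _ _ _
      · intro hr
        refine le_resid ?_
        calc _ = oneSpan R X ^ p * oneSpan R Y ^ (r - 1) *
              ((heckeSpan R T * heckeSpan R T) * genSpan R D ^ k) := by simp only [mul_assoc]
          _ ≤ S := by rw [heckeSpan_mul_self]; exact ih _ (by omega) p k h1 (by omega)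
      · intro hr
        refine le_resid ?_
        have c1 := pow_Y_mul_X H (r - l)
        have c2 := D_mul_hecke H
        calc oneSpan R X ^ p * (oneSpan R Y ^ (r - l) * (oneSpan R X * heckeSpan R T * genSpan R D)) *
              (heckeSpan R T * genSpan R D ^ k)
            = oneSpan R X ^ p * (oneSpan R Y ^ (r - l) * oneSpan R X) * heckeSpan R T *
              (genSpan R D * heckeSpan R T) * genSpan R D ^ k := by simp only [mul_assoc]
          _ ≤ oneSpan R X ^ p * (oneSpan R X * oneSpan R Y ^ (r - l) * heckeSpan R T) *
              heckeSpan R T * (heckeSpan R T * genSpan R D) * genSpan R D ^ k := by gcongr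
          _ = oneSpan R X ^ (p + 1) * oneSpan R Y ^ (r - l) *
              ((heckeSpan R T * heckeSpan R T * heckeSpan R T) * genSpan R D ^ (k + 1)) := by
              rw [pow_succ, pow_succ']; simp only [mul_assoc]
          _ ≤ S := by
              rw [heckeSpan_mul_self, heckeSpan_mul_self]
              refine ih _ (by omega) (p + 1) (k + 1) (by push_cast; omega) ?_
              rw [mul_add]; omega
    have hYr := oneSpan_pow_le (R := R) hY r
    have hr : oneSpan R Y ^ r ≤ resid (oneSpan R X ^ p) (heckeSpan R T * genSpan R D ^ k) S := by
      refine hYr.trans (Submodule.span_le.2 ?_)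
      rintro _ ⟨b, hb, rfl⟩
      rcases lt_or_eq_of_le (show ∑ i, b i ≤ r from hb) with h | h
      · have := ih _ h p k h1 (by omega)
        exact le_resid this (mono_mem_pow (mem_oneSpan Y) b)
      · exact red b h
    calc oneSpan R X ^ p * oneSpan R Y ^ r * (heckeSpan R T * genSpan R D ^ k)
        ≤ oneSpan R X ^ p * resid (oneSpan R X ^ p) (heckeSpan R T * genSpan R D ^ k) S *
          (heckeSpan R T * genSpan R D ^ k) := by gcongr
      _ ≤ S := mul_resid_mul_le _ _ _
  refine iSup₂_le fun x hx => ?_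
  rw [mul_assoc _ (heckeSpan R T)]
  exact main _ _ _ hx.1 hx.2

end Reduction
end CycDAHA

namespace CycDAHA
open Polynomial

/-! ### The DAHA relations expressed through `π` -/

section ExtendedAffine

variable {R A : Type*} [CommRing R] [Ring A] [Algebra R A] {n : ℕ}

/-- The double affine Hecke algebra relations in terms of `T_i`, `Y_i` and `P = π`. -/
structure ExtAffine (q t : Rˣ) (T : Fin n → A) (Y Y' : Fin (n + 1) → A) (P P' : A) : Prop where
  quad : ∀ i, (T i - algebraMap R A (t : R)) * (T i + algebraMap R A ((t⁻¹ : Rˣ) : R)) = 0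
  braid : ∀ i j : Fin n, (i : ℕ) + 1 = j → T i * T j * T i = T j * T i * T j
  comm : ∀ i j : Fin n, (i : ℕ) + 2 ≤ j → T i * T j = T j * T i
  stepY : ∀ i : Fin n, T i * Y i.castSucc * T i = Y i.succ
  commTY : ∀ (i : Fin n) (j : Fin (n + 1)), j ≠ i.castSucc → j ≠ i.succ → T i * Y j = Y j * T i
  commY : ∀ i j, Y i * Y j = Y j * Y i
  Y_mul_inv : ∀ i, Y i * Y' i = 1
  inv_mul_Y : ∀ i, Y' i * Y i = 1
  P_mul_inv : P * P' = 1
  inv_mul_P : P' * P = 1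
  P_mul_T : ∀ i j : Fin n, (i : ℕ) + 1 = j → P * T i = T j * P
  P_mul_P_mul_T : ∀ i j : Fin n, (i : ℕ) = 0 → (j : ℕ) + 1 = n → P * P * T j = T i * (P * P)
  Y_mul_P : ∀ j : Fin n, Y j.succ * P = P * Y j.castSucc
  Y_zero_mul_P : Y 0 * P = (q : R) • (P * Y (Fin.last n))

/-- `X_i` in terms of `π`. -/
def xOfPi (t : Rˣ) (T : Fin n → A) (P : A) (i : Fin (n + 1)) : A :=
  dn (ext T) 0 i * (P * dn (ext (tInv t T)) 0 n) * up (ext T) 0 i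

/-- `X_i⁻¹` in terms of `π⁻¹`. -/
def xInvOfPi (t : Rˣ) (T : Fin n → A) (P' : A) (i : Fin (n + 1)) : A :=
  dn (ext (tInv t T)) 0 i * (up (ext T) 0 n * P') * up (ext (tInv t T)) 0 i

namespace ExtAffine

variable {q t : Rˣ} {T : Fin n → A} {Y Y' : Fin (n + 1) → A} {P P' : A}

theorem braidSeq (S : ExtAffine q t T Y Y' P P') : BraidSeq n (ext T) (ext (tInv t T)) :=
  braidSeq_ext (fun i => (mul_tInv_of_quadratic (S.quad i)).1)
    (fun i => (mul_tInv_of_quadratic (S.quad i)).2) S.braid S.comm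

theorem twistedY (S : ExtAffine q t T Y Y' P P') : Twisted n (ext T) (ext Y) :=
  twisted_ext S.stepY S.commTY

theorem P_mul_ext (S : ExtAffine q t T Y Y' P P') {k : ℕ} (hk : k + 1 < n) :
    P * ext T k = ext T (k + 1) * P := by
  rw [ext_of_lt hk, ext_of_lt (by omega : k < n)]
  exact S.P_mul_T _ _ rfl

theorem P_mul_ext_inv (S : ExtAffine q t T Y Y' P P') {k : ℕ} (hk : k + 1 < n) :
    P * ext (tInv t T) k = ext (tInv t T) (k + 1) * P := by
  have h := S.P_mul_ext hk
  rw [ext_sub_tInv (t := t) hk, ext_sub_tInv (t := t) (by omega : k < n), mul_add, add_mul, ← Algebra.commutes] at h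
  exact add_right_cancel h

theorem ext_mul_P (S : ExtAffine q t T Y Y' P P') {k : ℕ} (hk : k < n) :
    ext Y (k + 1) * P = P * ext Y k := by
  rw [ext_of_lt (by omega : k < n + 1), ext_of_lt (by omega : k + 1 < n + 1)]
  exact S.Y_mul_P ⟨k, hk⟩

theorem ext_zero_mul_P (S : ExtAffine q t T Y Y' P P') :
    ext Y 0 * P = (q : R) • (P * ext Y n) := by
  have h1 : ext Y 0 = Y 0 := ext_val Y 0
  have h2 : ext Y n = Y (Fin.last n) := ext_val Y (Fin.last n)
  rw [h1, h2, S.Y_zero_mul_P]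

theorem dn_mul_P (S : ExtAffine q t T Y Y' P P') {a b : ℕ} (hb : b + 1 ≤ n) :
    dn (ext (tInv t T)) (a + 1) (b + 1) * P = P * dn (ext (tInv t T)) a b := by
  induction b with
  | zero => rw [dn_of_le (by omega), dn_of_le (Nat.zero_le _), mul_one, one_mul]
  | succ b ih =>
    rcases le_or_gt a b with h | h
    · rw [dn_succ (by omega), mul_assoc, ih (by omega), ← mul_assoc, ← S.P_mul_ext_inv hb,
        dn_succ h, mul_assoc]
    · rw [dn_of_le (by omega), dn_of_le (by omega), mul_one, one_mul]

/-- `T_k` passes through `T_{j-1}⁻¹ ⋯ T_0⁻¹` as `T_{k+1}`. -/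
theorem ext_mul_dn_inv (S : ExtAffine q t T Y Y' P P') {k j : ℕ} (hkj : k + 2 ≤ j) (hj : j ≤ n) :
    ext T k * dn (ext (tInv t T)) 0 j = dn (ext (tInv t T)) 0 j * ext T (k + 1) := by
  have B := S.braidSeq
  have h := B.symm.mul_dn hkj hj
  calc ext T k * dn (ext (tInv t T)) 0 j
      = ext T k * (dn (ext (tInv t T)) 0 j * ext (tInv t T) (k + 1)) * ext T (k + 1) := by
        simp only [mul_assoc, B.inv_mul, mul_one]
    _ = dn (ext (tInv t T)) 0 j * ext T (k + 1) := by rw [← h, B.mul_inv_assoc]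

/-- Each letter of a descending word, passed through the full descending word to its right, has its
index raised by one. -/
theorem dn_mul_dn (S : ExtAffine q t T Y Y' P P') {a b : ℕ} (hb : b + 1 ≤ n) :
    dn (ext (tInv t T)) a b * dn (ext (tInv t T)) 0 (b + 1) =
      dn (ext (tInv t T)) 0 (b + 1) * dn (ext (tInv t T)) (a + 1) (b + 1) := by
  have key : ∀ c, c ≤ b → dn (ext (tInv t T)) a c * dn (ext (tInv t T)) 0 (b + 1) =
      dn (ext (tInv t T)) 0 (b + 1) * dn (ext (tInv t T)) (a + 1) (c + 1) := by
    intro c hc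
    induction c with
    | zero =>
      rw [dn_of_le (Nat.zero_le a), dn_of_le (by omega : 0 + 1 ≤ a + 1), mul_one, one_mul]
    | succ c ih =>
      rcases le_or_gt a c with h | h
      · rw [dn_succ h, mul_assoc, ih (by omega), ← mul_assoc,
          S.braidSeq.symm.mul_dn (by omega) (by omega), mul_assoc,
          dn_succ (by omega : a + 1 ≤ c + 1)]
      · rw [dn_of_le (by omega : c + 1 ≤ a), dn_of_le (by omega : c + 1 + 1 ≤ a + 1), mul_one,
          one_mul]
  exact key b le_rfl

theorem ext_xOfPi_zero : ext (xOfPi t T P) 0 = P * dn (ext (tInv t T)) 0 n := by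
  have h : ext (xOfPi t T P) 0 = xOfPi t T P 0 := ext_val (xOfPi t T P) 0
  rw [h, xOfPi]
  simp [up_of_le, dn_of_le]

theorem commute_X_zero (S : ExtAffine q t T Y Y' P P') {k : ℕ} (hk : 0 < k) :
    Commute (ext T k) (ext (xOfPi t T P) 0) := by
  rcases lt_or_ge k n with h | h
  · obtain ⟨k, rfl⟩ : ∃ j, k = j + 1 := ⟨k - 1, by omega⟩
    have : ext T (k + 1) * ext (xOfPi t T P) 0 = ext (xOfPi t T P) 0 * ext T (k + 1) := by
      rw [ext_xOfPi_zero, ← mul_assoc, ← S.P_mul_ext h, mul_assoc,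
        S.ext_mul_dn_inv (by omega) le_rfl, mul_assoc]
    exact this
  · rw [ext_of_le h]; exact Commute.one_left _

theorem twistedX (S : ExtAffine q t T Y Y' P P') : Twisted n (ext T) (ext (xOfPi t T P)) := by
  refine Twisted.of_zero S.braidSeq (fun k hk => ext_of_le hk) (fun k hk => ext_of_le hk) ?_
    fun k => S.commute_X_zero
  intro k hk
  rw [ext_xOfPi_zero, ext_of_lt (by omega : k < n + 1), xOfPi]

/-- Since `X_1 = T_0 X_0 T_0`, the claim is that `T_0` commutes with `X_0 T_0 X_0`. Collecting the
two factors `π` writes this element as `π²` times a word in the `T_k⁻¹`; `T_0` crosses `π²` as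
`T_{n-1}`, and crosses the word back as `T_0`. -/
theorem commute_X_zero_one (S : ExtAffine q t T Y Y' P P') (hn : 0 < n) :
    Commute (ext (xOfPi t T P) 0) (ext (xOfPi t T P) 1) := by
  have B := S.braidSeq
  obtain ⟨b, rfl⟩ : ∃ b, n = b + 1 := ⟨n - 1, by omega⟩
  set x := ext (xOfPi t T P) 0 with hx
  have x1 : ext (xOfPi t T P) 1 = ext T 0 * x * ext T 0 := (S.twistedX.step 0 hn).symm
  have hPP : ext T 0 * (P * P) = P * P * ext T b := by
    rw [ext_of_lt hn, ext_of_lt (Nat.lt_succ_self b)]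
    exact (S.P_mul_P_mul_T _ _ rfl rfl).symm
  have e0 : x = P * dn (ext (tInv t T)) 0 (b + 1) := ext_xOfPi_zero
  have e1 : x * ext T 0 = P * dn (ext (tInv t T)) 1 (b + 1) := by
    rw [e0, dn_cons (by omega), mul_assoc, mul_assoc, B.inv_mul, mul_one]
  have e2 : x * ext T 0 * x =
      P * P * (dn (ext (tInv t T)) 0 b * dn (ext (tInv t T)) 0 (b + 1)) := by
    have h := S.dn_mul_P (a := 0) (b := b) le_rfl
    rw [zero_add] at h
    rw [e1, e0, mul_assoc, ← mul_assoc _ P, h]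
    simp only [mul_assoc]
  have e3 : ext T b * (dn (ext (tInv t T)) 0 b * dn (ext (tInv t T)) 0 (b + 1)) =
      dn (ext (tInv t T)) 0 b * dn (ext (tInv t T)) 0 (b + 1) * ext T 0 := by
    have h := S.dn_mul_dn (a := 0) (b := b) le_rfl
    rw [zero_add] at h
    calc ext T b * (dn (ext (tInv t T)) 0 b * dn (ext (tInv t T)) 0 (b + 1))
        = (ext T b * ext (tInv t T) b) * dn (ext (tInv t T)) 0 b *
          dn (ext (tInv t T)) 1 (b + 1) := by
          rw [h, dn_succ (Nat.zero_le b)]; simp only [mul_assoc]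
      _ = dn (ext (tInv t T)) 0 b * dn (ext (tInv t T)) 1 (b + 1) *
          (ext (tInv t T) 0 * ext T 0) := by rw [B.mul_inv, B.inv_mul, one_mul, mul_one]
      _ = _ := by
          rw [dn_cons (f := ext (tInv t T)) (by omega : 0 < b + 1)]; simp only [mul_assoc, zero_add]
  have e4 : ext T 0 * (x * ext T 0 * x) = x * ext T 0 * x * ext T 0 := by
    rw [e2, ← mul_assoc, hPP, mul_assoc, e3, ← mul_assoc]
  have : x * ext (xOfPi t T P) 1 = ext (xOfPi t T P) 1 * x := by
    rw [x1]
    simp only [mul_assoc] at e4 ⊢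
    exact e4.symm
  exact this

/-- Commutativity of all the `X_i` follows from that of `X_0, X_1`. For the mixed relation, `Y_1`
becomes `Y_0` on crossing `T_0⁻¹` from the right, commutes with the remaining `T_k⁻¹`, and becomes
`Y_1` again on crossing `π`. -/
theorem mixedSeq (S : ExtAffine q t T Y Y' P P') :
    MixedSeq n (ext T) (ext (tInv t T)) (ext (xOfPi t T P)) (ext Y) where
  braid := S.braidSeq
  tX := S.twistedX
  tY := S.twistedY
  commX := commute_ext fun i j => by
    have h := S.twistedX.commute_of_zero S.commute_X_zero_one (Nat.lt_succ_iff.1 i.2)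
      (Nat.lt_succ_iff.1 j.2)
    rw [ext_val, ext_val] at h
    exact h
  commY := commute_ext S.commY
  mixed hn := by
    have B := S.braidSeq
    have c : Commute (ext Y 0) (dn (ext (tInv t T)) 1 n) :=
      commute_dn fun k hk _ => (S.twistedY.commute_inv B (by omega) (by omega)).symm
    have e1 : ext (xOfPi t T P) 0 = P * dn (ext (tInv t T)) 1 n * ext (tInv t T) 0 := by
      rw [ext_xOfPi_zero, dn_cons hn, ← mul_assoc]
    calc ext (xOfPi t T P) 0 * ext Y 1
        = P * dn (ext (tInv t T)) 1 n * (ext (tInv t T) 0 * ext Y 1) := by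
          rw [e1]; simp only [mul_assoc]
      _ = P * (ext Y 0 * dn (ext (tInv t T)) 1 n) * ext T 0 := by
          rw [S.twistedY.inv_mul_succ B hn, c.eq]; simp only [mul_assoc]
      _ = ext Y 1 * P * dn (ext (tInv t T)) 1 n * (ext (tInv t T) 0 * ext T 0) * ext T 0 := by
          rw [B.inv_mul, mul_one, S.ext_mul_P hn]; simp only [mul_assoc]
      _ = _ := by rw [e1, pow_two]; simp only [mul_assoc]

theorem _root_.CycDAHA.Twisted.eq_dn_mul_up {B : Type*} [Monoid B] {g E : ℕ → B} (hE : Twisted n g E) {k : ℕ} (hk : k ≤ n) :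
    E k = dn g 0 k * E 0 * up g 0 k := by
  induction k with
  | zero => simp [up_of_le, dn_of_le]
  | succ k ih =>
    rw [← hE.step k hk, ih (by omega), dn_succ (Nat.zero_le k), up_succ (Nat.zero_le k)]
    simp only [mul_assoc]

theorem Y_zero_mul_X_zero (S : ExtAffine q t T Y Y' P P') :
    ext Y 0 * ext (xOfPi t T P) 0 =
      (q : R) • (ext (xOfPi t T P) 0 * (up (ext T) 0 n * dn (ext T) 0 n) * ext Y 0) := by
  have B := S.braidSeq
  rw [ext_xOfPi_zero, ← mul_assoc, S.ext_zero_mul_P, smul_mul_assoc,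
    Twisted.eq_dn_mul_up S.twistedY le_rfl]
  congr 1
  calc P * (dn (ext T) 0 n * ext Y 0 * up (ext T) 0 n) * dn (ext (tInv t T)) 0 n
      = P * dn (ext T) 0 n * ext Y 0 * (up (ext T) 0 n * dn (ext (tInv t T)) 0 n) := by
        simp only [mul_assoc]
    _ = P * (dn (ext (tInv t T)) 0 n * up (ext T) 0 n) * dn (ext T) 0 n * ext Y 0 := by
        rw [B.up_mul_dn, B.dn_mul_up, mul_one, mul_one]
    _ = _ := by simp only [mul_assoc]

/-- For `i = 0` the Hecke factors produced by `X_0` and by `X_1 ⋯ X_n` are inverse to each other,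
leaving only `q`. The other `Y_i` are products of `Y_0` and the `T_k`, which commute with `∏ X_i`.
-/
theorem Y_mul_prod (S : ExtAffine q t T Y Y' P P') {i : ℕ} (hi : i ≤ n) :
    ext Y i * up (ext (xOfPi t T P)) 0 (n + 1) =
      (q : R) • (up (ext (xOfPi t T P)) 0 (n + 1) * ext Y i) := by
  have B := S.braidSeq
  have M := S.mixedSeq
  set X := ext (xOfPi t T P)
  have h0 : ext Y 0 * up X 0 (n + 1) = (q : R) • (up X 0 (n + 1) * ext Y 0) := by
    rw [up_cons (f := X) (Nat.succ_pos n), zero_add, ← mul_assoc, S.Y_zero_mul_X_zero, smul_mul_assoc]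
    congr 1
    calc X 0 * (up (ext T) 0 n * dn (ext T) 0 n) * ext Y 0 * up X 1 (n + 1)
        = X 0 * (up (ext T) 0 n * dn (ext T) 0 n) * (ext Y 0 * up X 1 (n + 1)) := by
          simp only [mul_assoc]
      _ = X 0 * up (ext T) 0 n * (dn (ext T) 0 n * up (ext (tInv t T)) 0 n) *
            dn (ext (tInv t T)) 0 n * up X 1 (n + 1) * ext Y 0 := by
          rw [M.Y_zero_mul_up le_rfl]; simp only [mul_assoc]
      _ = X 0 * (up (ext T) 0 n * dn (ext (tInv t T)) 0 n) * up X 1 (n + 1) * ext Y 0 := by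
          rw [B.symm.dn_mul_up, mul_one]; simp only [mul_assoc]
      _ = _ := by rw [B.up_mul_dn, mul_one]
  have cT : ∀ k, k < n → Commute (ext T k) (up X 0 (n + 1)) := fun k hk =>
    M.tX.commute_prod M.commX hk
  rw [Twisted.eq_dn_mul_up S.twistedY hi]
  have c1 : Commute (up X 0 (n + 1)) (up (ext T) 0 i) :=
    commute_up fun k _ hk => (cT k (by omega)).symm
  have c2 : Commute (up X 0 (n + 1)) (dn (ext T) 0 i) :=
    commute_dn fun k _ hk => (cT k (by omega)).symm
  calc dn (ext T) 0 i * ext Y 0 * up (ext T) 0 i * up X 0 (n + 1)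
      = dn (ext T) 0 i * (ext Y 0 * up X 0 (n + 1)) * up (ext T) 0 i := by
        rw [mul_assoc, ← c1.eq]; simp only [mul_assoc]
    _ = (q : R) • ((dn (ext T) 0 i * up X 0 (n + 1)) * ext Y 0 * up (ext T) 0 i) := by
        rw [h0, mul_smul_comm, smul_mul_assoc]; simp only [mul_assoc]
    _ = _ := by rw [← c2.eq]; simp only [mul_assoc]

/-- Conjugation by `π` permutes the `Y_j` cyclically and rescales exactly one of them, the one that
wraps around; this gives the single factor `q⁻¹`. -/
theorem P_mul_prod (S : ExtAffine q t T Y Y' P P') :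
    P * up (ext Y) 0 (n + 1) = ((q⁻¹ : Rˣ) : R) • (up (ext Y) 0 (n + 1) * P) := by
  have h : ∀ k, k ≤ n → P * up (ext Y) 0 k = up (ext Y) 1 (k + 1) * P := by
    intro k hk
    induction k with
    | zero => rw [up_of_le le_rfl, up_of_le le_rfl, mul_one, one_mul]
    | succ k ih =>
      rw [up_succ (Nat.zero_le k), ← mul_assoc, ih (by omega), mul_assoc, ← S.ext_mul_P (by omega),
        ← mul_assoc, ← up_succ (by omega)]
  have hc : Commute (ext Y 0) (up (ext Y) 1 (n + 1)) :=
    commute_up fun k _ _ => commute_ext S.commY _ _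
  have e : P * ext Y n = ((q⁻¹ : Rˣ) : R) • (ext Y 0 * P) := by
    rw [S.ext_zero_mul_P, smul_smul, Units.inv_mul, one_smul]
  rw [up_succ (Nat.zero_le n), ← mul_assoc, h n le_rfl, mul_assoc, e, mul_smul_comm, ← mul_assoc,
    ← hc.eq, ← up_succ (Nat.zero_le n), up_cons (Nat.succ_pos n)]

theorem X_mul_prod (S : ExtAffine q t T Y Y' P P') (i : Fin (n + 1)) :
    xOfPi t T P i * up (ext Y) 0 (n + 1) =
      ((q⁻¹ : Rˣ) : R) • (up (ext Y) 0 (n + 1) * xOfPi t T P i) := by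
  have B := S.braidSeq
  set W := up (ext Y) 0 (n + 1) with hW
  have cT : ∀ k, k < n → Commute W (ext T k) := fun k hk =>
    (S.twistedY.commute_prod (commute_ext S.commY) hk).symm
  have c1 : Commute W (up (ext T) 0 i) := commute_up fun k _ hk => cT k (by omega)
  have c2 : Commute W (dn (ext T) 0 i) := commute_dn fun k _ hk => cT k (by omega)
  have c3 : Commute W (dn (ext (tInv t T)) 0 n) := commute_dn fun k _ hk =>
    commute_inv (cT k hk) (B.mul_inv k) (B.inv_mul k)
  rw [xOfPi]
  calc dn (ext T) 0 i * (P * dn (ext (tInv t T)) 0 n) * up (ext T) 0 i * W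
      = dn (ext T) 0 i * (P * dn (ext (tInv t T)) 0 n) * (W * up (ext T) 0 i) := by
        rw [c1.eq]; simp only [mul_assoc]
    _ = dn (ext T) 0 i * (P * (W * dn (ext (tInv t T)) 0 n)) * up (ext T) 0 i := by
        rw [c3.eq]; simp only [mul_assoc]
    _ = dn (ext T) 0 i * ((P * W) * dn (ext (tInv t T)) 0 n) * up (ext T) 0 i := by
        simp only [mul_assoc]
    _ = ((q⁻¹ : Rˣ) : R) • ((dn (ext T) 0 i * W) * P * dn (ext (tInv t T)) 0 n *
          up (ext T) 0 i) := by
        rw [hW, S.P_mul_prod, smul_mul_assoc, mul_smul_comm, smul_mul_assoc]; simp only [mul_assoc]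
    _ = _ := by rw [← c2.eq]; simp only [mul_assoc]

/-- The relations in terms of `π` imply those of the double affine Hecke algebra. -/
theorem eq_of_dahaRel (S : ExtAffine q t T Y Y' P P') {a b : A}
    (h : DahaRel q t T (xOfPi t T P) (xInvOfPi t T P') Y Y' a b) : a = b := by
  have B := S.braidSeq
  have M := S.mixedSeq
  have hX1 : ∀ i, xOfPi t T P i * xInvOfPi t T P' i = 1 := by
    intro i
    rw [xOfPi, xInvOfPi]
    calc _ = dn (ext T) 0 i * P * dn (ext (tInv t T)) 0 n *
          (up (ext T) 0 i * dn (ext (tInv t T)) 0 i) * up (ext T) 0 n * P' *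
          up (ext (tInv t T)) 0 i := by simp only [mul_assoc]
      _ = dn (ext T) 0 i * P * (dn (ext (tInv t T)) 0 n * up (ext T) 0 n) * P' *
          up (ext (tInv t T)) 0 i := by rw [B.up_mul_dn, mul_one]; simp only [mul_assoc]
      _ = dn (ext T) 0 i * (P * P') * up (ext (tInv t T)) 0 i := by
          rw [B.dn_mul_up, mul_one]; simp only [mul_assoc]
      _ = 1 := by rw [S.P_mul_inv, mul_one, B.symm.dn_mul_up]
  have hX2 : ∀ i, xInvOfPi t T P' i * xOfPi t T P i = 1 := by
    intro i
    rw [xOfPi, xInvOfPi]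
    calc _ = dn (ext (tInv t T)) 0 i * up (ext T) 0 n * P' *
          (up (ext (tInv t T)) 0 i * dn (ext T) 0 i) * P * dn (ext (tInv t T)) 0 n *
          up (ext T) 0 i := by simp only [mul_assoc]
      _ = dn (ext (tInv t T)) 0 i * up (ext T) 0 n * (P' * P) * dn (ext (tInv t T)) 0 n *
          up (ext T) 0 i := by rw [B.symm.up_mul_dn, mul_one]; simp only [mul_assoc]
      _ = dn (ext (tInv t T)) 0 i * (up (ext T) 0 n * dn (ext (tInv t T)) 0 n) *
          up (ext T) 0 i := by rw [S.inv_mul_P, mul_one]; simp only [mul_assoc]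
      _ = 1 := by rw [B.up_mul_dn, mul_one, B.dn_mul_up]
  cases h with
  | base h =>
    cases h with
    | R1 i => exact S.quad i
    | R2 i j h => exact S.braid i j h
    | R3 i j h =>
      rcases h with h | h
      · exact S.comm i j h
      · exact (S.comm j i h).symm
    | R4 i =>
      have h := M.tX.step i i.2
      rw [ext_val, ← Fin.val_succ, ext_val] at h
      rw [← h, ← ext_val (xOfPi t T P) i.castSucc]
      rfl
    | R5 i j h h' =>
      have e := (M.tX.comm i j (by simpa [Fin.ext_iff] using h) (by simpa [Fin.ext_iff] using h')).eq
      simpa only [ext_val] using e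
    | R6 i => exact S.stepY i
    | R7 i j h h' => exact S.commTY i j h h'
    | R11 i j => simpa only [ext_val] using (M.commX i j).eq
    | R12 i j => exact S.commY i j
  | X_mul_inv i => exact hX1 i
  | inv_mul_X i => exact hX2 i
  | Y_mul_inv i => exact S.Y_mul_inv i
  | inv_mul_Y i => exact S.inv_mul_Y i
  | R8 k hk =>
    have h := M.mixed (by have := k.2; omega)
    rw [← ext_castSucc_zero hk, ← ext_succ_zero hk, ← ext_zero_of hk] at h
    rw [mul_assoc, h]
    calc xInvOfPi t T P' k.castSucc * Y' k.succ * (Y k.succ * xOfPi t T P k.castSucc * T k ^ 2)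
        = xInvOfPi t T P' k.castSucc * (Y' k.succ * Y k.succ) * xOfPi t T P k.castSucc * T k ^ 2 := by
          simp only [mul_assoc]
      _ = T k ^ 2 := by rw [S.inv_mul_Y, mul_one, hX2, one_mul]
  | R9 i =>
    rw [ofFn_prod_eq_up, ← ext_val Y]
    exact S.Y_mul_prod (Nat.lt_succ_iff.1 i.2)
  | R10 i =>
    rw [ofFn_prod_eq_up]
    exact S.X_mul_prod i

end ExtAffine
end ExtendedAffine
end CycDAHA

namespace CycDAHA
open Polynomial

/-! ### Braid and rotation relations for windows -/

section WindowRelations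

variable {n : ℕ}

namespace Window

theorem entry_refl_castSucc (i : Fin n) (b : Window n) :
    (refl i b).entry i.castSucc = b.entry i.succ := by
  rw [entry_refl, Equiv.swap_apply_left]

theorem entry_refl_succ (i : Fin n) (b : Window n) :
    (refl i b).entry i.succ = b.entry i.castSucc := by
  rw [entry_refl, Equiv.swap_apply_right]

theorem entry_refl_of_ne {i : Fin n} {b : Window n} {j : Fin (n + 1)} (h : j ≠ i.castSucc)
    (h' : j ≠ i.succ) : (refl i b).entry j = b.entry j := by
  rw [entry_refl, Equiv.swap_apply_of_ne_of_ne h h']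

theorem refl_comm {i j : Fin n} (h : (i : ℕ) + 2 ≤ j) (b : Window n) :
    refl i (refl j b) = refl j (refl i b) := by
  refine ext_entry fun k => ?_
  simp only [entry_refl]
  have hd : Equiv.Perm.Disjoint (Equiv.swap j.castSucc j.succ) (Equiv.swap i.castSucc i.succ) :=
    Equiv.Perm.disjoint_swap_swap (by simp [Fin.ext_iff]; omega)
  exact congrArg b.entry (DFunLike.congr_fun hd.commute.eq k)

theorem refl_braid {i j : Fin n} (h : (i : ℕ) + 1 = j) (b : Window n) :
    refl i (refl j (refl i b)) = refl j (refl i (refl j b)) := by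
  have e : i.succ = j.castSucc := by ext; simpa using h
  have h1 : i.castSucc ≠ j.castSucc := by intro hh; simp [Fin.ext_iff] at hh; omega
  have h2 : i.castSucc ≠ j.succ := by intro hh; simp [Fin.ext_iff] at hh; omega
  have h3 : j.castSucc ≠ j.succ := Fin.castSucc_lt_succ.ne
  refine ext_entry fun k => ?_
  simp only [entry_refl, e]
  congr 1
  by_cases k1 : k = i.castSucc
  · subst k1; simp [Equiv.swap_apply_def, h1, h2, h3.symm, h2.symm]
  by_cases k2 : k = j.castSucc
  · subst k2; simp [Equiv.swap_apply_def, h1, h2, h3.symm, h2.symm]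
  by_cases k3 : k = j.succ
  · subst k3; simp [Equiv.swap_apply_def, h1, h2, h3.symm, h2.symm]
  rw [Equiv.swap_apply_of_ne_of_ne k1 k2, Equiv.swap_apply_of_ne_of_ne k2 k3,
    Equiv.swap_apply_of_ne_of_ne k1 k2, Equiv.swap_apply_of_ne_of_ne k2 k3]

theorem rot_refl {i j : Fin n} (h : (i : ℕ) + 1 = j) (b : Window n) :
    rot (refl i b) = refl j (rot b) := by
  have e : i.succ = j.castSucc := by ext; simpa using h
  refine ext_entry fun k => ?_
  refine Fin.cases ?_ (fun k => ?_) k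
  · rw [entry_refl_of_ne (by simp [Fin.ext_iff]; omega) (Fin.succ_ne_zero j).symm, entry_rot_zero,
      entry_rot_zero, entry_refl_of_ne]
    · exact (Fin.castSucc_lt_last i).ne'
    · rw [e]; exact (Fin.castSucc_lt_last j).ne'
  · rw [entry_rot_succ]
    by_cases k1 : k = i
    · rw [k1, entry_refl_castSucc, e, entry_refl_castSucc, entry_rot_succ]
    by_cases k2 : k = j
    · rw [k2, ← e, entry_refl_succ, entry_refl_succ, ← e, entry_rot_succ]
    rw [entry_refl_of_ne, entry_refl_of_ne, entry_rot_succ]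
    · rw [← e]; simpa using k1
    · simpa using k2
    · simpa using k1
    · rw [e]; simpa using k2

theorem rot_rot_refl {i j : Fin n} (hi : (i : ℕ) = 0) (hj : (j : ℕ) + 1 = n) (b : Window n) :
    rot (rot (refl j b)) = refl i (rot (rot b)) := by
  have ei : i.castSucc = 0 := by ext; simpa using hi
  have ej : Fin.last n = j.succ := by ext; simp [hj]
  refine ext_entry fun k => ?_
  by_cases k0 : k = i.castSucc
  · rw [k0, entry_refl_castSucc, entry_rot_succ, ei, entry_rot_zero, entry_rot_zero, ej,
      entry_rot_succ, entry_refl_castSucc]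
  by_cases k1 : k = i.succ
  · rw [k1, entry_refl_succ, entry_rot_succ, ei, entry_rot_zero, entry_rot_zero, ej,
      entry_rot_succ, entry_refl_succ]
  rw [entry_refl_of_ne k0 k1]
  have hk0 : (k : ℕ) ≠ 0 := fun h => k0 (by ext; simp [h, hi])
  have hk1 : (k : ℕ) ≠ 1 := fun h => k1 (by ext; simp [h, hi])
  obtain ⟨m, rfl⟩ : ∃ m : Fin n, k = m.succ := ⟨⟨k - 1, by omega⟩, by ext; simp; omega⟩
  have hm : (m : ℕ) ≠ 0 := by simpa using hk1
  obtain ⟨r, hr⟩ : ∃ r : Fin n, m.castSucc = r.succ := ⟨⟨m - 1, by omega⟩, by ext; simp; omega⟩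
  have hr' : (m : ℕ) = r + 1 := by simpa [Fin.ext_iff] using hr
  rw [entry_rot_succ, entry_rot_succ, hr, entry_rot_succ, entry_rot_succ, entry_refl_of_ne]
  · simp [Fin.ext_iff]; omega
  · simp [Fin.ext_iff]; omega

end Window
end WindowRelations

/-! ### Rational identities for the matrix coefficients -/

section Scalars

variable {K : Type*} [Field K]

/-- The coefficient of the reflected vector in the action of `T_i`. -/
def reflCoeff (t x z : K) : K := (t * x - t⁻¹ * z) / (x - z)

/-- The diagonal coefficient in the action of `T_i`. -/
def diagCoeff (t x z : K) : K := -((t - t⁻¹) * z) / (x - z)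

variable {t x y z : K}

theorem diagCoeff_add (h : x ≠ z) : diagCoeff t x z + diagCoeff t z x = t - t⁻¹ := by
  have h1 : x - z ≠ 0 := sub_ne_zero.2 h
  have h2 : z - x ≠ 0 := sub_ne_zero.2 h.symm
  rw [diagCoeff, diagCoeff, div_add_div _ _ h1 h2, div_eq_iff (mul_ne_zero h1 h2)]
  ring

/-- Together with `diagCoeff_add` this is the quadratic relation for `T_i` on the plane spanned by a
window and its reflection, where `diagCoeff t x z` and `diagCoeff t z x` are the diagonal entries.
-/
theorem reflCoeff_mul (ht : t ≠ 0) (h : x ≠ z) : reflCoeff t x z * reflCoeff t z x =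
    1 + (t - t⁻¹) * diagCoeff t x z - diagCoeff t x z ^ 2 := by
  have h1 : x - z ≠ 0 := sub_ne_zero.2 h
  have e : z - x = -(x - z) := by ring
  rw [reflCoeff, reflCoeff, diagCoeff, e]
  field_simp
  ring

theorem reflCoeff_mul_left {c : K} (hc : c ≠ 0) : reflCoeff t (c * x) (c * z) = reflCoeff t x z := by
  rw [reflCoeff, reflCoeff, ← mul_div_mul_left (t * x - _) _ hc]
  congr 1 <;> ring

theorem diagCoeff_mul_left {c : K} (hc : c ≠ 0) : diagCoeff t (c * x) (c * z) = diagCoeff t x z := by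
  rw [diagCoeff, diagCoeff, ← mul_div_mul_left (-((t - t⁻¹) * z)) _ hc]
  congr 1 <;> ring

theorem mul_diagCoeff (h : x ≠ z) : x * diagCoeff t x z = z * diagCoeff t x z - (t - t⁻¹) * z := by
  have h1 : x - z ≠ 0 := sub_ne_zero.2 h
  have : (x - z) * diagCoeff t x z = -((t - t⁻¹) * z) := by
    rw [diagCoeff, mul_div_cancel₀ _ h1]
  linear_combination this

/-- This compares the coefficients of the window reflected at `i` on the two sides of the braid
relation for `T_i`, `T_{i+1}`, after removing a common reflection coefficient; `diagCoeff_braid'` is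
the same at the next index. -/
theorem diagCoeff_braid (hxy : x ≠ y) (hxz : x ≠ z) (hyz : y ≠ z) :
    diagCoeff t x z * diagCoeff t y x + diagCoeff t x y * diagCoeff t y z =
      diagCoeff t y z * diagCoeff t x z := by
  have h1 : x - y ≠ 0 := sub_ne_zero.2 hxy
  have h2 : x - z ≠ 0 := sub_ne_zero.2 hxz
  have h3 : y - z ≠ 0 := sub_ne_zero.2 hyz
  have e : y - x = -(x - y) := by ring
  simp only [diagCoeff, e]
  field_simp
  ring

theorem diagCoeff_braid' (hxy : x ≠ y) (hxz : x ≠ z) (hyz : y ≠ z) :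
    diagCoeff t x y * diagCoeff t x z =
      diagCoeff t x z * diagCoeff t z y + diagCoeff t y z * diagCoeff t x y := by
  have h1 : x - y ≠ 0 := sub_ne_zero.2 hxy
  have h2 : x - z ≠ 0 := sub_ne_zero.2 hxz
  have h3 : y - z ≠ 0 := sub_ne_zero.2 hyz
  have e : z - y = -(y - z) := by ring
  simp only [diagCoeff, e]
  field_simp
  ring

/-- This compares the coefficients of the original window in the braid relation, once products of
reflection coefficients have been eliminated by `reflCoeff_mul`. -/
theorem diagCoeff_cubic (hxy : x ≠ y) (hxz : x ≠ z) (hyz : y ≠ z) :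
    ((t - t⁻¹) * diagCoeff t x y + 1 - diagCoeff t x y ^ 2) * diagCoeff t x z +
        diagCoeff t x y ^ 2 * diagCoeff t y z =
      ((t - t⁻¹) * diagCoeff t y z + 1 - diagCoeff t y z ^ 2) * diagCoeff t x z +
        diagCoeff t y z ^ 2 * diagCoeff t x y := by
  have h1 : x - y ≠ 0 := sub_ne_zero.2 hxy
  have h2 : x - z ≠ 0 := sub_ne_zero.2 hxz
  have h3 : y - z ≠ 0 := sub_ne_zero.2 hyz
  generalize hh : t - t⁻¹ = h
  simp only [diagCoeff, hh]
  field_simp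
  ring

end Scalars

/-! ### The representation on windows -/

section Representation

open Window

variable {R K : Type*} [CommRing R] [Field K] [Algebra R K] {n : ℕ}

/-- The weight of a window entry. -/
noncomputable def weight (q : Rˣ) (y : Fin (n + 1) → K) (c : Fin (n + 1) × ℤ) : K :=
  algebraMap R K ((q ^ c.2 : Rˣ) : R) * y c.1

/-- The endomorphism given on basis vectors. -/
noncomputable def basisMap (f : Window n → Window n →₀ K) : Module.End K (Window n →₀ K) :=
  Finsupp.linearCombination K f

theorem basisMap_single (f : Window n → Window n →₀ K) (b : Window n) :
    basisMap f (Finsupp.single b 1) = f b := by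
  simp [basisMap]

theorem end_ext {f g : Module.End K (Window n →₀ K)}
    (h : ∀ b, f (Finsupp.single b 1) = g (Finsupp.single b 1)) : f = g := by
  refine Finsupp.lhom_ext fun b c => ?_
  rw [← mul_one c, ← smul_eq_mul, ← Finsupp.smul_single, map_smul, map_smul, h]

variable (q t : Rˣ) (y : Fin (n + 1) → K)

/-- The action of `T_i`. -/
noncomputable def repT (i : Fin n) : Module.End K (Window n →₀ K) := basisMap fun b =>
  reflCoeff (algebraMap R K (t : R)) (weight q y (b.entry i.castSucc)) (weight q y (b.entry i.succ)) •
      Finsupp.single (refl i b) 1 +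
    diagCoeff (algebraMap R K (t : R)) (weight q y (b.entry i.castSucc)) (weight q y (b.entry i.succ)) •
      Finsupp.single b 1

/-- The action of `Y_j`. -/
noncomputable def repY (j : Fin (n + 1)) : Module.End K (Window n →₀ K) := basisMap fun b =>
  weight q y (b.entry j) • Finsupp.single b 1

/-- The action of `Y_j⁻¹`. -/
noncomputable def repYinv (j : Fin (n + 1)) : Module.End K (Window n →₀ K) := basisMap fun b =>
  (weight q y (b.entry j))⁻¹ • Finsupp.single b 1

/-- The action of `π`. -/
noncomputable def repPi (K : Type*) [Field K] (n : ℕ) : Module.End K (Window n →₀ K) :=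
  basisMap fun b => Finsupp.single (rot b) 1

/-- The action of `π⁻¹`. -/
noncomputable def repPiInv (K : Type*) [Field K] (n : ℕ) : Module.End K (Window n →₀ K) :=
  basisMap fun b => Finsupp.single (rotInv b) 1

variable {q t y}

theorem weight_rot_zero (b : Window n) : weight q y ((rot b).entry 0) =
    algebraMap R K (q : R) * weight q y (b.entry (Fin.last n)) := by
  rw [entry_rot_zero, weight, weight, zpow_add_one, Units.val_mul, map_mul]
  ring

theorem algebraMap_end_apply' (r : R) (m : Window n →₀ K) :
    algebraMap R (Module.End K (Window n →₀ K)) r m = algebraMap R K r • m := by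
  rw [Module.algebraMap_end_apply, algebraMap_smul]

theorem smul_end_apply (r : R) (f : Module.End K (Window n →₀ K)) (m : Window n →₀ K) :
    (r • f) m = algebraMap R K r • f m := by
  rw [LinearMap.smul_apply, algebraMap_smul]

theorem map_inv_unit (u : Rˣ) : algebraMap R K ((u⁻¹ : Rˣ) : R) = (algebraMap R K (u : R))⁻¹ := by
  refine eq_inv_of_mul_eq_one_left ?_
  rw [← map_mul, Units.inv_mul, map_one]

/-- The relations in terms of `π` hold in the representation. -/
theorem extAffine_rep (hy : ∀ c, weight q y c ≠ 0)
    (hw : ∀ c d : Fin (n + 1) × ℤ, c.1 ≠ d.1 → weight q y c ≠ weight q y d) :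
    ExtAffine q t (repT q t y) (repY q y) (repYinv q y) (repPi K n) (repPiInv K n) := by
  have ht : algebraMap R K (t : R) ≠ 0 := (t.isUnit.map (algebraMap R K)).ne_zero
  have hb : ∀ (b : Window n) {i j : Fin (n + 1)}, i ≠ j →
      weight q y (b.entry i) ≠ weight q y (b.entry j) :=
    fun b i j h => hw _ _ (b.entry_fst_ne h)
  have hlt : ∀ i : Fin n, i.castSucc ≠ i.succ := fun i => Fin.castSucc_lt_succ.ne
  have hsc : ∀ i j : Fin n, (i : ℕ) ≠ j → i.castSucc ≠ j.castSucc := fun i j h h' => h (by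
    simpa [Fin.ext_iff] using h')
  constructor
  · intro i
    refine end_ext fun b => ?_
    have e1 := diagCoeff_add (t := algebraMap R K (t : R)) (hb b (hlt i))
    have e2 := reflCoeff_mul ht (hb b (hlt i))
    simp only [algebraMap_end_apply', map_inv_unit, Module.End.mul_apply, LinearMap.sub_apply,
      LinearMap.add_apply, repT, basisMap_single, map_add, map_smul,
      refl_refl, entry_refl_castSucc, entry_refl_succ, LinearMap.zero_apply]
    match_scalars
    · linear_combination e2 - mul_inv_cancel₀ ht
    · linear_combination reflCoeff (algebraMap R K (t : R)) (weight q y (b.entry i.castSucc))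
        (weight q y (b.entry i.succ)) * e1
  · intro i j h
    have e : i.succ = j.castSucc := by ext; simpa using h
    have h1 : i.castSucc ≠ j.castSucc := hsc i j (by omega)
    have h2 : i.castSucc ≠ j.succ := by simp [Fin.ext_iff]; omega
    have h3 : j.castSucc ≠ j.succ := hlt j
    have r1 : ∀ b : Window n, (refl i b).entry j.castSucc = b.entry i.castSucc := fun b => by
      rw [← e, entry_refl_succ]
    have r2 : ∀ b : Window n, (refl i b).entry i.castSucc = b.entry j.castSucc := fun b => by
      rw [← e, entry_refl_castSucc]
    have r3 : ∀ b : Window n, (refl i b).entry j.succ = b.entry j.succ := fun b =>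
      entry_refl_of_ne h2.symm (by rw [e]; exact h3.symm)
    have r4 : ∀ b : Window n, (refl j b).entry i.castSucc = b.entry i.castSucc := fun b =>
      entry_refl_of_ne h1 h2
    refine end_ext fun b => ?_
    have hxy := hb b h1
    have hxz := hb b h2
    have hyz := hb b h3
    have e1 := diagCoeff_braid (t := algebraMap R K (t : R)) hxy hxz hyz
    have e2 := diagCoeff_braid' (t := algebraMap R K (t : R)) hxy hxz hyz
    have e3 := diagCoeff_cubic (t := algebraMap R K (t : R)) hxy hxz hyz
    have e4 := reflCoeff_mul ht hxy
    have e5 := reflCoeff_mul ht hyz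
    simp only [Module.End.mul_apply, repT, basisMap_single, map_add, map_smul, refl_refl, e, r1, r2,
      r3, r4, entry_refl_castSucc, entry_refl_succ, refl_braid h]
    generalize algebraMap R K (t : R) = u at *
    generalize weight q y (b.entry i.castSucc) = x at *
    generalize weight q y (b.entry j.castSucc) = v at *
    generalize weight q y (b.entry j.succ) = z at *
    -- The two sides involve the six windows obtained from `b` by the group generated by the two
    -- reflections. Only `b` itself and its two simple reflections need identities; the other three
    -- coefficients agree formally.
    match_scalars
    · ring
    · ring
    · linear_combination diagCoeff u x z * e4 - diagCoeff u x z * e5 + e3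
    · linear_combination reflCoeff u x v * e1
    · ring
    · linear_combination reflCoeff u v z * e2
  · intro i j h
    have h1 : i.castSucc ≠ j.castSucc := hsc i j (by omega)
    have h2 : i.castSucc ≠ j.succ := by simp [Fin.ext_iff]; omega
    have h3 : i.succ ≠ j.castSucc := by simp [Fin.ext_iff]; omega
    have h4 : i.succ ≠ j.succ := by simp [Fin.ext_iff]; omega
    refine end_ext fun b => ?_
    simp only [Module.End.mul_apply, repT, basisMap_single, map_add, map_smul, refl_comm h,
      entry_refl_of_ne h1 h2, entry_refl_of_ne h3 h4, entry_refl_of_ne h1.symm h3.symm,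
      entry_refl_of_ne h2.symm h4.symm]
    module
  · intro i
    refine end_ext fun b => ?_
    have e1 := diagCoeff_add (t := algebraMap R K (t : R)) (hb b (hlt i))
    have e2 := reflCoeff_mul ht (hb b (hlt i))
    have e3 := mul_diagCoeff (t := algebraMap R K (t : R)) (hb b (hlt i))
    have e4 := mul_diagCoeff (t := algebraMap R K (t : R)) (hb b (hlt i)).symm
    simp only [Module.End.mul_apply, repT, repY, basisMap_single, map_add, map_smul, refl_refl,
      entry_refl_castSucc, entry_refl_succ]
    generalize algebraMap R K (t : R) = u at *
    generalize weight q y (b.entry i.castSucc) = x at *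
    generalize weight q y (b.entry i.succ) = z at *
    match_scalars
    · linear_combination z * e2 + diagCoeff u x z * e3
    · linear_combination reflCoeff u x z * (z * e1 + e3)
  · intro i j h h'
    refine end_ext fun b => ?_
    simp only [Module.End.mul_apply, repT, repY, basisMap_single, map_add, map_smul,
      entry_refl_of_ne h h']
    module
  · intro i j
    refine end_ext fun b => ?_
    simp only [Module.End.mul_apply, repY, basisMap_single, map_smul]
    module
  · intro i
    refine end_ext fun b => ?_
    simp only [Module.End.mul_apply, repY, repYinv, basisMap_single, map_smul, smul_smul,
      Module.End.one_apply, inv_mul_cancel₀ (hy _), one_smul]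
  · intro i
    refine end_ext fun b => ?_
    simp only [Module.End.mul_apply, repY, repYinv, basisMap_single, map_smul, smul_smul,
      Module.End.one_apply, mul_inv_cancel₀ (hy _), one_smul]
  · refine end_ext fun b => ?_
    simp only [Module.End.mul_apply, repPi, repPiInv, basisMap_single, rot_rotInv,
      Module.End.one_apply]
  · refine end_ext fun b => ?_
    simp only [Module.End.mul_apply, repPi, repPiInv, basisMap_single, rotInv_rot,
      Module.End.one_apply]
  · intro i j h
    have e : j.castSucc = i.succ := by ext; simpa using h.symm
    refine end_ext fun b => ?_
    simp only [Module.End.mul_apply, repPi, repT, basisMap_single, map_add, map_smul, rot_refl h]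
    rw [entry_rot_succ, e, entry_rot_succ]
  · intro i j hi hj
    have ei : i.castSucc = 0 := by ext; simpa using hi
    have ej : Fin.last n = j.succ := by ext; simp [hj]
    refine end_ext fun b => ?_
    -- After two rotations both weights concerned have been multiplied by `q`, and the coefficients
    -- are homogeneous of degree zero.
    have hq : algebraMap R K (q : R) ≠ 0 := (q.isUnit.map (algebraMap R K)).ne_zero
    simp only [Module.End.mul_apply, repPi, repT, basisMap_single, map_add, map_smul,
      rot_rot_refl hi hj, entry_rot_succ, ei, weight_rot_zero, ej, reflCoeff_mul_left hq,
      diagCoeff_mul_left hq]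
  · intro j
    refine end_ext fun b => ?_
    simp only [Module.End.mul_apply, repPi, repY, basisMap_single, map_smul, entry_rot_succ]
  · refine end_ext fun b => ?_
    simp only [Module.End.mul_apply, repPi, repY, basisMap_single, map_smul, smul_end_apply,
      weight_rot_zero, smul_smul]

end Representation
end CycDAHA

namespace CycDAHA
open Polynomial

/-! ### Compatibility of the basic words with homomorphisms -/

section Maps

variable {R A B : Type*} [CommRing R] [Ring A] [Algebra R A] [Ring B] [Algebra R B] {n l : ℕ}

theorem map_ext (f : A →ₐ[R] B) (T : Fin n → A) (k : ℕ) : f (ext T k) = ext (fun i => f (T i)) k := by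
  unfold ext; split_ifs <;> simp

theorem map_up (f : A →ₐ[R] B) (T : Fin n → A) (a b : ℕ) :
    f (up (ext T) a b) = up (ext fun i => f (T i)) a b := by
  rw [up, up, map_list_prod, List.map_map]
  congr 2
  funext k
  exact map_ext f T k

theorem map_dn (f : A →ₐ[R] B) (T : Fin n → A) (a b : ℕ) :
    f (dn (ext T) a b) = dn (ext fun i => f (T i)) a b := by
  rw [dn, dn, map_list_prod, List.map_map]
  congr 2
  funext k
  exact map_ext f T k

theorem map_tInv (f : A →ₐ[R] B) (t : Rˣ) (T : Fin n → A) (k : Fin n) :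
    f (tInv t T k) = tInv t (fun i => f (T i)) k := by
  simp [tInv]

theorem map_zEval (f : A →ₐ[R] B) (Z : Fin l → Rˣ) (S : Finset (Fin l)) (u : A) :
    f (zEval Z S u) = zEval Z S (f u) := by
  rw [zEval, zEval, Polynomial.aeval_algHom_apply]

end Maps

/-! ### Coordinates of the operators -/

section Coordinates

open Window

variable {R K : Type*} [CommRing R] [Field K] [Algebra R K] {n l : ℕ} {q t : Rˣ}
  {y : Fin (n + 1) → K}

theorem rot_eq_iff {b u : Window n} : rot b = u ↔ b = rotInv u :=
  ⟨fun h => by rw [← h, rotInv_rot], fun h => by rw [h, rot_rotInv]⟩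

theorem refl_eq_iff {i : Fin n} {b u : Window n} : refl i b = u ↔ b = refl i u :=
  ⟨fun h => by rw [← h, refl_refl], fun h => by rw [h, refl_refl]⟩

/-- To compute the coordinates of a linear image it suffices to treat basis vectors. -/
theorem coord_ext {f : Module.End K (Window n →₀ K)} {u : Window n}
    {φ : (Window n →₀ K) →ₗ[K] K} (h : ∀ b, f (Finsupp.single b 1) u = φ (Finsupp.single b 1))
    (v : Window n →₀ K) : f v u = φ v := by
  have : (Finsupp.lapply u).comp f = φ := by
    refine Finsupp.lhom_ext fun b c => ?_
    rw [← mul_one c, ← smul_eq_mul, ← Finsupp.smul_single, map_smul, map_smul, ← h]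
    rfl
  exact LinearMap.congr_fun this v

/-- The coordinate at `u` receives the reflection term from the window `refl i u`, whose entries `i`
and `i + 1` are those of `u` exchanged; hence the reversed arguments of `reflCoeff`. -/
theorem repT_apply (i : Fin n) (v : Window n →₀ K) (u : Window n) : repT q t y i v u =
    reflCoeff (algebraMap R K (t : R)) (weight q y (u.entry i.succ)) (weight q y (u.entry i.castSucc)) *
      v (refl i u) +
    diagCoeff (algebraMap R K (t : R)) (weight q y (u.entry i.castSucc)) (weight q y (u.entry i.succ)) *
      v u := by
  refine coord_ext (φ := (_ : K) • (Finsupp.lapply (refl i u) : (Window n →₀ K) →ₗ[K] K) +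
    (_ : K) • (Finsupp.lapply u : (Window n →₀ K) →ₗ[K] K)) (fun b => ?_) v
  rw [repT, basisMap_single]
  simp only [Finsupp.add_apply, Finsupp.smul_apply, LinearMap.add_apply, LinearMap.smul_apply,
    Finsupp.lapply_apply, Finsupp.single_apply, smul_eq_mul, refl_eq_iff]
  congr 1
  · split_ifs with h
    · rw [h, entry_refl_castSucc, entry_refl_succ]
    · simp
  · split_ifs with h
    · rw [h]
    · simp

theorem repPi_apply (v : Window n →₀ K) (u : Window n) : repPi K n v u = v (rotInv u) := by
  refine coord_ext (φ := Finsupp.lapply (rotInv u)) (fun b => ?_) v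
  rw [repPi, basisMap_single]
  simp only [Finsupp.lapply_apply, Finsupp.single_apply, rot_eq_iff]

theorem repPiInv_apply (v : Window n →₀ K) (u : Window n) : repPiInv K n v u = v (rot u) := by
  refine coord_ext (φ := Finsupp.lapply (rot u)) (fun b => ?_) v
  rw [repPiInv, basisMap_single]
  simp only [Finsupp.lapply_apply, Finsupp.single_apply]
  simp only [eq_comm (a := b), rot_eq_iff, eq_comm (b := u)]

theorem repY_apply (j : Fin (n + 1)) (v : Window n →₀ K) (u : Window n) :
    repY q y j v u = weight q y (u.entry j) * v u := by
  refine coord_ext (φ := (_ : K) • (Finsupp.lapply u : (Window n →₀ K) →ₗ[K] K)) (fun b => ?_) v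
  rw [repY, basisMap_single]
  simp only [Finsupp.smul_apply, LinearMap.smul_apply, Finsupp.lapply_apply, Finsupp.single_apply,
    smul_eq_mul]
  split_ifs with h
  · rw [h]
  · simp

theorem pow_repY_apply (j : Fin (n + 1)) (k : ℕ) (v : Window n →₀ K) (u : Window n) :
    (repY q y j ^ k) v u = weight q y (u.entry j) ^ k * v u := by
  induction k with
  | zero => simp
  | succ k ih => rw [pow_succ', Module.End.mul_apply, repY_apply, ih]; ring

theorem mono_apply {m : ℕ} {f : Fin m → Module.End K (Window n →₀ K)} {w : Fin m → K}
    {u : Window n} (h : ∀ j k v, (f j ^ k) v u = w j ^ k * v u) (β : Fin m → ℕ)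
    (v : Window n →₀ K) : mono f β v u = (∏ j, w j ^ β j) * v u := by
  induction m with
  | zero => simp [mono]
  | succ m ih =>
    rw [mono_succ, Module.End.mul_apply, h, ih (fun j => h j.succ), Fin.prod_univ_succ]
    ring

theorem mono_repY_apply (β : Fin (n + 1) → ℕ) (v : Window n →₀ K) (u : Window n) :
    mono (repY q y) β v u = (∏ j, weight q y (u.entry j) ^ β j) * v u :=
  mono_apply (fun j k v => pow_repY_apply j k v u) β v

theorem zEval_repY_apply (Z : Fin l → Rˣ) (S : Finset (Fin l)) (j : Fin (n + 1))
    (v : Window n →₀ K) (u : Window n) :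
    zEval Z S (repY q y j) v u = zEval Z S (weight q y (u.entry j)) * v u := by
  classical
  induction S using Finset.induction_on with
  | empty => simp [zEval_empty]
  | insert r S hr ih =>
    rw [zEval_insert Z hr, zEval_insert Z hr, Module.End.mul_apply, LinearMap.sub_apply,
      Finsupp.sub_apply, repY_apply, algebraMap_end_apply', Finsupp.smul_apply, ih, smul_eq_mul]
    ring

end Coordinates

/-! ### Generic weights -/

section Generic

variable {R K : Type*} [CommRing R] [Field K] [Algebra R K] {n l : ℕ} {q t : Rˣ}
  {y : Fin (n + 1) → K}

theorem unit_smul_ne (hy : AlgebraicIndependent R y) (r s : Rˣ) {c d : Fin (n + 1)} (h : c ≠ d) :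
    algebraMap R K (r : R) * y c ≠ algebraMap R K (s : R) * y d := by
  have := (algebraMap R K).domain_nontrivial
  intro e
  have e' : MvPolynomial.aeval y (MvPolynomial.C (r : R) * MvPolynomial.X c) =
      MvPolynomial.aeval y (MvPolynomial.C (s : R) * MvPolynomial.X d) := by
    simpa [MvPolynomial.algHom_C] using e
  have e2 := congrArg (MvPolynomial.coeff (Finsupp.single c 1)) (hy e')
  rw [MvPolynomial.coeff_C_mul, MvPolynomial.coeff_C_mul, MvPolynomial.coeff_X,
    MvPolynomial.coeff_X, if_pos rfl, if_neg] at e2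
  · simp at e2
  · intro h'
    exact h (Finsupp.single_left_injective one_ne_zero h').symm

theorem unit_smul_ne_const (hy : AlgebraicIndependent R y) (r : Rˣ) (s : R) (c : Fin (n + 1)) :
    algebraMap R K (r : R) * y c ≠ algebraMap R K s := by
  have := (algebraMap R K).domain_nontrivial
  intro e
  have e' : MvPolynomial.aeval y (MvPolynomial.C (r : R) * MvPolynomial.X c) =
      MvPolynomial.aeval y (MvPolynomial.C s) := by
    simpa [MvPolynomial.algHom_C] using e
  have e2 := congrArg (MvPolynomial.coeff (Finsupp.single c 1)) (hy e')
  rw [MvPolynomial.coeff_C_mul, MvPolynomial.coeff_X, if_pos rfl, MvPolynomial.coeff_C, if_neg] at e2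
  · simp at e2
  · intro h'
    have := DFunLike.congr_fun h' c
    simp at this

/-- Up to unit powers of `q` and a permutation of the variables, these are the monomials in the
algebraically independent `y_c`. -/
theorem linearIndependent_prod_weight (hy : AlgebraicIndependent R y) (b : Window n) :
    LinearIndependent R fun β : Fin (n + 1) → ℕ => ∏ j, weight q y (b.entry j) ^ β j := by
  have h1 : LinearIndependent R fun s : Fin (n + 1) →₀ ℕ =>
      MvPolynomial.aeval y (MvPolynomial.monomial s (1 : R)) := by
    have := (MvPolynomial.basisMonomials (Fin (n + 1)) R).linearIndependent.map'
      (MvPolynomial.aeval y).toLinearMap (LinearMap.ker_eq_bot.2 hy)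
    simpa [Function.comp_def] using this
  have h2 := h1.comp (fun β : Fin (n + 1) → ℕ =>
    Finsupp.equivFunOnFinite.symm fun i => β (b.1.symm i)) (fun β β' h => by
      have := Finsupp.equivFunOnFinite.symm.injective h
      funext j
      simpa using congrFun this (b.1 j))
  have h3 := h2.units_smul fun β => ∏ j, (q ^ b.2 j) ^ β j
  convert h3 using 2 with β
  have e : ∏ i, y i ^ β (b.1.symm i) = ∏ j, y (b.1 j) ^ β j := by
    rw [← Equiv.prod_comp b.1]; simp
  simp only [Pi.smul_apply', Function.comp_apply]
  rw [MvPolynomial.aeval_monomial, map_one, one_mul,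
    Finsupp.prod_fintype _ _ (fun _ => pow_zero _), Units.smul_def, Algebra.smul_def]
  simp only [Finsupp.equivFunOnFinite_symm_apply_apply]
  rw [e, Units.coe_prod, map_prod, ← Finset.prod_mul_distrib]
  refine Finset.prod_congr rfl fun j _ => ?_
  simp [weight, Window.entry, mul_pow]

end Generic

/-! ### Triangular elements attached to windows -/

section Triangular

open Window

variable {R K A : Type*} [CommRing R] [Field K] [Algebra R K] [Ring A] [Algebra R A]
  {n l : ℕ} {q t : Rˣ} {Z : Fin l → Rˣ} {T : Fin n → A} {X Y D : Fin (n + 1) → A}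
  {y : Fin (n + 1) → K}

/-- The total degree of a window. -/
def deg (b : Window n) : ℤ := ∑ j, b.2 j

/-- The negative part of the degree of a window. -/
def negDeg (b : Window n) : ℕ := ∑ j, (-b.2 j).toNat

/-- The total absolute degree of a window. -/
def absDeg (b : Window n) : ℕ := ∑ j, (b.2 j).natAbs

theorem sum_refl {M : Type*} [AddCommMonoid M] (f : ℤ → M) (i : Fin n) (b : Window n) :
    ∑ j, f ((refl i b).2 j) = ∑ j, f (b.2 j) :=
  Equiv.sum_comp (Equiv.swap i.castSucc i.succ) fun j => f (b.2 j)

/-- Rotation changes one translation from `m` to `m + 1`. Taking `f` to be the identity, the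
negative part or the absolute value tracks the three degrees used in the induction. -/
theorem sum_rot {M : Type*} [AddCommMonoid M] (f : ℤ → M) (b : Window n) :
    ∑ j, f ((rot b).2 j) + f (b.2 (Fin.last n)) =
      ∑ j, f (b.2 j) + f (b.2 (Fin.last n) + 1) := by
  rw [Fin.sum_univ_succ, Fin.sum_univ_castSucc fun j => f (b.2 j)]
  have h0 : (rot b).2 0 = b.2 (Fin.last n) + 1 := congrArg Prod.snd (entry_rot_zero b)
  have hs : ∀ j : Fin n, (rot b).2 j.succ = b.2 j.castSucc := fun j =>
    congrArg Prod.snd (entry_rot_succ b j)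
  simp only [h0, hs]
  abel

theorem zEval_eq_prod {K : Type*} [Field K] [Algebra R K] (Z : Fin l → Rˣ) (S : Finset (Fin l))
    (u : K) : zEval Z S u = ∏ m ∈ S, (u - algebraMap R K (Z m)) := by
  simp [zEval, zPoly, map_prod]

theorem weight_ne (hy : AlgebraicIndependent R y) (r s : Rˣ) {c d : Fin (n + 1) × ℤ}
    (h : c.1 ≠ d.1) : algebraMap R K (r : R) * weight q y c ≠ algebraMap R K (s : R) * weight q y d := by
  have := unit_smul_ne hy (r * q ^ c.2) (s * q ^ d.2) h
  simpa only [weight, Units.val_mul, map_mul, mul_assoc] using this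

theorem extAffine_of_algebraicIndependent (hy : AlgebraicIndependent R y) :
    ExtAffine q t (repT q t y) (repY q y) (repYinv q y) (repPi K n) (repPiInv K n) := by
  refine extAffine_rep (fun c h => ?_) fun c d h => by simpa using weight_ne (q := q) hy 1 1 h
  refine unit_smul_ne_const hy (q ^ c.2) 0 c.1 ?_
  rw [map_zero]
  exact h

/-- Induction on the total absolute translation, then on length. At a descent the window is reached
from its shorter reflection by `T_i`. Without descents the translations are weakly decreasing: a
positive first one is removed by undoing `π`, a negative last one by undoing `π⁻¹ f(Y_0)`, and
otherwise the window is the identity. The operator `π` costs one `X`, and `π⁻¹ f(Y_0)` costs one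
`D`, hence `l` in the weighted degree; this explains the filtration step. -/
theorem exists_triangular (H : ∀ a b, CycRel q t Z T X Y D a b → a = b)
    (hy : AlgebraicIndependent R y) (ρ : A →ₐ[R] Module.End K (Window n →₀ K))
    (hT : ∀ i, ρ (T i) = repT q t y i)
    (hX : ρ (X 0) = repPi K n * dn (ext (tInv t (repT q t y))) 0 n)
    (hD : ρ (D 0) = up (ext (repT q t y)) 0 n * repPiInv K n * zEval Z Finset.univ (repY q y 0))
    (b : Window n) :
    ∃ G ∈ filt R l T X Y D (deg b) (l * negDeg b), ρ G (Finsupp.single (1, 0) 1) b ≠ 0 ∧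
      ∀ u, ρ G (Finsupp.single (1, 0) 1) u ≠ 0 → u = b ∨ u.len < b.len := by
  have Hb : ∀ a b, BaseRel t T X Y a b → a = b := fun a b h => H a b (.base h)
  have B := (extAffine_of_algebraicIndependent (q := q) (t := t) hy).braidSeq
  have hT' : (fun i => ρ (T i)) = repT q t y := funext hT
  have hTi : (fun i => ρ (tInv t T i)) = tInv t (repT q t y) :=
    funext fun i => by rw [tInv, tInv, map_sub, hT, AlgHom.commutes]
  have hTup : ρ (up (ext T) 0 n) = up (ext (repT q t y)) 0 n := by
    rw [← hT']; exact map_up (B := Module.End K (Window n →₀ K)) ρ T 0 n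
  have hTdn : ρ (dn (ext (tInv t T)) 0 n) = dn (ext (tInv t (repT q t y))) 0 n := by
    rw [← hTi]; exact map_dn (B := Module.End K (Window n →₀ K)) ρ (tInv t T) 0 n
  have hup : ρ (X 0 * up (ext T) 0 n) = repPi K n := by
    rw [map_mul, hTup, hX, mul_assoc, B.dn_mul_up, mul_one]
  have hdn : ρ (dn (ext (tInv t T)) 0 n * D 0) =
      repPiInv K n * zEval Z Finset.univ (repY q y 0) := by
    rw [map_mul, hTdn, hD, ← mul_assoc, ← mul_assoc, B.dn_mul_up, one_mul]
  induction hd : absDeg b using Nat.strong_induction_on generalizing b with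
  | _ d ihd =>
  induction hl : b.len using Nat.strong_induction_on generalizing b with
  | _ k ihl =>
  by_cases hasc : ∀ i, Ascent i b
  · have anti := antitone_of_ascents hasc
    by_cases h0 : 0 < b.2 0
    · obtain ⟨b', rfl⟩ : ∃ b', b = rot b' := ⟨rotInv b, (rot_rotInv b).symm⟩
      have e0 : (rot b').2 0 = b'.2 (Fin.last n) + 1 := congrArg Prod.snd (entry_rot_zero b')
      have s1 := sum_rot (fun m => m) b'
      have s2 := sum_rot (fun m => (-m).toNat) b'
      have s3 := sum_rot Int.natAbs b'
      obtain ⟨G, hG, g1, g2⟩ := ihd (absDeg b') (by unfold absDeg at hd ⊢; omega) b' rfl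
      refine ⟨X 0 * up (ext T) 0 n * G, ?_, ?_, ?_⟩
      · have m1 := hecke_mul_filt (l := l) H _ _ (Submodule.mul_mem_mul
          (up_mem_heckeSpan (R := R) (T := T) ext_mem_heckeSpan 0 n) hG)
        have m2 := X_mul_filt (R := R) (l := l) _ _ (Submodule.mul_mem_mul (mem_oneSpan X 0) m1)
        rw [mul_assoc]
        refine filt_mono ?_ ?_ m2
        · unfold deg; omega
        · unfold negDeg; exact Nat.mul_le_mul_left l (by omega)
      · rwa [map_mul, hup, Module.End.mul_apply, repPi_apply, rotInv_rot]
      · intro u hu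
        rw [map_mul, hup, Module.End.mul_apply, repPi_apply] at hu
        rcases g2 _ hu with h | h
        · left; rw [← h, rot_rotInv]
        · right; rwa [len_rotInv, ← len_rot b', hl] at h
    · by_cases h1 : b.2 (Fin.last n) < 0
      · have s1 := sum_rot (fun m => m) b
        have s2 := sum_rot (fun m => (-m).toNat) b
        have s3 := sum_rot Int.natAbs b
        obtain ⟨G, hG, g1, g2⟩ := ihd (absDeg (rot b)) (by unfold absDeg at hd ⊢; omega) (rot b) rfl
        refine ⟨dn (ext (tInv t T)) 0 n * D 0 * G, ?_, ?_, ?_⟩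
        · have m1 := D_mul_filt (l := l) H _ _ (Submodule.mul_mem_mul (mem_genSpan D 0) hG)
          have m2 := hecke_mul_filt (l := l) H _ _ (Submodule.mul_mem_mul
            (dn_mem_heckeSpan (R := R) (T := T) (ext_tInv_mem_heckeSpan (t := t)) 0 n) m1)
          rw [mul_assoc]
          refine filt_mono ?_ ?_ m2
          · unfold deg; omega
          · have : negDeg (rot b) + 1 = negDeg b := by unfold negDeg; omega
            rw [← this, mul_add, mul_one]
        · rw [map_mul, hdn, Module.End.mul_apply, Module.End.mul_apply, repPiInv_apply,
            zEval_repY_apply, zEval_eq_prod]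
          -- The eigenvalue of `f(Y_0)` does not vanish, because a generic weight is never equal to
          -- a constant `Z_m` of the base ring.
          refine mul_ne_zero (Finset.prod_ne_zero_iff.2 fun m _ => ?_) g1
          exact sub_ne_zero.2 (unit_smul_ne_const hy _ _ _)
        · intro u hu
          rw [map_mul, hdn, Module.End.mul_apply, Module.End.mul_apply, repPiInv_apply,
            zEval_repY_apply] at hu
          rcases g2 _ (right_ne_zero_of_mul hu) with h | h
          · left; rw [← rotInv_rot u, h, rotInv_rot]
          · right; rwa [len_rot, len_rot, hl] at h
      · have hb0 : b.2 = 0 := by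
          funext j
          have a1 := anti (Fin.zero_le j)
          have a2 := anti (Fin.le_last j)
          show b.2 j = 0
          omega
        obtain rfl := eq_one_of_ascents hasc hb0
        refine ⟨1, ?_, ?_, ?_⟩
        · refine le_filt (p := 0) (r := 0) (k := 0) (by simp [deg]) (by simp) ?_
          simpa using one_mem_heckeSpan
        · simp
        · intro u hu
          left
          rw [map_one, Module.End.one_apply, Finsupp.single_apply] at hu
          by_contra h
          exact hu (if_neg fun h' => h h'.symm)
  · push Not at hasc
    obtain ⟨i, hi⟩ := hasc
    have hlen := len_refl_of_not_ascent hi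
    have s1 := sum_refl (fun m => m) i b
    have s2 := sum_refl (fun m => (-m).toNat) i b
    have s3 := sum_refl Int.natAbs i b
    obtain ⟨G, hG, g1, g2⟩ := ihl (refl i b).len (by omega) (refl i b)
      (by unfold absDeg at hd ⊢; omega) rfl
    refine ⟨T i * G, ?_, ?_, ?_⟩
    · have m1 := hecke_mul_filt (l := l) H _ _ (Submodule.mul_mem_mul
          (ext_mem_heckeSpan (R := R) (T := T) i) hG)
      rw [ext_val] at m1
      refine filt_mono ?_ ?_ m1
      · unfold deg; omega
      · unfold negDeg; rw [s2]
    -- The window `b` is longer than the leading window `refl i b`, so the diagonal part of `T_i`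
    -- contributes nothing to the coordinate at `b`.
    · have hb0 : ρ G (Finsupp.single (1, 0) 1) b = 0 := by
        by_contra h
        rcases g2 _ h with h | h
        · have := congrArg len h; omega
        · omega
      rw [map_mul, hT, Module.End.mul_apply, repT_apply, hb0, mul_zero, add_zero]
      refine mul_ne_zero (div_ne_zero (sub_ne_zero.2 ?_) (sub_ne_zero.2 ?_)) g1
      · rw [← map_inv_unit]
        exact weight_ne hy t t⁻¹ (b.entry_fst_ne Fin.castSucc_lt_succ.ne')
      · simpa using weight_ne (q := q) hy 1 1 (b.entry_fst_ne (Fin.castSucc_lt_succ (i := i)).ne')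
    · intro u hu
      rw [map_mul, hT, Module.End.mul_apply, repT_apply] at hu
      by_cases h : ρ G (Finsupp.single (1, 0) 1) u = 0
      · rw [h, mul_zero, add_zero] at hu
        rcases g2 _ (right_ne_zero_of_mul hu) with h | h
        · left; rw [← refl_refl i u, h, refl_refl]
        · right
          have := len_refl_le i (refl i u)
          rw [refl_refl] at this
          omega
      · right
        rcases g2 _ h with h | h
        · rw [h]; omega
        · omega

/-- In a relation, take a window `b` of maximal length among those with a nonzero coefficient. Only
the terms attached to `b` contribute to the coordinate at `b`, where `Y` acts by the weights of `b`.
After dividing by the leading coefficient this is a relation among the monomials in these weights.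
-/
theorem linearIndependent_Y_mul (hy : AlgebraicIndependent R y)
    (ρ : A →ₐ[R] Module.End K (Window n →₀ K)) (hY : ∀ i, ρ (Y i) = repY q y i)
    {G : Window n → A} (h1 : ∀ b, ρ (G b) (Finsupp.single (1, 0) 1) b ≠ 0)
    (h2 : ∀ b u, ρ (G b) (Finsupp.single (1, 0) 1) u ≠ 0 → u = b ∨ u.len < b.len) :
    LinearIndependent R fun x : Window n × (Fin (n + 1) → ℕ) => mono Y x.2 * G x.1 := by
  classical
  have hm : ∀ (β : Fin (n + 1) → ℕ), ρ (mono Y β) = mono (repY q y) β := by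
    intro β
    rw [mono, mono, map_list_prod, List.map_ofFn]
    congr 2
    funext i
    simp [hY]
  rw [linearIndependent_iff']
  intro s g hg
  by_contra! hne
  obtain ⟨x1, hx1, hgx1⟩ := hne
  obtain ⟨x0, hx0, hmax⟩ := Finset.exists_max_image (s.filter fun x => g x ≠ 0)
    (fun x => x.1.len) ⟨x1, by simp [hx1, hgx1]⟩
  rw [Finset.mem_filter] at hx0
  set b := x0.1 with hb
  set w : (Fin (n + 1) → ℕ) → K := fun β => ∏ j, weight q y (b.entry j) ^ β j with hw
  have e := congrArg (fun a => ρ a (Finsupp.single (1, 0) 1) b) hg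
  simp only [map_sum, map_smul, map_mul, map_zero, LinearMap.sum_apply, LinearMap.smul_apply,
    Module.End.mul_apply, Finsupp.finsetSum_apply, Finsupp.smul_apply, hm, mono_repY_apply,
    LinearMap.zero_apply, Finsupp.zero_apply] at e
  have e2 : ∑ x ∈ s.filter (fun x => x.1 = b), g x • w x.2 = 0 := by
    have : (∑ x ∈ s.filter (fun x => x.1 = b), g x • w x.2) *
        ρ (G b) (Finsupp.single (1, 0) 1) b = 0 := by
      rw [← e, Finset.sum_mul, Finset.sum_filter]
      refine Finset.sum_congr rfl fun x hx => ?_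
      split_ifs with hxb
      · rw [hxb, smul_mul_assoc]
      · by_cases hgx : g x = 0
        · rw [hgx, zero_smul]
        · by_cases hG : ρ (G x.1) (Finsupp.single (1, 0) 1) b = 0
          · rw [hG, mul_zero, smul_zero]
          · rcases h2 _ _ hG with h | h
            · exact absurd h.symm hxb
            · have := hmax x (by simp [hx, hgx])
              omega
    exact (mul_eq_zero.1 this).resolve_right (h1 b)
  have e3 : ∑ β ∈ (s.filter fun x => x.1 = b).image Prod.snd, g (b, β) • w β = 0 := by
    rw [Finset.sum_image, ← e2]
    · refine Finset.sum_congr rfl fun x hx => ?_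
      rw [← (Finset.mem_filter.1 hx).2]
    · intro x hx x' hx' h
      exact Prod.ext ((Finset.mem_filter.1 hx).2.trans (Finset.mem_filter.1 hx').2.symm) h
  refine hx0.2 (linearIndependent_iff'.1 (linearIndependent_prod_weight (q := q) hy b) _ _ e3 x0.2 ?_)
  exact Finset.mem_image.2 ⟨x0, Finset.mem_filter.2 ⟨hx0.1, rfl⟩, rfl⟩

end Triangular
end CycDAHA

namespace CycDAHA
open Polynomial

/-! ### Matching standard monomials with windows -/

section Counting

variable {n l : ℕ}

/-- The bijection between standard monomials and pairs of a window and a monomial in the `Y_j`. -/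
def stdEquiv (hl : 1 ≤ l) : StdIndex n l ≃ Window n × (Fin (n + 1) → ℕ) where
  -- The common part `min a_i c_i` of the exponents of `X_i` and `D_i` is exchanged for `Y`-degree
  -- `l * min a_i c_i`, as `X_0 D_0 = f(Y_0)` suggests. Since `b_i < l`, division with remainder
  -- recovers both parts.
  toFun x := ((x.2.2.1, fun i => (x.1 i : ℤ) - x.2.2.2 i),
    fun i => x.2.1 i + l * min (x.1 i) (x.2.2.2 i))
  invFun z := (fun i => (z.1.2 i).toNat + z.2 i / l, fun i => ⟨z.2 i % l, Nat.mod_lt _ hl⟩, z.1.1,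
    fun i => (-z.1.2 i).toNat + z.2 i / l)
  left_inv := by
    rintro ⟨a, b, s, c⟩
    have h : ∀ i, ((b i : ℕ) + l * min (a i) (c i)) / l = min (a i) (c i) := fun i => by
      rw [Nat.add_mul_div_left _ _ hl, Nat.div_eq_of_lt (b i).2, zero_add]
    simp only [Prod.mk.injEq, true_and]
    refine ⟨funext fun i => ?_, funext fun i => Fin.ext ?_, funext fun i => ?_⟩
    · rw [h]; omega
    · simp [Nat.mod_eq_of_lt (b i).2]
    · rw [h]; omega
  right_inv := by
    rintro ⟨⟨s, m⟩, β⟩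
    simp only [Prod.mk.injEq, true_and]
    refine ⟨funext fun i => ?_, funext fun i => ?_⟩
    · push_cast; omega
    · have h : min ((m i).toNat + β i / l) ((-m i).toNat + β i / l) = β i / l := by omega
      rw [h]; exact Nat.mod_add_div _ _

theorem finite_stdSet (hl : 1 ≤ l) (d : ℤ) (e : ℕ) : (stdSet n l d e).Finite := by
  refine Set.Finite.subset ((Set.finite_Iic fun _ => (d + e).toNat).prod
    (Set.finite_univ.prod (Set.finite_univ.prod (Set.finite_Iic fun _ => e)))) ?_
  rintro ⟨a, b, s, c⟩ ⟨h1, h2⟩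
  have hc : ∑ i, c i ≤ e := by
    have : ∑ i, c i ≤ l * ∑ i, c i := Nat.le_mul_of_pos_left _ hl
    dsimp only at h2
    omega
  refine ⟨fun i => ?_, trivial, trivial, fun i => ?_⟩
  · have := Finset.single_le_sum (f := a) (fun j _ => Nat.zero_le _) (Finset.mem_univ i)
    dsimp only at h1 ⊢
    omega
  · have := Finset.single_le_sum (f := c) (fun j _ => Nat.zero_le _) (Finset.mem_univ i)
    dsimp only
    omega

theorem exists_subset_stdSet (S : Finset (StdIndex n l)) :
    ∃ (d : ℤ) (e : ℕ), (S : Set (StdIndex n l)) ⊆ stdSet n l d e := by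
  refine ⟨((∑ x ∈ S, ∑ i, x.1 i : ℕ) : ℤ), ∑ x ∈ S, (∑ i, (x.2.1 i : ℕ) + l * ∑ i, x.2.2.2 i),
    fun x hx => ⟨?_, ?_⟩⟩
  · have := Finset.single_le_sum (f := fun x : StdIndex n l => ∑ i, x.1 i)
      (fun j _ => Nat.zero_le _) hx
    omega
  · exact Finset.single_le_sum (f := fun x : StdIndex n l => ∑ i, (x.2.1 i : ℕ) + l * ∑ i, x.2.2.2 i)
      (fun j _ => Nat.zero_le _) hx

theorem deg_stdEquiv (hl : 1 ≤ l) (x : StdIndex n l) :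
    deg (stdEquiv hl x).1 = (∑ i, x.1 i : ℕ) - (∑ i, x.2.2.2 i : ℕ) := by
  simp [deg, stdEquiv, Finset.sum_sub_distrib]

/-- Since `min a c + max (c - a) 0 = c`, the weighted `Y`-degree of `Y^β G_b` equals that of the
corresponding standard monomial. -/
theorem negDeg_stdEquiv (hl : 1 ≤ l) (x : StdIndex n l) :
    ∑ i, (stdEquiv hl x).2 i + l * negDeg (stdEquiv hl x).1 =
      ∑ i, (x.2.1 i : ℕ) + l * ∑ i, x.2.2.2 i := by
  simp only [negDeg, stdEquiv, Equiv.coe_fn_mk, Finset.sum_add_distrib, ← Finset.mul_sum]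
  rw [add_assoc, ← mul_add, ← Finset.sum_add_distrib]
  congr 2
  refine Finset.sum_congr rfl fun i _ => ?_
  omega

end Counting

/-! ### Linear independence of the standard monomials -/

section Independence

variable {R K A : Type*} [CommRing R] [Field K] [Algebra R K] [Ring A] [Algebra R A]
  {n l : ℕ} {q t : Rˣ} {Z : Fin l → Rˣ} {T : Fin n → A} {X Y D : Fin (n + 1) → A}
  {y : Fin (n + 1) → K}

theorem pow_Y_mul_filt (H : ∀ a b, CycRel q t Z T X Y D a b → a = b) (d : ℤ) (e r : ℕ) :
    oneSpan R Y ^ r * filt R l T X Y D d e ≤ filt R l T X Y D d (e + r) := by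
  induction r with
  | zero => simp
  | succ r ih =>
    rw [pow_succ', mul_assoc]
    calc oneSpan R Y * (oneSpan R Y ^ r * filt R l T X Y D d e)
        ≤ oneSpan R Y * filt R l T X Y D d (e + r) := by gcongr
      _ ≤ _ := Y_mul_filt H d (e + r)

/-- The standard monomials are linearly independent. -/
theorem linearIndependent_stdElem [IsDomain R] (H : ∀ a b, CycRel q t Z T X Y D a b → a = b) (hl : 1 ≤ l)
    (hy : AlgebraicIndependent R y) (ρ : A →ₐ[R] Module.End K (Window n →₀ K))
    (hT : ∀ i, ρ (T i) = repT q t y i) (hY : ∀ i, ρ (Y i) = repY q y i)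
    (hX : ρ (X 0) = repPi K n * dn (ext (tInv t (repT q t y))) 0 n)
    (hD : ρ (D 0) = up (ext (repT q t y)) 0 n * repPiInv K n * zEval Z Finset.univ (repY q y 0))
    {w : Equiv.Perm (Fin (n + 1)) → List (Fin n)} (hw : ∀ s, IsReducedWord (w s) s) :
    LinearIndependent R (stdElem T X Y D w : StdIndex n l → A) := by
  choose G hG h1 h2 using exists_triangular H hy ρ hT hX hD
  refine linearIndependent_of_filtered_span (stdEquiv hl) (linearIndependent_Y_mul hy ρ hY h1 h2)
    fun S => ?_
  obtain ⟨d, e, hS⟩ := exists_subset_stdSet S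
  refine ⟨(finite_stdSet hl d e).toFinset, fun x hx => by simpa using hS hx, fun x hx => ?_⟩
  rw [Set.Finite.mem_toFinset] at hx
  rw [Set.Finite.coe_toFinset]
  refine filt_le_span H hl hw d e ?_
  -- The degrees of `Y^β G_b` agree with those of the standard monomial `x`, so it lies in the step
  -- `(d, e)`, which is spanned by the finite set `stdSet n l d e`.
  have m := pow_Y_mul_filt H _ _ _ (Submodule.mul_mem_mul
    (mono_mem_pow (mem_oneSpan (R := R) Y) (stdEquiv hl x).2) (hG (stdEquiv hl x).1))
  refine filt_mono ?_ ?_ m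
  · rw [deg_stdEquiv]
    have := hx.1
    omega
  · have := hx.2
    have := negDeg_stdEquiv hl x
    omega

end Independence
end CycDAHA

namespace CycDAHA
open Polynomial

/-! ### Transport of relations along homomorphisms -/

section RelationMaps

variable {R A B : Type*} [CommRing R] [Ring A] [Algebra R A] [Ring B] [Algebra R B] {n l : ℕ}
  {q t : Rˣ} {Z : Fin l → Rˣ} {T : Fin n → A} {X X' Y Y' D : Fin (n + 1) → A}

theorem map_asc (f : A →ₐ[R] B) (T : Fin n → A) (a b : ℕ) :
    f (asc T a b) = asc (fun i => f (T i)) a b := map_up f T a b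

theorem map_desc (f : A →ₐ[R] B) (T : Fin n → A) (a b : ℕ) :
    f (desc T a b) = desc (fun i => f (T i)) a b := map_dn f T a b

theorem map_jUp (f : A →ₐ[R] B) (T : Fin n → A) (i : ℕ) :
    f (jUp T i) = jUp (fun i => f (T i)) i := by
  rw [jUp, jUp, map_mul, map_asc, map_desc]

theorem map_jDown (f : A →ₐ[R] B) (T : Fin n → A) (i : ℕ) :
    f (jDown t T i) = jDown t (fun i => f (T i)) i := by
  rw [jDown, jDown, map_mul, map_asc, map_desc]
  simp only [map_tInv]

theorem map_prod_ofFn (f : A →ₐ[R] B) {m : ℕ} (X : Fin m → A) :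
    f (List.ofFn X).prod = (List.ofFn fun i => f (X i)).prod := by
  rw [map_list_prod, List.map_ofFn]; rfl

theorem map_mono (f : A →ₐ[R] B) {m : ℕ} (X : Fin m → A) (a : Fin m → ℕ) :
    f (mono X a) = mono (fun i => f (X i)) a := by
  rw [mono, mono, map_prod_ofFn]; simp

/-- A relation between the images of generators is the image of a relation. -/
theorem BaseRel.exists_of_map (f : A →ₐ[R] B) {a b : B}
    (h : BaseRel t (fun i => f (T i)) (fun i => f (X i)) (fun i => f (Y i)) a b) :
    ∃ a' b', BaseRel t T X Y a' b' ∧ f a' = a ∧ f b' = b := by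
  cases h with
  | R1 i => exact ⟨_, _, .R1 i, by simp, by simp⟩
  | R2 i j h => exact ⟨_, _, .R2 i j h, by simp, by simp⟩
  | R3 i j h => exact ⟨_, _, .R3 i j h, by simp, by simp⟩
  | R4 i => exact ⟨_, _, .R4 i, by simp, by simp⟩
  | R5 i j h h' => exact ⟨_, _, .R5 i j h h', by simp, by simp⟩
  | R6 i => exact ⟨_, _, .R6 i, by simp, by simp⟩
  | R7 i j h h' => exact ⟨_, _, .R7 i j h h', by simp, by simp⟩
  | R11 i j => exact ⟨_, _, .R11 i j, by simp, by simp⟩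
  | R12 i j => exact ⟨_, _, .R12 i j, by simp, by simp⟩

theorem BaseRel.map (f : A →ₐ[R] B) {a b : A} (h : BaseRel t T X Y a b) :
    BaseRel t (fun i => f (T i)) (fun i => f (X i)) (fun i => f (Y i)) (f a) (f b) := by
  cases h with
  | R1 i => convert BaseRel.R1 i using 1 <;> simp
  | R2 i j h => convert BaseRel.R2 i j h using 1 <;> simp
  | R3 i j h => convert BaseRel.R3 i j h using 1 <;> simp
  | R4 i => convert BaseRel.R4 i using 1; simp
  | R5 i j h h' => convert BaseRel.R5 i j h h' using 1 <;> simp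
  | R6 i => convert BaseRel.R6 i using 1; simp
  | R7 i j h h' => convert BaseRel.R7 i j h h' using 1 <;> simp
  | R11 i j => convert BaseRel.R11 i j using 1 <;> simp
  | R12 i j => convert BaseRel.R12 i j using 1 <;> simp

theorem DahaRel.exists_of_map (f : A →ₐ[R] B) {a b : B}
    (h : DahaRel q t (fun i => f (T i)) (fun i => f (X i)) (fun i => f (X' i)) (fun i => f (Y i))
      (fun i => f (Y' i)) a b) :
    ∃ a' b', DahaRel q t T X X' Y Y' a' b' ∧ f a' = a ∧ f b' = b := by
  cases h with
  | base h =>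
    obtain ⟨a', b', h', h1, h2⟩ := h.exists_of_map f
    exact ⟨a', b', .base h', h1, h2⟩
  | X_mul_inv i => exact ⟨_, _, .X_mul_inv i, by simp, by simp⟩
  | inv_mul_X i => exact ⟨_, _, .inv_mul_X i, by simp, by simp⟩
  | Y_mul_inv i => exact ⟨_, _, .Y_mul_inv i, by simp, by simp⟩
  | inv_mul_Y i => exact ⟨_, _, .inv_mul_Y i, by simp, by simp⟩
  | R8 k hk => exact ⟨_, _, .R8 k hk, by simp, by simp⟩
  | R9 i => exact ⟨_, _, .R9 i, by simp only [map_mul, map_prod_ofFn],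
      by simp only [map_smul, map_mul, map_prod_ofFn]⟩
  | R10 i => exact ⟨_, _, .R10 i, by simp only [map_mul, map_prod_ofFn],
      by simp only [map_smul, map_mul, map_prod_ofFn]⟩

theorem DahaRel.map (f : A →ₐ[R] B) {a b : A} (h : DahaRel q t T X X' Y Y' a b) :
    DahaRel q t (fun i => f (T i)) (fun i => f (X i)) (fun i => f (X' i)) (fun i => f (Y i))
      (fun i => f (Y' i)) (f a) (f b) := by
  cases h with
  | base h => exact .base (h.map f)
  | X_mul_inv i => convert DahaRel.X_mul_inv i using 1 <;> simp
  | inv_mul_X i => convert DahaRel.inv_mul_X i using 1 <;> simp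
  | Y_mul_inv i => convert DahaRel.Y_mul_inv i using 1 <;> simp
  | inv_mul_Y i => convert DahaRel.inv_mul_Y i using 1 <;> simp
  | R8 k hk => convert DahaRel.R8 k hk using 1 <;> simp
  | R9 i => convert DahaRel.R9 i using 1 <;> simp only [map_smul, map_mul, map_prod_ofFn]
  | R10 i => convert DahaRel.R10 i using 1 <;> simp only [map_smul, map_mul, map_prod_ofFn]

theorem CycRel.exists_of_map (f : A →ₐ[R] B) {a b : B}
    (h : CycRel q t Z (fun i => f (T i)) (fun i => f (X i)) (fun i => f (Y i))
      (fun i => f (D i)) a b) :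
    ∃ a' b', CycRel q t Z T X Y D a' b' ∧ f a' = a ∧ f b' = b := by
  have e : (fun i => f (tInv t T i)) = tInv t fun i => f (T i) := funext fun i => map_tInv f t T i
  cases h with
  | base h =>
    obtain ⟨a', b', h', h1, h2⟩ := h.exists_of_map f
    exact ⟨a', b', .base h', h1, h2⟩
  | cd1 i j h => exact ⟨_, _, .cd1 i j h, by simp, by simp [map_asc, map_desc, map_ext, e]⟩
  | cd2 i j h => exact ⟨_, _, .cd2 i j h, by simp, by simp [map_asc, map_desc, map_ext, e]⟩
  | cd3 i => exact ⟨_, _, .cd3 i, by simp [map_jDown], by simp [map_jUp]⟩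
  | cd4 i j => exact ⟨_, _, .cd4 i j, by simp, by simp⟩
  | cd5 i => exact ⟨_, _, .cd5 i, by simp [map_tInv], by simp⟩
  | cd5_comm j i h => exact ⟨_, _, .cd5_comm j i h, by simp, by simp⟩
  | cd6 i j h => exact ⟨_, _, .cd6 i j h, by simp, by simp [map_asc, map_desc, map_ext, e]⟩
  | cd7 i j h => exact ⟨_, _, .cd7 i j h, by simp [map_asc, map_desc, map_ext, e], by simp⟩
  | cd8 i => exact ⟨_, _, .cd8 i, by simp [map_jDown], by simp [map_jUp]⟩
  | cd9_left => exact ⟨_, _, .cd9_left, by simp, by simp [map_zEval]⟩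
  | cd9_right => exact ⟨_, _, .cd9_right, by simp, by simp [map_zEval, map_jUp]⟩
  | cd10 k hk => exact ⟨_, _, .cd10 k hk, by simp, by simp [map_zEval, map_jUp, map_tInv]⟩

theorem CycRel.map (f : A →ₐ[R] B) {a b : A} (h : CycRel q t Z T X Y D a b) :
    CycRel q t Z (fun i => f (T i)) (fun i => f (X i)) (fun i => f (Y i)) (fun i => f (D i))
      (f a) (f b) := by
  have e : (fun i => f (tInv t T i)) = tInv t fun i => f (T i) := funext fun i => map_tInv f t T i
  cases h with
  | base h => exact .base (h.map f)
  | cd1 i j h => convert CycRel.cd1 i j h using 1 <;> simp [map_asc, map_desc, map_ext, e]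
  | cd2 i j h => convert CycRel.cd2 i j h using 1 <;> simp [map_asc, map_desc, map_ext, e]
  | cd3 i => convert CycRel.cd3 i using 1 <;> simp [map_jDown, map_jUp]
  | cd4 i j => convert CycRel.cd4 i j using 1 <;> simp
  | cd5 i => convert CycRel.cd5 i using 1; simp [map_tInv]
  | cd5_comm j i h => convert CycRel.cd5_comm j i h using 1 <;> simp
  | cd6 i j h => convert CycRel.cd6 i j h using 1 <;> simp [map_asc, map_desc, map_ext, e]
  | cd7 i j h => convert CycRel.cd7 i j h using 1 <;> simp [map_asc, map_desc, map_ext, e]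
  | cd8 i => convert CycRel.cd8 i using 1 <;> simp [map_jDown, map_jUp]
  | cd9_left => convert CycRel.cd9_left using 1 <;> simp [map_zEval]
  | cd9_right => convert CycRel.cd9_right using 1 <;> simp [map_zEval, map_jUp]
  | cd10 k hk => convert CycRel.cd10 k hk using 1 <;> simp [map_zEval, map_jUp, map_tInv]

theorem CycLocRel.exists_of_map (f : A →ₐ[R] B) {a b : B}
    (h : CycLocRel q t Z (fun i => f (T i)) (fun i => f (X i)) (fun i => f (Y i))
      (fun i => f (Y' i)) (fun i => f (D i)) a b) :
    ∃ a' b', CycLocRel q t Z T X Y Y' D a' b' ∧ f a' = a ∧ f b' = b := by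
  cases h with
  | cyc h =>
    obtain ⟨a', b', h', h1, h2⟩ := h.exists_of_map f
    exact ⟨a', b', .cyc h', h1, h2⟩
  | Y_mul_inv i => exact ⟨_, _, .Y_mul_inv i, by simp, by simp⟩
  | inv_mul_Y i => exact ⟨_, _, .inv_mul_Y i, by simp, by simp⟩

theorem CycLocRel.map (f : A →ₐ[R] B) {a b : A} (h : CycLocRel q t Z T X Y Y' D a b) :
    CycLocRel q t Z (fun i => f (T i)) (fun i => f (X i)) (fun i => f (Y i)) (fun i => f (Y' i))
      (fun i => f (D i)) (f a) (f b) := by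
  cases h with
  | cyc h => exact .cyc (h.map f)
  | Y_mul_inv i => convert CycLocRel.Y_mul_inv i using 1 <;> simp
  | inv_mul_Y i => convert CycLocRel.inv_mul_Y i using 1 <;> simp

end RelationMaps

/-! ### Universal properties of the presented algebras -/

section Presentations

variable {R A : Type*} [CommRing R] [Ring A] [Algebra R A] {n l : ℕ} {q t : Rˣ} {Z : Fin l → Rˣ}

theorem eq_of_dahaRel {a b : DAHA n q t}
    (h : DahaRel q t (DAHA.T q t) (DAHA.X q t) (DAHA.Xinv q t) (DAHA.Y q t) (DAHA.Yinv q t) a b) :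
    a = b := by
  obtain ⟨a', b', h', rfl, rfl⟩ := DahaRel.exists_of_map (RingQuot.mkAlgHom R _) h
  exact RingQuot.mkAlgHom_rel R h'

/-- Homomorphisms out of the double affine Hecke algebra. -/
theorem exists_daha_hom {T : Fin n → A} {X X' Y Y' : Fin (n + 1) → A}
    (H : ∀ a b, DahaRel q t T X X' Y Y' a b → a = b) :
    ∃ f : DAHA n q t →ₐ[R] A, (∀ i, f (DAHA.T q t i) = T i) ∧ (∀ i, f (DAHA.X q t i) = X i) ∧
      (∀ i, f (DAHA.Xinv q t i) = X' i) ∧ (∀ i, f (DAHA.Y q t i) = Y i) ∧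
      ∀ i, f (DAHA.Yinv q t i) = Y' i := by
  let g : DahaGen n → A
    | .T i => T i
    | .X i => X i
    | .Xinv i => X' i
    | .Y i => Y i
    | .Yinv i => Y' i
  have hg : ∀ x, FreeAlgebra.lift R g (FreeAlgebra.ι R x) = g x := FreeAlgebra.lift_ι_apply g
  refine ⟨RingQuot.liftAlgHom R ⟨FreeAlgebra.lift R g, fun a b h => H _ _ ?_⟩, ?_⟩
  · have := h.map (FreeAlgebra.lift R g)
    simpa only [hg] using this
  · simp only [DAHA.T, DAHA.X, DAHA.Xinv, DAHA.Y, DAHA.Yinv, DAHA.gen,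
      RingQuot.liftAlgHom_mkAlgHom_apply, hg]
    simp [g]

theorem eq_of_cycRel {a b : PresPlus n q t Z}
    (h : CycRel q t Z (fun i => PresPlus.gen q t Z (.T i)) (fun i => PresPlus.gen q t Z (.X i))
      (fun i => PresPlus.gen q t Z (.Y i)) (fun i => PresPlus.gen q t Z (.D i)) a b) : a = b := by
  obtain ⟨a', b', h', rfl, rfl⟩ := CycRel.exists_of_map (RingQuot.mkAlgHom R _) h
  exact RingQuot.mkAlgHom_rel R h'

theorem exists_presPlus_hom {T : Fin n → A} {X Y D : Fin (n + 1) → A}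
    (H : ∀ a b, CycRel q t Z T X Y D a b → a = b) :
    ∃ f : PresPlus n q t Z →ₐ[R] A, (∀ i, f (PresPlus.gen q t Z (.T i)) = T i) ∧
      (∀ i, f (PresPlus.gen q t Z (.X i)) = X i) ∧ (∀ i, f (PresPlus.gen q t Z (.Y i)) = Y i) ∧
      ∀ i, f (PresPlus.gen q t Z (.D i)) = D i := by
  let g : CycGen n → A
    | .T i => T i
    | .X i => X i
    | .Y i => Y i
    | .D i => D i
  have hg : ∀ x, FreeAlgebra.lift R g (FreeAlgebra.ι R x) = g x := FreeAlgebra.lift_ι_apply g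
  refine ⟨RingQuot.liftAlgHom R ⟨FreeAlgebra.lift R g, fun a b h => H _ _ ?_⟩, ?_⟩
  · have := h.map (FreeAlgebra.lift R g)
    simpa only [hg] using this
  · simp only [PresPlus.gen, RingQuot.liftAlgHom_mkAlgHom_apply, hg]
    simp [g]

theorem eq_of_cycLocRel {a b : PresLoc n q t Z}
    (h : CycLocRel q t Z (fun i => PresLoc.gen q t Z (.T i)) (fun i => PresLoc.gen q t Z (.X i))
      (fun i => PresLoc.gen q t Z (.Y i)) (fun i => PresLoc.gen q t Z (.Yinv i))
      (fun i => PresLoc.gen q t Z (.D i)) a b) : a = b := by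
  obtain ⟨a', b', h', rfl, rfl⟩ := CycLocRel.exists_of_map (RingQuot.mkAlgHom R _) h
  exact RingQuot.mkAlgHom_rel R h'

theorem exists_presLoc_hom {T : Fin n → A} {X Y Y' D : Fin (n + 1) → A}
    (H : ∀ a b, CycLocRel q t Z T X Y Y' D a b → a = b) :
    ∃ f : PresLoc n q t Z →ₐ[R] A, (∀ i, f (PresLoc.gen q t Z (.T i)) = T i) ∧
      (∀ i, f (PresLoc.gen q t Z (.X i)) = X i) ∧ (∀ i, f (PresLoc.gen q t Z (.Y i)) = Y i) ∧
      (∀ i, f (PresLoc.gen q t Z (.Yinv i)) = Y' i) ∧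
      ∀ i, f (PresLoc.gen q t Z (.D i)) = D i := by
  let g : CycLocGen n → A
    | .T i => T i
    | .X i => X i
    | .Y i => Y i
    | .Yinv i => Y' i
    | .D i => D i
  have hg : ∀ x, FreeAlgebra.lift R g (FreeAlgebra.ι R x) = g x := FreeAlgebra.lift_ι_apply g
  refine ⟨RingQuot.liftAlgHom R ⟨FreeAlgebra.lift R g, fun a b h => H _ _ ?_⟩, ?_⟩
  · have := h.map (FreeAlgebra.lift R g)
    simpa only [hg] using this
  · simp only [PresLoc.gen, RingQuot.liftAlgHom_mkAlgHom_apply, hg]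
    simp [g]

/-- The quotient of a free algebra is generated by the images of the generators. -/
theorem adjoin_range_mk {G : Type*} (r : FreeAlgebra R G → FreeAlgebra R G → Prop) :
    Algebra.adjoin R (Set.range fun g => RingQuot.mkAlgHom R r (FreeAlgebra.ι R g)) = ⊤ := by
  have h := congrArg (Subalgebra.map (RingQuot.mkAlgHom R r)) (FreeAlgebra.adjoin_range_ι R G)
  rw [AlgHom.map_adjoin, ← Set.range_comp, Algebra.map_top,
    (AlgHom.range_eq_top _).2 (RingQuot.mkAlgHom_surjective R r)] at h
  exact h

end Presentations
end CycDAHA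

namespace CycDAHA
open Polynomial

/-! ### A generic point in a field of rational functions -/

section GenericPoint

variable (R : Type*) [CommRing R] (n : ℕ)

/-- Independent transcendentals in the field of rational functions. -/
noncomputable def genericPoint (j : Fin (n + 1)) :
    FractionRing (MvPolynomial (Fin (n + 1)) R) :=
  algebraMap (MvPolynomial (Fin (n + 1)) R) _ (MvPolynomial.X j)

theorem algebraicIndependent_genericPoint : AlgebraicIndependent R (genericPoint R n) := by
  have h := (MvPolynomial.algebraicIndependent_X (Fin (n + 1)) R).map'
    (f := IsScalarTower.toAlgHom R (MvPolynomial (Fin (n + 1)) R)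
      (FractionRing (MvPolynomial (Fin (n + 1)) R)))
    (IsFractionRing.injective (MvPolynomial (Fin (n + 1)) R) _)
  exact h

end GenericPoint

/-! ### Independence inside the DAHA -/

section Independence

variable {R : Type*} [CommRing R] {n l : ℕ} {q t : Rˣ} {Z : Fin l → Rˣ}

theorem DAHA.D_zero (Z : Fin l → Rˣ) : DAHA.D (n := n) q t Z 0 =
    DAHA.Xinv q t 0 * zEval Z Finset.univ (DAHA.Y q t 0) := by
  simp [DAHA.D, ← up_eq_asc, ← dn_eq_desc, up_of_le, dn_of_le]

theorem eq_of_cycRel_daha {a b : DAHA n q t}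
    (h : CycRel q t Z (DAHA.T q t) (DAHA.X q t) (DAHA.Y q t) (DAHA.D q t Z) a b) : a = b :=
  eq_of_cycRel_of_dahaRel (fun _ _ => eq_of_dahaRel) (fun _ => rfl) h

theorem eq_of_cycLocRel_daha {a b : DAHA n q t}
    (h : CycLocRel q t Z (DAHA.T q t) (DAHA.X q t) (DAHA.Y q t) (DAHA.Yinv q t) (DAHA.D q t Z) a b) :
    a = b := by
  cases h with
  | cyc h => exact eq_of_cycRel_daha h
  | Y_mul_inv i => exact eq_of_dahaRel (.Y_mul_inv i)
  | inv_mul_Y i => exact eq_of_dahaRel (.inv_mul_Y i)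

/-- The standard monomials are linearly independent in the double affine Hecke algebra. -/
theorem linearIndependent_stdElem_daha [IsDomain R] (hl : 1 ≤ l)
    {w : Equiv.Perm (Fin (n + 1)) → List (Fin n)} (hw : ∀ s, IsReducedWord (w s) s) :
    LinearIndependent R
      (stdElem (DAHA.T q t) (DAHA.X q t) (DAHA.Y q t) (DAHA.D q t Z) w : StdIndex n l → _) := by
  have hy := algebraicIndependent_genericPoint R n
  obtain ⟨ρ, hT, hX, hX', hY, hY'⟩ := exists_daha_hom fun a b =>
    (extAffine_of_algebraicIndependent (q := q) (t := t) hy).eq_of_dahaRel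
  refine linearIndependent_stdElem (Z := Z) (fun _ _ => eq_of_cycRel_daha) hl hy ρ hT hY ?_ ?_ hw
  · rw [hX, ← ExtAffine.ext_xOfPi_zero]
    exact (ext_val (xOfPi t _ _) 0).symm
  · rw [DAHA.D_zero, map_mul, hX']
    have e : ρ (zEval Z Finset.univ (DAHA.Y q t 0)) =
        zEval Z Finset.univ (repY q (genericPoint R n) 0) := by
      rw [zEval, zEval, ← hY]
      exact (Polynomial.aeval_algHom_apply ρ _ _).symm
    refine congrArg₂ _ ?_ e
    simp [xInvOfPi, up_of_le, dn_of_le]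

/-- The elements `X^a Y^b T_s`. -/
def pbwElem {A : Type*} [Ring A] (T : Fin n → A) (X Y : Fin (n + 1) → A)
    (w : Equiv.Perm (Fin (n + 1)) → List (Fin n))
    (x : (Fin (n + 1) → ℕ) × (Fin (n + 1) → ℕ) × Equiv.Perm (Fin (n + 1))) : A :=
  mono X x.1 * mono Y x.2.1 * ((w x.2.2).map T).prod

/-- A finite set of such elements has all its `Y`-exponents below some `m`. They are then standard
monomials without `D`-part for `m` parameters all equal to `1`. The auxiliary parameters do not
enter the DAHA, so they may be chosen freely. -/
theorem linearIndependent_pbwElem [IsDomain R] {w : Equiv.Perm (Fin (n + 1)) → List (Fin n)}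
    (hw : ∀ s, IsReducedWord (w s) s) :
    LinearIndependent R (pbwElem (DAHA.T q t) (DAHA.X q t) (DAHA.Y q t) w) := by
  rw [linearIndependent_iff_finset_linearIndependent]
  intro S
  set m := (∑ x ∈ S, ∑ i, x.2.1 i) + 1 with hm
  have hlt : ∀ (x : S) i, x.1.2.1 i < m := fun x i => by
    have h1 := Finset.single_le_sum (f := fun x : (Fin (n + 1) → ℕ) × (Fin (n + 1) → ℕ) ×
      Equiv.Perm (Fin (n + 1)) => ∑ i, x.2.1 i) (fun j _ => Nat.zero_le _) x.2
    have h2 := Finset.single_le_sum (f := x.1.2.1) (fun j _ => Nat.zero_le _) (Finset.mem_univ i)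
    omega
  have h := (linearIndependent_stdElem_daha (q := q) (t := t) (Z := fun _ : Fin m => 1)
    (Nat.le_add_left 1 _) hw).comp
    (fun x : S => (x.1.1, (fun i => ⟨x.1.2.1 i, hlt x i⟩), x.1.2.2, 0)) (fun x x' e => by
      simp only [Prod.mk.injEq, and_true] at e
      refine Subtype.ext (Prod.ext e.1 (Prod.ext (funext fun i => ?_) e.2.2))
      simpa using congrFun e.2.1 i)
  have e : pbwElem (DAHA.T q t) (DAHA.X q t) (DAHA.Y q t) w ∘ ((↑) : S → _) =
      stdElem (DAHA.T q t) (DAHA.X q t) (DAHA.Y q t) (DAHA.D q t fun _ : Fin m => 1) w ∘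
        fun x : S => (x.1.1, (fun i => ⟨x.1.2.1 i, hlt x i⟩), x.1.2.2, 0) := by
    funext x
    rw [Function.comp_apply, Function.comp_apply, stdElem, pbwElem, mono_zero, mul_one]
  exact e ▸ h

theorem exists_isReducedWord : ∃ w : Equiv.Perm (Fin (n + 1)) → List (Fin n),
    ∀ s, IsReducedWord (w s) s := by
  choose w hw hl using exists_word (n := n)
  refine ⟨w, fun s => ⟨hw s, fun L' h => ?_⟩⟩
  rw [hl, ← h]
  exact invLen_permWord_le L'

theorem eq_zero_of_mem_span {M N ι : Type*} [AddCommGroup M] [Module R M] [AddCommGroup N]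
    [Module R N] (f : M →ₗ[R] N) {v : ι → M} (hv : LinearIndependent R (f ∘ v)) {x : M}
    (hx : x ∈ Submodule.span R (Set.range v)) (h : f x = 0) : x = 0 := by
  obtain ⟨c, rfl⟩ := Finsupp.mem_span_range_iff_exists_finsupp.1 hx
  have : c = 0 := by
    refine linearIndependent_iff.1 hv c ?_
    rw [← h, Finsupp.linearCombination_apply, map_finsuppSum]
    simp
  rw [this, Finsupp.sum_zero_index]

end Independence

/-! ### Spanning of the presented algebra and clearing of denominators -/

section Injectivity

variable {R A : Type*} [CommRing R] [Ring A] [Algebra R A] {n l : ℕ} {q t : Rˣ} {Z : Fin l → Rˣ}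
  {T : Fin n → A} {X Y D : Fin (n + 1) → A}

theorem map_stdElem {B : Type*} [Ring B] [Algebra R B] (f : A →ₐ[R] B)
    (w : Equiv.Perm (Fin (n + 1)) → List (Fin n)) (x : StdIndex n l) :
    f (stdElem T X Y D w x) =
      stdElem (fun i => f (T i)) (fun i => f (X i)) (fun i => f (Y i)) (fun i => f (D i)) w x := by
  simp only [stdElem, map_mul, map_mono, map_list_prod, List.map_map]
  rfl

theorem map_pbwElem {B : Type*} [Ring B] [Algebra R B] (f : A →ₐ[R] B)
    (w : Equiv.Perm (Fin (n + 1)) → List (Fin n))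
    (x : (Fin (n + 1) → ℕ) × (Fin (n + 1) → ℕ) × Equiv.Perm (Fin (n + 1))) :
    f (pbwElem T X Y w x) = pbwElem (fun i => f (T i)) (fun i => f (X i)) (fun i => f (Y i)) w x := by
  simp only [pbwElem, map_mul, map_mono, map_list_prod, List.map_map]
  rfl

theorem adjoin_presPlus : Algebra.adjoin R (Set.range (fun i => PresPlus.gen q t Z (.T i)) ∪
    Set.range (fun i => PresPlus.gen q t Z (.X i)) ∪ Set.range (fun i => PresPlus.gen q t Z (.Y i)) ∪
    Set.range (fun i => PresPlus.gen (n := n) q t Z (.D i))) = ⊤ := by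
  rw [eq_top_iff, ← adjoin_range_mk]
  refine Algebra.adjoin_mono ?_
  rintro _ ⟨g, rfl⟩
  cases g with
  | T i => exact .inl (.inl (.inl ⟨i, rfl⟩))
  | X i => exact .inl (.inl (.inr ⟨i, rfl⟩))
  | Y i => exact .inl (.inr ⟨i, rfl⟩)
  | D i => exact .inr ⟨i, rfl⟩

theorem adjoin_presLoc : Algebra.adjoin R (Set.range (fun i => PresLoc.gen q t Z (.T i)) ∪
    Set.range (fun i => PresLoc.gen q t Z (.X i)) ∪ Set.range (fun i => PresLoc.gen q t Z (.Y i)) ∪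
    Set.range (fun i => PresLoc.gen q t Z (.Yinv i)) ∪
    Set.range (fun i => PresLoc.gen (n := n) q t Z (.D i))) = ⊤ := by
  rw [eq_top_iff, ← adjoin_range_mk]
  refine Algebra.adjoin_mono ?_
  rintro _ ⟨g, rfl⟩
  cases g with
  | T i => exact .inl (.inl (.inl (.inl ⟨i, rfl⟩)))
  | X i => exact .inl (.inl (.inl (.inr ⟨i, rfl⟩)))
  | Y i => exact .inl (.inl (.inr ⟨i, rfl⟩))
  | Yinv i => exact .inl (.inr ⟨i, rfl⟩)
  | D i => exact .inr ⟨i, rfl⟩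

theorem span_stdElem (hl : 1 ≤ l) {w : Equiv.Perm (Fin (n + 1)) → List (Fin n)}
    (hw : ∀ s, IsReducedWord (w s) s) :
    Submodule.span R (Set.range (stdElem (fun i => PresPlus.gen q t Z (.T i))
      (fun i => PresPlus.gen q t Z (.X i)) (fun i => PresPlus.gen q t Z (.Y i))
      (fun i => PresPlus.gen q t Z (.D i)) w : StdIndex n l → _)) = ⊤ := by
  rw [eq_top_iff]
  intro p _
  have H := fun a b => eq_of_cycRel (n := n) (q := q) (t := t) (Z := Z) (a := a) (b := b)
  have hp : p ∈ (⊤ : Subalgebra R (PresPlus n q t Z)) := trivial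
  rw [← adjoin_presPlus] at hp
  obtain ⟨d, e, h⟩ := exists_mem_filt H hp
  exact Submodule.span_mono (Set.image_subset_range _ _) (filt_le_span H hl hw d e h)

/-- Moving powers of the `X_i` to the left. -/
theorem triple_mul_pow_X (H : ∀ a b, CycRel q t Z T X Y D a b → a = b) (p r m : ℕ) :
    oneSpan R X ^ p * oneSpan R Y ^ r * heckeSpan R T * oneSpan R X ^ m ≤
      oneSpan R X ^ (p + m) * oneSpan R Y ^ r * heckeSpan R T := by
  have h1 := hecke_mul_pow_X H m
  have h2 := mul_pow_le_mul heckeSpan_mul_self_le one_le_heckeSpan (pow_Y_mul_X H r)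
    (hecke_mul_one_X H) m
  calc oneSpan R X ^ p * oneSpan R Y ^ r * heckeSpan R T * oneSpan R X ^ m
      = oneSpan R X ^ p * oneSpan R Y ^ r * (heckeSpan R T * oneSpan R X ^ m) := by
        simp only [mul_assoc]
    _ ≤ oneSpan R X ^ p * oneSpan R Y ^ r * (oneSpan R X ^ m * heckeSpan R T) := by gcongr
    _ = oneSpan R X ^ p * (oneSpan R Y ^ r * oneSpan R X ^ m) * heckeSpan R T := by
        simp only [mul_assoc]
    _ ≤ oneSpan R X ^ p * (oneSpan R X ^ m * oneSpan R Y ^ r * heckeSpan R T) * heckeSpan R T := by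
        gcongr
    _ = _ := by rw [pow_add]; simp only [mul_assoc, heckeSpan_mul_self]

theorem D_mul_X_eq_one {Z : Fin 0 → Rˣ} (H : ∀ a b, CycRel q t Z T X Y D a b → a = b)
    (i : Fin (n + 1)) : D i * X i = 1 ∧ X i * D i = 1 := by
  have Hb : ∀ a b, BaseRel t T X Y a b → a = b := fun a b h => H a b (.base h)
  have B := braidSeq_of_baseRel Hb
  induction i using Fin.induction with
  | zero =>
    refine ⟨?_, ?_⟩
    · rw [H _ _ .cd9_right, Finset.univ_eq_empty, zEval_empty]
    · rw [H _ _ .cd9_left, Finset.univ_eq_empty, zEval_empty]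
  | succ i ih =>
    have h1 := B.mul_inv i
    have h2 := B.inv_mul i
    rw [ext_val, ext_val] at h1 h2
    rw [← H _ _ (.cd5 i), ← Hb _ _ (.R4 i)]
    refine ⟨?_, ?_⟩
    · calc tInv t T i * D i.castSucc * tInv t T i * (T i * X i.castSucc * T i)
          = tInv t T i * D i.castSucc * (tInv t T i * T i) * X i.castSucc * T i := by
            simp only [mul_assoc]
        _ = tInv t T i * (D i.castSucc * X i.castSucc) * T i := by
            rw [h2, mul_one]; simp only [mul_assoc]
        _ = 1 := by rw [ih.1, mul_one, h2]
    · calc T i * X i.castSucc * T i * (tInv t T i * D i.castSucc * tInv t T i)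
          = T i * X i.castSucc * (T i * tInv t T i) * D i.castSucc * tInv t T i := by
            simp only [mul_assoc]
        _ = T i * (X i.castSucc * D i.castSucc) * tInv t T i := by
            rw [h1, mul_one]; simp only [mul_assoc]
        _ = 1 := by rw [ih.2, mul_one, h1]

theorem triple_mono {m m' : ℕ} (h : m ≤ m') :
    oneSpan R X ^ m * oneSpan R Y ^ m * heckeSpan R T ≤
      oneSpan R X ^ m' * oneSpan R Y ^ m' * heckeSpan R T := by
  have h1 : oneSpan R X ^ m ≤ oneSpan R X ^ m' := pow_le_pow_right₀ (one_le_oneSpan X) h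
  have h2 : oneSpan R Y ^ m ≤ oneSpan R Y ^ m' := pow_le_pow_right₀ (one_le_oneSpan Y) h
  gcongr

/-- In rank `l = 0` the denominators `D_i = X_i⁻¹` can be cleared. -/
theorem exists_mul_pow_mem {Z : Fin 0 → Rˣ} (H : ∀ a b, CycRel q t Z T X Y D a b → a = b) {a : A}
    (ha : a ∈ Algebra.adjoin R (Set.range T ∪ Set.range X ∪ Set.range Y ∪ Set.range D)) :
    ∃ k m : ℕ, a * mono X (fun _ => 1) ^ k ∈
      oneSpan R X ^ m * oneSpan R Y ^ m * heckeSpan R T := by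
  have Hb : ∀ a b, BaseRel t T X Y a b → a = b := fun a b h => H a b (.base h)
  have hX : ∀ i j, X i * X j = X j * X i := fun i j => Hb _ _ (.R11 i j)
  set x := mono X fun _ => 1 with hx
  have hxmem : x ∈ oneSpan R X ^ (n + 1) := by
    have := mono_mem_pow (R := R) (mem_oneSpan (R := R) X) fun _ => 1
    simpa using this
  have hshift : ∀ (b : A) (m k : ℕ), b ∈ oneSpan R X ^ m * oneSpan R Y ^ m * heckeSpan R T →
      b * x ^ k ∈ oneSpan R X ^ (m + (n + 1) * k) * oneSpan R Y ^ (m + (n + 1) * k) *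
        heckeSpan R T := by
    intro b m k hb
    have h1 := triple_mul_pow_X H m m ((n + 1) * k) (Submodule.mul_mem_mul hb
      (by rw [pow_mul]; exact Submodule.pow_mem_pow _ hxmem k))
    have h2 : oneSpan R Y ^ m ≤ oneSpan R Y ^ (m + (n + 1) * k) :=
      pow_le_pow_right₀ (one_le_oneSpan Y) (Nat.le_add_right _ _)
    have h3 : oneSpan R X ^ (m + (n + 1) * k) * oneSpan R Y ^ m * heckeSpan R T ≤
        oneSpan R X ^ (m + (n + 1) * k) * oneSpan R Y ^ (m + (n + 1) * k) * heckeSpan R T := by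
      gcongr
    exact h3 h1
  -- The elements whose denominators can be cleared form a submodule: two of them are brought to a
  -- common power of `x`, which is then moved to the left.
  let S : Submodule R A :=
    { carrier := {b | ∃ k m : ℕ, b * x ^ k ∈ oneSpan R X ^ m * oneSpan R Y ^ m * heckeSpan R T}
      zero_mem' := ⟨0, 0, by simp⟩
      add_mem' := by
        rintro b c ⟨k, m, h⟩ ⟨k', m', h'⟩
        refine ⟨k + k', (m + (n + 1) * k') + (m' + (n + 1) * k), ?_⟩
        have h1 := triple_mono (R := R) (T := T) (X := X) (Y := Y)
          (Nat.le_add_right (m + (n + 1) * k') (m' + (n + 1) * k)) (hshift _ m k' h)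
        have h2 := triple_mono (R := R) (T := T) (X := X) (Y := Y)
          (Nat.le_add_left (m' + (n + 1) * k) (m + (n + 1) * k')) (hshift _ m' k h')
        rw [mul_assoc b, ← pow_add] at h1
        rw [mul_assoc c, ← pow_add] at h2
        rw [add_comm k' k] at h2
        rw [add_mul b c]
        exact add_mem h1 h2
      smul_mem' := by
        rintro c b ⟨k, m, h⟩
        exact ⟨k, m, by rw [smul_mul_assoc]; exact Submodule.smul_mem _ _ h⟩ }
  -- Since `D_i` is the inverse of `X_i`, it cancels one factor of the commutative product `x = ∏
  -- X_j`, leaving `n` factors.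
  have hDx : genSpan R D * (R ∙ x) ≤ oneSpan R X ^ n := by
    rw [genSpan, Submodule.span_mul_span, Submodule.span_le]
    rintro _ ⟨_, ⟨i, rfl⟩, _, rfl, rfl⟩
    have e : (fun _ => 1 : Fin (n + 1) → ℕ) = Pi.single i 1 + ((fun _ => 1) - Pi.single i 1) := by
      refine (add_tsub_cancel_of_le fun j => ?_).symm
      by_cases h : j = i
      · subst h; simp
      · simp [h]
    have hs : n + 1 = 1 + ∑ j, ((fun _ => 1) - Pi.single i 1 : Fin (n + 1) → ℕ) j := by
      have h1 := congrArg (fun f : Fin (n + 1) → ℕ => ∑ j, f j) e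
      have h2 : ∑ j, (Pi.single i 1 + ((fun _ => 1) - Pi.single i 1) : Fin (n + 1) → ℕ) j =
          1 + ∑ j, ((fun _ => 1) - Pi.single i 1 : Fin (n + 1) → ℕ) j := by
        simp only [Pi.add_apply, Finset.sum_add_distrib, sum_single]
      rw [← h2, ← h1]
      simp
    have e2 : D i * x = mono X ((fun _ => 1) - Pi.single i 1) := by
      rw [hx, e, mono_add hX, mono_single, pow_one, ← mul_assoc, (D_mul_X_eq_one H i).1, one_mul,
        add_tsub_cancel_left]
    have hm := mono_mem_pow (R := R) (mem_oneSpan (R := R) X) ((fun _ => 1) - Pi.single i 1)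
    show D i * x ∈ _
    rw [e2]
    rwa [show ∑ j, ((fun _ => 1) - Pi.single i 1 : Fin (n + 1) → ℕ) j = n by omega] at hm
  have hDk : ∀ k, genSpan R D ^ k * (R ∙ x) ^ k ≤ oneSpan R X ^ (n * k) := by
    intro k
    induction k with
    | zero => simp
    | succ k ih =>
      have hc : oneSpan R X ^ (n * k) * (R ∙ x) = (R ∙ x) * oneSpan R X ^ (n * k) := by
        have hv : ∀ v ∈ oneSpan R X ^ (n * k), v * x = x * v := fun v hv => by
          refine Submodule.span_induction (p := fun v _ => v * x = x * v) ?_ (by simp)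
            (fun a b _ _ ha hb => by rw [add_mul, mul_add, ha, hb])
            (fun c a _ ha => by rw [smul_mul_assoc, mul_smul_comm, ha]) (oneSpan_pow_le hX _ hv)
          rintro _ ⟨a, -, rfl⟩
          rw [hx, ← mono_add hX, ← mono_add hX, add_comm a]
        refine le_antisymm (Submodule.mul_le.2 fun v hv' w hw => ?_)
          (Submodule.mul_le.2 fun w hw v hv' => ?_) <;>
          obtain ⟨c, rfl⟩ := Submodule.mem_span_singleton.1 hw
        · rw [mul_smul_comm, hv v hv', ← smul_mul_assoc]
          exact Submodule.mul_mem_mul hw hv'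
        · rw [smul_mul_assoc, ← hv v hv', ← mul_smul_comm]
          exact Submodule.mul_mem_mul hv' hw
      calc genSpan R D ^ (k + 1) * (R ∙ x) ^ (k + 1)
          = genSpan R D * (genSpan R D ^ k * (R ∙ x) ^ k) * (R ∙ x) := by
            rw [pow_succ', pow_succ]; simp only [mul_assoc]
        _ ≤ genSpan R D * oneSpan R X ^ (n * k) * (R ∙ x) := by gcongr
        _ = (genSpan R D * (R ∙ x)) * oneSpan R X ^ (n * k) := by
            rw [mul_assoc, hc, mul_assoc]
        _ ≤ oneSpan R X ^ n * oneSpan R X ^ (n * k) := by gcongr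
        _ = _ := by rw [← pow_add]; congr 1; ring
  obtain ⟨d, e, h⟩ := exists_mem_filt H ha
  refine (?_ : filt R 0 T X Y D d e ≤ S) h
  refine iSup₂_le fun y _ b hb => ⟨y.2.2, y.1 + n * y.2.2 + y.2.1, ?_⟩
  have hb' := Submodule.mul_mem_mul hb
    (Submodule.pow_mem_pow _ (Submodule.mem_span_singleton_self (R := R) x) y.2.2)
  have h1 : oneSpan R X ^ (y.1 + n * y.2.2) ≤ oneSpan R X ^ (y.1 + n * y.2.2 + y.2.1) :=
    pow_le_pow_right₀ (one_le_oneSpan X) (by omega)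
  have h2 : oneSpan R Y ^ y.2.1 ≤ oneSpan R Y ^ (y.1 + n * y.2.2 + y.2.1) :=
    pow_le_pow_right₀ (one_le_oneSpan Y) (by omega)
  have h3 := hDk y.2.2
  refine (?_ : _ ≤ oneSpan R X ^ (y.1 + n * y.2.2 + y.2.1) *
    oneSpan R Y ^ (y.1 + n * y.2.2 + y.2.1) * heckeSpan R T) hb'
  calc oneSpan R X ^ y.1 * oneSpan R Y ^ y.2.1 * heckeSpan R T * genSpan R D ^ y.2.2 *
        (R ∙ x) ^ y.2.2
      = oneSpan R X ^ y.1 * oneSpan R Y ^ y.2.1 * heckeSpan R T * (genSpan R D ^ y.2.2 *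
        (R ∙ x) ^ y.2.2) := by simp only [mul_assoc]
    _ ≤ oneSpan R X ^ y.1 * oneSpan R Y ^ y.2.1 * heckeSpan R T * oneSpan R X ^ (n * y.2.2) := by
        gcongr
    _ ≤ oneSpan R X ^ (y.1 + n * y.2.2) * oneSpan R Y ^ y.2.1 * heckeSpan R T :=
        triple_mul_pow_X H _ _ _
    _ ≤ _ := by gcongr

end Injectivity
end CycDAHA

namespace CycDAHA
open Polynomial

/-! ### Presentation and basis of the unlocalized algebra -/

section PlusPresentation

variable {R : Type*} [CommRing R] {n l : ℕ} {q t : Rˣ} {Z : Fin l → Rˣ}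

theorem exists_algEquiv_of_injective {A B : Type*} [Ring A] [Ring B] [Algebra R A] [Algebra R B]
    (f : A →ₐ[R] B) (hf : Function.Injective f) {S : Subalgebra R B} (h : f.range = S) :
    ∃ e : A ≃ₐ[R] S, ∀ a, (e a : B) = f a := by
  subst h
  exact ⟨AlgEquiv.ofInjective f hf, fun a => rfl⟩

/-- The elements `X^a Y^b T_s` span the products of `X`'s, `Y`'s and Hecke algebra elements. -/
theorem triple_le_span {A : Type*} [Ring A] [Algebra R A] {T : Fin n → A} {X Y : Fin (n + 1) → A}
    (H : ∀ a b, BaseRel t T X Y a b → a = b) {w : Equiv.Perm (Fin (n + 1)) → List (Fin n)}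
    (hw : ∀ s, IsReducedWord (w s) s) (m m' : ℕ) :
    oneSpan R X ^ m * oneSpan R Y ^ m' * heckeSpan R T ≤
      Submodule.span R (Set.range (pbwElem T X Y w)) := by
  have h1 := oneSpan_pow_le (R := R) (fun i j => H _ _ (.R11 i j)) m
  have h2 := oneSpan_pow_le (R := R) (fun i j => H _ _ (.R12 i j)) m'
  have h3 := heckeSpan_le_span (braidFamily_of_baseRel H) (quadratic_of_baseRel H) hw
  refine (mul_le_mul' (mul_le_mul' h1 h2) h3).trans ?_
  rw [monoSpan, monoSpan, Submodule.span_mul_span, Submodule.span_mul_span, Submodule.span_le]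
  rintro _ ⟨_, ⟨_, ⟨a, -, rfl⟩, _, ⟨b, -, rfl⟩, rfl⟩, _, ⟨s, rfl⟩, rfl⟩
  exact Submodule.subset_span ⟨(a, b, s), rfl⟩

theorem isUnit_mono {A : Type*} [Ring A] {m : ℕ} {X : Fin m → A} (h : ∀ i, IsUnit (X i))
    (a : Fin m → ℕ) : IsUnit (mono X a) := by
  refine List.prod_isUnit fun x hx => ?_
  obtain ⟨i, rfl⟩ := List.mem_ofFn.1 hx
  exact (h i).pow _

theorem comp_stdElem (f : PresPlus n q t Z →ₐ[R] DAHA n q t)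
    (hT : ∀ i, f (PresPlus.gen q t Z (.T i)) = DAHA.T q t i)
    (hX : ∀ i, f (PresPlus.gen q t Z (.X i)) = DAHA.X q t i)
    (hY : ∀ i, f (PresPlus.gen q t Z (.Y i)) = DAHA.Y q t i)
    (hD : ∀ i, f (PresPlus.gen q t Z (.D i)) = DAHA.D q t Z i)
    (w : Equiv.Perm (Fin (n + 1)) → List (Fin n)) :
    f.toLinearMap ∘ (stdElem (fun i => PresPlus.gen q t Z (.T i))
      (fun i => PresPlus.gen q t Z (.X i)) (fun i => PresPlus.gen q t Z (.Y i))
      (fun i => PresPlus.gen q t Z (.D i)) w : StdIndex n l → _) =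
      stdElem (DAHA.T q t) (DAHA.X q t) (DAHA.Y q t) (DAHA.D q t Z) w := by
  funext x
  refine (map_stdElem f w x).trans ?_
  rw [funext hT, funext hX, funext hY, funext hD]

/-- The algebra defined by the presentation embeds into the double affine Hecke algebra. -/
theorem injective_presPlus_hom [IsDomain R] (f : PresPlus n q t Z →ₐ[R] DAHA n q t)
    (hT : ∀ i, f (PresPlus.gen q t Z (.T i)) = DAHA.T q t i)
    (hX : ∀ i, f (PresPlus.gen q t Z (.X i)) = DAHA.X q t i)
    (hY : ∀ i, f (PresPlus.gen q t Z (.Y i)) = DAHA.Y q t i)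
    (hD : ∀ i, f (PresPlus.gen q t Z (.D i)) = DAHA.D q t Z i) : Function.Injective f := by
  obtain ⟨w, hw⟩ := exists_isReducedWord (n := n)
  rw [injective_iff_map_eq_zero]
  intro p hp
  rcases Nat.eq_zero_or_pos l with rfl | hl
  -- For `l = 0` the index set of the standard monomials is empty, so the elements `X^a Y^b T_s`
  -- replace them after multiplication by a power of `∏ X_i`. The `X_i` are units, with inverses
  -- `D_i`, so this loses nothing.
  · have H := fun a b => eq_of_cycRel (n := n) (q := q) (t := t) (Z := Z) (a := a) (b := b)
    have hp' : p ∈ (⊤ : Subalgebra R (PresPlus n q t Z)) := trivial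
    rw [← adjoin_presPlus] at hp'
    obtain ⟨k, m, h⟩ := exists_mul_pow_mem H hp'
    have hv : LinearIndependent R (f.toLinearMap ∘ pbwElem (fun i => PresPlus.gen q t Z (.T i))
        (fun i => PresPlus.gen q t Z (.X i)) (fun i => PresPlus.gen q t Z (.Y i)) w) := by
      have e : f.toLinearMap ∘ pbwElem (fun i => PresPlus.gen q t Z (.T i))
          (fun i => PresPlus.gen q t Z (.X i)) (fun i => PresPlus.gen q t Z (.Y i)) w =
          pbwElem (DAHA.T q t) (DAHA.X q t) (DAHA.Y q t) w := by
        funext x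
        refine (map_pbwElem f w x).trans ?_
        rw [funext hT, funext hX, funext hY]
      rw [e]
      exact linearIndependent_pbwElem hw
    have h0 := eq_zero_of_mem_span f.toLinearMap hv
      (triple_le_span (fun a b h => H a b (.base h)) hw m m h) (by
        rw [AlgHom.toLinearMap_apply, map_mul, hp, zero_mul])
    refine ((isUnit_mono (fun i => ?_) _).pow k).mul_left_eq_zero.1 h0
    exact ⟨⟨_, _, (D_mul_X_eq_one H i).2, (D_mul_X_eq_one H i).1⟩, rfl⟩
  -- For `l ≥ 1`, the standard monomials span the source and have independent images, which gives
  -- injectivity.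
  · refine eq_zero_of_mem_span f.toLinearMap (v := stdElem (l := l)
      (fun i => PresPlus.gen q t Z (.T i))
      (fun i => PresPlus.gen q t Z (.X i)) (fun i => PresPlus.gen q t Z (.Y i))
      (fun i => PresPlus.gen q t Z (.D i)) w) ?_ ?_ hp
    · rw [comp_stdElem f hT hX hY hD]
      exact linearIndependent_stdElem_daha hl hw
    · rw [span_stdElem hl hw]
      trivial

/-- The presentation of the unlocalized cyclotomic double affine Hecke algebra. -/
theorem exists_presPlus_equiv [IsDomain R] : ∃ e : PresPlus n q t Z ≃ₐ[R] cyclotomicPlus n q t Z,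
    (∀ i, (e (PresPlus.gen q t Z (.T i)) : DAHA n q t) = DAHA.T q t i) ∧
    (∀ i, (e (PresPlus.gen q t Z (.X i)) : DAHA n q t) = DAHA.X q t i) ∧
    (∀ i, (e (PresPlus.gen q t Z (.Y i)) : DAHA n q t) = DAHA.Y q t i) ∧
    (∀ i, (e (PresPlus.gen q t Z (.D i)) : DAHA n q t) = DAHA.D q t Z i) := by
  obtain ⟨f, hT, hX, hY, hD⟩ := exists_presPlus_hom (n := n) (q := q) (t := t) (Z := Z)
    (fun _ _ => eq_of_cycRel_daha)
  have hr : f.range = cyclotomicPlus n q t Z := by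
    rw [← Algebra.map_top, ← adjoin_presPlus, AlgHom.map_adjoin, cyclotomicPlus]
    simp only [Set.image_union, ← Set.range_comp, Function.comp_def, hT, hX, hY, hD]
  obtain ⟨e, he⟩ := exists_algEquiv_of_injective f (injective_presPlus_hom f hT hX hY hD) hr
  exact ⟨e, fun i => by rw [he, hT], fun i => by rw [he, hX], fun i => by rw [he, hY],
    fun i => by rw [he, hD]⟩

/-- The basis of the unlocalized cyclotomic double affine Hecke algebra. -/
theorem exists_basis [IsDomain R] (hl : 1 ≤ l) {w : Equiv.Perm (Fin (n + 1)) → List (Fin n)}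
    (hw : ∀ s, IsReducedWord (w s) s) :
    ∃ b : Module.Basis (StdIndex n l) R (cyclotomicPlus n q t Z), ∀ x, (b x : DAHA n q t) =
      stdElem (DAHA.T q t) (DAHA.X q t) (DAHA.Y q t) (DAHA.D q t Z) w x := by
  obtain ⟨e, hT, hX, hY, hD⟩ := exists_presPlus_equiv (n := n) (q := q) (t := t) (Z := Z)
  have hc := comp_stdElem ((cyclotomicPlus n q t Z).val.comp e.toAlgHom) hT hX hY hD w
  have hli := linearIndependent_stdElem_daha (q := q) (t := t) (Z := Z) hl hw
  rw [← hc] at hli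
  refine ⟨(Module.Basis.mk (LinearIndependent.of_comp _ hli) (span_stdElem hl hw).ge).map
    e.toLinearEquiv, fun x => ?_⟩
  rw [Module.Basis.map_apply, Module.Basis.mk_apply, ← congrFun hc x]
  rfl

end PlusPresentation
end CycDAHA

namespace CycDAHA
open Polynomial

/-! ### Presentation of the algebra with invertible `Y_i` -/

section LocPresentation

variable {R : Type*} [CommRing R] {n l : ℕ} {q t : Rˣ} {Z : Fin l → Rˣ}

theorem mono_one_eq {A : Type*} [Ring A] {m : ℕ} (X : Fin m → A) :
    mono X (fun _ => 1) = (List.ofFn X).prod := by simp [mono]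

theorem exists_mul_eq_mono_one {A : Type*} [Ring A] {m : ℕ} {X : Fin m → A}
    (hX : ∀ i j, X i * X j = X j * X i) (i : Fin m) : ∃ c, c * X i = mono X fun _ => 1 := by
  refine ⟨mono X ((fun _ => 1) - Pi.single i 1), ?_⟩
  have e : (fun _ => 1 : Fin m → ℕ) = ((fun _ => 1) - Pi.single i 1) + Pi.single i 1 := by
    refine (tsub_add_cancel_of_le fun j => ?_).symm
    by_cases h : j = i
    · subst h; simp
    · simp [h]
  conv_rhs => rw [e, mono_add hX, mono_single, pow_one]

theorem tInv_mem_of_mem {A : Type*} [Ring A] [Algebra R A] {S : Subalgebra R A} {T : Fin n → A}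
    (h : ∀ i, T i ∈ S) (i : Fin n) : tInv t T i ∈ S :=
  sub_mem (h i) (S.algebraMap_mem _)

theorem asc_mem_of_mem {A : Type*} [Ring A] [Algebra R A] {S : Subalgebra R A} {T : Fin n → A}
    (h : ∀ i, T i ∈ S) (a b : ℕ) : asc T a b ∈ S := by
  refine list_prod_mem fun x hx => ?_
  obtain ⟨k, -, rfl⟩ := List.mem_map.1 hx
  exact ext_cases (P := fun u => u ∈ S) (one_mem S) h k

theorem desc_mem_of_mem {A : Type*} [Ring A] [Algebra R A] {S : Subalgebra R A} {T : Fin n → A}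
    (h : ∀ i, T i ∈ S) (a b : ℕ) : desc T a b ∈ S := by
  refine list_prod_mem fun x hx => ?_
  obtain ⟨k, -, rfl⟩ := List.mem_map.1 hx
  exact ext_cases (P := fun u => u ∈ S) (one_mem S) h k

theorem baseRel_daha {a b : DAHA n q t}
    (h : BaseRel t (DAHA.T q t) (DAHA.X q t) (DAHA.Y q t) a b) : a = b :=
  eq_of_dahaRel (.base h)

theorem DAHA.prodY_mul_T (i : Fin n) : mono (DAHA.Y q t) (fun _ => 1) * DAHA.T q t i =
    DAHA.T q t i * mono (DAHA.Y q t) (fun _ => 1) := by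
  have h := (twistedY_of_baseRel (fun _ _ => baseRel_daha (q := q) (t := t))).commute_prod
    (commute_ext fun i j => baseRel_daha (.R12 i j)) i.2
  rw [ext_val, ← ofFn_prod_eq_up, ← mono_one_eq] at h
  exact h.eq.symm

theorem DAHA.prodY_mul_Y (i : Fin (n + 1)) : mono (DAHA.Y q t) (fun _ => 1) * DAHA.Y q t i =
    DAHA.Y q t i * mono (DAHA.Y q t) (fun _ => 1) :=
  (commute_mono (fun j => baseRel_daha (.R12 i j)) _).eq.symm

theorem DAHA.prodY_mul_X (i : Fin (n + 1)) : mono (DAHA.Y q t) (fun _ => 1) * DAHA.X q t i =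
    (q : R) • (DAHA.X q t i * mono (DAHA.Y q t) (fun _ => 1)) := by
  have h := eq_of_dahaRel (q := q) (t := t) (.R10 i)
  rw [← mono_one_eq] at h
  rw [h, smul_smul, Units.mul_inv, one_smul]

theorem DAHA.prodY_mul_Xinv (i : Fin (n + 1)) : mono (DAHA.Y q t) (fun _ => 1) * DAHA.Xinv q t i =
    ((q⁻¹ : Rˣ) : R) • (DAHA.Xinv q t i * mono (DAHA.Y q t) (fun _ => 1)) := by
  have h := eq_of_dahaRel (q := q) (t := t) (.R10 i)
  have h1 := eq_of_dahaRel (q := q) (t := t) (.X_mul_inv i)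
  have h2 := eq_of_dahaRel (q := q) (t := t) (.inv_mul_X i)
  rw [← mono_one_eq] at h
  set y := mono (DAHA.Y q t) (fun _ => 1)
  calc y * DAHA.Xinv q t i = DAHA.Xinv q t i * (DAHA.X q t i * y) * DAHA.Xinv q t i := by
        rw [← mul_assoc, h2, one_mul]
    _ = ((q⁻¹ : Rˣ) : R) • (DAHA.Xinv q t i * y * (DAHA.X q t i * DAHA.Xinv q t i)) := by
        rw [h, mul_smul_comm, smul_mul_assoc]; simp only [mul_assoc]
    _ = _ := by rw [h1, mul_one]

theorem DAHA.prodY_mul_D (i : Fin (n + 1)) : mono (DAHA.Y q t) (fun _ => 1) * DAHA.D q t Z i =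
    ((q⁻¹ : Rˣ) : R) • (DAHA.D q t Z i * mono (DAHA.Y q t) (fun _ => 1)) := by
  have hT : ∀ k, DAHA.T q t k ∈ Subalgebra.centralizer R {mono (DAHA.Y (n := n) q t) (fun _ => 1)} := by
    intro k
    rw [Subalgebra.mem_centralizer_iff]
    rintro _ rfl
    exact DAHA.prodY_mul_T k
  have c1 : Commute (mono (DAHA.Y q t) fun _ => 1) (desc (tInv t (DAHA.T q t)) 0 i) :=
    (Subalgebra.mem_centralizer_iff R).1 (desc_mem_of_mem (tInv_mem_of_mem hT) 0 i) _ rfl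
  have c2 : Commute (mono (DAHA.Y q t) fun _ => 1) (asc (tInv t (DAHA.T q t)) 0 i) :=
    (Subalgebra.mem_centralizer_iff R).1 (asc_mem_of_mem (tInv_mem_of_mem hT) 0 i) _ rfl
  have c3 := commute_zEval Z Finset.univ (DAHA.prodY_mul_Y (q := q) (t := t) (0 : Fin (n + 1)))
  have c4 := DAHA.prodY_mul_Xinv (q := q) (t := t) (0 : Fin (n + 1))
  rw [DAHA.D]
  set y := mono (DAHA.Y q t) (fun _ => 1)
  set a := desc (tInv t (DAHA.T q t)) 0 i
  set b := asc (tInv t (DAHA.T q t)) 0 i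
  calc y * (a * (DAHA.Xinv q t 0 * zEval Z Finset.univ (DAHA.Y q t 0)) * b)
      = (y * a) * (DAHA.Xinv q t 0 * zEval Z Finset.univ (DAHA.Y q t 0)) * b := by
        simp only [mul_assoc]
    _ = a * (y * DAHA.Xinv q t 0) * zEval Z Finset.univ (DAHA.Y q t 0) * b := by
        rw [c1.eq]; simp only [mul_assoc]
    _ = ((q⁻¹ : Rˣ) : R) •
          (a * DAHA.Xinv q t 0 * (y * zEval Z Finset.univ (DAHA.Y q t 0)) * b) := by
        rw [c4, mul_smul_comm, smul_mul_assoc, smul_mul_assoc]; simp only [mul_assoc]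
    _ = ((q⁻¹ : Rˣ) : R) •
          (a * DAHA.Xinv q t 0 * zEval Z Finset.univ (DAHA.Y q t 0) * (y * b)) := by
        rw [c3.eq]; simp only [mul_assoc]
    _ = _ := by rw [c2.eq]; simp only [mul_assoc]

/-- The product of the `Y_i` can be moved across any element. -/
theorem exists_prodY_mul_eq [IsDomain R] (a : PresPlus n q t Z) :
    ∃ a', mono (fun i => PresPlus.gen q t Z (.Y i)) (fun _ => 1) * a =
      a' * mono (fun i => PresPlus.gen q t Z (.Y i)) (fun _ => 1) := by
  obtain ⟨f, hT, hX, hY, hD⟩ := exists_presPlus_hom (n := n) (q := q) (t := t) (Z := Z)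
    (fun _ _ => eq_of_cycRel_daha)
  -- The commutation of `∏ Y_i` with the generators up to powers of `q` is not among the defining
  -- relations. It is verified in the DAHA and pulled back through the injective homomorphism.
  have hf := injective_presPlus_hom f hT hX hY hD
  have hy : f (mono (fun i => PresPlus.gen q t Z (.Y i)) fun _ => 1) =
      mono (DAHA.Y q t) fun _ => 1 := by rw [map_mono, funext hY]
  have ha : a ∈ (⊤ : Subalgebra R (PresPlus n q t Z)) := trivial
  rw [← adjoin_presPlus] at ha
  induction ha using Algebra.adjoin_induction with
  | mem x hx =>
    rcases hx with ((⟨i, rfl⟩ | ⟨i, rfl⟩) | ⟨i, rfl⟩) | ⟨i, rfl⟩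
    · refine ⟨PresPlus.gen q t Z (.T i), hf ?_⟩
      rw [map_mul, map_mul, hy, hT, DAHA.prodY_mul_T]
    · refine ⟨(q : R) • PresPlus.gen q t Z (.X i), hf ?_⟩
      rw [smul_mul_assoc, map_smul, map_mul, map_mul, hy, hX, DAHA.prodY_mul_X]
    · refine ⟨PresPlus.gen q t Z (.Y i), hf ?_⟩
      rw [map_mul, map_mul, hy, hY, DAHA.prodY_mul_Y]
    · refine ⟨((q⁻¹ : Rˣ) : R) • PresPlus.gen q t Z (.D i), hf ?_⟩
      rw [smul_mul_assoc, map_smul, map_mul, map_mul, hy, hD, DAHA.prodY_mul_D]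
  | algebraMap r => exact ⟨algebraMap _ _ r, (Algebra.commutes r _).symm⟩
  | add x x' _ _ h h' =>
    obtain ⟨z, hz⟩ := h
    obtain ⟨z', hz'⟩ := h'
    exact ⟨z + z', by rw [mul_add, add_mul, hz, hz']⟩
  | mul x x' _ _ h h' =>
    obtain ⟨z, hz⟩ := h
    obtain ⟨z', hz'⟩ := h'
    exact ⟨z * z', by rw [← mul_assoc, hz, mul_assoc, hz', mul_assoc]⟩

theorem exists_pow_prodY_mul_eq [IsDomain R] (k : ℕ) (a : PresPlus n q t Z) :
    ∃ a', mono (fun i => PresPlus.gen q t Z (.Y i)) (fun _ => 1) ^ k * a =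
      a' * mono (fun i => PresPlus.gen q t Z (.Y i)) (fun _ => 1) ^ k := by
  induction k generalizing a with
  | zero => exact ⟨a, by simp⟩
  | succ k ih =>
    obtain ⟨b, hb⟩ := exists_prodY_mul_eq a
    obtain ⟨c, hc⟩ := ih b
    exact ⟨c, by rw [pow_succ, mul_assoc, hb, ← mul_assoc, hc, mul_assoc]⟩

/-- Every element of the localized algebra becomes integral after multiplication by a power of the
product of the `Y_i`. -/
theorem exists_pow_prodY_mul_mem [IsDomain R] (h : PresPlus n q t Z →ₐ[R] PresLoc n q t Z)
    (hT : ∀ i, h (PresPlus.gen q t Z (.T i)) = PresLoc.gen q t Z (.T i))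
    (hX : ∀ i, h (PresPlus.gen q t Z (.X i)) = PresLoc.gen q t Z (.X i))
    (hY : ∀ i, h (PresPlus.gen q t Z (.Y i)) = PresLoc.gen q t Z (.Y i))
    (hD : ∀ i, h (PresPlus.gen q t Z (.D i)) = PresLoc.gen q t Z (.D i)) (p : PresLoc n q t Z) :
    ∃ (k : ℕ) (r : PresPlus n q t Z),
      h (mono (fun i => PresPlus.gen q t Z (.Y i)) fun _ => 1) ^ k * p = h r := by
  have hp : p ∈ (⊤ : Subalgebra R (PresLoc n q t Z)) := trivial
  rw [← adjoin_presLoc] at hp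
  induction hp using Algebra.adjoin_induction with
  | mem x hx =>
    rcases hx with (((⟨i, rfl⟩ | ⟨i, rfl⟩) | ⟨i, rfl⟩) | ⟨i, rfl⟩) | ⟨i, rfl⟩
    · exact ⟨0, _, by rw [pow_zero, one_mul]; exact (hT i).symm⟩
    · exact ⟨0, _, by rw [pow_zero, one_mul]; exact (hX i).symm⟩
    · exact ⟨0, _, by rw [pow_zero, one_mul]; exact (hY i).symm⟩
    -- Writing the product of all the `Y_j` as `c * Y_i` shows that one factor of it clears `Y_i⁻¹`.
    · obtain ⟨c, hc⟩ := exists_mul_eq_mono_one (X := fun i => PresPlus.gen q t Z (.Y i))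
        (fun i j => eq_of_cycRel (.base (.R12 i j))) i
      refine ⟨1, c, ?_⟩
      rw [pow_one, ← hc, map_mul, mul_assoc, hY, eq_of_cycLocRel (.Y_mul_inv i), mul_one]
    · exact ⟨0, _, by rw [pow_zero, one_mul]; exact (hD i).symm⟩
  | algebraMap r => exact ⟨0, algebraMap _ _ r, by rw [pow_zero, one_mul, AlgHom.commutes]⟩
  | add x x' _ _ hx hx' =>
    obtain ⟨k, r, hr⟩ := hx
    obtain ⟨k', r', hr'⟩ := hx'
    refine ⟨k + k', mono (fun i => PresPlus.gen q t Z (.Y i)) (fun _ => 1) ^ k' * r +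
      mono (fun i => PresPlus.gen q t Z (.Y i)) (fun _ => 1) ^ k * r', ?_⟩
    rw [map_add, map_mul, map_mul, map_pow, map_pow, ← hr, ← hr', ← mul_assoc, ← mul_assoc,
      ← pow_add, ← pow_add, mul_add, add_comm k' k]
  | mul x x' _ _ hx hx' =>
    obtain ⟨k, r, hr⟩ := hx
    obtain ⟨k', r', hr'⟩ := hx'
    -- An Ore-type step: the power needed for the second factor is first moved across the cleared
    -- first factor `r`.
    obtain ⟨s, hs⟩ := exists_pow_prodY_mul_eq k' r
    refine ⟨k' + k, s * r', ?_⟩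
    rw [pow_add, mul_assoc, ← mul_assoc _ x, hr, ← mul_assoc, ← map_pow, ← map_mul, hs, map_mul,
      map_mul, mul_assoc, ← hr', map_pow]

/-- If `p` is in the kernel, a power of the unit `∏ Y_i` times `p` comes from some `r` in the
unlocalized algebra. The composite to the DAHA kills `r` and is injective, so `r = 0` and hence `p =
0`. -/
theorem injective_presLoc_hom [IsDomain R] (g : PresLoc n q t Z →ₐ[R] DAHA n q t)
    (hT : ∀ i, g (PresLoc.gen q t Z (.T i)) = DAHA.T q t i)
    (hX : ∀ i, g (PresLoc.gen q t Z (.X i)) = DAHA.X q t i)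
    (hY : ∀ i, g (PresLoc.gen q t Z (.Y i)) = DAHA.Y q t i)
    (hD : ∀ i, g (PresLoc.gen q t Z (.D i)) = DAHA.D q t Z i) : Function.Injective g := by
  obtain ⟨h, kT, kX, kY, kD⟩ := exists_presPlus_hom (n := n) (q := q) (t := t) (Z := Z)
    (fun _ _ h => eq_of_cycLocRel (.cyc h))
  have hf := injective_presPlus_hom (g.comp h) (fun i => by rw [AlgHom.comp_apply, kT, hT])
    (fun i => by rw [AlgHom.comp_apply, kX, hX]) (fun i => by rw [AlgHom.comp_apply, kY, hY])
    (fun i => by rw [AlgHom.comp_apply, kD, hD])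
  rw [injective_iff_map_eq_zero]
  intro p hp
  obtain ⟨k, r, hr⟩ := exists_pow_prodY_mul_mem h kT kX kY kD p
  have hr0 : r = 0 := hf (by rw [AlgHom.comp_apply, ← hr, map_mul, hp, mul_zero, map_zero])
  rw [hr0, map_zero, map_mono] at hr
  refine ((isUnit_mono (fun i => ?_) _).pow k).mul_right_eq_zero.1 hr
  rw [kY]
  exact ⟨⟨_, _, eq_of_cycLocRel (.Y_mul_inv i), eq_of_cycLocRel (.inv_mul_Y i)⟩, rfl⟩

/-- Two generating systems of the cyclotomic double affine Hecke algebra. -/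
theorem adjoin_eq_cyclotomic : Algebra.adjoin R (Set.range (DAHA.T q t) ∪ Set.range (DAHA.X q t) ∪
    Set.range (DAHA.Y q t) ∪ Set.range (DAHA.Yinv q t) ∪ Set.range (DAHA.D q t Z)) =
      cyclotomic n q t Z := by
  have B := braidSeq_of_baseRel fun _ _ => baseRel_daha (n := n) (q := q) (t := t)
  have W := twistedX_of_baseRel fun _ _ => baseRel_daha (n := n) (q := q) (t := t)
  apply le_antisymm
  · have hT : ∀ i, DAHA.T q t i ∈ cyclotomic n q t Z := fun i =>
      Algebra.subset_adjoin (.inl (.inl (.inl ⟨i, rfl⟩)))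
    have hX0 : DAHA.X q t 0 ∈ cyclotomic n q t Z := by
      -- `X_0` and `D_0` differ from `π` and `π₋` only by invertible Hecke factors, and the
      -- remaining `X_i`, `D_i` are obtained from these by multiplication with Hecke elements.
      have e : DAHA.X q t 0 = DAHA.pi n q t * desc (tInv t (DAHA.T q t)) 0 n := by
        rw [DAHA.pi, mul_assoc, ← up_eq_asc, ← dn_eq_desc, B.up_mul_dn, mul_one]
      rw [e]
      exact mul_mem (Algebra.subset_adjoin (.inr (.inl rfl)))
        (desc_mem_of_mem (tInv_mem_of_mem hT) _ _)
    have hD0 : DAHA.Xinv q t 0 * zEval Z Finset.univ (DAHA.Y q t 0) ∈ cyclotomic n q t Z := by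
      have e : DAHA.Xinv q t 0 * zEval Z Finset.univ (DAHA.Y q t 0) =
          asc (DAHA.T q t) 0 n * DAHA.piMinus n q t Z := by
        rw [DAHA.piMinus, DAHA.piInv, ← mul_assoc, ← mul_assoc, ← up_eq_asc, ← dn_eq_desc,
          B.up_mul_dn, one_mul]
      rw [e]
      exact mul_mem (asc_mem_of_mem hT _ _) (Algebra.subset_adjoin (.inr (.inr rfl)))
    refine Algebra.adjoin_le ?_
    rintro _ ((((⟨i, rfl⟩ | ⟨i, rfl⟩) | ⟨i, rfl⟩) | ⟨i, rfl⟩) | ⟨i, rfl⟩)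
    · exact hT i
    · rw [← ext_val (DAHA.X q t), Twisted.eq_dn_mul_up W (Nat.lt_succ_iff.1 i.2), up_eq_asc, dn_eq_desc]
      refine mul_mem (mul_mem (desc_mem_of_mem hT _ _) ?_) (asc_mem_of_mem hT _ _)
      exact (ext_val (DAHA.X (n := n) q t) 0).symm ▸ hX0
    · exact Algebra.subset_adjoin (.inl (.inl (.inr ⟨i, rfl⟩)))
    · exact Algebra.subset_adjoin (.inl (.inr ⟨i, rfl⟩))
    · exact mul_mem (mul_mem (desc_mem_of_mem (tInv_mem_of_mem hT) _ _) hD0)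
        (asc_mem_of_mem (tInv_mem_of_mem hT) _ _)
  · set S := Algebra.adjoin R (Set.range (DAHA.T q t) ∪ Set.range (DAHA.X (n := n) q t) ∪
      Set.range (DAHA.Y q t) ∪ Set.range (DAHA.Yinv q t) ∪ Set.range (DAHA.D q t Z))
    have hT : ∀ i, DAHA.T q t i ∈ S := fun i =>
      Algebra.subset_adjoin (.inl (.inl (.inl (.inl ⟨i, rfl⟩))))
    refine Algebra.adjoin_le ?_
    rintro _ (((⟨i, rfl⟩ | ⟨i, rfl⟩) | ⟨i, rfl⟩) | rfl | rfl)
    · exact hT i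
    · exact Algebra.subset_adjoin (.inl (.inl (.inr ⟨i, rfl⟩)))
    · exact Algebra.subset_adjoin (.inl (.inr ⟨i, rfl⟩))
    · exact mul_mem (Algebra.subset_adjoin (.inl (.inl (.inl (.inr ⟨0, rfl⟩)))))
        (asc_mem_of_mem hT _ _)
    · rw [DAHA.piMinus, DAHA.piInv, mul_assoc, ← DAHA.D_zero]
      exact mul_mem (desc_mem_of_mem (tInv_mem_of_mem hT) _ _)
        (Algebra.subset_adjoin (.inr ⟨0, rfl⟩))

/-- The presentation of the cyclotomic double affine Hecke algebra. -/
theorem exists_presLoc_equiv [IsDomain R] : ∃ e : PresLoc n q t Z ≃ₐ[R] cyclotomic n q t Z,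
    (∀ i, (e (PresLoc.gen q t Z (.T i)) : DAHA n q t) = DAHA.T q t i) ∧
    (∀ i, (e (PresLoc.gen q t Z (.X i)) : DAHA n q t) = DAHA.X q t i) ∧
    (∀ i, (e (PresLoc.gen q t Z (.Y i)) : DAHA n q t) = DAHA.Y q t i) ∧
    (∀ i, (e (PresLoc.gen q t Z (.Yinv i)) : DAHA n q t) = DAHA.Yinv q t i) ∧
    (∀ i, (e (PresLoc.gen q t Z (.D i)) : DAHA n q t) = DAHA.D q t Z i) := by
  obtain ⟨f, hT, hX, hY, hY', hD⟩ := exists_presLoc_hom (n := n) (q := q) (t := t) (Z := Z)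
    (fun _ _ => eq_of_cycLocRel_daha)
  have hr : f.range = cyclotomic n q t Z := by
    rw [← Algebra.map_top, ← adjoin_presLoc, AlgHom.map_adjoin, ← adjoin_eq_cyclotomic]
    simp only [Set.image_union, ← Set.range_comp, Function.comp_def, hT, hX, hY, hY', hD]
  obtain ⟨e, he⟩ := exists_algEquiv_of_injective f (injective_presLoc_hom f hT hX hY hD) hr
  exact ⟨e, fun i => by rw [he, hT], fun i => by rw [he, hX], fun i => by rw [he, hY],
    fun i => by rw [he, hY'], fun i => by rw [he, hD]⟩

end LocPresentation
end CycDAHA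

theorem theorem3p21 {R : Type*} [CommRing R] [IsDomain R] [Algebra ℂ R]
    (n l : ℕ) (q t : Rˣ) (Z : Fin l → Rˣ) :
    -- presentation of the unlocalized cyclotomic DAHA
    (∃ e : CycDAHA.PresPlus n q t Z ≃ₐ[R] CycDAHA.cyclotomicPlus n q t Z,
      (∀ i, (e (CycDAHA.PresPlus.gen q t Z (.T i)) : CycDAHA.DAHA n q t) = CycDAHA.DAHA.T q t i) ∧
      (∀ i, (e (CycDAHA.PresPlus.gen q t Z (.X i)) : CycDAHA.DAHA n q t) = CycDAHA.DAHA.X q t i) ∧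
      (∀ i, (e (CycDAHA.PresPlus.gen q t Z (.Y i)) : CycDAHA.DAHA n q t) = CycDAHA.DAHA.Y q t i) ∧
      (∀ i, (e (CycDAHA.PresPlus.gen q t Z (.D i)) : CycDAHA.DAHA n q t) =
        CycDAHA.DAHA.D q t Z i)) ∧
    -- the basis of standard monomials, for any choice of reduced expressions defining the `T_s`
    (1 ≤ l → ∀ w : Equiv.Perm (Fin (n + 1)) → List (Fin n),
      (∀ s, CycDAHA.IsReducedWord (w s) s) →
      ∃ b : Module.Basis ((Fin (n + 1) → ℕ) × (Fin (n + 1) → Fin l) × Equiv.Perm (Fin (n + 1)) ×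
          (Fin (n + 1) → ℕ)) R (CycDAHA.cyclotomicPlus n q t Z),
        ∀ α β s γ, (b (α, β, s, γ) : CycDAHA.DAHA n q t) =
          CycDAHA.stdMonomial q t Z α (fun i => (β i : ℕ)) (w s) γ) ∧
    -- presentation of the cyclotomic DAHA
    (∃ e : CycDAHA.PresLoc n q t Z ≃ₐ[R] CycDAHA.cyclotomic n q t Z,
      (∀ i, (e (CycDAHA.PresLoc.gen q t Z (.T i)) : CycDAHA.DAHA n q t) = CycDAHA.DAHA.T q t i) ∧
      (∀ i, (e (CycDAHA.PresLoc.gen q t Z (.X i)) : CycDAHA.DAHA n q t) = CycDAHA.DAHA.X q t i) ∧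
      (∀ i, (e (CycDAHA.PresLoc.gen q t Z (.Y i)) : CycDAHA.DAHA n q t) = CycDAHA.DAHA.Y q t i) ∧
      (∀ i, (e (CycDAHA.PresLoc.gen q t Z (.Yinv i)) : CycDAHA.DAHA n q t) =
        CycDAHA.DAHA.Yinv q t i) ∧
      (∀ i, (e (CycDAHA.PresLoc.gen q t Z (.D i)) : CycDAHA.DAHA n q t) =
        CycDAHA.DAHA.D q t Z i)) := by
  refine ⟨CycDAHA.exists_presPlus_equiv, fun hl w hw => ?_, CycDAHA.exists_presLoc_equiv⟩
  obtain ⟨b, hb⟩ := CycDAHA.exists_basis (q := q) (t := t) (Z := Z) hl hw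
  exact ⟨b, fun α β s γ => hb (α, β, s, γ)⟩
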